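/- **Conventions.** 2-categories, 2-functors and 2-natural transformations are strict. For 2-categories $\mathcal A,\mathcal B$, $\mathcal Hom(\mathcal A,\mathcal B)$ is the 2-category of 2-functors $\mathcal A\to\mathcal B$, 2-natural transformations and modifications; $(-)^{op}$ reverses 1-cells but not 2-cells. A 2-functor $F:\mathcal A\to\mathcal B$ is a *2-equivalence* if there are a 2-functor $G:\mathcal B\to\mathcal A$ and invertible 2-natural transformations $FG\cong id_{\mathcal B}$ and $GF\cong id_{\mathcal A}$. A 2-category $\mathcal I$ is *2-filtered* if (F0) for all objects $i,j$ there are 1-cells $i\to k$, $j\to k$ for some $k$; (F1) for all 1-cells $f,g:i\to j$ there are a 1-cell $h:j\to k$ and an invertible 2-cell $hf\cong hg$; (F2) for all 2-cells $\alpha,\beta:f\Rightarrow g:i\to j$ there is a 1-cell $h:j\to k$ with $h\alpha=h\beta$. It is *small* if its objects, 1-cells and 2-cells form sets. A *pseudocone* with vertex $L$ on a 2-functor $X:\mathcal A\to\mathcal B$ consists of 1-cells $\theta_i:L\to X_i$ and invertible 2-cells $\theta_u:\theta_j\Rightarrow X_u\theta_i$ for $u:i\to j$, such that $\theta_{id_i}=id$,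 $\theta_{vu}=(X_v\theta_u)\circ\theta_v$, and $(X_\alpha\theta_i)\circ\theta_u=\theta_v$ for every 2-cell $\alpha:u\Rightarrow v$. A morphism of pseudocones $\theta\to\eta$ is a family of 2-cells $\rho_i:\theta_i\Rightarrow\eta_i$ with $\eta_u\circ\rho_j=(X_u\rho_i)\circ\theta_u$. A pseudocone $\pi$ with vertex $L$ is a *pseudolimit* if for every object $M$ composition with $\pi$ is an isomorphism of categories from $\mathcal B(M,L)$ to the category of pseudocones with vertex $M$ on $X$. Pseudocolimits are defined dually. A 2-category $\mathcal E$ is *closed under small 2-cofiltered pseudolimits* if every 2-functor $\mathcal I^{op}\to\mathcal E$ with $\mathcal I$ small and 2-filtered has a pseudolimit; a 2-functor *preserves* them if it sends every pseudolimit pseudocone on such a diagram to a pseudolimit pseudocone. **2-pro-objects.** Let $\mathcal C$ be a 2-category whose hom-categories are small. A *2-pro-object* of $\mathcal C$ is a 2-functor $X:\mathcal I^{op}\to\mathcal C$ with $\mathcal I$ a small 2-filtered 2-category. Put $\mathsf L X=\mathrm{colim}_{i\in\mathcal I}\,\mathcal C(X_i,-)$, the (pointwise computed) pseudocolimit in $\mathcal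 Hom(\mathcal C,\mathcal Cat)$. The 2-category $2\text{-}\mathcal Pro(\mathcal C)$ has the 2-pro-objects as objects, the hom-categories $$2\text{-}\mathcal Pro(\mathcal C)(X,Y)=\mathcal Hom(\mathcal C,\mathcal Cat)(\mathsf L Y,\mathsf L X),$$ and the compositions of $\mathcal Hom(\mathcal C,\mathcal Cat)^{op}$. The embedding $c:\mathcal C\to 2\text{-}\mathcal Pro(\mathcal C)$ is the 2-functor sending an object of $\mathcal C$ to the 2-pro-object indexed by the one-point 2-category with that value, and 1-cells and 2-cells to those they induce. **Theorem.** Let $\mathcal C$ be any 2-category with small hom-categories, and let $\mathcal E$ be any 2-category closed under small 2-cofiltered pseudolimits. Let $\mathcal Hom(2\text{-}\mathcal Pro(\mathcal C),\mathcal E)_+$ be the full sub-2-category of $\mathcal Hom(2\text{-}\mathcal Pro(\mathcal C),\mathcal E)$ on the 2-functors that preserve small 2-cofiltered pseudolimits. Then pre-composition with $c$, $$c^*:\ \mathcal Hom(2\text{-}\mathcal Pro(\mathcal C),\mathcal E)_+\longrightarrow\mathcal Hom(\mathcal C,\mathcal E),$$ is a 2-equivalence of 2-categories. -/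

import Mathlib

universe w w₁ w₂ w₃ v₁ v₂ v₃ u₁ u₂ u₃ u w' v' u'

namespace TwoPro

open CategoryTheory Bicategory Opposite
open scoped CategoryTheory.Pseudofunctor.StrongTrans

set_option linter.unusedSectionVars false

section Basic

variable {A : Type u₁} [Bicategory.{w₁, v₁} A] [Bicategory.Strict A]
  {B : Type u₂} [Bicategory.{w₂, v₂} B] [Bicategory.Strict B]
  {D : Type u₃} [Bicategory.{w₃, v₃} D] [Bicategory.Strict D]

/-- A 2-natural transformation between (strict) 2-functors: a strong transformation all of whose
structure 2-cells are identities, i.e. `F f ≫ θ_b = θ_a ≫ G f` for all 1-cells `f`, compatibly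
with 2-cells. -/
structure TwoNatTrans (F G : StrictPseudofunctor A B) where
  toStrongTrans : F.toPseudofunctor ⟶ G.toPseudofunctor
  naturality_eq : ∀ {a b : A} (f : a ⟶ b),
    F.map f ≫ toStrongTrans.app b = toStrongTrans.app a ≫ G.map f
  naturality_eqToIso : ∀ {a b : A} (f : a ⟶ b),
    toStrongTrans.naturality f = eqToIso (naturality_eq f)

namespace TwoNatTrans

variable {F G H K : StrictPseudofunctor A B}

theorem ext' {θ η : TwoNatTrans F G} (h : ∀ a, θ.toStrongTrans.app a = η.toStrongTrans.app a) :
    θ = η := by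
  obtain ⟨⟨θ₀, θ₁, _, _, _⟩, hθ, hθ'⟩ := θ
  obtain ⟨⟨η₀, η₁, _, _, _⟩, hη, hη'⟩ := η
  obtain rfl : θ₀ = η₀ := funext h
  obtain rfl : @θ₁ = @η₁ := by
    funext a b f
    exact (hθ' f).trans (hη' f).symm
  rfl

/-- The identity 2-natural transformation. -/
def id (F : StrictPseudofunctor A B) : TwoNatTrans F F where
  toStrongTrans := 𝟙 F.toPseudofunctor
  naturality_eq f := (Strict.comp_id (F.map f)).trans (Strict.id_comp (F.map f)).symm
  naturality_eqToIso f := by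
    ext
    simp [Strict.leftUnitor_eqToIso, Strict.rightUnitor_eqToIso]
    rfl

/-- The composite of 2-natural transformations. -/
def comp (θ : TwoNatTrans F G) (η : TwoNatTrans G H) : TwoNatTrans F H where
  toStrongTrans := θ.toStrongTrans ≫ η.toStrongTrans
  naturality_eq {a b} f := by
    change F.map f ≫ θ.toStrongTrans.app b ≫ η.toStrongTrans.app b =
      (θ.toStrongTrans.app a ≫ η.toStrongTrans.app a) ≫ H.map f
    rw [← Strict.assoc, θ.naturality_eq, Strict.assoc, η.naturality_eq, Strict.assoc]
  naturality_eqToIso f := by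
    ext
    simp [Strict.associator_eqToIso, naturality_eqToIso]
    repeat erw [eqToHom_trans]
    rfl

end TwoNatTrans

/-- The 2-functors `A ⟶ B` with 2-natural transformations as 1-cells. -/
instance : CategoryStruct (StrictPseudofunctor A B) where
  Hom F G := TwoNatTrans F G
  id F := TwoNatTrans.id F
  comp θ η := TwoNatTrans.comp θ η

/-- A modification between 2-natural transformations (a modification of the underlying strong
transformations). -/
@[ext]
structure TwoNatTrans.Hom {F G : StrictPseudofunctor A B} (θ η : F ⟶ G) where
  hom : TwoNatTrans.toStrongTrans θ ⟶ TwoNatTrans.toStrongTrans η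

instance (F G : StrictPseudofunctor A B) : Category (F ⟶ G) where
  Hom θ η := TwoNatTrans.Hom θ η
  id θ := ⟨𝟙 (TwoNatTrans.toStrongTrans θ)⟩
  comp ρ σ := ⟨ρ.hom ≫ σ.hom⟩

namespace TwoNatTrans

variable {F G H K : StrictPseudofunctor A B}

@[ext]
theorem hom_ext {θ η : F ⟶ G} {ρ σ : θ ⟶ η} (h : ∀ a, ρ.hom.as.app a = σ.hom.as.app a) :
    ρ = σ :=
  TwoNatTrans.Hom.ext (Pseudofunctor.StrongTrans.homCategory.ext h)

@[simp] theorem id_hom (θ : F ⟶ G) : TwoNatTrans.Hom.hom (𝟙 θ) = 𝟙 (toStrongTrans θ) := rfl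

@[simp] theorem comp_hom {θ η ζ : F ⟶ G} (ρ : θ ⟶ η) (σ : η ⟶ ζ) :
    TwoNatTrans.Hom.hom (ρ ≫ σ) = ρ.hom ≫ σ.hom := rfl

@[simp] theorem id_toStrongTrans (F : StrictPseudofunctor A B) :
    toStrongTrans (𝟙 F) = 𝟙 F.toPseudofunctor := rfl

@[simp] theorem comp_toStrongTrans (θ : F ⟶ G) (η : G ⟶ H) :
    toStrongTrans (θ ≫ η) = toStrongTrans θ ≫ toStrongTrans η := rfl

/-- An invertible modification. -/
def isoMk {θ η : F ⟶ G} (e : toStrongTrans θ ≅ toStrongTrans η) : θ ≅ η where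
  hom := ⟨e.hom⟩
  inv := ⟨e.inv⟩

end TwoNatTrans

namespace TwoNatTrans

variable {F G H K : StrictPseudofunctor A B}

/-- Whiskering of a modification by a 2-natural transformation. -/
def whiskerLeft (θ : F ⟶ G) {η ζ : G ⟶ H} (ρ : η ⟶ ζ) : θ ≫ η ⟶ θ ≫ ζ where
  hom := toStrongTrans θ ◁ ρ.hom

/-- Whiskering of a modification by a 2-natural transformation. -/
def whiskerRight {θ η : F ⟶ G} (ρ : θ ⟶ η) (ζ : G ⟶ H) : θ ≫ ζ ⟶ η ≫ ζ where
  hom := ρ.hom ▷ toStrongTrans ζ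

end TwoNatTrans

/-- The 2-category `Hom(A, B)` of 2-functors, 2-natural transformations and modifications. -/
instance : Bicategory (StrictPseudofunctor A B) where
  whiskerLeft θ _ _ ρ := TwoNatTrans.whiskerLeft θ ρ
  whiskerRight ρ ζ := TwoNatTrans.whiskerRight ρ ζ
  associator θ η ζ := TwoNatTrans.isoMk
    (α_ (TwoNatTrans.toStrongTrans θ) (TwoNatTrans.toStrongTrans η) (TwoNatTrans.toStrongTrans ζ))
  leftUnitor θ := TwoNatTrans.isoMk (λ_ (TwoNatTrans.toStrongTrans θ))
  rightUnitor θ := TwoNatTrans.isoMk (ρ_ (TwoNatTrans.toStrongTrans θ))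
  whiskerLeft_id _ _ := TwoNatTrans.Hom.ext (Bicategory.whiskerLeft_id _ _)
  whiskerLeft_comp _ _ _ _ _ _ := TwoNatTrans.Hom.ext (Bicategory.whiskerLeft_comp _ _ _)
  id_whiskerLeft _ := TwoNatTrans.Hom.ext (Bicategory.id_whiskerLeft _)
  comp_whiskerLeft _ _ _ _ _ := TwoNatTrans.Hom.ext (Bicategory.comp_whiskerLeft _ _ _)
  id_whiskerRight _ _ := TwoNatTrans.Hom.ext (Bicategory.id_whiskerRight _ _)
  comp_whiskerRight _ _ _ := TwoNatTrans.Hom.ext (Bicategory.comp_whiskerRight _ _ _)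
  whiskerRight_id _ := TwoNatTrans.Hom.ext (Bicategory.whiskerRight_id _)
  whiskerRight_comp _ _ _ := TwoNatTrans.Hom.ext (Bicategory.whiskerRight_comp _ _ _)
  whisker_assoc _ _ _ _ _ := TwoNatTrans.Hom.ext (Bicategory.whisker_assoc _ _ _)
  whisker_exchange _ _ := TwoNatTrans.Hom.ext (Bicategory.whisker_exchange _ _)
  pentagon _ _ _ _ := TwoNatTrans.Hom.ext (Bicategory.pentagon _ _ _ _)
  triangle _ _ := TwoNatTrans.Hom.ext (Bicategory.triangle _ _)

namespace TwoNatTrans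

variable {F G H K : StrictPseudofunctor A B}

theorem comp_hom_app {θ η ζ : F ⟶ G} (ρ : θ ⟶ η) (σ : η ⟶ ζ) (a : A) :
    (TwoNatTrans.Hom.hom (ρ ≫ σ)).as.app a = ρ.hom.as.app a ≫ σ.hom.as.app a := rfl

theorem eqToHom_app {θ η : F ⟶ G} (h : θ = η) (a : A) :
    (TwoNatTrans.Hom.hom (eqToHom h)).as.app a =
      eqToHom (by rw [h] : (toStrongTrans θ).app a = (toStrongTrans η).app a) := by
  subst h
  simp

theorem eqToHom_conj_app {θ η θ' η' : F ⟶ G} (h : θ = θ') (ρ : θ' ⟶ η') (h' : η' = η) (a : A)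
    (e : (toStrongTrans θ).app a = (toStrongTrans θ').app a)
    (e' : (toStrongTrans η').app a = (toStrongTrans η).app a) :
    (TwoNatTrans.Hom.hom (eqToHom h ≫ ρ ≫ eqToHom h')).as.app a =
      eqToHom e ≫ ρ.hom.as.app a ≫ eqToHom e' := by
  subst h h'
  simp

end TwoNatTrans

instance : Bicategory.Strict (StrictPseudofunctor A B) where
  id_comp _ := TwoNatTrans.ext' fun _ => Strict.id_comp _
  comp_id _ := TwoNatTrans.ext' fun _ => Strict.comp_id _
  assoc _ _ _ := TwoNatTrans.ext' fun _ => Strict.assoc _ _ _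
  leftUnitor_eqToIso θ := by
    apply Iso.ext
    apply TwoNatTrans.hom_ext
    intro a
    rw [eqToIso.hom, TwoNatTrans.eqToHom_app]
    exact congrArg Iso.hom (Strict.leftUnitor_eqToIso _)
  rightUnitor_eqToIso θ := by
    apply Iso.ext
    apply TwoNatTrans.hom_ext
    intro a
    rw [eqToIso.hom, TwoNatTrans.eqToHom_app]
    exact congrArg Iso.hom (Strict.rightUnitor_eqToIso _)
  associator_eqToIso θ η ζ := by
    apply Iso.ext
    apply TwoNatTrans.hom_ext
    intro a
    rw [eqToIso.hom, TwoNatTrans.eqToHom_app]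
    exact congrArg Iso.hom (Strict.associator_eqToIso _ _ _)

theorem op2_eqToHom {a b : Aᵒᵖ} {f g : a ⟶ b} (h : f.unop = g.unop) :
    (_root_.Bicategory.Opposite.Hom2.op2' (eqToHom h) : f ⟶ g) = eqToHom (Quiver.Hom.unop_inj h) := by
  obtain rfl : f = g := Quiver.Hom.unop_inj h
  rfl

instance : Bicategory.Strict Aᵒᵖ where
  id_comp f := Quiver.Hom.unop_inj (Strict.comp_id f.unop)
  comp_id f := Quiver.Hom.unop_inj (Strict.id_comp f.unop)
  assoc f g h := Quiver.Hom.unop_inj (Strict.assoc h.unop g.unop f.unop).symm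
  leftUnitor_eqToIso f := by
    apply Iso.ext
    rw [eqToIso.hom, ← op2_eqToHom (Strict.comp_id f.unop)]
    exact congrArg _root_.Bicategory.Opposite.Hom2.op2'
      (congrArg Iso.hom (Strict.rightUnitor_eqToIso f.unop))
  rightUnitor_eqToIso f := by
    apply Iso.ext
    rw [eqToIso.hom, ← op2_eqToHom (Strict.id_comp f.unop)]
    exact congrArg _root_.Bicategory.Opposite.Hom2.op2'
      (congrArg Iso.hom (Strict.leftUnitor_eqToIso f.unop))
  associator_eqToIso f g h := by
    apply Iso.ext
    rw [eqToIso.hom, ← op2_eqToHom (Strict.assoc h.unop g.unop f.unop).symm]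
    exact congrArg _root_.Bicategory.Opposite.Hom2.op2'
      (congrArg Iso.inv (Strict.associator_eqToIso h.unop g.unop f.unop))

/-- Constructor of 2-natural transformations: components, strict naturality for 1-cells, and
naturality for 2-cells. -/
def TwoNatTrans.mk' {F G : StrictPseudofunctor A B} (app : ∀ a, F.obj a ⟶ G.obj a)
    (nat : ∀ {a b : A} (f : a ⟶ b), F.map f ≫ app b = app a ≫ G.map f)
    (nat₂ : ∀ {a b : A} {f g : a ⟶ b} (ρ : f ⟶ g),
      F.map₂ ρ ▷ app b ≫ eqToHom (nat g) = eqToHom (nat f) ≫ app a ◁ G.map₂ ρ) : F ⟶ G where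
  toStrongTrans :=
    { app := app
      naturality f := eqToIso (nat f)
      naturality_naturality ρ := nat₂ ρ
      naturality_id a := by
        simp [F.mapId_eq_eqToIso, G.mapId_eq_eqToIso, Strict.leftUnitor_eqToIso,
          Strict.rightUnitor_eqToIso]
      naturality_comp f g := by
        simp [F.mapComp_eq_eqToIso, G.mapComp_eq_eqToIso, Strict.associator_eqToIso] }
  naturality_eq := nat
  naturality_eqToIso _ := rfl

theorem TwoNatTrans.nat₂ {F G : StrictPseudofunctor A B} (θ : F ⟶ G) {a b : A} {f g : a ⟶ b}
    (ρ : f ⟶ g) :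
    F.map₂ ρ ▷ (toStrongTrans θ).app b ≫ eqToHom (θ.naturality_eq g) =
      eqToHom (θ.naturality_eq f) ≫ (toStrongTrans θ).app a ◁ G.map₂ ρ := by
  simpa [TwoNatTrans.naturality_eqToIso] using (toStrongTrans θ).naturality_naturality ρ

/-- Constructor of modifications between 2-natural transformations. -/
def TwoNatTrans.homMk {F G : StrictPseudofunctor A B} {θ η : F ⟶ G}
    (app : ∀ a, (toStrongTrans θ).app a ⟶ (toStrongTrans η).app a)
    (nat : ∀ {a b : A} (f : a ⟶ b), F.map f ◁ app b ≫ eqToHom (η.naturality_eq f) =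
      eqToHom (θ.naturality_eq f) ≫ app a ▷ G.map f) : θ ⟶ η where
  hom :=
    { as :=
        { app := app
          naturality f := by
            simpa [TwoNatTrans.naturality_eqToIso] using nat f } }

theorem TwoNatTrans.hom_nat {F G : StrictPseudofunctor A B} {θ η : F ⟶ G}
    (ρ : θ ⟶ η) {a b : A} (f : a ⟶ b) :
    F.map f ◁ ρ.hom.as.app b ≫ eqToHom (η.naturality_eq f) =
      eqToHom (θ.naturality_eq f) ≫ ρ.hom.as.app a ▷ G.map f := by
  simpa [TwoNatTrans.naturality_eqToIso] using ρ.hom.as.naturality f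

/-- The whiskering `θ K : F K ⟶ G K` of a 2-natural transformation `θ : F ⟶ G` by a 2-functor `K`. -/
def TwoNatTrans.precomp (K : StrictPseudofunctor A B) {F G : StrictPseudofunctor B D}
    (θ : F ⟶ G) : K.comp F ⟶ K.comp G :=
  TwoNatTrans.mk' (fun a => (toStrongTrans θ).app (K.obj a))
    (fun f => θ.naturality_eq (K.map f)) (fun ρ => θ.nat₂ (K.map₂ ρ))

/-- The whiskering of a modification by a 2-functor `K`. -/
def TwoNatTrans.precomp₂ (K : StrictPseudofunctor A B) {F G : StrictPseudofunctor B D}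
    {θ η : F ⟶ G} (ρ : θ ⟶ η) : precomp K θ ⟶ precomp K η :=
  TwoNatTrans.homMk (fun a => ρ.hom.as.app (K.obj a)) (fun f => hom_nat ρ (K.map f))

namespace TwoNatTrans

variable (K : StrictPseudofunctor A B) {F G H : StrictPseudofunctor B D}

theorem precomp_id (F : StrictPseudofunctor B D) : precomp K (𝟙 F) = 𝟙 (K.comp F) :=
  ext' fun _ => rfl

theorem precomp_comp (θ : F ⟶ G) (η : G ⟶ H) : precomp K (θ ≫ η) = precomp K θ ≫ precomp K η :=
  ext' fun _ => rfl

theorem precomp₂_whiskerLeft (θ : F ⟶ G) {η ζ : G ⟶ H} (ρ : η ⟶ ζ) :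
    precomp₂ K (θ ◁ ρ) = eqToHom (precomp_comp K θ η) ≫ precomp K θ ◁ precomp₂ K ρ ≫
      eqToHom (precomp_comp K θ ζ).symm := by
  apply hom_ext
  intro a
  refine Eq.trans ?_ (eqToHom_conj_app (precomp_comp K θ η) (precomp K θ ◁ precomp₂ K ρ)
    (precomp_comp K θ ζ).symm a rfl rfl).symm
  exact ((Category.id_comp _).trans (Category.comp_id _)).symm

theorem precomp₂_whiskerRight {θ η : F ⟶ G} (ρ : θ ⟶ η) (ζ : G ⟶ H) :
    precomp₂ K (ρ ▷ ζ) = eqToHom (precomp_comp K θ ζ) ≫ precomp₂ K ρ ▷ precomp K ζ ≫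
      eqToHom (precomp_comp K η ζ).symm := by
  apply hom_ext
  intro a
  refine Eq.trans ?_ (eqToHom_conj_app (precomp_comp K θ ζ) (precomp₂ K ρ ▷ precomp K ζ)
    (precomp_comp K η ζ).symm a rfl rfl).symm
  exact ((Category.id_comp _).trans (Category.comp_id _)).symm

end TwoNatTrans

/-- The 2-functor `K^* : Hom(B, D) ⟶ Hom(A, D)` of precomposition with a 2-functor `K : A ⟶ B`. -/
def precomp (D : Type u₃) [Bicategory.{w₃, v₃} D] [Bicategory.Strict D]
    (K : StrictPseudofunctor A B) :
    StrictPseudofunctor (StrictPseudofunctor B D) (StrictPseudofunctor A D) :=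
  StrictPseudofunctor.mk''
    { obj F := K.comp F
      map θ := TwoNatTrans.precomp K θ
      map₂ ρ := TwoNatTrans.precomp₂ K ρ
      map₂_id _ := rfl
      map₂_comp _ _ := rfl
      map_id F := TwoNatTrans.precomp_id K F
      map_comp θ η := TwoNatTrans.precomp_comp K θ η
      map₂_whisker_left θ _ _ ρ := TwoNatTrans.precomp₂_whiskerLeft K θ ρ
      map₂_whisker_right ρ ζ := TwoNatTrans.precomp₂_whiskerRight K ρ ζ }

section Limits

variable {X : StrictPseudofunctor A B}

/-- A pseudocone with vertex `L` on a 2-functor `X : A ⟶ B`: 1-cells `L ⟶ X i` and invertible 2-cells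
`app j ≅ app i ≫ X u` for `u : i ⟶ j`, compatible with identities, composition and 2-cells. -/
structure PseudoCone (X : StrictPseudofunctor A B) (L : B) where
  app (i : A) : L ⟶ X.obj i
  iso {i j : A} (u : i ⟶ j) : app j ≅ app i ≫ X.map u
  iso_id (i : A) : (iso (𝟙 i)).hom = eqToHom (by rw [X.map_id, Strict.comp_id])
  iso_comp {i j k : A} (u : i ⟶ j) (v : j ⟶ k) :
    (iso (u ≫ v)).hom =
      (iso v).hom ≫ (iso u).hom ▷ X.map v ≫ eqToHom (by rw [X.map_comp, Strict.assoc])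
  iso_naturality {i j : A} {u v : i ⟶ j} (α : u ⟶ v) :
    (iso u).hom ≫ app i ◁ X.map₂ α = (iso v).hom

namespace PseudoCone

/-- A morphism of pseudocones with the same vertex. -/
@[ext]
structure Hom {L : B} (θ η : PseudoCone X L) where
  app (i : A) : θ.app i ⟶ η.app i
  naturality {i j : A} (u : i ⟶ j) :
    app j ≫ (η.iso u).hom = (θ.iso u).hom ≫ app i ▷ X.map u

instance (L : B) : Category (PseudoCone X L) where
  Hom θ η := Hom θ η
  id θ := { app i := 𝟙 (θ.app i), naturality u := by simp }
  comp ρ σ :=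
    { app i := ρ.app i ≫ σ.app i
      naturality u := by
        rw [Category.assoc, σ.naturality, ← Category.assoc, ρ.naturality, Category.assoc,
          comp_whiskerRight] }
  id_comp _ := Hom.ext (funext fun _ => Category.id_comp _)
  comp_id _ := Hom.ext (funext fun _ => Category.comp_id _)
  assoc _ _ _ := Hom.ext (funext fun _ => Category.assoc _ _ _)

/-- The pseudocone with vertex `M` obtained from one with vertex `L` and a 1-cell `h : M ⟶ L`. -/
def precomp {L : B} (π : PseudoCone X L) {M : B} (h : M ⟶ L) : PseudoCone X M where
  app i := h ≫ π.app i
  iso {i _} u := whiskerLeftIso h (π.iso u) ≪≫ eqToIso (Strict.assoc h (π.app i) (X.map u)).symm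
  iso_id i := by simp [π.iso_id]
  iso_comp u v := by
    simp [π.iso_comp, whisker_assoc, Strict.associator_eqToIso]
  iso_naturality α := by
    simp [← π.iso_naturality α, Strict.associator_eqToIso]

/-- For a pseudocone `π` with vertex `L`, the functor from the category of 1-cells `M ⟶ L` to the
category of pseudocones with vertex `M`. -/
def precompFunctor {L : B} (π : PseudoCone X L) (M : B) : (M ⟶ L) ⥤ PseudoCone X M where
  obj h := π.precomp h
  map {_ Y} α :=
    { app i := α ▷ π.app i
      naturality {i _} u := by
        have h := associator_naturality_left α (π.app _) (X.map u)
        simp only [Strict.associator_eqToIso, eqToIso.hom] at h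
        change α ▷ π.app _ ≫ _ ◁ (π.iso u).hom ≫ eqToHom (Strict.assoc _ (π.app _) (X.map u)).symm =
          (_ ◁ (π.iso u).hom ≫ eqToHom (Strict.assoc _ (π.app _) (X.map u)).symm) ≫
          α ▷ π.app _ ▷ X.map u
        rw [← whisker_exchange_assoc]
        refine Eq.trans ?_ (Category.assoc _ _ _).symm
        congr 1
        rw [← cancel_mono (eqToHom (Strict.assoc Y (π.app i) (X.map u)))]
        simp only [Category.assoc, h, eqToHom_trans, eqToHom_trans_assoc, eqToHom_refl,
          Category.comp_id, Category.id_comp] }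
  map_id h := Hom.ext (funext fun _ => id_whiskerRight _ _)
  map_comp _ _ := Hom.ext (funext fun _ => comp_whiskerRight _ _ _)

/-- `π` is a pseudolimit cone: for every object `M`, composition with `π` is an *isomorphism* of
categories from 1-cells `M ⟶ L` to pseudocones with vertex `M`. -/
def IsPseudolimit {L : B} (π : PseudoCone X L) : Prop :=
  ∀ M : B, (π.precompFunctor M).IsIso

/-- The image of a pseudocone under a 2-functor `H`. -/
def map {L : B} (π : PseudoCone X L) (H : StrictPseudofunctor B D) :
    PseudoCone (X.comp H) (H.obj L) where
  app i := H.map (π.app i)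
  iso {i _} u := H.map₂Iso (π.iso u) ≪≫ eqToIso (H.map_comp (π.app i) (X.map u))
  iso_id i := by
    change H.map₂ (π.iso (𝟙 i)).hom ≫ eqToHom (H.map_comp (π.app i) (X.map (𝟙 i))) = _
    rw [π.iso_id, PrelaxFunctor.map₂_eqToHom, eqToHom_trans]
    rfl
  iso_comp {i _ _} u v := by
    change H.map₂ (π.iso (u ≫ v)).hom ≫ eqToHom (H.map_comp (π.app i) (X.map (u ≫ v))) =
      (H.map₂ (π.iso v).hom ≫ eqToHom (H.map_comp _ (X.map v))) ≫
      (H.map₂ (π.iso u).hom ≫ eqToHom (H.map_comp (π.app i) (X.map u))) ▷ H.map (X.map v) ≫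
        eqToHom (by rw [X.map_comp, H.map_comp, Strict.assoc])
    have h := H.map₂_whisker_right (π.iso u).hom (X.map v)
    simp only [H.mapComp_eq_eqToIso, eqToIso.hom, eqToIso.inv] at h
    rw [π.iso_comp, H.map₂_comp, H.map₂_comp, h, PrelaxFunctor.map₂_eqToHom, comp_whiskerRight,
      eqToHom_whiskerRight]
    simp only [Category.assoc, eqToHom_trans]
  iso_naturality {i _ u v} α := by
    change (H.map₂ (π.iso u).hom ≫ eqToHom (H.map_comp (π.app i) (X.map u))) ≫
      H.map (π.app i) ◁ H.map₂ (X.map₂ α) =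
      H.map₂ (π.iso v).hom ≫ eqToHom (H.map_comp (π.app i) (X.map v))
    have h := H.map₂_whisker_left (π.app i) (X.map₂ α)
    simp only [H.mapComp_eq_eqToIso, eqToIso.hom, eqToIso.inv] at h
    rw [← π.iso_naturality α, H.map₂_comp, h]
    simp

end PseudoCone

/-- A 2-filtered 2-category. (No non-emptiness is required.) -/
class IsTwoFiltered (I : Type u₁) [Bicategory.{w₁, v₁} I] : Prop where
  cocone_objs (i j : I) : ∃ k : I, Nonempty (i ⟶ k) ∧ Nonempty (j ⟶ k)
  cocone_maps {i j : I} (f g : i ⟶ j) : ∃ (k : I) (h : j ⟶ k), Nonempty (f ≫ h ≅ g ≫ h)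
  cocone_cells {i j : I} {f g : i ⟶ j} (α β : f ⟶ g) : ∃ (k : I) (h : j ⟶ k), α ▷ h = β ▷ h

/-- `E` is closed under small 2-cofiltered pseudolimits: every 2-functor `Iᵒᵖ ⟶ E` with `I` a small
2-filtered 2-category has a pseudolimit. -/
def HasSmallTwoCofilteredPseudolimits (E : Type u₁) [Bicategory.{w₁, v₁} E]
    [Bicategory.Strict E] : Prop :=
  ∀ (I : Type w) [Bicategory.{w, w} I] [Bicategory.Strict I] [IsTwoFiltered I]
    (X : StrictPseudofunctor Iᵒᵖ E), ∃ (L : E) (π : PseudoCone X L), π.IsPseudolimit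

/-- The 2-functor `H` preserves small 2-cofiltered pseudolimits: it sends pseudolimit cones to
pseudolimit cones. -/
def PreservesSmallTwoCofilteredPseudolimits (H : StrictPseudofunctor B D) : Prop :=
  ∀ (I : Type w) [Bicategory.{w, w} I] [Bicategory.Strict I] [IsTwoFiltered I]
    (X : StrictPseudofunctor Iᵒᵖ B) (L : B) (π : PseudoCone X L),
    π.IsPseudolimit → (π.map H).IsPseudolimit

/-- The 2-functor `F` is a 2-equivalence: there is a 2-functor `G` in the other direction with
invertible 2-natural transformations `F G ≅ id` and `G F ≅ id`. -/
def IsTwoEquivalence (F : StrictPseudofunctor B D) : Prop :=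
  ∃ (G : StrictPseudofunctor D B)
    (α : G.comp F ⟶ StrictPseudofunctor.id D) (α' : StrictPseudofunctor.id D ⟶ G.comp F)
    (β : F.comp G ⟶ StrictPseudofunctor.id B) (β' : StrictPseudofunctor.id B ⟶ F.comp G),
    α ≫ α' = 𝟙 _ ∧ α' ≫ α = 𝟙 _ ∧ β ≫ β' = 𝟙 _ ∧ β' ≫ β = 𝟙 _

end Limits

end Basic

section Colim

variable {C : Type u} [Bicategory.{w, w} C] [Bicategory.Strict C]
  {I : Type w} [Bicategory.{w, w} I]

/-- The objects of (the chosen construction of) the pseudocolimit in `Cat`, over `i : I`, of the hom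
categories `C(X_i, c)`: pairs of an index `i` and an object `arr : X_i ⟶ c` of `C(X_i, c)`. -/
structure PseudoColim (X : StrictPseudofunctor Iᵒᵖ C) (c : C) : Type w where
  idx : I
  arr : X.obj (op idx) ⟶ c

namespace PseudoColim

variable {X : StrictPseudofunctor Iᵒᵖ C} {c d : C}

/-- Formal composites of the generating arrows of the pseudocolimit of the categories `C(X_i, c)`:
`cell` are the arrows of the categories `C(X_i, c)`, and `push u r`, with formal inverse `pull u r`,
are the components of the invertible structure 2-cells of the universal pseudococone. -/
inductive Word (X : StrictPseudofunctor Iᵒᵖ C) (c : C) : PseudoColim X c → PseudoColim X c → Type w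
  | id (x : PseudoColim X c) : Word X c x x
  | comp {x y z : PseudoColim X c} (p : Word X c x y) (q : Word X c y z) : Word X c x z
  | cell (i : I) {r s : X.obj (op i) ⟶ c} (θ : r ⟶ s) : Word X c ⟨i, r⟩ ⟨i, s⟩
  | push {i j : I} (u : i ⟶ j) (r : X.obj (op i) ⟶ c) : Word X c ⟨i, r⟩ ⟨j, X.map u.op ≫ r⟩
  | pull {i j : I} (u : i ⟶ j) (r : X.obj (op i) ⟶ c) : Word X c ⟨j, X.map u.op ≫ r⟩ ⟨i, r⟩

theorem push_id_eq (X : StrictPseudofunctor Iᵒᵖ C) {i : I} (r : X.obj (op i) ⟶ c) :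
    r = X.map (𝟙 i : i ⟶ i).op ≫ r :=
  ((congrArg (· ≫ r) (X.map_id (op i))).trans (Strict.id_comp r)).symm

theorem push_comp_eq (X : StrictPseudofunctor Iᵒᵖ C) {i j k : I} (u : i ⟶ j) (v : j ⟶ k)
    (r : X.obj (op i) ⟶ c) :
    X.map v.op ≫ X.map u.op ≫ r = X.map (u ≫ v).op ≫ r :=
  ((congrArg (· ≫ r) (X.map_comp v.op u.op)).trans (Strict.assoc _ _ r)).symm

/-- The congruence on formal composites generated by: the axioms of a category, functoriality of
`cell`, invertibility and naturality of `push`, and the three axioms of a pseudococone. -/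
inductive Rel (X : StrictPseudofunctor Iᵒᵖ C) (c : C) :
    ∀ {x y : PseudoColim X c}, Word X c x y → Word X c x y → Prop
  | refl {x y : PseudoColim X c} (p : Word X c x y) : Rel X c p p
  | symm {x y : PseudoColim X c} {p q : Word X c x y} : Rel X c p q → Rel X c q p
  | trans {x y : PseudoColim X c} {p q r : Word X c x y} : Rel X c p q → Rel X c q r → Rel X c p r
  | comp {x y z : PseudoColim X c} {p p' : Word X c x y} {q q' : Word X c y z} :
      Rel X c p p' → Rel X c q q' → Rel X c (p.comp q) (p'.comp q')
  | id_comp {x y : PseudoColim X c} (p : Word X c x y) : Rel X c ((Word.id x).comp p) p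
  | comp_id {x y : PseudoColim X c} (p : Word X c x y) : Rel X c (p.comp (Word.id y)) p
  | assoc {x y z t : PseudoColim X c} (p : Word X c x y) (q : Word X c y z) (r : Word X c z t) :
      Rel X c ((p.comp q).comp r) (p.comp (q.comp r))
  | cell_id (i : I) (r : X.obj (op i) ⟶ c) : Rel X c (Word.cell i (𝟙 r)) (Word.id ⟨i, r⟩)
  | cell_comp (i : I) {r s t : X.obj (op i) ⟶ c} (θ : r ⟶ s) (η : s ⟶ t) :
      Rel X c (Word.cell i (θ ≫ η)) ((Word.cell i θ).comp (Word.cell i η))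
  | push_pull {i j : I} (u : i ⟶ j) (r : X.obj (op i) ⟶ c) :
      Rel X c ((Word.push u r).comp (Word.pull u r)) (Word.id ⟨i, r⟩)
  | pull_push {i j : I} (u : i ⟶ j) (r : X.obj (op i) ⟶ c) :
      Rel X c ((Word.pull u r).comp (Word.push u r)) (Word.id ⟨j, X.map u.op ≫ r⟩)
  | push_naturality {i j : I} (u : i ⟶ j) {r s : X.obj (op i) ⟶ c} (θ : r ⟶ s) :
      Rel X c ((Word.cell i θ).comp (Word.push u s))
        ((Word.push u r).comp (Word.cell j (X.map u.op ◁ θ)))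
  | push_id (i : I) (r : X.obj (op i) ⟶ c) :
      Rel X c (Word.push (𝟙 i) r) (Word.cell i (eqToHom (push_id_eq X r)))
  | push_comp {i j k : I} (u : i ⟶ j) (v : j ⟶ k) (r : X.obj (op i) ⟶ c) :
      Rel X c (Word.push (u ≫ v) r)
        ((Word.push u r).comp ((Word.push v (X.map u.op ≫ r)).comp
          (Word.cell k (eqToHom (push_comp_eq X u v r)))))
  | push_cell {i j : I} {u v : i ⟶ j} (α : u ⟶ v) (r : X.obj (op i) ⟶ c) :
      Rel X c ((Word.push u r).comp
        (Word.cell j (X.map₂ (_root_.Bicategory.Opposite.op2 α) ▷ r))) (Word.push v r)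

instance setoid (x y : PseudoColim X c) : Setoid (Word X c x y) where
  r := Rel X c
  iseqv := ⟨Rel.refl, Rel.symm, Rel.trans⟩

instance : Category.{w} (PseudoColim X c) where
  Hom x y := Quotient (setoid x y)
  id x := Quotient.mk _ (Word.id x)
  comp := Quotient.map₂ Word.comp fun _ _ h _ _ h' => Rel.comp h h'
  id_comp := by rintro _ _ ⟨p⟩; exact Quotient.sound (Rel.id_comp p)
  comp_id := by rintro _ _ ⟨p⟩; exact Quotient.sound (Rel.comp_id p)
  assoc := by rintro _ _ _ _ ⟨p⟩ ⟨q⟩ ⟨r⟩; exact Quotient.sound (Rel.assoc p q r)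

/-- The arrow of the pseudocolimit given by an arrow `θ` of `C(X_i, c)`. -/
def cell {i : I} {r s : X.obj (op i) ⟶ c} (θ : r ⟶ s) : (⟨i, r⟩ : PseudoColim X c) ⟶ ⟨i, s⟩ :=
  Quotient.mk (setoid _ _) (Word.cell i θ)

/-- The component at `r` of the invertible structure 2-cell, at `u : i ⟶ j`, of the universal
pseudococone. -/
def push {i j : I} (u : i ⟶ j) (r : X.obj (op i) ⟶ c) :
    (⟨i, r⟩ : PseudoColim X c) ≅ ⟨j, X.map u.op ≫ r⟩ where
  hom := Quotient.mk (setoid _ _) (Word.push u r)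
  inv := Quotient.mk (setoid _ _) (Word.pull u r)
  hom_inv_id := Quotient.sound (Rel.push_pull u r)
  inv_hom_id := Quotient.sound (Rel.pull_push u r)

@[simp]
theorem cell_id {i : I} (r : X.obj (op i) ⟶ c) : cell (𝟙 r) = 𝟙 (⟨i, r⟩ : PseudoColim X c) :=
  Quotient.sound (Rel.cell_id i r)

@[simp]
theorem cell_comp {i : I} {r s t : X.obj (op i) ⟶ c} (θ : r ⟶ s) (η : s ⟶ t) :
    cell θ ≫ cell η = cell (X := X) (θ ≫ η) :=
  (Quotient.sound (Rel.cell_comp i θ η)).symm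

@[simp]
theorem cell_comp_assoc {i : I} {r s t : X.obj (op i) ⟶ c} (θ : r ⟶ s) (η : s ⟶ t)
    {z : PseudoColim X c} (h : (⟨i, t⟩ : PseudoColim X c) ⟶ z) :
    cell θ ≫ cell η ≫ h = cell (X := X) (θ ≫ η) ≫ h := by
  rw [← Category.assoc, cell_comp]

theorem push_naturality {i j : I} (u : i ⟶ j) {r s : X.obj (op i) ⟶ c} (θ : r ⟶ s) :
    cell θ ≫ (push u s).hom = (push u r).hom ≫ cell (X.map u.op ◁ θ) :=
  Quotient.sound (Rel.push_naturality u θ)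

theorem push_naturality_assoc {i j : I} (u : i ⟶ j) {r s : X.obj (op i) ⟶ c} (θ : r ⟶ s)
    {z : PseudoColim X c} (h : (⟨j, X.map u.op ≫ s⟩ : PseudoColim X c) ⟶ z) :
    cell θ ≫ (push u s).hom ≫ h = (push u r).hom ≫ cell (X.map u.op ◁ θ) ≫ h := by
  rw [← Category.assoc, push_naturality, Category.assoc]

theorem push_id {i : I} (r : X.obj (op i) ⟶ c) :
    (push (𝟙 i) r).hom = cell (eqToHom (push_id_eq X r)) :=
  Quotient.sound (Rel.push_id i r)

theorem push_comp {i j k : I} (u : i ⟶ j) (v : j ⟶ k) (r : X.obj (op i) ⟶ c) :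
    (push (u ≫ v) r).hom = (push u r).hom ≫ (push v (X.map u.op ≫ r)).hom ≫
      cell (eqToHom (push_comp_eq X u v r)) :=
  Quotient.sound (Rel.push_comp u v r)

theorem push_cell {i j : I} {u v : i ⟶ j} (α : u ⟶ v) (r : X.obj (op i) ⟶ c) :
    (push u r).hom ≫ cell (X.map₂ (_root_.Bicategory.Opposite.op2 α) ▷ r) = (push v r).hom :=
  Quotient.sound (Rel.push_cell α r)

theorem push_cell_assoc {i j : I} {u v : i ⟶ j} (α : u ⟶ v) (r : X.obj (op i) ⟶ c)
    {z : PseudoColim X c} (h : (⟨j, X.map v.op ≫ r⟩ : PseudoColim X c) ⟶ z) :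
    (push u r).hom ≫ cell (X.map₂ (_root_.Bicategory.Opposite.op2 α) ▷ r) ≫ h =
      (push v r).hom ≫ h := by
  rw [← Category.assoc, push_cell]

theorem eqToHom_eq_cell {i : I} {r s : X.obj (op i) ⟶ c} (h : r = s)
    (h' : (⟨i, r⟩ : PseudoColim X c) = ⟨i, s⟩) : eqToHom h' = cell (eqToHom h) := by
  subst h
  simp

/-- Induction principle for arrows: generators, identities and composites. -/
theorem hom_induction {P : ∀ {x y : PseudoColim X c}, (x ⟶ y) → Prop}
    (id : ∀ x : PseudoColim X c, P (𝟙 x))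
    (comp : ∀ {x y z : PseudoColim X c} (f : x ⟶ y) (g : y ⟶ z), P f → P g → P (f ≫ g))
    (cell : ∀ (i : I) {r s : X.obj (op i) ⟶ c} (θ : r ⟶ s), P (cell θ))
    (push : ∀ {i j : I} (u : i ⟶ j) (r : X.obj (op i) ⟶ c), P (push u r).hom)
    (pull : ∀ {i j : I} (u : i ⟶ j) (r : X.obj (op i) ⟶ c), P (PseudoColim.push u r).inv)
    {x y : PseudoColim X c} (f : x ⟶ y) : P f := by
  refine Quotient.inductionOn f fun p => ?_
  clear f
  induction p with
  | id x => exact id x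
  | comp p q hp hq => exact comp _ _ hp hq
  | cell i θ => exact cell i θ
  | push u r => exact push u r
  | pull u r => exact pull u r

/-- A pseudococone with vertex `K` on the diagram of categories `i ↦ C(X_i, c)`, written out: functors
`C(X_i, c) ⥤ K` (`obj`, `cell`) and natural isomorphisms `push`, subject to the pseudococone axioms. -/
structure CoconeData (X : StrictPseudofunctor Iᵒᵖ C) (c : C) (K : Type*) [Category K] where
  obj (i : I) (r : X.obj (op i) ⟶ c) : K
  cell (i : I) {r s : X.obj (op i) ⟶ c} (θ : r ⟶ s) : obj i r ⟶ obj i s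
  push {i j : I} (u : i ⟶ j) (r : X.obj (op i) ⟶ c) : obj i r ≅ obj j (X.map u.op ≫ r)
  cell_id (i : I) (r : X.obj (op i) ⟶ c) : cell i (𝟙 r) = 𝟙 (obj i r)
  cell_comp (i : I) {r s t : X.obj (op i) ⟶ c} (θ : r ⟶ s) (η : s ⟶ t) :
    cell i (θ ≫ η) = cell i θ ≫ cell i η
  push_naturality {i j : I} (u : i ⟶ j) {r s : X.obj (op i) ⟶ c} (θ : r ⟶ s) :
    cell i θ ≫ (push u s).hom = (push u r).hom ≫ cell j (X.map u.op ◁ θ)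
  push_id (i : I) (r : X.obj (op i) ⟶ c) :
    (push (𝟙 i) r).hom = cell i (eqToHom (push_id_eq X r))
  push_comp {i j k : I} (u : i ⟶ j) (v : j ⟶ k) (r : X.obj (op i) ⟶ c) :
    (push (u ≫ v) r).hom = (push u r).hom ≫ (push v (X.map u.op ≫ r)).hom ≫
      cell k (eqToHom (push_comp_eq X u v r))
  push_cell {i j : I} {u v : i ⟶ j} (α : u ⟶ v) (r : X.obj (op i) ⟶ c) :
    (push u r).hom ≫ cell j (X.map₂ (_root_.Bicategory.Opposite.op2 α) ▷ r) = (push v r).hom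

namespace CoconeData

variable {K : Type*} [Category K] (F : CoconeData X c K)

/-- The value on formal composites of the functor induced by a pseudococone. -/
def word : ∀ {x y : PseudoColim X c}, Word X c x y → (F.obj x.idx x.arr ⟶ F.obj y.idx y.arr)
  | _, _, .id _ => 𝟙 _
  | _, _, .comp p q => word p ≫ word q
  | _, _, .cell i θ => F.cell i θ
  | _, _, .push u r => (F.push u r).hom
  | _, _, .pull u r => (F.push u r).inv

theorem word_rel {x y : PseudoColim X c} {p q : Word X c x y} (h : Rel X c p q) :
    F.word p = F.word q := by
  induction h with
  | refl => rfl
  | symm _ ih => exact ih.symm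
  | trans _ _ ih ih' => exact ih.trans ih'
  | comp _ _ ih ih' => simp only [word, ih, ih']
  | id_comp => simp only [word, Category.id_comp]
  | comp_id => simp only [word, Category.comp_id]
  | assoc => simp only [word, Category.assoc]
  | cell_id => exact F.cell_id _ _
  | cell_comp => exact F.cell_comp _ _ _
  | push_pull => exact Iso.hom_inv_id _
  | pull_push => exact Iso.inv_hom_id _
  | push_naturality => exact F.push_naturality _ _
  | push_id => exact F.push_id _ _
  | push_comp => exact F.push_comp _ _ _
  | push_cell => exact F.push_cell _ _

/-- The functor out of the pseudocolimit induced by a pseudococone. Together with `functor_ext` and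
`natTrans` below, this is the universal property of `PseudoColim X c`. -/
def functor : PseudoColim X c ⥤ K where
  obj x := F.obj x.idx x.arr
  map := Quotient.lift F.word fun _ _ h => F.word_rel h
  map_id _ := rfl
  map_comp := by rintro _ _ _ ⟨p⟩ ⟨q⟩; rfl

end CoconeData

/-- Functors out of `PseudoColim X c` that agree on objects and on the generating arrows are equal. -/
theorem functor_ext {K : Type*} [Category K] {F G : PseudoColim X c ⥤ K} (hobj : ∀ x, F.obj x = G.obj x)
    (hcell : ∀ (i : I) {r s : X.obj (op i) ⟶ c} (θ : r ⟶ s),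
      F.map (cell θ) ≫ eqToHom (hobj _) = eqToHom (hobj _) ≫ G.map (cell θ))
    (hpush : ∀ {i j : I} (u : i ⟶ j) (r : X.obj (op i) ⟶ c),
      F.map (push u r).hom ≫ eqToHom (hobj _) = eqToHom (hobj _) ≫ G.map (push u r).hom) :
    F = G := by
  refine CategoryTheory.Functor.ext hobj fun x y f => ?_
  suffices h : F.map f ≫ eqToHom (hobj y) = eqToHom (hobj x) ≫ G.map f by
    rw [← Category.assoc, ← h]
    simp
  induction f using hom_induction with
  | id x => simp
  | comp f g hf hg => simp [hg, reassoc_of% hf]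
  | cell i θ => exact hcell i θ
  | push u r => exact hpush u r
  | pull u r =>
    rw [← cancel_epi (F.map (push u r).hom), ← F.map_comp_assoc, Iso.hom_inv_id, F.map_id,
      ← Category.assoc, hpush]
    simp [← G.map_comp]

/-- A natural transformation out of the pseudocolimit is determined by naturality on generators. -/
def natTrans {K : Type*} [Category K] {F G : PseudoColim X c ⥤ K} (app : ∀ x, F.obj x ⟶ G.obj x)
    (hcell : ∀ (i : I) {r s : X.obj (op i) ⟶ c} (θ : r ⟶ s),
      F.map (cell θ) ≫ app _ = app _ ≫ G.map (cell θ))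
    (hpush : ∀ {i j : I} (u : i ⟶ j) (r : X.obj (op i) ⟶ c),
      F.map (push u r).hom ≫ app _ = app _ ≫ G.map (push u r).hom) : F ⟶ G where
  app := app
  naturality x y f := by
    induction f using hom_induction with
    | id x => simp
    | comp f g hf hg => simp [hg, reassoc_of% hf]
    | cell i θ => exact hcell i θ
    | push u r => exact hpush u r
    | pull u r =>
      rw [← cancel_epi (F.map (push u r).hom), ← F.map_comp_assoc, Iso.hom_inv_id, F.map_id,
        ← Category.assoc, hpush]
      simp [← G.map_comp]

/-- The functor from the pseudocolimit of `C(X_i, c)` to that of `C(X_i, d)` induced by composition with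
`g : c ⟶ d`. -/
def post (X : StrictPseudofunctor Iᵒᵖ C) {c d : C} (g : c ⟶ d) : PseudoColim X c ⥤ PseudoColim X d :=
  CoconeData.functor
    { obj i r := ⟨i, r ≫ g⟩
      cell i _ _ θ := cell (θ ▷ g)
      push {_ j} u r := push u (r ≫ g) ≪≫
        eqToIso (congrArg (PseudoColim.mk j) (Strict.assoc (X.map u.op) r g).symm)
      cell_id i r := by simp
      cell_comp i _ _ _ θ η := by simp
      push_naturality u {r s} θ := by
        simp [eqToHom_eq_cell (Strict.assoc _ _ g).symm, push_naturality_assoc, Strict.associator_eqToIso]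
      push_id i r := by
        simp [eqToHom_eq_cell (Strict.assoc _ _ g).symm, push_id]
      push_comp u v r := by
        simp [eqToHom_eq_cell (Strict.assoc _ _ g).symm, push_comp, push_naturality_assoc]
      push_cell {i j u v} α r := by
        simp [eqToHom_eq_cell (Strict.assoc _ _ g).symm, ← push_cell α (r ≫ g), Strict.associator_eqToIso] }

@[simp]
theorem post_obj (g : c ⟶ d) (x : PseudoColim X c) : (post X g).obj x = ⟨x.idx, x.arr ≫ g⟩ := rfl

@[simp]
theorem post_map_cell (g : c ⟶ d) {i : I} {r s : X.obj (op i) ⟶ c} (θ : r ⟶ s) :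
    (post X g).map (cell θ) = cell (θ ▷ g) := rfl

@[simp]
theorem post_map_push (g : c ⟶ d) {i j : I} (u : i ⟶ j) (r : X.obj (op i) ⟶ c) :
    (post X g).map (push u r).hom =
      (push u (r ≫ g)).hom ≫ cell (eqToHom (Strict.assoc (X.map u.op) r g).symm) := by
  rw [← eqToHom_eq_cell (Strict.assoc (X.map u.op) r g).symm
    (congrArg (PseudoColim.mk j) (Strict.assoc (X.map u.op) r g).symm)]
  rfl

theorem post_id (X : StrictPseudofunctor Iᵒᵖ C) (c : C) : post X (𝟙 c) = 𝟭 (PseudoColim X c) :=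
  functor_ext (fun x => congrArg (PseudoColim.mk x.idx) (Strict.comp_id x.arr))
    (fun i r s θ => by
      change cell (θ ▷ 𝟙 c) ≫ eqToHom (congrArg (PseudoColim.mk i) (Strict.comp_id s)) =
        eqToHom (congrArg (PseudoColim.mk i) (Strict.comp_id r)) ≫ cell θ
      rw [eqToHom_eq_cell (Strict.comp_id s), eqToHom_eq_cell (Strict.comp_id r)]
      simp [Strict.rightUnitor_eqToIso])
    (fun {i j} u r => by
      rw [post_map_push]
      change ((push u (r ≫ 𝟙 c)).hom ≫ cell (eqToHom (Strict.assoc (X.map u.op) r (𝟙 c)).symm)) ≫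
          eqToHom (congrArg (PseudoColim.mk j) (Strict.comp_id (X.map u.op ≫ r))) =
        eqToHom (congrArg (PseudoColim.mk i) (Strict.comp_id r)) ≫ (push u r).hom
      rw [eqToHom_eq_cell (Strict.comp_id r), eqToHom_eq_cell (Strict.comp_id (X.map u.op ≫ r))]
      simp [push_naturality])

theorem post_comp (X : StrictPseudofunctor Iᵒᵖ C) {c d e : C} (g : c ⟶ d) (h : d ⟶ e) :
    post X (g ≫ h) = post X g ⋙ post X h :=
  functor_ext (fun x => congrArg (PseudoColim.mk x.idx) (Strict.assoc x.arr g h).symm)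
    (fun i r s θ => by
      change cell (θ ▷ (g ≫ h)) ≫ eqToHom (congrArg (PseudoColim.mk i) (Strict.assoc s g h).symm) =
        eqToHom (congrArg (PseudoColim.mk i) (Strict.assoc r g h).symm) ≫ cell (θ ▷ g ▷ h)
      rw [eqToHom_eq_cell (Strict.assoc s g h).symm, eqToHom_eq_cell (Strict.assoc r g h).symm]
      simp [Strict.associator_eqToIso])
    (fun {i j} u r => by
      rw [post_map_push]
      change ((push u (r ≫ g ≫ h)).hom ≫
          cell (eqToHom (Strict.assoc (X.map u.op) r (g ≫ h)).symm)) ≫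
          eqToHom (congrArg (PseudoColim.mk j) (Strict.assoc (X.map u.op ≫ r) g h).symm) =
        eqToHom (congrArg (PseudoColim.mk i) (Strict.assoc r g h).symm) ≫
          (post X h).map ((post X g).map (push u r).hom)
      rw [eqToHom_eq_cell (Strict.assoc r g h).symm,
        eqToHom_eq_cell (Strict.assoc (X.map u.op ≫ r) g h).symm]
      simp [push_naturality_assoc])

/-- The natural transformation induced by a 2-cell `g ⟶ h`. -/
def post₂ (X : StrictPseudofunctor Iᵒᵖ C) {g h : c ⟶ d} (ρ : g ⟶ h) : post X g ⟶ post X h :=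
  natTrans (fun x => cell (x.arr ◁ ρ))
    (fun i r s θ => by simp [whisker_exchange])
    (fun {i j} u r => by
      simp [push_naturality_assoc, Strict.associator_eqToIso])

theorem post₂_id (X : StrictPseudofunctor Iᵒᵖ C) (g : c ⟶ d) : post₂ X (𝟙 g) = 𝟙 (post X g) := by
  ext x
  exact (congrArg cell (whiskerLeft_id x.arr g)).trans (cell_id _)

theorem post₂_comp (X : StrictPseudofunctor Iᵒᵖ C) {g h k : c ⟶ d} (ρ : g ⟶ h) (σ : h ⟶ k) :
    post₂ X (ρ ≫ σ) = post₂ X ρ ≫ post₂ X σ := by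
  ext x
  exact (congrArg cell (whiskerLeft_comp x.arr ρ σ)).trans (cell_comp _ _).symm

theorem post₂_whiskerLeft (X : StrictPseudofunctor Iᵒᵖ C) {e : C} (f : c ⟶ d) {g h : d ⟶ e}
    (ρ : g ⟶ h) :
    post₂ X (f ◁ ρ) = eqToHom (post_comp X f g) ≫ Functor.whiskerLeft (post X f) (post₂ X ρ) ≫
      eqToHom (post_comp X f h).symm := by
  ext x
  rw [NatTrans.comp_app, NatTrans.comp_app, eqToHom_app, eqToHom_app]
  change cell (x.arr ◁ f ◁ ρ) =
    eqToHom (congrArg (PseudoColim.mk x.idx) (Strict.assoc x.arr f g).symm) ≫ cell ((x.arr ≫ f) ◁ ρ) ≫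
      eqToHom (congrArg (PseudoColim.mk x.idx) (Strict.assoc x.arr f h))
  rw [eqToHom_eq_cell (Strict.assoc x.arr f g).symm, eqToHom_eq_cell (Strict.assoc x.arr f h)]
  simp [Strict.associator_eqToIso]

theorem post₂_whiskerRight (X : StrictPseudofunctor Iᵒᵖ C) {e : C} {f g : c ⟶ d} (ρ : f ⟶ g)
    (h : d ⟶ e) :
    post₂ X (ρ ▷ h) = eqToHom (post_comp X f h) ≫ Functor.whiskerRight (post₂ X ρ) (post X h) ≫
      eqToHom (post_comp X g h).symm := by
  ext x
  rw [NatTrans.comp_app, NatTrans.comp_app, eqToHom_app, eqToHom_app]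
  change cell (x.arr ◁ ρ ▷ h) =
    eqToHom (congrArg (PseudoColim.mk x.idx) (Strict.assoc x.arr f h).symm) ≫ cell ((x.arr ◁ ρ) ▷ h) ≫
      eqToHom (congrArg (PseudoColim.mk x.idx) (Strict.assoc x.arr g h))
  rw [eqToHom_eq_cell (Strict.assoc x.arr f h).symm, eqToHom_eq_cell (Strict.assoc x.arr g h)]
  simp [Strict.associator_eqToIso]

end PseudoColim

theorem eqToHom_toCatHom₂ {K K' : Type w} [Category.{w} K] [Category.{w} K'] {F G : K ⥤ K'}
    (h : F = G) : (eqToHom h).toCatHom₂ = eqToHom (congrArg Functor.toCatHom h) := by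
  subst h
  rfl

/-- The 2-functor `L X : C ⟶ Cat`, `c ↦ colim_i C(X_i, c)`, i.e. the (pointwise computed) pseudocolimit
in `Hom(C, Cat)` of the representable 2-functors `C(X_i, -)`. -/
def proFunctor (X : StrictPseudofunctor Iᵒᵖ C) : StrictPseudofunctor C Cat.{w, w} :=
  StrictPseudofunctor.mk''
    { obj c := Cat.of (PseudoColim X c)
      map g := (PseudoColim.post X g).toCatHom
      map₂ ρ := (PseudoColim.post₂ X ρ).toCatHom₂
      map₂_id g := congrArg NatTrans.toCatHom₂ (PseudoColim.post₂_id X g)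
      map₂_comp ρ σ := congrArg NatTrans.toCatHom₂ (PseudoColim.post₂_comp X ρ σ)
      map_id c := congrArg Functor.toCatHom (PseudoColim.post_id X c)
      map_comp g h := congrArg Functor.toCatHom (PseudoColim.post_comp X g h)
      map₂_whisker_left f g h ρ := by
        refine (congrArg NatTrans.toCatHom₂ (PseudoColim.post₂_whiskerLeft X f ρ)).trans ?_
        rw [NatTrans.toCatHom₂_comp, NatTrans.toCatHom₂_comp, eqToHom_toCatHom₂,
          eqToHom_toCatHom₂]
        rfl
      map₂_whisker_right ρ g := by
        refine (congrArg NatTrans.toCatHom₂ (PseudoColim.post₂_whiskerRight X ρ g)).trans ?_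
        rw [NatTrans.toCatHom₂_comp, NatTrans.toCatHom₂_comp, eqToHom_toCatHom₂,
          eqToHom_toCatHom₂]
        rfl }

/-- The constant 2-functor with value `c`. -/
def constDiagram (J : Type w) [Bicategory.{w, w} J] [Bicategory.Strict J] (c : C) : StrictPseudofunctor J C :=
  StrictPseudofunctor.mk''
    { obj _ := c
      map _ := 𝟙 c
      map₂ _ := 𝟙 (𝟙 c)
      map₂_id _ := rfl
      map₂_comp _ _ := (Category.comp_id _).symm
      map_id _ := rfl
      map_comp _ _ := (Strict.comp_id _).symm
      map₂_whisker_left _ _ _ _ := by simp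
      map₂_whisker_right _ _ := by simp }

end Colim

section

variable {C : Type u} [Bicategory.{w, w} C] [Bicategory.Strict C]
  {I : Type w} [Bicategory.{w, w} I] [Bicategory.Strict I]

namespace PseudoColim

variable {X Y Z : StrictPseudofunctor Iᵒᵖ C} {c d : C}

/-- The component at `i` of a 2-natural transformation between diagrams. -/
abbrev compAt (τ : X ⟶ Y) (i : I) : X.obj (op i) ⟶ Y.obj (op i) :=
  (TwoNatTrans.toStrongTrans τ).app (op i)

theorem pre_eq (τ : X ⟶ Y) {i j : I} (u : i ⟶ j) (r : Y.obj (op i) ⟶ c) :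
    X.map u.op ≫ compAt τ i ≫ r = compAt τ j ≫ Y.map u.op ≫ r := by
  rw [← Strict.assoc, TwoNatTrans.naturality_eq τ u.op, Strict.assoc]

theorem pre_cell_eq (τ : X ⟶ Y) {i j : I} {u v : i ⟶ j} (α : u ⟶ v) (r : Y.obj (op i) ⟶ c) :
    X.map₂ (_root_.Bicategory.Opposite.op2 α) ▷ (compAt τ i ≫ r) ≫ eqToHom (pre_eq τ v r) =
      eqToHom (pre_eq τ u r) ≫ compAt τ j ◁ Y.map₂ (_root_.Bicategory.Opposite.op2 α) ▷ r := by
  have h := congrArg (· ▷ r) (TwoNatTrans.nat₂ τ (_root_.Bicategory.Opposite.op2 α))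
  simp only [comp_whiskerRight, eqToHom_whiskerRight, whisker_assoc, Strict.associator_eqToIso,
    eqToIso.hom, eqToIso.inv] at h
  rw [whiskerRight_comp]
  simp only [Strict.associator_eqToIso, eqToIso.hom, eqToIso.inv, Category.assoc]
  rw [← cancel_mono (eqToHom (Strict.assoc (compAt τ j) (Y.map v.op) r).symm)]
  rw [← cancel_epi (eqToHom (Strict.assoc (X.map u.op) (compAt τ i) r))]
  simpa using h

theorem pre_whisker_eq (τ : X ⟶ Y) {i j : I} (u : i ⟶ j) {r s : Y.obj (op i) ⟶ c} (θ : r ⟶ s) :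
    X.map u.op ◁ compAt τ i ◁ θ ≫ eqToHom (pre_eq τ u s) =
      eqToHom (pre_eq τ u r) ≫ compAt τ j ◁ Y.map u.op ◁ θ := by
  have h := congr_whiskerLeft (TwoNatTrans.naturality_eq τ u.op) θ
  simp only [comp_whiskerLeft, Strict.associator_eqToIso, eqToIso.hom, eqToIso.inv] at h
  rw [← cancel_mono (eqToHom (Strict.assoc (compAt τ j) (Y.map u.op) s).symm)]
  rw [← cancel_epi (eqToHom (Strict.assoc (X.map u.op) (compAt τ i) r))]
  rw [← cancel_mono (eqToHom (congrArg (· ≫ s) (TwoNatTrans.naturality_eq τ u.op).symm))]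
  simpa using h

/-- The functor from the pseudocolimit of `C(Y_i, c)` to that of `C(X_i, c)` induced by a 2-natural
transformation `τ : X ⟶ Y` of diagrams. -/
def pre (τ : X ⟶ Y) (c : C) : PseudoColim Y c ⥤ PseudoColim X c :=
  CoconeData.functor
    { obj i r := ⟨i, compAt τ i ≫ r⟩
      cell i _ _ θ := cell (compAt τ i ◁ θ)
      push {i j} u r := push u (compAt τ i ≫ r) ≪≫ eqToIso (congrArg (PseudoColim.mk j) (pre_eq τ u r))
      cell_id i r := by simp
      cell_comp i _ _ _ θ η := by simp
      push_naturality {_ _} u {r s} θ := by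
        simp [eqToHom_eq_cell (pre_eq τ u r), eqToHom_eq_cell (pre_eq τ u s),
          push_naturality_assoc, pre_whisker_eq]
      push_id i r := by
        simp [eqToHom_eq_cell (pre_eq τ _ _), push_id]
      push_comp u v r := by
        simp [eqToHom_eq_cell (pre_eq τ _ _), push_comp, push_naturality_assoc]
      push_cell {i j u v} α r := by
        simp only [Iso.trans_hom, eqToIso.hom]
        rw [eqToHom_eq_cell (pre_eq τ u r), eqToHom_eq_cell (pre_eq τ v r), Category.assoc,
          cell_comp, ← pre_cell_eq, ← cell_comp, push_cell_assoc] }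

theorem pre_map_cell (τ : X ⟶ Y) {i : I} {r s : Y.obj (op i) ⟶ c} (θ : r ⟶ s) :
    (pre τ c).map (cell θ) = cell (compAt τ i ◁ θ) := rfl

theorem pre_map_push (τ : X ⟶ Y) {i j : I} (u : i ⟶ j) (r : Y.obj (op i) ⟶ c) :
    (pre τ c).map (push u r).hom = (push u (compAt τ i ≫ r)).hom ≫ cell (eqToHom (pre_eq τ u r)) := by
  rw [← eqToHom_eq_cell (pre_eq τ u r) (congrArg (PseudoColim.mk j) (pre_eq τ u r))]
  rfl

theorem pre_map_push_cell (τ : X ⟶ Y) {i j : I} (u : i ⟶ j) (r : Y.obj (op i) ⟶ c)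
    {s : Y.obj (op j) ⟶ c} (θ : Y.map u.op ≫ r ⟶ s) :
    (pre τ c).map ((push u r).hom ≫ cell θ) =
      (push u (compAt τ i ≫ r)).hom ≫ cell (eqToHom (pre_eq τ u r) ≫ compAt τ j ◁ θ) := by
  refine ((pre τ c).map_comp _ _).trans ((congrArg (· ≫ cell (compAt τ j ◁ θ))
    (pre_map_push τ u r)).trans ?_)
  exact (Category.assoc _ _ _).trans (congrArg (_ ≫ ·) (cell_comp _ _))

theorem post_map_push_cell (g : c ⟶ d) {i j : I} (u : i ⟶ j) (r : X.obj (op i) ⟶ c)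
    {s : X.obj (op j) ⟶ c} (θ : X.map u.op ≫ r ⟶ s) :
    (post X g).map ((push u r).hom ≫ cell θ) =
      (push u (r ≫ g)).hom ≫ cell (eqToHom (Strict.assoc (X.map u.op) r g).symm ≫ θ ▷ g) := by
  refine ((post X g).map_comp _ _).trans ((congrArg (· ≫ cell (θ ▷ g))
    (post_map_push g u r)).trans ?_)
  exact (Category.assoc _ _ _).trans (congrArg (_ ≫ ·) (cell_comp _ _))

theorem pre₂_eq {τ σ : X ⟶ Y} (ρ : τ ⟶ σ) {i j : I} (u : i ⟶ j) (r : Y.obj (op i) ⟶ c) :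
    eqToHom (pre_eq τ u r) ≫ ρ.hom.as.app (op j) ▷ (Y.map u.op ≫ r) =
      X.map u.op ◁ ρ.hom.as.app (op i) ▷ r ≫ eqToHom (pre_eq σ u r) := by
  have h := congrArg (· ▷ r) (TwoNatTrans.hom_nat ρ u.op)
  simp only [comp_whiskerRight, eqToHom_whiskerRight, whisker_assoc, Strict.associator_eqToIso,
    eqToIso.hom, eqToIso.inv] at h
  rw [whiskerRight_comp]
  simp only [Strict.associator_eqToIso, eqToIso.hom, eqToIso.inv]
  rw [← cancel_mono (eqToHom (Strict.assoc (compAt σ j) (Y.map u.op) r).symm)]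
  rw [← cancel_epi (eqToHom (Strict.assoc (X.map u.op) (compAt τ i) r))]
  simpa using h.symm

/-- The natural transformation induced by a modification. -/
def pre₂ {τ σ : X ⟶ Y} (ρ : τ ⟶ σ) (c : C) : pre τ c ⟶ pre σ c :=
  natTrans (fun x => cell (ρ.hom.as.app (op x.idx) ▷ x.arr))
    (fun i r s θ => by
      change cell (compAt τ i ◁ θ) ≫ cell (ρ.hom.as.app (op i) ▷ s) =
        cell (ρ.hom.as.app (op i) ▷ r) ≫ cell (compAt σ i ◁ θ)
      rw [cell_comp, cell_comp, whisker_exchange])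
    (fun {i j} u r => by
      rw [pre_map_push, pre_map_push]
      change ((push u (compAt τ i ≫ r)).hom ≫ cell (eqToHom (pre_eq τ u r))) ≫
        cell (ρ.hom.as.app (op j) ▷ (Y.map u.op ≫ r)) = cell (ρ.hom.as.app (op i) ▷ r) ≫
        (push u (compAt σ i ≫ r)).hom ≫ cell (eqToHom (pre_eq σ u r))
      rw [push_naturality_assoc, Category.assoc, cell_comp, cell_comp, pre₂_eq])

theorem pre_post (τ : X ⟶ Y) {c d : C} (g : c ⟶ d) :
    post Y g ⋙ pre τ d = pre τ c ⋙ post X g :=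
  functor_ext (fun x => congrArg (PseudoColim.mk x.idx) (Strict.assoc (compAt τ x.idx) x.arr g).symm)
    (fun i r s θ => by
      change cell (compAt τ i ◁ θ ▷ g) ≫
          eqToHom (congrArg (PseudoColim.mk i) (Strict.assoc (compAt τ i) s g).symm) =
        eqToHom (congrArg (PseudoColim.mk i) (Strict.assoc (compAt τ i) r g).symm) ≫ cell ((compAt τ i ◁ θ) ▷ g)
      rw [eqToHom_eq_cell (Strict.assoc (compAt τ i) r g).symm,
        eqToHom_eq_cell (Strict.assoc (compAt τ i) s g).symm]
      simp [Strict.associator_eqToIso])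
    (fun {i j} u r => by
      have E1 : X.map u.op ≫ compAt τ i ≫ r ≫ g = compAt τ j ≫ (Y.map u.op ≫ r) ≫ g :=
        (pre_eq τ u (r ≫ g)).trans (congrArg (compAt τ j ≫ ·) (Strict.assoc (Y.map u.op) r g).symm)
      have E2 : X.map u.op ≫ (compAt τ i ≫ r) ≫ g = (compAt τ j ≫ Y.map u.op ≫ r) ≫ g :=
        (Strict.assoc (X.map u.op) (compAt τ i ≫ r) g).symm.trans (congrArg (· ≫ g) (pre_eq τ u r))
      have e1 : (pre τ d).map ((post Y g).map (push u r).hom) =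
          (push u (compAt τ i ≫ r ≫ g)).hom ≫ cell (eqToHom E1) := by
        refine (congrArg (pre τ d).map (post_map_push g u r)).trans ?_
        refine (pre_map_push_cell τ u (r ≫ g) _).trans ?_
        rw [whiskerLeft_eqToHom, eqToHom_trans]
      have e2 : (post X g).map ((pre τ c).map (push u r).hom) =
          (push u ((compAt τ i ≫ r) ≫ g)).hom ≫ cell (eqToHom E2) := by
        refine (congrArg (post X g).map (pre_map_push τ u r)).trans ?_
        refine (post_map_push_cell g u (compAt τ i ≫ r) _).trans ?_
        rw [eqToHom_whiskerRight, eqToHom_trans]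
      change (pre τ d).map ((post Y g).map (push u r).hom) ≫ _ =
        _ ≫ (post X g).map ((pre τ c).map (push u r).hom)
      rw [e1, e2]
      change ((push u (compAt τ i ≫ r ≫ g)).hom ≫ cell (eqToHom E1)) ≫
          eqToHom (congrArg (PseudoColim.mk j) (Strict.assoc (compAt τ j) (Y.map u.op ≫ r) g).symm) =
        eqToHom (congrArg (PseudoColim.mk i) (Strict.assoc (compAt τ i) r g).symm) ≫
          (push u ((compAt τ i ≫ r) ≫ g)).hom ≫ cell (eqToHom E2)
      rw [eqToHom_eq_cell (Strict.assoc (compAt τ i) r g).symm,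
        eqToHom_eq_cell (Strict.assoc (compAt τ j) (Y.map u.op ≫ r) g).symm,
        Category.assoc (push u _).hom,
        cell_comp, push_naturality_assoc, cell_comp, whiskerLeft_eqToHom, eqToHom_trans,
        eqToHom_trans])

theorem pre_post₂ (τ : X ⟶ Y) {c d : C} {g h : c ⟶ d} (ρ : g ⟶ h) :
    Functor.whiskerRight (post₂ Y ρ) (pre τ d) ≫ eqToHom (pre_post τ h) =
      eqToHom (pre_post τ g) ≫ Functor.whiskerLeft (pre τ c) (post₂ X ρ) := by
  ext x
  rw [NatTrans.comp_app, NatTrans.comp_app, eqToHom_app, eqToHom_app]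
  change cell (compAt τ x.idx ◁ x.arr ◁ ρ) ≫
      eqToHom (congrArg (PseudoColim.mk x.idx) (Strict.assoc (compAt τ x.idx) x.arr h).symm) =
    eqToHom (congrArg (PseudoColim.mk x.idx) (Strict.assoc (compAt τ x.idx) x.arr g).symm) ≫
      cell ((compAt τ x.idx ≫ x.arr) ◁ ρ)
  rw [eqToHom_eq_cell (Strict.assoc (compAt τ x.idx) x.arr g).symm,
    eqToHom_eq_cell (Strict.assoc (compAt τ x.idx) x.arr h).symm]
  simp [Strict.associator_eqToIso]

theorem pre₂_post {τ σ : X ⟶ Y} (ρ : τ ⟶ σ) {c d : C} (g : c ⟶ d) :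
    Functor.whiskerLeft (post Y g) (pre₂ ρ d) ≫ eqToHom (pre_post σ g) =
      eqToHom (pre_post τ g) ≫ Functor.whiskerRight (pre₂ ρ c) (post X g) := by
  ext x
  rw [NatTrans.comp_app, NatTrans.comp_app, eqToHom_app, eqToHom_app]
  change cell (ρ.hom.as.app (op x.idx) ▷ (x.arr ≫ g)) ≫
      eqToHom (congrArg (PseudoColim.mk x.idx) (Strict.assoc (compAt σ x.idx) x.arr g).symm) =
    eqToHom (congrArg (PseudoColim.mk x.idx) (Strict.assoc (compAt τ x.idx) x.arr g).symm) ≫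
      cell (ρ.hom.as.app (op x.idx) ▷ x.arr ▷ g)
  rw [eqToHom_eq_cell (Strict.assoc (compAt τ x.idx) x.arr g).symm,
    eqToHom_eq_cell (Strict.assoc (compAt σ x.idx) x.arr g).symm]
  simp [Strict.associator_eqToIso]

theorem pre_id (X : StrictPseudofunctor Iᵒᵖ C) (c : C) : pre (𝟙 X) c = 𝟭 (PseudoColim X c) :=
  functor_ext (fun x => congrArg (PseudoColim.mk x.idx) (Strict.id_comp x.arr))
    (fun i r s θ => by
      change cell (𝟙 (X.obj (op i)) ◁ θ) ≫ eqToHom (congrArg (PseudoColim.mk i) (Strict.id_comp s)) =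
        eqToHom (congrArg (PseudoColim.mk i) (Strict.id_comp r)) ≫ cell θ
      rw [eqToHom_eq_cell (Strict.id_comp s), eqToHom_eq_cell (Strict.id_comp r)]
      simp [Strict.leftUnitor_eqToIso])
    (fun {i j} u r => by
      rw [pre_map_push]
      have E : X.map u.op ≫ 𝟙 (X.obj (op i)) ≫ r = 𝟙 (X.obj (op j)) ≫ X.map u.op ≫ r :=
        pre_eq (𝟙 X) u r
      change ((push u (𝟙 (X.obj (op i)) ≫ r)).hom ≫ cell (eqToHom E)) ≫
          eqToHom (congrArg (PseudoColim.mk j) (Strict.id_comp (X.map u.op ≫ r))) =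
        eqToHom (congrArg (PseudoColim.mk i) (Strict.id_comp r)) ≫ (push u r).hom
      rw [eqToHom_eq_cell (Strict.id_comp r), eqToHom_eq_cell (Strict.id_comp (X.map u.op ≫ r)),
        push_naturality, Category.assoc, cell_comp, whiskerLeft_eqToHom, eqToHom_trans])

theorem pre_comp (τ : X ⟶ Y) (σ : Y ⟶ Z) (c : C) : pre (τ ≫ σ) c = pre σ c ⋙ pre τ c :=
  functor_ext (fun x => congrArg (PseudoColim.mk x.idx) (Strict.assoc (compAt τ x.idx) (compAt σ x.idx) x.arr))
    (fun i r s θ => by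
      change cell ((compAt τ i ≫ compAt σ i) ◁ θ) ≫
          eqToHom (congrArg (PseudoColim.mk i) (Strict.assoc (compAt τ i) (compAt σ i) s)) =
        eqToHom (congrArg (PseudoColim.mk i) (Strict.assoc (compAt τ i) (compAt σ i) r)) ≫
          cell (compAt τ i ◁ compAt σ i ◁ θ)
      rw [eqToHom_eq_cell (Strict.assoc (compAt τ i) (compAt σ i) s),
        eqToHom_eq_cell (Strict.assoc (compAt τ i) (compAt σ i) r)]
      simp [Strict.associator_eqToIso])
    (fun {i j} u r => by
      have E : X.map u.op ≫ (compAt τ i ≫ compAt σ i) ≫ r = (compAt τ j ≫ compAt σ j) ≫ Z.map u.op ≫ r :=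
        pre_eq (τ ≫ σ) u r
      have E2 : X.map u.op ≫ compAt τ i ≫ compAt σ i ≫ r = compAt τ j ≫ compAt σ j ≫ Z.map u.op ≫ r :=
        (pre_eq τ u (compAt σ i ≫ r)).trans (congrArg (compAt τ j ≫ ·) (pre_eq σ u r))
      have e2 : (pre τ c).map ((pre σ c).map (push u r).hom) =
          (push u (compAt τ i ≫ compAt σ i ≫ r)).hom ≫ cell (eqToHom E2) := by
        refine (congrArg (pre τ c).map (pre_map_push σ u r)).trans ?_
        refine (pre_map_push_cell τ u (compAt σ i ≫ r) _).trans ?_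
        rw [whiskerLeft_eqToHom, eqToHom_trans]
      rw [pre_map_push]
      change _ = _ ≫ (pre τ c).map ((pre σ c).map (push u r).hom)
      rw [e2]
      change ((push u ((compAt τ i ≫ compAt σ i) ≫ r)).hom ≫ cell (eqToHom E)) ≫
          eqToHom (congrArg (PseudoColim.mk j) (Strict.assoc (compAt τ j) (compAt σ j) (Z.map u.op ≫ r))) =
        eqToHom (congrArg (PseudoColim.mk i) (Strict.assoc (compAt τ i) (compAt σ i) r)) ≫
          (push u (compAt τ i ≫ compAt σ i ≫ r)).hom ≫ cell (eqToHom E2)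
      rw [eqToHom_eq_cell (Strict.assoc (compAt τ i) (compAt σ i) r),
        eqToHom_eq_cell (Strict.assoc (compAt τ j) (compAt σ j) (Z.map u.op ≫ r)),
        Category.assoc (push u _).hom,
        cell_comp, push_naturality_assoc, cell_comp, whiskerLeft_eqToHom, eqToHom_trans,
        eqToHom_trans])

end PseudoColim

open _root_.Bicategory.Opposite

/-- The 2-natural transformation `L Y ⟶ L X` induced by `τ : X ⟶ Y`. -/
def proMap {X Y : StrictPseudofunctor Iᵒᵖ C} (τ : X ⟶ Y) : proFunctor Y ⟶ proFunctor X :=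
  TwoNatTrans.mk' (fun c => (PseudoColim.pre τ c).toCatHom)
    (fun g => congrArg Functor.toCatHom (PseudoColim.pre_post τ g))
    (fun ρ => by
      have h := congrArg NatTrans.toCatHom₂ (PseudoColim.pre_post₂ τ ρ)
      rw [NatTrans.toCatHom₂_comp, NatTrans.toCatHom₂_comp, eqToHom_toCatHom₂,
        eqToHom_toCatHom₂] at h
      exact h)

/-- The modification induced by a modification `τ ⟶ σ`. -/
def proMap₂ {X Y : StrictPseudofunctor Iᵒᵖ C} {τ σ : X ⟶ Y} (ρ : τ ⟶ σ) : proMap τ ⟶ proMap σ :=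
  TwoNatTrans.homMk (fun c => (PseudoColim.pre₂ ρ c).toCatHom₂)
    (fun g => by
      have h := congrArg NatTrans.toCatHom₂ (PseudoColim.pre₂_post ρ g)
      rw [NatTrans.toCatHom₂_comp, NatTrans.toCatHom₂_comp, eqToHom_toCatHom₂,
        eqToHom_toCatHom₂] at h
      exact h)

end

section

variable {C : Type u} [Bicategory.{w, w} C] [Bicategory.Strict C]
  {I : Type w} [Bicategory.{w, w} I] [Bicategory.Strict I]

theorem proMap_id (X : StrictPseudofunctor Iᵒᵖ C) : proMap (𝟙 X) = 𝟙 (proFunctor X) :=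
  TwoNatTrans.ext' fun c => congrArg Functor.toCatHom (PseudoColim.pre_id X c)

theorem proMap_comp {X Y Z : StrictPseudofunctor Iᵒᵖ C} (τ : X ⟶ Y) (σ : Y ⟶ Z) :
    proMap (τ ≫ σ) = proMap σ ≫ proMap τ :=
  TwoNatTrans.ext' fun c => congrArg Functor.toCatHom (PseudoColim.pre_comp τ σ c)

theorem proMap₂_id {X Y : StrictPseudofunctor Iᵒᵖ C} (τ : X ⟶ Y) : proMap₂ (𝟙 τ) = 𝟙 (proMap τ) := by
  apply TwoNatTrans.hom_ext
  intro c
  refine congrArg NatTrans.toCatHom₂ ?_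
  ext x
  exact (congrArg PseudoColim.cell (id_whiskerRight _ x.arr)).trans (PseudoColim.cell_id _)

theorem proMap₂_comp {X Y : StrictPseudofunctor Iᵒᵖ C} {τ σ ρ : X ⟶ Y} (α : τ ⟶ σ) (β : σ ⟶ ρ) :
    proMap₂ (α ≫ β) = proMap₂ α ≫ proMap₂ β := by
  apply TwoNatTrans.hom_ext
  intro c
  refine congrArg NatTrans.toCatHom₂ ?_
  ext x
  exact (congrArg PseudoColim.cell (comp_whiskerRight _ _ x.arr)).trans (PseudoColim.cell_comp _ _).symm

theorem proMap₂_whiskerLeft {X Y Z : StrictPseudofunctor Iᵒᵖ C} (τ : X ⟶ Y) {σ ρ : Y ⟶ Z}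
    (α : σ ⟶ ρ) :
    proMap₂ (τ ◁ α) = eqToHom (proMap_comp τ σ) ≫ proMap₂ α ▷ proMap τ ≫
      eqToHom (proMap_comp τ ρ).symm := by
  apply TwoNatTrans.hom_ext
  intro c
  refine Eq.trans ?_ (TwoNatTrans.eqToHom_conj_app (proMap_comp τ σ) (proMap₂ α ▷ proMap τ)
    (proMap_comp τ ρ).symm c (congrArg Functor.toCatHom (PseudoColim.pre_comp τ σ c))
    (congrArg Functor.toCatHom (PseudoColim.pre_comp τ ρ c).symm)).symm
  refine Eq.trans (congrArg NatTrans.toCatHom₂ (?_ : PseudoColim.pre₂ (τ ◁ α) c =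
    eqToHom (PseudoColim.pre_comp τ σ c) ≫ Functor.whiskerRight (PseudoColim.pre₂ α c) (PseudoColim.pre τ c) ≫
      eqToHom (PseudoColim.pre_comp τ ρ c).symm)) ?_
  rotate_left
  · rw [NatTrans.toCatHom₂_comp, NatTrans.toCatHom₂_comp, eqToHom_toCatHom₂, eqToHom_toCatHom₂]
    rfl
  ext x
  rw [NatTrans.comp_app, NatTrans.comp_app, eqToHom_app, eqToHom_app]
  change PseudoColim.cell ((PseudoColim.compAt τ x.idx ◁ α.hom.as.app (op x.idx)) ▷ x.arr) =
    eqToHom (congrArg (PseudoColim.mk x.idx) (Strict.assoc (PseudoColim.compAt τ x.idx) (PseudoColim.compAt σ x.idx) x.arr)) ≫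
      PseudoColim.cell (PseudoColim.compAt τ x.idx ◁ α.hom.as.app (op x.idx) ▷ x.arr) ≫
      eqToHom (congrArg (PseudoColim.mk x.idx)
        (Strict.assoc (PseudoColim.compAt τ x.idx) (PseudoColim.compAt ρ x.idx) x.arr).symm)
  rw [PseudoColim.eqToHom_eq_cell (Strict.assoc (PseudoColim.compAt τ x.idx) (PseudoColim.compAt σ x.idx) x.arr),
    PseudoColim.eqToHom_eq_cell (Strict.assoc (PseudoColim.compAt τ x.idx) (PseudoColim.compAt ρ x.idx) x.arr).symm]
  simp [Strict.associator_eqToIso]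

theorem proMap₂_whiskerRight {X Y Z : StrictPseudofunctor Iᵒᵖ C} {τ σ : X ⟶ Y} (α : τ ⟶ σ)
    (ρ : Y ⟶ Z) :
    proMap₂ (α ▷ ρ) = eqToHom (proMap_comp τ ρ) ≫ proMap ρ ◁ proMap₂ α ≫
      eqToHom (proMap_comp σ ρ).symm := by
  apply TwoNatTrans.hom_ext
  intro c
  refine Eq.trans ?_ (TwoNatTrans.eqToHom_conj_app (proMap_comp τ ρ) (proMap ρ ◁ proMap₂ α)
    (proMap_comp σ ρ).symm c (congrArg Functor.toCatHom (PseudoColim.pre_comp τ ρ c))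
    (congrArg Functor.toCatHom (PseudoColim.pre_comp σ ρ c).symm)).symm
  refine Eq.trans (congrArg NatTrans.toCatHom₂ (?_ : PseudoColim.pre₂ (α ▷ ρ) c =
    eqToHom (PseudoColim.pre_comp τ ρ c) ≫ Functor.whiskerLeft (PseudoColim.pre ρ c) (PseudoColim.pre₂ α c) ≫
      eqToHom (PseudoColim.pre_comp σ ρ c).symm)) ?_
  rotate_left
  · rw [NatTrans.toCatHom₂_comp, NatTrans.toCatHom₂_comp, eqToHom_toCatHom₂, eqToHom_toCatHom₂]
    rfl
  ext x
  rw [NatTrans.comp_app, NatTrans.comp_app, eqToHom_app, eqToHom_app]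
  change PseudoColim.cell ((α.hom.as.app (op x.idx) ▷ PseudoColim.compAt ρ x.idx) ▷ x.arr) =
    eqToHom (congrArg (PseudoColim.mk x.idx) (Strict.assoc (PseudoColim.compAt τ x.idx) (PseudoColim.compAt ρ x.idx) x.arr)) ≫
      PseudoColim.cell (α.hom.as.app (op x.idx) ▷ (PseudoColim.compAt ρ x.idx ≫ x.arr)) ≫
      eqToHom (congrArg (PseudoColim.mk x.idx)
        (Strict.assoc (PseudoColim.compAt σ x.idx) (PseudoColim.compAt ρ x.idx) x.arr).symm)
  rw [PseudoColim.eqToHom_eq_cell (Strict.assoc (PseudoColim.compAt τ x.idx) (PseudoColim.compAt ρ x.idx) x.arr),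
    PseudoColim.eqToHom_eq_cell (Strict.assoc (PseudoColim.compAt σ x.idx) (PseudoColim.compAt ρ x.idx) x.arr).symm]
  simp [Strict.associator_eqToIso]

section
variable (J : Type w) [Bicategory.{w, w} J] [Bicategory.Strict J]

/-- The 2-natural transformation between constant 2-functors given by a 1-cell `f`. -/
def constMap {a b : C} (f : a ⟶ b) : constDiagram J a ⟶ constDiagram J b :=
  TwoNatTrans.mk' (fun _ => f) (fun _ => (Strict.id_comp f).trans (Strict.comp_id f).symm)
    (fun _ => by
      change 𝟙 (𝟙 a) ▷ f ≫ eqToHom ((Strict.id_comp f).trans (Strict.comp_id f).symm) =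
        eqToHom ((Strict.id_comp f).trans (Strict.comp_id f).symm) ≫ f ◁ 𝟙 (𝟙 b)
      simp)

/-- The modification given by a 2-cell `α`. -/
def constMap₂ {a b : C} {f g : a ⟶ b} (α : f ⟶ g) : constMap J f ⟶ constMap J g :=
  TwoNatTrans.homMk (fun _ => α) (fun _ => by
    change 𝟙 a ◁ α ≫ eqToHom ((Strict.id_comp g).trans (Strict.comp_id g).symm) =
      eqToHom ((Strict.id_comp f).trans (Strict.comp_id f).symm) ≫ α ▷ 𝟙 b
    simp [Strict.leftUnitor_eqToIso, Strict.rightUnitor_eqToIso])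

theorem constMap_id (a : C) : constMap J (𝟙 a) = 𝟙 (constDiagram J a) :=
  TwoNatTrans.ext' fun _ => rfl

theorem constMap_comp {a b c : C} (f : a ⟶ b) (g : b ⟶ c) :
    constMap J (f ≫ g) = constMap J f ≫ constMap J g :=
  TwoNatTrans.ext' fun _ => rfl

theorem constMap₂_whiskerLeft {a b c : C} (f : a ⟶ b) {g h : b ⟶ c} (α : g ⟶ h) :
    constMap₂ J (f ◁ α) = eqToHom (constMap_comp J f g) ≫ constMap J f ◁ constMap₂ J α ≫
      eqToHom (constMap_comp J f h).symm := by
  apply TwoNatTrans.hom_ext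
  intro i
  refine Eq.trans ?_ (TwoNatTrans.eqToHom_conj_app (constMap_comp J f g)
    (constMap J f ◁ constMap₂ J α) (constMap_comp J f h).symm i rfl rfl).symm
  exact ((Category.id_comp _).trans (Category.comp_id _)).symm

theorem constMap₂_whiskerRight {a b c : C} {f g : a ⟶ b} (α : f ⟶ g) (h : b ⟶ c) :
    constMap₂ J (α ▷ h) = eqToHom (constMap_comp J f h) ≫ constMap₂ J α ▷ constMap J h ≫
      eqToHom (constMap_comp J g h).symm := by
  apply TwoNatTrans.hom_ext
  intro i
  refine Eq.trans ?_ (TwoNatTrans.eqToHom_conj_app (constMap_comp J f h)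
    (constMap₂ J α ▷ constMap J h) (constMap_comp J g h).symm i rfl rfl).symm
  exact ((Category.id_comp _).trans (Category.comp_id _)).symm

/-- The diagonal 2-functor `C ⟶ Hom(J, C)`, sending an object to the constant 2-functor at it. -/
def diagonal (C : Type u) [Bicategory.{w, w} C] [Bicategory.Strict C] : StrictPseudofunctor C (StrictPseudofunctor J C) :=
  StrictPseudofunctor.mk''
    { obj a := constDiagram J a
      map f := constMap J f
      map₂ α := constMap₂ J α
      map₂_id _ := rfl
      map₂_comp _ _ := rfl
      map_id a := constMap_id J a
      map_comp f g := constMap_comp J f g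
      map₂_whisker_left f _ _ α := constMap₂_whiskerLeft J f α
      map₂_whisker_right α h := constMap₂_whiskerRight J α h }

end

theorem op2_conj {B : Type*} [Bicategory B] {a b : B} {f f' g' g : a ⟶ b} (h : f = f')
    (η : f' ⟶ g') (h' : g' = g) :
    _root_.Bicategory.Opposite.op2 (eqToHom h ≫ η ≫ eqToHom h') =
      eqToHom (congrArg Quiver.Hom.op h) ≫ _root_.Bicategory.Opposite.op2 η ≫
        eqToHom (congrArg Quiver.Hom.op h') := by
  subst h h'
  simp

/-- For a fixed index 2-category `I`, the assignment `X ↦ L X` as a 2-functor from diagrams to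
`Hom(C, Cat)ᵒᵖ` (the opposite reverses 1-cells but not 2-cells). -/
def proFunctorTwo (C : Type u) [Bicategory.{w, w} C] [Bicategory.Strict C]
    (I : Type w) [Bicategory.{w, w} I] [Bicategory.Strict I] :
    StrictPseudofunctor (StrictPseudofunctor Iᵒᵖ C) (StrictPseudofunctor C Cat.{w, w})ᵒᵖ :=
  StrictPseudofunctor.mk''
    { obj X := op (proFunctor X)
      map τ := (proMap τ).op
      map₂ α := _root_.Bicategory.Opposite.op2 (proMap₂ α)
      map₂_id τ := congrArg _root_.Bicategory.Opposite.op2 (proMap₂_id τ)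
      map₂_comp α β := congrArg _root_.Bicategory.Opposite.op2 (proMap₂_comp α β)
      map_id X := congrArg Quiver.Hom.op (proMap_id X)
      map_comp τ σ := congrArg Quiver.Hom.op (proMap_comp τ σ)
      map₂_whisker_left τ _ _ α := by
        refine (congrArg _root_.Bicategory.Opposite.op2 (proMap₂_whiskerLeft τ α)).trans ?_
        exact op2_conj (proMap_comp τ _) _ (proMap_comp τ _).symm
      map₂_whisker_right α ρ := by
        refine (congrArg _root_.Bicategory.Opposite.op2 (proMap₂_whiskerRight α ρ)).trans ?_
        exact op2_conj (proMap_comp _ ρ) _ (proMap_comp _ ρ).symm }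

end

/-- A 2-pro-object of `C`: a 2-functor `Iᵒᵖ ⟶ C` with `I` a small 2-filtered 2-category. -/
structure ProObj (C : Type u) [Bicategory.{w, w} C] [Bicategory.Strict C] where
  I : Type w
  [bicategory : Bicategory.{w, w} I]
  [strict : Bicategory.Strict I]
  [isTwoFiltered : IsTwoFiltered I]
  diagram : StrictPseudofunctor Iᵒᵖ C

attribute [instance] ProObj.bicategory ProObj.strict ProObj.isTwoFiltered

/-- The 2-category `2-Pro(C)` of 2-pro-objects of `C`: the category of morphisms `X ⟶ Y` is
`Hom(C, Cat)ᵒᵖ (L X, L Y) = Hom(C, Cat) (L Y, L X)`, where `L X = colim_i C(X_i, -)`, and compositions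
are those of `Hom(C, Cat)ᵒᵖ`. -/
abbrev Pro (C : Type u) [Bicategory.{w, w} C] [Bicategory.Strict C] :=
  InducedBicategory (StrictPseudofunctor C Cat.{w, w})ᵒᵖ fun X : ProObj C => op (proFunctor X.diagram)

/-- The one-point 2-category. -/
abbrev PointIndex : Type w := LocallyDiscrete (Discrete PUnit.{w + 1})

instance : IsTwoFiltered PointIndex.{w} where
  cocone_objs i j := by
    obtain ⟨⟨⟨⟩⟩⟩ := i
    obtain ⟨⟨⟨⟩⟩⟩ := j
    exact ⟨⟨⟨⟨⟩⟩⟩, ⟨𝟙 _⟩, ⟨𝟙 _⟩⟩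
  cocone_maps {i j} f g := by
    obtain ⟨f⟩ := f
    obtain ⟨g⟩ := g
    obtain rfl : f = g := Subsingleton.elim f g
    exact ⟨j, 𝟙 j, ⟨Iso.refl _⟩⟩
  cocone_cells {i j f g} α β := ⟨j, 𝟙 j, by rw [Subsingleton.elim α β]⟩

/-- The 2-pro-object indexed by the one-point 2-category given by an object `a`. -/
def pointPro {C : Type u} [Bicategory.{w, w} C] [Bicategory.Strict C] (a : C) :
    Pro C :=
  ProObj.mk PointIndex.{w} (constDiagram PointIndex.{w}ᵒᵖ a)

/-- The 2-functor `C ⟶ Hom(C, Cat)ᵒᵖ`, `a ↦ L (a regarded as a diagram indexed by the point)`. -/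
def pointTwoFunctor (C : Type u) [Bicategory.{w, w} C] [Bicategory.Strict C] :
    StrictPseudofunctor C (StrictPseudofunctor C Cat.{w, w})ᵒᵖ :=
  (diagonal PointIndex.{w}ᵒᵖ C).comp (proFunctorTwo C PointIndex.{w})

theorem hom₂_conj {B K : Type*} [Bicategory K] {F : B → K} {a b : InducedBicategory K F}
    {f f' g g' : a ⟶ b} (ζ : f ⟶ g) (h : f = f') (η : f' ⟶ g') (h' : g' = g)
    (e : f.hom = f'.hom) (e' : g'.hom = g.hom)
    (H : ζ.hom = eqToHom e ≫ η.hom ≫ eqToHom e') : ζ = eqToHom h ≫ η ≫ eqToHom h' := by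
  subst h h'
  exact InducedBicategory.hom₂_ext H

/-- The embedding 2-functor `c : C ⟶ 2-Pro(C)`: an object is sent to itself, regarded as a 2-pro-object
indexed by the one-point 2-category. -/
def proEmbedding (C : Type u) [Bicategory.{w, w} C] [Bicategory.Strict C] :
    StrictPseudofunctor C (Pro C) :=
  StrictPseudofunctor.mk''
    { obj a := pointPro a
      map f := InducedBicategory.mkHom ((pointTwoFunctor C).map f)
      map₂ α := InducedBicategory.mkHom₂ ((pointTwoFunctor C).map₂ α)
      map₂_id f := InducedBicategory.hom₂_ext ((pointTwoFunctor C).map₂_id f)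
      map₂_comp α β := InducedBicategory.hom₂_ext ((pointTwoFunctor C).map₂_comp α β)
      map_id a := InducedBicategory.hom_ext ((pointTwoFunctor C).map_id a)
      map_comp f g := InducedBicategory.hom_ext ((pointTwoFunctor C).map_comp f g)
      map₂_whisker_left f g h α := by
        have H := (pointTwoFunctor C).map₂_whisker_left f α
        simp only [StrictPseudofunctor.mapComp_eq_eqToIso, eqToIso.hom, eqToIso.inv] at H
        exact hom₂_conj _ _ _ _ _ _ H
      map₂_whisker_right α h := by
        have H := (pointTwoFunctor C).map₂_whisker_right α h
        simp only [StrictPseudofunctor.mapComp_eq_eqToIso, eqToIso.hom, eqToIso.inv] at H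
        exact hom₂_conj _ _ _ _ _ _ H }

/-- `Hom(2-Pro(C), E)_+`: the full sub-2-category of `Hom(2-Pro(C), E)` whose objects are the 2-functors
that preserve small 2-cofiltered pseudolimits. -/
abbrev HomPlus (C : Type u) [Bicategory.{w, w} C] [Bicategory.Strict C]
    (E : Type u') [Bicategory.{w', v'} E] [Bicategory.Strict E] :=
  InducedBicategory (StrictPseudofunctor (Pro C) E)
    (Subtype.val : {H : StrictPseudofunctor (Pro C) E //
      PreservesSmallTwoCofilteredPseudolimits.{w} H} → StrictPseudofunctor (Pro C) E)

/-- Precomposition with `c : C ⟶ 2-Pro(C)`, as a 2-functor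
`Hom(2-Pro(C), E)_+ ⟶ Hom(C, E)`. -/
def precompPlus (C : Type u) [Bicategory.{w, w} C] [Bicategory.Strict C]
    (E : Type u') [Bicategory.{w', v'} E] [Bicategory.Strict E] :
    StrictPseudofunctor (HomPlus C E) (StrictPseudofunctor C E) :=
  InducedBicategory.forget.comp (precomp E (proEmbedding C))

end TwoPro

/-! All universal properties in play are isomorphisms of categories, so the whole argument can be
run with strict equalities of functors between hom-categories. A 2-functor is a 2-equivalence as
soon as it is an isomorphism on hom-categories and reaches every object up to an invertible 1-cell
(`isTwoEquivalence_of_isIso`).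

Two facts about 2-Pro(C), recorded in `Presentation`, are enough: every X is the pseudolimit of its
objects c X_i, and 2-Pro(C)(X, c d) is the pseudocolimit of the categories C(X_i, d). Both are forms
of the Yoneda lemma (`isIso_proYoneda`, `proCone_isPseudolimit`). By the second fact a pseudocone on
F X_i with vertex M is the same as a 2-natural family of functors 2-Pro(C)(X, c d) → E(M, F d), a
`Het`. This description does not mention the indices i, and it is what makes constructions
functorial in X.

Given F : C → E, let R X be a pseudolimit of the F X_i. The index-free universal property makes R a
2-functor (`exists_ran`), and R c ≅ F because c is an isomorphism on hom-categories
(`Ran.exists_counit`). If H' preserves small 2-cofiltered pseudolimits, then H' X is the pseudolimit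
of the H' c X_i, so transformations and modifications into H' are determined by, and extend uniquely
from, their restrictions along c (`isIso_precomp_mapFunctor`).

The hard point is that R preserves small 2-cofiltered pseudolimits (`Ran.preserves`). For a diagram
X of 2-pro-objects indexed by I, the pairs of an index i and an index of X_i form a 2-category
`Idx`, whose 1-cells are representatives in C of the transition 1-cells X_u together with an
invertible 2-cell. It is 2-filtered because in a 2-filtered pseudocolimit every arrow comes from
some stage and equal arrows become equal at a later stage (`PseudoColim.exists_comp_push_eq`,
`PseudoColim.exists_whiskerLeft_eq`). The resulting diagram in C is a 2-pro-object Y, and its cone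
lifts to a pseudocone ϖ on X (`exists_isLift`). Pseudocones on R X embed in pseudocones over `Idx`,
and the latter are represented by R Y; hence R ϖ is a pseudolimit (`Ran.isPseudolimit_map`). The
identity 2-functor is itself the Kan extension of c, so the same statement shows that ϖ is a
pseudolimit, and every other pseudolimit of X is isomorphic to it. -/

namespace TwoPro

open CategoryTheory Bicategory Opposite

set_option linter.unusedSectionVars false
set_option linter.unusedVariables false

/-! ### Strict 2-functors and 2-natural transformations as equalities of functors on hom-categories.
-/

section Calculus

variable {A : Type u₁} [Bicategory.{w₁, v₁} A] [Bicategory.Strict A]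
  {B : Type u₂} [Bicategory.{w₂, v₂} B] [Bicategory.Strict B]

theorem comp_eqToHom_of_eq_conj {K : Type*} [Category K] {a a' b b' : K} {x : a ⟶ b} {y : a' ⟶ b'}
    {h : a = a'} {h' : b' = b} (e : x = eqToHom h ≫ y ≫ eqToHom h') :
    x ≫ eqToHom h'.symm = eqToHom h ≫ y := by
  subst h h'
  simpa using e

theorem eq_conj_of_comp_eqToHom {K : Type*} [Category K] {a a' b b' : K} {x : a ⟶ b} {y : a' ⟶ b'}
    {h : a = a'} {h' : b = b'} (e : x ≫ eqToHom h' = eqToHom h ≫ y) :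
    x = eqToHom h ≫ y ≫ eqToHom h'.symm := by
  subst h h'
  simpa using e

/-- Strict associativity for 1-cells and 2-cells at once, as a single equation of functors. With its
companions below it replaces `eqToHom` bookkeeping by rewriting with `precomp`, `postcomp` and
`mapFunctor`. -/
theorem precomp_functor_comp {a b c : A} (x : A) (f : a ⟶ b) (g : b ⟶ c) :
    Bicategory.precomp x (f ≫ g) = Bicategory.precomp x g ⋙ Bicategory.precomp x f :=
  CategoryTheory.Functor.ext (fun _ => Strict.assoc _ _ _) fun r s η => by
    change (f ≫ g) ◁ η = eqToHom (Strict.assoc f g r) ≫ f ◁ g ◁ η ≫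
      eqToHom (Strict.assoc f g s).symm
    simp [Strict.associator_eqToIso]

theorem precomp_functor_id (a x : A) : Bicategory.precomp x (𝟙 a) = 𝟭 _ :=
  CategoryTheory.Functor.ext (fun _ => Strict.id_comp _) fun r s η => by
    change 𝟙 a ◁ η = eqToHom (Strict.id_comp r) ≫ η ≫ eqToHom (Strict.id_comp s).symm
    simp [Strict.leftUnitor_eqToIso]

theorem postcomp_functor_comp {b c d : A} (a : A) (g : b ⟶ c) (h : c ⟶ d) :
    Bicategory.postcomp a (g ≫ h) = Bicategory.postcomp a g ⋙ Bicategory.postcomp a h :=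
  CategoryTheory.Functor.ext (fun _ => (Strict.assoc _ _ _).symm) fun r s η => by
    change η ▷ (g ≫ h) = eqToHom (Strict.assoc r g h).symm ≫ η ▷ g ▷ h ≫
      eqToHom (Strict.assoc s g h)
    simp [Strict.associator_eqToIso]

theorem postcomp_functor_id (a b : A) : Bicategory.postcomp a (𝟙 b) = 𝟭 _ :=
  CategoryTheory.Functor.ext (fun _ => Strict.comp_id _) fun r s η => by
    change η ▷ 𝟙 b = eqToHom (Strict.comp_id r) ≫ η ≫ eqToHom (Strict.comp_id s).symm
    simp [Strict.rightUnitor_eqToIso]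

theorem precomp_postcomp {a b c d : A} (f : a ⟶ b) (g : c ⟶ d) :
    Bicategory.precomp c f ⋙ Bicategory.postcomp a g =
      Bicategory.postcomp b g ⋙ Bicategory.precomp d f :=
  CategoryTheory.Functor.ext (fun _ => Strict.assoc _ _ _) fun r s η => by
    change (f ◁ η) ▷ g = eqToHom (Strict.assoc f r g) ≫ f ◁ η ▷ g ≫
      eqToHom (Strict.assoc f s g).symm
    simp [Strict.associator_eqToIso]

theorem mapFunctor_postcomp (F : StrictPseudofunctor A B) (a : A) {b c : A} (g : b ⟶ c) :
    F.mapFunctor a b ⋙ Bicategory.postcomp _ (F.map g) =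
      Bicategory.postcomp a g ⋙ F.mapFunctor a c :=
  CategoryTheory.Functor.ext (fun _ => (F.map_comp _ _).symm) fun r s η => by
    change F.map₂ η ▷ F.map g = eqToHom (F.map_comp r g).symm ≫ F.map₂ (η ▷ g) ≫
      eqToHom (F.map_comp s g)
    simp [F.mapComp_eq_eqToIso]

theorem precomp_mapFunctor (F : StrictPseudofunctor A B) {a b : A} (c : A) (f : a ⟶ b) :
    Bicategory.precomp c f ⋙ F.mapFunctor a c =
      F.mapFunctor b c ⋙ Bicategory.precomp _ (F.map f) :=
  CategoryTheory.Functor.ext (fun _ => F.map_comp _ _) fun r s η => by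
    change F.map₂ (f ◁ η) = eqToHom (F.map_comp f r) ≫ F.map f ◁ F.map₂ η ≫
      eqToHom (F.map_comp f s).symm
    simp [F.mapComp_eq_eqToIso]

/-- A strict 2-functor from its functors on hom-categories. -/
def strictPseudofunctorOfFunctors (obj : A → B) (m : ∀ a b : A, (a ⟶ b) ⥤ (obj a ⟶ obj b))
    (hid : ∀ a, (m a a).obj (𝟙 a) = 𝟙 (obj a))
    (hpost : ∀ (a : A) {b c : A} (g : b ⟶ c),
      m a b ⋙ Bicategory.postcomp _ ((m b c).obj g) = Bicategory.postcomp a g ⋙ m a c)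
    (hpre : ∀ {a b : A} (c : A) (f : a ⟶ b),
      Bicategory.precomp c f ⋙ m a c = m b c ⋙ Bicategory.precomp _ ((m a b).obj f)) :
    StrictPseudofunctor A B :=
  StrictPseudofunctor.mk''
    { obj := obj
      map := fun f => (m _ _).obj f
      map₂ := fun α => (m _ _).map α
      map₂_id := fun _ => (m _ _).map_id _
      map₂_comp := fun _ _ => (m _ _).map_comp _ _
      map_id := hid
      map_comp := fun f g => Functor.congr_obj (hpre _ f) g
      map₂_whisker_left := fun f _ _ η => Functor.congr_hom (hpre _ f) η
      map₂_whisker_right := fun η g => Functor.congr_hom (hpost _ g).symm η }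

variable {F G : StrictPseudofunctor A B}

/-- A 2-natural transformation from its components, with naturality as equalities of functors. -/
def TwoNatTrans.ofFunctors (app : ∀ a, F.obj a ⟶ G.obj a)
    (h : ∀ a b, F.mapFunctor a b ⋙ Bicategory.postcomp _ (app b) =
      G.mapFunctor a b ⋙ Bicategory.precomp _ (app a)) : F ⟶ G :=
  TwoNatTrans.mk' app (fun {a b} f => Functor.congr_obj (h a b) f) (fun {a b _ _} ρ =>
    comp_eqToHom_of_eq_conj (Functor.congr_hom (h a b) ρ))

/-- The object part is naturality on 1-cells, the morphism part is naturality on 2-cells. -/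
theorem TwoNatTrans.mapFunctor_eq (θ : F ⟶ G) (a b : A) :
    F.mapFunctor a b ⋙ Bicategory.postcomp _ ((toStrongTrans θ).app b) =
      G.mapFunctor a b ⋙ Bicategory.precomp _ ((toStrongTrans θ).app a) :=
  CategoryTheory.Functor.ext (fun f => θ.naturality_eq f) fun _ _ ρ =>
    eq_conj_of_comp_eqToHom (TwoNatTrans.nat₂ θ ρ)

/-- The component at `a`, as a functor from the category of 2-natural transformations. -/
def TwoNatTrans.evalApp (F G : StrictPseudofunctor A B) (a : A) :
    (F ⟶ G) ⥤ (F.obj a ⟶ G.obj a) where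
  obj θ := (toStrongTrans θ).app a
  map ρ := ρ.hom.as.app a

/-- The counterpart with `f` fixed and the transformation varying: the object part is naturality,
the morphism part is the modification axiom. -/
theorem TwoNatTrans.evalApp_precomp (F G : StrictPseudofunctor A B) {a b : A} (f : a ⟶ b) :
    evalApp F G b ⋙ Bicategory.precomp _ (F.map f) =
      evalApp F G a ⋙ Bicategory.postcomp _ (G.map f) :=
  CategoryTheory.Functor.ext (fun θ => θ.naturality_eq f) fun _ _ ρ =>
    eq_conj_of_comp_eqToHom (TwoNatTrans.hom_nat ρ f)

variable {Q : Type*} [Category Q]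

/-- A functor to the category of 2-natural transformations, from its components. -/
def TwoNatTrans.functorOf (S : ∀ a, Q ⥤ (F.obj a ⟶ G.obj a))
    (h : ∀ q a b, F.mapFunctor a b ⋙ Bicategory.postcomp _ ((S b).obj q) =
      G.mapFunctor a b ⋙ Bicategory.precomp _ ((S a).obj q))
    (h' : ∀ {a b} (f : a ⟶ b), S b ⋙ Bicategory.precomp _ (F.map f) =
      S a ⋙ Bicategory.postcomp _ (G.map f)) : Q ⥤ (F ⟶ G) where
  obj q := TwoNatTrans.ofFunctors (fun a => (S a).obj q) (h q)
  map m := TwoNatTrans.homMk (fun a => (S a).map m) (fun {a b} f =>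
    comp_eqToHom_of_eq_conj (Functor.congr_hom (h' f) m))
  map_id q := TwoNatTrans.hom_ext fun a => (S a).map_id q
  map_comp m n := TwoNatTrans.hom_ext fun a => (S a).map_comp m n

theorem TwoNatTrans.functor_ext {S T : Q ⥤ (F ⟶ G)}
    (h : ∀ a, S ⋙ evalApp F G a = T ⋙ evalApp F G a) : S = T :=
  CategoryTheory.Functor.ext (fun q => TwoNatTrans.ext' fun a => Functor.congr_obj (h a) q) fun q r m => by
    apply TwoNatTrans.hom_ext
    intro a
    rw [TwoNatTrans.eqToHom_conj_app _ _ _ _ (Functor.congr_obj (h a) q)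
      (Functor.congr_obj (h a) r).symm]
    exact Functor.congr_hom (h a) m

end Calculus

/-! ### Strict inverses and cancellation for isomorphisms of categories. -/

section Cancel

variable {K : Type*} [Category K] {K' : Type*} [Category K'] {K'' : Type*} [Category K'']

theorem comp_strictInv (N : K ⥤ K') [N.IsIso] : N ⋙ N.strictInv = 𝟭 _ :=
  N.asIsomorphism.unit_eq.symm

theorem strictInv_comp (N : K ⥤ K') [N.IsIso] : N.strictInv ⋙ N = 𝟭 _ :=
  N.asIsomorphism.counit_eq

theorem isIso_of_inverse (N : K ⥤ K') (M : K' ⥤ K) (h : N ⋙ M = 𝟭 _) (h' : M ⋙ N = 𝟭 _) :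
    N.IsIso :=
  IsoCat.isIso_functor ⟨N, M, h.symm, h'⟩

theorem cancel_right_isIso (N : K' ⥤ K'') [N.IsIso] {S T : K ⥤ K'} (h : S ⋙ N = T ⋙ N) : S = T := by
  have := congrArg (· ⋙ N.strictInv) h
  simpa only [Functor.assoc, comp_strictInv, Functor.comp_id] using this

theorem cancel_left_isIso (N : K ⥤ K') [N.IsIso] {S T : K' ⥤ K''} (h : N ⋙ S = N ⋙ T) : S = T := by
  have := congrArg (N.strictInv ⋙ ·) h
  simpa only [← Functor.assoc, strictInv_comp, Functor.id_comp] using this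

end Cancel

/-! ### A criterion for 2-equivalences. -/

section Equivalence

variable {B : Type u₂} [Bicategory.{w₂, v₂} B] [Bicategory.Strict B]
  {D : Type u₃} [Bicategory.{w₃, v₃} D] [Bicategory.Strict D]

theorem postcomp_cancel {a b : D} (x : D) (e : a ⟶ b) (e' : b ⟶ a) (h : e ≫ e' = 𝟙 a) :
    Bicategory.postcomp x e ⋙ Bicategory.postcomp x e' = 𝟭 _ := by
  rw [← postcomp_functor_comp, h, postcomp_functor_id]

/-- A strict 2-functor that is an isomorphism on hom-categories and surjective on objects up to
isomorphism is a 2-equivalence. -/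
theorem isTwoEquivalence_of_isIso (N : StrictPseudofunctor B D)
    (hN : ∀ a b, (N.mapFunctor a b).IsIso)
    (o : D → B) (e : ∀ d, N.obj (o d) ⟶ d) (e' : ∀ d, d ⟶ N.obj (o d))
    (h₁ : ∀ d, e d ≫ e' d = 𝟙 _) (h₂ : ∀ d, e' d ≫ e d = 𝟙 _) : IsTwoEquivalence N := by
  let I (a b : B) := (N.mapFunctor a b).strictInv
  have hI (a b) : I a b ⋙ N.mapFunctor a b = 𝟭 _ := strictInv_comp _
  have hI' (a b) : N.mapFunctor a b ⋙ I a b = 𝟭 _ := comp_strictInv _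
  have hIo (a b f) : N.map ((I a b).obj f) = f := Functor.congr_obj (hI a b) f
  -- Conjugation f ↦ e_d f e'_{d'}. Since e and e' are strictly inverse, composing `T` with e on one
  -- side leaves composition with e on the other (`hTe`), and likewise for e' (`heT`); the 2-functor
  -- axioms for the inverse need little more.
  let T (d d' : D) : (d ⟶ d') ⥤ (N.obj (o d) ⟶ N.obj (o d')) :=
    Bicategory.precomp _ (e d) ⋙ Bicategory.postcomp _ (e' d')
  let m (d d' : D) : (d ⟶ d') ⥤ (o d ⟶ o d') := T d d' ⋙ I _ _
  have hm (d d') : m d d' ⋙ N.mapFunctor _ _ = T d d' := by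
    simp only [m, Functor.assoc, hI, Functor.comp_id]
  have hm' (d d') {K : Type v₃} [Category.{w₃} K] (S : (N.obj (o d) ⟶ N.obj (o d')) ⥤ K) :
      m d d' ⋙ N.mapFunctor _ _ ⋙ S = T d d' ⋙ S := by
    rw [← Functor.assoc, hm]
  have hmo (d d' f) : N.map ((m d d').obj f) = (e d ≫ f) ≫ e' d' := hIo _ _ _
  have hinj {a b : B} {f g : a ⟶ b} (h : N.map f = N.map g) : f = g :=
    (N.mapFunctor a b).bijective_obj.1 h
  have hTe (d d') : T d d' ⋙ Bicategory.postcomp _ (e d') = Bicategory.precomp _ (e d) := by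
    simp only [T, Functor.assoc]
    rw [← postcomp_functor_comp, h₂, postcomp_functor_id, Functor.comp_id]
  have heT (d d') : T d d' ⋙ Bicategory.precomp _ (e' d) = Bicategory.postcomp _ (e' d') := by
    simp only [T, precomp_postcomp, Functor.assoc]
    rw [← precomp_functor_comp, h₂, precomp_functor_id, Functor.comp_id]
  let G : StrictPseudofunctor D B := strictPseudofunctorOfFunctors o m
    (fun d => hinj (by rw [hmo, N.map_id, Strict.comp_id, h₁]))
    (fun a b c g => cancel_right_isIso (N.mapFunctor _ _) (by
      rw [Functor.assoc, ← mapFunctor_postcomp, hm', Functor.assoc (Bicategory.postcomp a g), hm, hmo,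
        Strict.assoc, postcomp_functor_comp, ← Functor.assoc (T a b), hTe, postcomp_functor_comp,
        ← Functor.assoc, precomp_postcomp, Functor.assoc]))
    (fun {a b} c f => cancel_right_isIso (N.mapFunctor _ _) (by
      rw [Functor.assoc, hm, Functor.assoc, precomp_mapFunctor, hm', hmo,
        precomp_functor_comp, ← Functor.assoc (T b c), heT, precomp_functor_comp]
      simp only [T, precomp_postcomp, ← Functor.assoc]))
  have hG (d d') : G.mapFunctor d d' = m d d' := rfl
  refine ⟨G, TwoNatTrans.ofFunctors e (fun d d' => ?_), TwoNatTrans.ofFunctors e' (fun d d' => ?_),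
    TwoNatTrans.ofFunctors (fun b => (I _ _).obj (e (N.obj b))) (fun b b' => ?_),
    TwoNatTrans.ofFunctors (fun b => (I _ _).obj (e' (N.obj b))) (fun b b' => ?_),
    ?_, ?_, ?_, ?_⟩
  · exact (congrArg (· ⋙ Bicategory.postcomp _ (e d')) (hm d d')).trans (hTe d d')
  · exact ((congrArg (· ⋙ Bicategory.precomp _ (e' d)) (hm d d')).trans (heT d d')).symm
  -- The last two transformations live in `B`. As `N` is an isomorphism on hom-categories, their
  -- naturality may be checked after `N`, where it is again `hTe` and `heT`.
  · apply cancel_right_isIso (N.mapFunctor _ _)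
    change N.mapFunctor b b' ⋙ m (N.obj b) (N.obj b') ⋙
      Bicategory.postcomp (o (N.obj b)) ((I (o (N.obj b')) b').obj (e (N.obj b'))) ⋙ N.mapFunctor _ _ =
      Bicategory.precomp b' ((I (o (N.obj b)) b).obj (e (N.obj b))) ⋙ N.mapFunctor _ _
    rw [← mapFunctor_postcomp, precomp_mapFunctor, hIo, hIo, hm', hTe]
  · apply cancel_right_isIso (N.mapFunctor _ _)
    change Bicategory.postcomp b ((I b' (o (N.obj b'))).obj (e' (N.obj b'))) ⋙ N.mapFunctor _ _ =
      N.mapFunctor b b' ⋙ m (N.obj b) (N.obj b') ⋙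
      Bicategory.precomp _ ((I b (o (N.obj b))).obj (e' (N.obj b))) ⋙ N.mapFunctor _ _
    rw [← mapFunctor_postcomp, precomp_mapFunctor, hIo, hIo, hm', heT]
  · exact TwoNatTrans.ext' h₁
  · exact TwoNatTrans.ext' h₂
  · refine TwoNatTrans.ext' fun b => hinj ((N.map_comp _ _).trans ?_)
    exact (congrArg₂ (· ≫ ·) (hIo _ _ _) (hIo _ _ _)).trans ((h₁ _).trans (N.map_id _).symm)
  · refine TwoNatTrans.ext' fun b => hinj ((N.map_comp _ _).trans ?_)
    exact (congrArg₂ (· ≫ ·) (hIo _ _ _) (hIo _ _ _)).trans ((h₂ _).trans (N.map_id _).symm)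

end Equivalence

end TwoPro

namespace TwoPro

open CategoryTheory Bicategory Opposite

set_option linter.unusedSectionVars false
set_option linter.unusedVariables false

namespace PseudoCone

/-! ### Pseudocones on composite diagrams, with legs indexed covariantly. -/

section Legs

variable {A : Type u₃} [Bicategory.{w₃, v₃} A] [Bicategory.Strict A]
  {B : Type u₂} [Bicategory.{w₂, v₂} B] [Bicategory.Strict B]
  {E : Type u₁} [Bicategory.{w₁, v₁} E] [Bicategory.Strict E]
  {D : StrictPseudofunctor Aᵒᵖ B} {F : StrictPseudofunctor B E} {M : E}

/-- The component at `i` of a pseudocone on a composite diagram `Aᵒᵖ ⟶ B ⟶ E`. -/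
def leg (θ : PseudoCone (D.comp F) M) (i : A) : M ⟶ F.obj (D.obj (op i)) := θ.app (op i)

/-- The structure 2-cell at `u` of a pseudocone on a composite diagram. -/
def legIso (θ : PseudoCone (D.comp F) M) {i j : A} (u : i ⟶ j) :
    θ.leg i ≅ θ.leg j ≫ F.map (D.map u.op) := θ.iso u.op

theorem legIso_id_eq (f : M ⟶ F.obj (D.obj (op i))) : f = f ≫ F.map (D.map (𝟙 i : i ⟶ i).op) := by
  rw [op_id, D.map_id, F.map_id, Strict.comp_id]

theorem legIso_comp_eq {i j k : A} (u : i ⟶ j) (v : j ⟶ k) (f : M ⟶ F.obj (D.obj (op k))) :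
    (f ≫ F.map (D.map v.op)) ≫ F.map (D.map u.op) = f ≫ F.map (D.map (u ≫ v).op) := by
  rw [op_comp, D.map_comp, F.map_comp, Strict.assoc]

theorem legIso_id (θ : PseudoCone (D.comp F) M) (i : A) :
    (θ.legIso (𝟙 i)).hom = eqToHom (legIso_id_eq (θ.leg i)) :=
  θ.iso_id (op i)

theorem legIso_comp (θ : PseudoCone (D.comp F) M) {i j k : A} (u : i ⟶ j) (v : j ⟶ k) :
    (θ.legIso (u ≫ v)).hom = (θ.legIso u).hom ≫ (θ.legIso v).hom ▷ F.map (D.map u.op) ≫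
      eqToHom (legIso_comp_eq u v (θ.leg k)) :=
  θ.iso_comp v.op u.op

theorem legIso_naturality (θ : PseudoCone (D.comp F) M) {i j : A} {u v : i ⟶ j} (α : u ⟶ v) :
    (θ.legIso u).hom ≫ θ.leg j ◁ F.map₂ (D.map₂ (_root_.Bicategory.Opposite.op2 α)) =
      (θ.legIso v).hom :=
  θ.iso_naturality (_root_.Bicategory.Opposite.op2 α)

/-- Constructor of pseudocones on a composite diagram `Aᵒᵖ ⟶ B ⟶ E`. -/
def ofLegs (leg : ∀ i : A, M ⟶ F.obj (D.obj (op i)))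
    (iso : ∀ {i j : A} (u : i ⟶ j), leg i ≅ leg j ≫ F.map (D.map u.op))
    (iso_id : ∀ i : A, (iso (𝟙 i)).hom = eqToHom (legIso_id_eq (leg i)))
    (iso_comp : ∀ {i j k : A} (u : i ⟶ j) (v : j ⟶ k), (iso (u ≫ v)).hom =
      (iso u).hom ≫ (iso v).hom ▷ F.map (D.map u.op) ≫ eqToHom (legIso_comp_eq u v (leg k)))
    (iso_naturality : ∀ {i j : A} {u v : i ⟶ j} (α : u ⟶ v),
      (iso u).hom ≫ leg j ◁ F.map₂ (D.map₂ (_root_.Bicategory.Opposite.op2 α)) = (iso v).hom) :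
    PseudoCone (D.comp F) M where
  app i := leg i.unop
  iso u := iso u.unop
  iso_id i := iso_id i.unop
  iso_comp u v := iso_comp v.unop u.unop
  iso_naturality α := iso_naturality α.unop2

/-- The component at `i`, as a functor. -/
def legFunctor (D : StrictPseudofunctor Aᵒᵖ B) (F : StrictPseudofunctor B E) (M : E) (i : A) :
    PseudoCone (D.comp F) M ⥤ (M ⟶ F.obj (D.obj (op i))) where
  obj θ := θ.leg i
  map ρ := Hom.app ρ (op i)

/-- The component at `i` of a morphism of pseudocones on a composite diagram. -/
def legHom {θ η : PseudoCone (D.comp F) M} (ρ : θ ⟶ η) (i : A) : θ.leg i ⟶ η.leg i :=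
  Hom.app ρ (op i)

theorem legHom_naturality {θ η : PseudoCone (D.comp F) M} (ρ : θ ⟶ η) {i j : A} (u : i ⟶ j) :
    legHom ρ i ≫ (η.legIso u).hom = (θ.legIso u).hom ≫ legHom ρ j ▷ F.map (D.map u.op) :=
  Hom.naturality ρ u.op

/-- Constructor of morphisms of pseudocones on a composite diagram. -/
def homOfLegs {θ η : PseudoCone (D.comp F) M} (ρ : ∀ i, θ.leg i ⟶ η.leg i)
    (h : ∀ {i j : A} (u : i ⟶ j), ρ i ≫ (η.legIso u).hom =
      (θ.legIso u).hom ≫ ρ j ▷ F.map (D.map u.op)) : θ ⟶ η :=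
  show Hom θ η from { app := fun i => ρ i.unop, naturality := fun u => h u.unop }

theorem hom_ext_legs {θ η : PseudoCone (D.comp F) M} {ρ σ : θ ⟶ η}
    (h : ∀ i, legHom ρ i = legHom σ i) : ρ = σ :=
  Hom.ext (funext fun i => h i.unop)

theorem ext_legs {θ η : PseudoCone (D.comp F) M} (h : ∀ i, θ.leg i = η.leg i)
    (h' : ∀ {i j : A} (u : i ⟶ j), (θ.legIso u).hom ≫
      eqToHom (congrArg (· ≫ F.map (D.map u.op)) (h j)) = eqToHom (h i) ≫ (η.legIso u).hom) :
    θ = η := by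
  obtain ⟨θ₀, θ₁, _, _, _⟩ := θ
  obtain ⟨η₀, η₁, _, _, _⟩ := η
  obtain rfl : θ₀ = η₀ := funext fun i => h i.unop
  obtain rfl : @θ₁ = @η₁ := by
    funext i j u
    apply Iso.ext
    have : (θ₁ u).hom ≫ 𝟙 _ = 𝟙 _ ≫ (η₁ u).hom := h' u.unop
    rwa [Category.comp_id, Category.id_comp] at this
  rfl

variable {Q : Type*} [Category Q]

theorem legHom_eqToHom {θ η : PseudoCone (D.comp F) M} (h : θ = η) (i : A) :
    legHom (eqToHom h) i = eqToHom (by rw [h]) := by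
  subst h
  rfl

theorem legHom_comp {θ η ζ : PseudoCone (D.comp F) M} (ρ : θ ⟶ η) (σ : η ⟶ ζ) (i : A) :
    legHom (ρ ≫ σ) i = legHom ρ i ≫ legHom σ i := rfl

/-- Agreement of all the leg functors says nothing about the structure 2-cells of the values, hence
the separate hypothesis on objects; on arrows, legs are enough. -/
theorem functor_ext {S T : Q ⥤ PseudoCone (D.comp F) M}
    (h : ∀ i, S ⋙ legFunctor D F M i = T ⋙ legFunctor D F M i)
    (h' : ∀ q, S.obj q = T.obj q) : S = T :=
  CategoryTheory.Functor.ext h' fun q r m => by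
    apply hom_ext_legs
    intro i
    rw [legHom_comp, legHom_comp, legHom_eqToHom, legHom_eqToHom]
    exact Functor.congr_hom (h i) m

theorem precomp_legIso {L : E} (π : PseudoCone (D.comp F) L) (h : M ⟶ L) {i j : A} (u : i ⟶ j) :
    ((π.precomp h).legIso u).hom = h ◁ (π.legIso u).hom ≫
      eqToHom (Strict.assoc h (π.leg j) (F.map (D.map u.op))).symm := rfl

theorem precomp_precomp_aux {a b c d e : E} (k : a ⟶ b) (h : b ⟶ c) {p : c ⟶ e} {l : c ⟶ d}
    {f : d ⟶ e} (x : p ⟶ l ≫ f) :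
    (k ◁ (h ◁ x ≫ eqToHom (Strict.assoc h l f).symm) ≫ eqToHom (Strict.assoc k (h ≫ l) f).symm) ≫
      eqToHom (congrArg (· ≫ f) (Strict.assoc k h l).symm) =
    eqToHom (Strict.assoc k h p).symm ≫ (k ≫ h) ◁ x ≫ eqToHom (Strict.assoc (k ≫ h) l f).symm := by
  simp [Strict.associator_eqToIso]

end Legs

/-! ### The functors out of the pseudocolimits of C(D_i, d) given by a pseudocone. -/

section Ev

variable {C : Type u} [Bicategory.{w, w} C] [Bicategory.Strict C]
  {I : Type w} [Bicategory.{w, w} I]  [Bicategory.Strict I]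
  {E : Type u₁} [Bicategory.{w₁, v₁} E] [Bicategory.Strict E]
  {F : StrictPseudofunctor C E} {D : StrictPseudofunctor Iᵒᵖ C} {M : E}

theorem ev_eq {i j : I} (f : M ⟶ F.obj (D.obj (op j))) (u : i ⟶ j) {d : C}
    (r : D.obj (op i) ⟶ d) :
    (f ≫ F.map (D.map u.op)) ≫ F.map r = f ≫ F.map (D.map u.op ≫ r) := by
  rw [F.map_comp, Strict.assoc]

/-- The functor `colim_i C(D_i, d) ⥤ E(M, F d)` induced by a pseudocone with vertex `M` on `F D`. -/
def ev (θ : PseudoCone (D.comp F) M) (d : C) : PseudoColim D d ⥤ (M ⟶ F.obj d) :=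
  PseudoColim.CoconeData.functor
    { obj i r := θ.leg i ≫ F.map r
      cell i _ _ α := θ.leg i ◁ F.map₂ α
      push {i j} u r := whiskerRightIso (θ.legIso u) (F.map r) ≪≫ eqToIso (ev_eq (θ.leg j) u r)
      cell_id i r := by simp
      cell_comp i _ _ _ α β := by simp
      push_naturality {i j} u {r s} α := by
        have := whisker_exchange (θ.legIso u).hom (F.map₂ α)
        simp [F.mapComp_eq_eqToIso, reassoc_of% this, Strict.associator_eqToIso]
      push_id i r := by
        simp [legIso_id, PrelaxFunctor.map₂_eqToHom]
      push_comp {i j k} u v r := by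
        simp [legIso_comp, PrelaxFunctor.map₂_eqToHom,
          whiskerRight_congr (F.map_comp (D.map u.op) r), Strict.associator_eqToIso]
      push_cell {i j u v} α r := by
        simp [← legIso_naturality θ α, F.mapComp_eq_eqToIso, Strict.associator_eqToIso] }

theorem ev_map_push (θ : PseudoCone (D.comp F) M) {d : C} {i j : I} (u : i ⟶ j)
    (r : D.obj (op i) ⟶ d) : (θ.ev d).map (PseudoColim.push u r).hom =
      (θ.legIso u).hom ▷ F.map r ≫ eqToHom (ev_eq (θ.leg j) u r) := rfl

/-- The inclusion of `C(D_i, d)` in the pseudocolimit. -/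
def inc (D : StrictPseudofunctor Iᵒᵖ C) (i : I) (d : C) : (D.obj (op i) ⟶ d) ⥤ PseudoColim D d where
  obj r := ⟨i, r⟩
  map α := PseudoColim.cell α
  map_id r := PseudoColim.cell_id r
  map_comp α β := (PseudoColim.cell_comp α β).symm

theorem inc_ev (θ : PseudoCone (D.comp F) M) (i : I) (d : C) :
    inc D i d ⋙ θ.ev d = F.mapFunctor _ d ⋙ Bicategory.precomp _ (θ.leg i) := rfl

/-- Naturality of `ev` in `d`; together with `inc_ev` it presents a pseudocone as a 2-natural family
on the pseudocolimits. -/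
theorem ev_postcomp (θ : PseudoCone (D.comp F) M) {c d : C} (h : c ⟶ d) :
    θ.ev c ⋙ Bicategory.postcomp M (F.map h) = PseudoColim.post D h ⋙ θ.ev d :=
  PseudoColim.functor_ext
    (fun x => (Strict.assoc _ _ _).trans (congrArg (_ ≫ ·) (F.map_comp _ _).symm))
    (fun i r s α => by
      change (θ.leg i ◁ F.map₂ α) ▷ F.map h ≫ eqToHom ((Strict.assoc (θ.leg i) (F.map s) (F.map h)).trans
        (congrArg (_ ≫ ·) (F.map_comp _ _).symm)) = eqToHom ((Strict.assoc (θ.leg i) (F.map r) (F.map h)).trans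
        (congrArg (_ ≫ ·) (F.map_comp _ _).symm)) ≫ θ.leg i ◁ F.map₂ (α ▷ h)
      simp [F.mapComp_eq_eqToIso, Strict.associator_eqToIso])
    (fun {i j} u r => by
      refine Eq.trans ?_ (congrArg (eqToHom _ ≫ ·) ((congrArg (θ.ev d).map
        (PseudoColim.post_map_push h u r)).trans ((θ.ev d).map_comp _ _)).symm)
      change ((θ.legIso u).hom ▷ F.map r ≫ eqToHom (ev_eq (θ.leg j) u r)) ▷ F.map h ≫
        eqToHom ((Strict.assoc (θ.leg j) (F.map (D.map u.op ≫ r)) (F.map h)).trans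
        (congrArg (_ ≫ ·) (F.map_comp _ _).symm)) =
        eqToHom ((Strict.assoc (θ.leg i) (F.map r) (F.map h)).trans
        (congrArg (_ ≫ ·) (F.map_comp _ _).symm)) ≫
        ((θ.legIso u).hom ▷ F.map (r ≫ h) ≫ eqToHom (ev_eq (θ.leg j) u (r ≫ h))) ≫
        θ.leg j ◁ F.map₂ (eqToHom (Strict.assoc (D.map u.op) r h).symm)
      simp [PrelaxFunctor.map₂_eqToHom, whiskerRight_congr (F.map_comp r h),
        Strict.associator_eqToIso])

theorem precomp_ev {L : E} (θ : PseudoCone (D.comp F) L) (h : M ⟶ L) (d : C) :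
    (θ.precomp h).ev d = θ.ev d ⋙ Bicategory.precomp _ h :=
  PseudoColim.functor_ext
    (fun x => (Strict.assoc h (θ.leg x.idx) (F.map x.arr)))
    (fun i r s α => by
      change (h ≫ θ.leg i) ◁ F.map₂ α ≫ eqToHom (Strict.assoc h (θ.leg i) (F.map s)) =
        eqToHom (Strict.assoc h (θ.leg i) (F.map r)) ≫ h ◁ θ.leg i ◁ F.map₂ α
      simp [Strict.associator_eqToIso])
    (fun {i j} u r => by
      change ((h ◁ (θ.legIso u).hom ≫
        eqToHom (Strict.assoc h (θ.leg j) (F.map (D.map u.op))).symm) ▷ F.map r ≫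
          eqToHom (ev_eq (h ≫ θ.leg j) u r)) ≫
          eqToHom (Strict.assoc h (θ.leg j) (F.map (D.map u.op ≫ r))) =
        eqToHom (Strict.assoc h (θ.leg i) (F.map r)) ≫
          h ◁ ((θ.legIso u).hom ▷ F.map r ≫ eqToHom (ev_eq (θ.leg j) u r))
      simp [Strict.associator_eqToIso])

theorem eq_of_whiskerRight {a b : E} {f g : a ⟶ b} {k : b ⟶ b} (hk : k = 𝟙 b) {α β : f ⟶ g}
    (h : α ▷ k = β ▷ k) : α = β := by
  subst hk
  simpa using h

/-- The Yoneda argument: the leg at i is the value at the identity of D_i, and the structure 2-cell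
at u is the value at the arrow `push u` of that identity. Strict equality of pseudocones thus
becomes an equality of functors, which is how it is proved from here on. -/
theorem ev_injective {θ η : PseudoCone (D.comp F) M} (h : ∀ d, θ.ev d = η.ev d) : θ = η := by
  have h₀ (i : I) : θ.leg i = η.leg i := by
    have : θ.leg i ≫ F.map (𝟙 _) = η.leg i ≫ F.map (𝟙 _) :=
      Functor.congr_obj (h (D.obj (op i))) ⟨i, 𝟙 _⟩
    simpa [F.map_id, Strict.comp_id] using this
  refine ext_legs h₀ fun {i j} u => ?_
  have := Functor.congr_hom (h (D.obj (op i))) (PseudoColim.push u (𝟙 _)).hom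
  rw [ev_map_push, ev_map_push] at this
  -- The family `ev` shows the structure 2-cell only whiskered by `F.map (𝟙 _)`; this 1-cell is
  -- strictly an identity, so the whiskering can be removed.
  apply eq_of_whiskerRight (F.map_id (D.obj (op i)))
  have : ((θ.legIso u).hom ▷ F.map (𝟙 (D.obj (op i))) ≫ eqToHom (ev_eq (θ.leg j) u (𝟙 _))) ≫
      eqToHom (congrArg (· ≫ F.map (D.map u.op ≫ 𝟙 (D.obj (op i)))) (h₀ j)) =
    eqToHom (congrArg (· ≫ F.map (𝟙 (D.obj (op i)))) (h₀ i)) ≫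
      (η.legIso u).hom ▷ F.map (𝟙 (D.obj (op i))) ≫ eqToHom (ev_eq (η.leg j) u (𝟙 _)) :=
    comp_eqToHom_of_eq_conj this
  simp only [comp_whiskerRight, eqToHom_whiskerRight]
  rw [← cancel_mono (eqToHom (ev_eq (η.leg j) u (𝟙 _)))]
  simpa using this

/-- The functor `ev`, functorially in the pseudocone. -/
def evFunctor (D : StrictPseudofunctor Iᵒᵖ C) (F : StrictPseudofunctor C E) (M : E) (d : C) :
    PseudoCone (D.comp F) M ⥤ PseudoColim D d ⥤ (M ⟶ F.obj d) where
  obj θ := θ.ev d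
  map {θ η} ρ := PseudoColim.natTrans (fun x => legHom ρ x.idx ▷ F.map x.arr)
    (fun i r s α => (whisker_exchange _ _))
    (fun {i j} u r => by
      rw [ev_map_push, ev_map_push]
      change ((θ.legIso u).hom ▷ F.map r ≫ eqToHom (ev_eq (θ.leg j) u r)) ≫
        legHom ρ j ▷ F.map (D.map u.op ≫ r) = legHom ρ i ▷ F.map r ≫
        (η.legIso u).hom ▷ F.map r ≫ eqToHom (ev_eq (η.leg j) u r)
      rw [← comp_whiskerRight_assoc, legHom_naturality,
        whiskerRight_congr (F.map_comp (D.map u.op) r)]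
      simp [Strict.associator_eqToIso])
  map_id θ := by
    ext x
    exact id_whiskerRight _ _
  map_comp ρ σ := by
    ext x
    exact comp_whiskerRight _ _ _

end Ev

end PseudoCone

end TwoPro

namespace TwoPro

open CategoryTheory Bicategory Opposite

set_option linter.unusedSectionVars false
set_option linter.unusedVariables false

/-! ### Pseudocones as 2-natural families, and the index-free form of the universal property. -/

section Het

variable {C : Type u} [Bicategory.{w, w} C] [Bicategory.Strict C]
  {P : Type u₂} [Bicategory.{w₂, v₂} P] [Bicategory.Strict P]
  {E : Type u₁} [Bicategory.{w₁, v₁} E] [Bicategory.Strict E]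
  {c : StrictPseudofunctor C P} {F : StrictPseudofunctor C E}

/-- A presentation of an object `X` as a small 2-cofiltered pseudolimit of objects in the image of
`c : C ⟶ P`, such that each `P(X, c d)` is the pseudocolimit of the categories `C(X_i, d)`. -/
structure Presentation (c : StrictPseudofunctor C P) (X : P) where
  I : Type w
  [bicategory : Bicategory.{w, w} I]
  [strict : Bicategory.Strict I]
  [isTwoFiltered : IsTwoFiltered I]
  diagram : StrictPseudofunctor Iᵒᵖ C
  cone : PseudoCone (diagram.comp c) X
  isIso_ev (d : C) : (cone.ev d).IsIso
  isPseudolimit : cone.IsPseudolimit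

attribute [instance] Presentation.bicategory Presentation.strict Presentation.isTwoFiltered
  Presentation.isIso_ev

/-- A 2-natural family of functors `P(X, c d) ⥤ E(M, F d)`. -/
@[ext]
structure Het (c : StrictPseudofunctor C P) (F : StrictPseudofunctor C E) (M : E) (X : P) where
  app (d : C) : (X ⟶ c.obj d) ⥤ (M ⟶ F.obj d)
  post {d d' : C} (h : d ⟶ d') : app d ⋙ Bicategory.postcomp M (F.map h) =
    Bicategory.postcomp X (c.map h) ⋙ app d'
  pre {d : C} (d' : C) (k : X ⟶ c.obj d) : F.mapFunctor d d' ⋙ Bicategory.precomp _ ((app d).obj k) =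
    c.mapFunctor d d' ⋙ Bicategory.precomp _ k ⋙ app d'

namespace Het

variable {M : E} {X : P}

theorem post_obj (μ : Het c F M X) {d d' : C} (k : X ⟶ c.obj d) (h : d ⟶ d') :
    (μ.app d).obj k ≫ F.map h = (μ.app d').obj (k ≫ c.map h) :=
  Functor.congr_obj (μ.post h) k

theorem map_whiskerRight (μ : Het c F M X) {d d' : C} {k l : X ⟶ c.obj d} (κ : k ⟶ l) (h : d ⟶ d') :
    (μ.app d').map (κ ▷ c.map h) = eqToHom (μ.post_obj k h).symm ≫ (μ.app d).map κ ▷ F.map h ≫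
      eqToHom (μ.post_obj l h) :=
  Functor.congr_hom (μ.post h).symm κ

theorem map_whiskerLeft (μ : Het c F M X) {d d' : C} (k : X ⟶ c.obj d) {h h' : d ⟶ d'} (η : h ⟶ h') :
    (μ.app d').map (k ◁ c.map₂ η) = eqToHom (μ.post_obj k h).symm ≫ (μ.app d).obj k ◁ F.map₂ η ≫
      eqToHom (μ.post_obj k h') :=
  Functor.congr_hom (μ.pre d' k).symm η

variable {A : Type u₃} [Bicategory.{w₃, v₃} A] [Bicategory.Strict A] {D : StrictPseudofunctor Aᵒᵖ C}

/-- The image of a pseudocone on `c D` with vertex `X` is a pseudocone on `F D` with vertex `M`. -/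
def mapCone (μ : Het c F M X) (θ : PseudoCone (D.comp c) X) : PseudoCone (D.comp F) M :=
  PseudoCone.ofLegs (fun i => (μ.app _).obj (θ.leg i))
    (fun {i j} u => (μ.app _).mapIso (θ.legIso u) ≪≫ eqToIso (μ.post_obj (θ.leg j) (D.map u.op)).symm)
    (fun i => by
      simp [PseudoCone.legIso_id, eqToHom_map])
    (fun {i j k} u v => by
      simp [PseudoCone.legIso_comp, eqToHom_map, map_whiskerRight])
    (fun {i j u v} α => by
      simp [← PseudoCone.legIso_naturality θ α, map_whiskerLeft])

/-- The composite of a 1-cell and a 2-natural family. -/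
def comp {M' : E} (h : M' ⟶ M) (μ : Het c F M X) : Het c F M' X where
  app d := μ.app d ⋙ Bicategory.precomp _ h
  post g := by
    rw [Functor.assoc, precomp_postcomp, ← Functor.assoc, μ.post, Functor.assoc]
  pre {d} d' k := by
    change F.mapFunctor d d' ⋙ Bicategory.precomp _ (h ≫ (μ.app d).obj k) = _
    rw [precomp_functor_comp, ← Functor.assoc, μ.pre, Functor.assoc, Functor.assoc]

/-- The composite of a 2-natural family and a 1-cell. -/
def whisker {Y : P} (f : X ⟶ Y) (μ : Het c F M X) : Het c F M Y where
  app d := Bicategory.precomp _ f ⋙ μ.app d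
  post g := by
    rw [Functor.assoc, μ.post, ← Functor.assoc, precomp_postcomp, Functor.assoc]
  pre {d} d' k := by
    rw [← Functor.assoc (Bicategory.precomp _ k), ← precomp_functor_comp]
    exact μ.pre d' (f ≫ k)

section

variable {I : Type w} [Bicategory.{w, w} I] [Bicategory.Strict I] {D : StrictPseudofunctor Iᵒᵖ C}

/-- Through `ev`, applying a family to a pseudocone is just composition of functors; the other facts
about `mapCone` reduce to this one. -/
theorem mapCone_ev (μ : Het c F M X) (θ : PseudoCone (D.comp c) X) (d : C) :
    (μ.mapCone θ).ev d = θ.ev d ⋙ μ.app d :=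
  PseudoColim.functor_ext (fun x => μ.post_obj (θ.leg x.idx) x.arr)
    (fun i r s α => by
      change (μ.app _).obj (θ.leg i) ◁ F.map₂ α ≫ eqToHom (μ.post_obj (θ.leg i) s) =
        eqToHom (μ.post_obj (θ.leg i) r) ≫ (μ.app d).map (θ.leg i ◁ c.map₂ α)
      simp [map_whiskerLeft])
    (fun {i j} u r => by
      change (((μ.app _).map (θ.legIso u).hom ≫
        eqToHom (μ.post_obj (θ.leg j) (D.map u.op)).symm) ▷ F.map r ≫
        eqToHom (PseudoCone.ev_eq ((μ.app _).obj (θ.leg j)) u r)) ≫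
        eqToHom (μ.post_obj (θ.leg j) (D.map u.op ≫ r)) =
        eqToHom (μ.post_obj (θ.leg i) r) ≫ (μ.app d).map ((θ.legIso u).hom ▷ c.map r ≫
          eqToHom (PseudoCone.ev_eq (θ.leg j) u r))
      simp [map_whiskerRight, eqToHom_map])

theorem mapCone_precomp {M' : E} (h : M' ⟶ M) (μ : Het c F M X) (θ : PseudoCone (D.comp c) X) :
    (μ.mapCone θ).precomp h = (μ.comp h).mapCone θ :=
  PseudoCone.ev_injective fun d => by
    rw [PseudoCone.precomp_ev, mapCone_ev, mapCone_ev]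
    rfl

end

variable (p : Presentation c X)

/-- The 2-natural family determined by a pseudocone on `F X_i`. -/
noncomputable def ofCone (θ : PseudoCone (p.diagram.comp F) M) : Het c F M X where
  app d := (p.cone.ev d).strictInv ⋙ θ.ev d
  post {d d'} h := by
    apply cancel_left_isIso (p.cone.ev d)
    rw [← Functor.assoc, ← Functor.assoc, comp_strictInv, Functor.id_comp, ← Functor.assoc,
      PseudoCone.ev_postcomp, PseudoCone.ev_postcomp, Functor.assoc, ← Functor.assoc (p.cone.ev d'),
      comp_strictInv, Functor.id_comp]
  pre {d} d' k := by
    -- Since `ev d` is bijective on objects, every 1-cell to c d is equal to a leg followed by some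
    -- c r. For these the equation follows from functoriality of F and c.
    obtain ⟨⟨i, r⟩, rfl⟩ := (p.cone.ev d).bijective_obj.2 k
    have h₁ : ((p.cone.ev d).strictInv ⋙ θ.ev d).obj ((p.cone.ev d).obj ⟨i, r⟩) =
        θ.leg i ≫ F.map r :=
      congrArg (θ.ev d).obj (Functor.congr_obj (comp_strictInv (p.cone.ev d)) ⟨i, r⟩)
    have h₂ : (p.cone.ev d).obj ⟨i, r⟩ = p.cone.leg i ≫ c.map r := rfl
    have h₃ : p.cone.ev d' ⋙ (p.cone.ev d').strictInv ⋙ θ.ev d' = θ.ev d' := by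
      rw [← Functor.assoc, comp_strictInv, Functor.id_comp]
    rw [h₁, h₂, precomp_functor_comp, precomp_functor_comp, ← Functor.assoc, ← precomp_mapFunctor,
      Functor.assoc, ← PseudoCone.inc_ev, Functor.assoc (Bicategory.precomp _ (c.map r)),
      ← Functor.assoc (c.mapFunctor d d'), ← precomp_mapFunctor, Functor.assoc,
      ← Functor.assoc (c.mapFunctor _ d'), ← PseudoCone.inc_ev, Functor.assoc, h₃]

theorem ev_ofCone_app (θ : PseudoCone (p.diagram.comp F) M) (d : C) :
    p.cone.ev d ⋙ (ofCone p θ).app d = θ.ev d := by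
  change p.cone.ev d ⋙ (p.cone.ev d).strictInv ⋙ θ.ev d = θ.ev d
  rw [← Functor.assoc, comp_strictInv, Functor.id_comp]

theorem ofCone_mapCone (θ : PseudoCone (p.diagram.comp F) M) : (ofCone p θ).mapCone p.cone = θ :=
  PseudoCone.ev_injective fun d => by rw [mapCone_ev, ev_ofCone_app]

/-- With `ofCone_mapCone`: families and pseudocones on F X_i are in bijection, so a pseudolimit of
the F X_i is a universal family. -/
theorem eq_of_mapCone {μ ν : Het c F M X} (h : μ.mapCone p.cone = ν.mapCone p.cone) : μ = ν :=
  Het.ext (funext fun d => cancel_left_isIso (p.cone.ev d) (by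
    rw [← mapCone_ev, ← mapCone_ev, h]))

variable {p} {R : E} {l : Het c F R X} {Q : Type*} [Category Q]

/-- The uniqueness part of the universal property of `l`, for functors to `E(M, R)`. -/
theorem functor_ext (hl : (l.mapCone p.cone).IsPseudolimit) {S T : Q ⥤ (M ⟶ R)}
    (h : ∀ d (k : X ⟶ c.obj d), S ⋙ Bicategory.postcomp M ((l.app d).obj k) =
      T ⋙ Bicategory.postcomp M ((l.app d).obj k))
    (h' : ∀ q d, l.app d ⋙ Bicategory.precomp _ (S.obj q) =
      l.app d ⋙ Bicategory.precomp _ (T.obj q)) : S = T := by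
  have := hl M
  apply cancel_right_isIso ((l.mapCone p.cone).precompFunctor M)
  refine PseudoCone.functor_ext (fun i => h _ _) fun q => ?_
  change (l.mapCone p.cone).precomp (S.obj q) = (l.mapCone p.cone).precomp (T.obj q)
  rw [mapCone_precomp, mapCone_precomp]
  congr 1
  exact Het.ext (funext fun d => h' q d)

theorem hom_ext (hl : (l.mapCone p.cone).IsPseudolimit) {f g : M ⟶ R}
    (h' : ∀ d, l.app d ⋙ Bicategory.precomp _ f = l.app d ⋙ Bicategory.precomp _ g) : f = g := by
  have := hl M
  apply ((l.mapCone p.cone).precompFunctor M).bijective_obj.1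
  change (l.mapCone p.cone).precomp f = (l.mapCone p.cone).precomp g
  rw [mapCone_precomp, mapCone_precomp]
  congr 1
  exact Het.ext (funext fun d => h' d)

end Het

/-- A family of 2-natural families `P(X, c d) ⥤ E(M, F d)`, functorial in a parameter in `Q`. -/
structure HetFamily (c : StrictPseudofunctor C P) (F : StrictPseudofunctor C E) (Q : Type*)
    [Category Q] (M : E) (X : P) where
  app (d : C) : (X ⟶ c.obj d) ⥤ Q ⥤ (M ⟶ F.obj d)
  post {d d' : C} (h : d ⟶ d') (q : Q) :
    (app d ⋙ (evaluation _ _).obj q) ⋙ Bicategory.postcomp M (F.map h) =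
      Bicategory.postcomp X (c.map h) ⋙ (app d' ⋙ (evaluation _ _).obj q)
  post' {d d' : C} (h : d ⟶ d') (k : X ⟶ c.obj d) :
    (app d).obj k ⋙ Bicategory.postcomp M (F.map h) = (app d').obj (k ≫ c.map h)
  pre {d : C} (d' : C) (k : X ⟶ c.obj d) (q : Q) :
    F.mapFunctor d d' ⋙ Bicategory.precomp _ (((app d).obj k).obj q) =
      c.mapFunctor d d' ⋙ Bicategory.precomp _ k ⋙ (app d' ⋙ (evaluation _ _).obj q)

namespace HetFamily

variable {Q : Type*} [Category Q] {M : E} {X : P} (b : HetFamily c F Q M X)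

/-- The member at `q` of a family. -/
def at' (q : Q) : Het c F M X where
  app d := b.app d ⋙ (evaluation _ _).obj q
  post h := b.post h q
  pre d' k := b.pre d' k q

variable {A : Type u₃} [Bicategory.{w₃, v₃} A] [Bicategory.Strict A] {D : StrictPseudofunctor Aᵒᵖ C}

/-- The images of a pseudocone under the members of a family. -/
def coneFunctor (θ : PseudoCone (D.comp c) X) : Q ⥤ PseudoCone (D.comp F) M where
  obj q := (b.at' q).mapCone θ
  map {q q'} m := PseudoCone.homOfLegs (fun i => ((b.app _).obj (θ.leg i)).map m)
    (fun {i j} u => by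
      have h₁ := ((b.app _).map (θ.legIso u).hom).naturality m
      have h₂ := comp_eqToHom_of_eq_conj
        (Functor.congr_hom (b.post' (D.map u.op) (θ.leg j)).symm m)
      change ((b.app _).obj (θ.leg i)).map m ≫ ((b.app _).map (θ.legIso u).hom).app q' ≫
          eqToHom ((b.at' q').post_obj (θ.leg j) (D.map u.op)).symm =
        (((b.app _).map (θ.legIso u).hom).app q ≫
          eqToHom ((b.at' q).post_obj (θ.leg j) (D.map u.op)).symm) ≫
          ((b.app _).obj (θ.leg j)).map m ▷ F.map (D.map u.op)
      rw [reassoc_of% h₁]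
      exact (congrArg (((b.app _).map (θ.legIso u).hom).app q ≫ ·) h₂).trans
        (Category.assoc _ _ _).symm)
  map_id q := PseudoCone.hom_ext_legs fun i => ((b.app _).obj (θ.leg i)).map_id q
  map_comp m n := PseudoCone.hom_ext_legs fun i => ((b.app _).obj (θ.leg i)).map_comp m n

variable {p : Presentation c X} {R : E} {l : Het c F R X}

/-- The existence part of the universal property of `l`, for functors to `E(M, R)`. -/
theorem exists_functor (hl : (l.mapCone p.cone).IsPseudolimit) :
    ∃ S : Q ⥤ (M ⟶ R), (∀ d (k : X ⟶ c.obj d),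
        S ⋙ Bicategory.postcomp M ((l.app d).obj k) = (b.app d).obj k) ∧
      ∀ q d, l.app d ⋙ Bicategory.precomp _ (S.obj q) = b.app d ⋙ (evaluation _ _).obj q := by
  have := hl M
  -- The members of the family give a functor from `Q` to pseudocones; the isomorphism `N` is
  -- inverted on all of it at once, which takes care of the arrows of `Q`.
  let N := (l.mapCone p.cone).precompFunctor M
  have hN : (b.coneFunctor p.cone ⋙ N.strictInv) ⋙ N = b.coneFunctor p.cone := by
    rw [Functor.assoc, strictInv_comp, Functor.comp_id]
  refine ⟨b.coneFunctor p.cone ⋙ N.strictInv, fun d k => ?_, fun q d => ?_⟩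
  -- The pseudolimit controls only composites with legs; a general k is a leg followed by c r, and
  -- naturality in d does the rest.
  · obtain ⟨⟨i, r⟩, rfl⟩ := (p.cone.ev d).bijective_obj.2 k
    change _ ⋙ Bicategory.postcomp M ((l.app d).obj (p.cone.leg i ≫ c.map r)) =
      (b.app d).obj (p.cone.leg i ≫ c.map r)
    rw [← l.post_obj, postcomp_functor_comp, ← b.post', ← Functor.assoc]
    congr 1
    exact congrArg (· ⋙ PseudoCone.legFunctor p.diagram F M i) hN
  · apply cancel_left_isIso (p.cone.ev d)
    rw [← Functor.assoc, ← Het.mapCone_ev, ← PseudoCone.precomp_ev]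
    refine Eq.trans ?_ (Het.mapCone_ev (b.at' q) p.cone d)
    exact congrArg (fun θ => PseudoCone.ev θ d) (Functor.congr_obj hN q)

end HetFamily

end Het

end TwoPro

namespace TwoPro

open CategoryTheory Bicategory Opposite

set_option linter.unusedSectionVars false
set_option linter.unusedVariables false

/-! ### Reassociation of diagrams, and inverses of 2-natural transformations. -/

section Recast

variable {A : Type u₃} [Bicategory.{w₃, v₃} A] [Bicategory.Strict A]
  {C : Type u} [Bicategory.{w', v'} C] [Bicategory.Strict C]
  {P : Type u₂} [Bicategory.{w₂, v₂} P] [Bicategory.Strict P]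
  {E : Type u₁} [Bicategory.{w₁, v₁} E] [Bicategory.Strict E]
  {D : StrictPseudofunctor A C} {c : StrictPseudofunctor C P} {H : StrictPseudofunctor P E} {M : E}

/-- Reassociation of the diagram of a pseudocone. -/
def PseudoCone.reassoc (θ : PseudoCone ((D.comp c).comp H) M) : PseudoCone (D.comp (c.comp H)) M where
  app i := θ.app i
  iso u := θ.iso u
  iso_id i := θ.iso_id i
  iso_comp u v := θ.iso_comp u v
  iso_naturality α := θ.iso_naturality α

/-- Reassociation of the diagram of a pseudocone. -/
def PseudoCone.reassocInv (θ : PseudoCone (D.comp (c.comp H)) M) :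
    PseudoCone ((D.comp c).comp H) M where
  app i := θ.app i
  iso u := θ.iso u
  iso_id i := θ.iso_id i
  iso_comp u v := θ.iso_comp u v
  iso_naturality α := θ.iso_naturality α

/-- Reassociation of the diagram of a pseudocone, as a functor. -/
def PseudoCone.reassocFunctor (D : StrictPseudofunctor A C) (c : StrictPseudofunctor C P)
    (H : StrictPseudofunctor P E) (M : E) :
    PseudoCone ((D.comp c).comp H) M ⥤ PseudoCone (D.comp (c.comp H)) M where
  obj θ := θ.reassoc
  map ρ := show PseudoCone.Hom _ _ from ⟨fun i => PseudoCone.Hom.app ρ i,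
    fun u => PseudoCone.Hom.naturality ρ u⟩
  map_id _ := rfl
  map_comp _ _ := rfl

/-- Reassociation of the diagram of a pseudocone, as a functor. -/
def PseudoCone.reassocInvFunctor (D : StrictPseudofunctor A C) (c : StrictPseudofunctor C P)
    (H : StrictPseudofunctor P E) (M : E) :
    PseudoCone (D.comp (c.comp H)) M ⥤ PseudoCone ((D.comp c).comp H) M where
  obj θ := θ.reassocInv
  map ρ := show PseudoCone.Hom _ _ from ⟨fun i => PseudoCone.Hom.app ρ i,
    fun u => PseudoCone.Hom.naturality ρ u⟩
  map_id _ := rfl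
  map_comp _ _ := rfl

instance : (PseudoCone.reassocFunctor D c H M).IsIso :=
  isIso_of_inverse _ (PseudoCone.reassocInvFunctor D c H M) rfl rfl

theorem isIso_comp {K : Type*} [Category K] {K' : Type*} [Category K'] {K'' : Type*} [Category K'']
    (S : K ⥤ K') (T : K' ⥤ K'') [S.IsIso] [T.IsIso] : (S ⋙ T).IsIso :=
  isIso_of_inverse _ (T.strictInv ⋙ S.strictInv)
    (by rw [Functor.assoc, ← Functor.assoc T, comp_strictInv, Functor.id_comp, comp_strictInv])
    (by rw [Functor.assoc, ← Functor.assoc S.strictInv, strictInv_comp, Functor.id_comp,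
      strictInv_comp])

theorem PseudoCone.IsPseudolimit.reassoc {θ : PseudoCone ((D.comp c).comp H) M}
    (h : θ.IsPseudolimit) : θ.reassoc.IsPseudolimit := fun L => by
  have := h L
  exact isIso_comp (θ.precompFunctor L) (PseudoCone.reassocFunctor D c H L)

/-- Only pointwise inverses are needed: conjugating the naturality equation of `θ` by them on both
sides is the naturality equation of the inverse. -/
theorem TwoNatTrans.exists_inverse {F G : StrictPseudofunctor A C} (θ : F ⟶ G)
    (inv : ∀ a, G.obj a ⟶ F.obj a) (h₁ : ∀ a, (toStrongTrans θ).app a ≫ inv a = 𝟙 _)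
    (h₂ : ∀ a, inv a ≫ (toStrongTrans θ).app a = 𝟙 _) :
    ∃ η : G ⟶ F, θ ≫ η = 𝟙 _ ∧ η ≫ θ = 𝟙 _ := by
  refine ⟨TwoNatTrans.ofFunctors inv fun a b => ?_, TwoNatTrans.ext' h₁, TwoNatTrans.ext' h₂⟩
  have h := congrArg (fun S => S ⋙ Bicategory.precomp _ (inv a) ⋙ Bicategory.postcomp _ (inv b))
    (θ.mapFunctor_eq a b)
  simp only [Functor.assoc] at h
  rw [← Functor.assoc (Bicategory.precomp _ _) (Bicategory.precomp _ _), ← precomp_functor_comp, h₂,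
    precomp_functor_id, Functor.id_comp, precomp_postcomp, ← Functor.assoc (Bicategory.postcomp _ _),
    ← postcomp_functor_comp, h₁, postcomp_functor_id, Functor.id_comp] at h
  exact h.symm

end Recast

/-! ### Pointwise right Kan extensions along c: existence, local invertibility of restriction, and
the counit. -/

section Ran

variable {C : Type u} [Bicategory.{w, w} C] [Bicategory.Strict C]
  {P : Type u₂} [Bicategory.{w₂, v₂} P] [Bicategory.Strict P]
  {E : Type u₁} [Bicategory.{w₁, v₁} E] [Bicategory.Strict E]
  {c : StrictPseudofunctor C P} {F : StrictPseudofunctor C E} {R H : StrictPseudofunctor P E}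

/-- The functorial family obtained from a 2-natural family by composition. -/
def Het.whiskerFamily {M : E} {X : P} (μ : Het c F M X) (Y : P) : HetFamily c F (X ⟶ Y) M Y where
  app d := Bicategory.postcomposing X Y (c.obj d) ⋙ (Functor.whiskeringRight _ _ _).obj (μ.app d)
  post h f := (μ.whisker f).post h
  post' h k := by
    change (Bicategory.postcomp X k ⋙ μ.app _) ⋙ Bicategory.postcomp M (F.map h) =
      Bicategory.postcomp X (k ≫ c.map h) ⋙ μ.app _
    rw [Functor.assoc, μ.post, postcomp_functor_comp, Functor.assoc]
  pre d' k f := (μ.whisker f).pre d' k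

/-- `R` is a pointwise right Kan extension of `F` along `c`, computed by pseudolimits over the
chosen presentations of the objects of `P`. -/
structure Ran (pres : ∀ X : P, Presentation c X) (F : StrictPseudofunctor C E)
    (R : StrictPseudofunctor P E) where
  het (X : P) : Het c F (R.obj X) X
  nat₁ {X Y : P} (f : X ⟶ Y) (d : C) :
    (het Y).app d ⋙ Bicategory.precomp _ (R.map f) = Bicategory.precomp _ f ⋙ (het X).app d
  nat₂ (X : P) {Y : P} {d : C} (k : Y ⟶ c.obj d) :
    R.mapFunctor X Y ⋙ Bicategory.postcomp _ (((het Y).app d).obj k) =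
      Bicategory.postcomp X k ⋙ (het X).app d
  univ (X : P) : ((het X).mapCone (pres X).cone).IsPseudolimit

variable {pres : ∀ X : P, Presentation c X}

/-- R X is a chosen pseudolimit of the F X_i. For X → Y, the family of R X whiskered along 1-cells X
→ Y factors through the universal family of R Y, functorially in the 1-cell; uniqueness in the
universal property yields the 2-functor laws. -/
theorem exists_ran (hE : HasSmallTwoCofilteredPseudolimits.{w} E) (F : StrictPseudofunctor C E) :
    ∃ R : StrictPseudofunctor P E, Nonempty (Ran pres F R) := by
  choose o π hπ using fun X => hE (pres X).I ((pres X).diagram.comp F)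
  let l (X : P) : Het c F (o X) X := Het.ofCone (pres X) (π X)
  have hl (X) : ((l X).mapCone (pres X).cone).IsPseudolimit := by
    rw [Het.ofCone_mapCone]
    exact hπ X
  choose m hm₂ hm₁ using fun X Y => ((l X).whiskerFamily Y).exists_functor (hl Y)
  replace hm₁ (X Y) (f : X ⟶ Y) (d) : (l Y).app d ⋙ Bicategory.precomp _ ((m X Y).obj f) =
      Bicategory.precomp _ f ⋙ (l X).app d := hm₁ X Y f d
  replace hm₂ (X Y d) (k : Y ⟶ c.obj d) : m X Y ⋙ Bicategory.postcomp _ (((l Y).app d).obj k) =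
      Bicategory.postcomp X k ⋙ (l X).app d := hm₂ X Y d k
  have hm₃ (X Y) (f : X ⟶ Y) (d) (k : Y ⟶ c.obj d) :
      (m X Y).obj f ≫ ((l Y).app d).obj k = ((l X).app d).obj (f ≫ k) :=
    Functor.congr_obj (hm₁ X Y f d) k
  -- Compatibility with composition on 1-cells comes before the functor-level laws, since it
  -- supplies the object hypothesis of `Het.functor_ext` in both of them.
  have hm₄ {X Y Z} (f : X ⟶ Y) (g : Y ⟶ Z) : (m X Y).obj f ≫ (m Y Z).obj g = (m X Z).obj (f ≫ g) := by
    apply Het.hom_ext (hl Z)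
    intro d
    rw [precomp_functor_comp, ← Functor.assoc, hm₁, Functor.assoc, hm₁, hm₁, precomp_functor_comp,
      Functor.assoc]
  refine ⟨strictPseudofunctorOfFunctors o m (fun X => ?_) (fun X {Y Z} g => ?_)
    (fun {X Y} Z f => ?_), ⟨⟨l, fun {X Y} f d => hm₁ X Y f d, fun X {Y d} k => hm₂ X Y d k, hl⟩⟩⟩
  · apply Het.hom_ext (hl X)
    intro d
    rw [hm₁, precomp_functor_id, precomp_functor_id, Functor.id_comp, Functor.comp_id]
  · apply Het.functor_ext (hl Z)
    · intro d k
      rw [Functor.assoc, ← postcomp_functor_comp, hm₃, hm₂, postcomp_functor_comp, Functor.assoc,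
        Functor.assoc, hm₂]
    · intro f d
      exact congrArg (fun x => (l Z).app d ⋙ Bicategory.precomp _ x) (hm₄ f g)
  · apply Het.functor_ext (hl Z)
    · intro d k
      rw [Functor.assoc, Functor.assoc, hm₂, precomp_postcomp, ← Functor.assoc, precomp_postcomp,
        Functor.assoc, ← hm₁, ← Functor.assoc, ← hm₂, Functor.assoc]
    · intro g d
      exact congrArg (fun x => (l Z).app d ⋙ Bicategory.precomp _ x) (hm₄ f g).symm

/-- The action of a 2-functor `H` on 1-cells to the objects `c d`. -/
def Het.ofFunctor (c : StrictPseudofunctor C P) (H : StrictPseudofunctor P E) (X : P) :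
    Het c (c.comp H) (H.obj X) X where
  app d := H.mapFunctor X (c.obj d)
  post h := mapFunctor_postcomp H X (c.map h)
  pre {d} d' k := congrArg (c.mapFunctor d d' ⋙ ·) (precomp_mapFunctor H (c.obj d') k).symm

/-- The component at `d` of a 2-natural transformation from a composite 2-functor, as a functor. -/
def TwoNatTrans.compEval (c : StrictPseudofunctor C P) (H : StrictPseudofunctor P E)
    (F : StrictPseudofunctor C E) (d : C) : (c.comp H ⟶ F) ⥤ (H.obj (c.obj d) ⟶ F.obj d) :=
  TwoNatTrans.evalApp (c.comp H) F d

theorem TwoNatTrans.compEval_mapFunctor (τ : c.comp H ⟶ F) (d d' : C) :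
    c.mapFunctor d d' ⋙ H.mapFunctor _ _ ⋙
      Bicategory.postcomp _ ((TwoNatTrans.compEval c H F d').obj τ) =
    F.mapFunctor d d' ⋙ Bicategory.precomp _ ((TwoNatTrans.compEval c H F d).obj τ) :=
  TwoNatTrans.mapFunctor_eq τ d d'

theorem TwoNatTrans.compEval_naturality (τ : c.comp H ⟶ F) {d d' : C} (h : d ⟶ d') :
    H.map (c.map h) ≫ (TwoNatTrans.compEval c H F d').obj τ =
      (TwoNatTrans.compEval c H F d).obj τ ≫ F.map h :=
  TwoNatTrans.naturality_eq τ h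

theorem TwoNatTrans.compEval_precomp (c : StrictPseudofunctor C P) (H : StrictPseudofunctor P E)
    (F : StrictPseudofunctor C E) {d d' : C} (h : d ⟶ d') :
    TwoNatTrans.compEval c H F d' ⋙ Bicategory.precomp _ (H.map (c.map h)) =
      TwoNatTrans.compEval c H F d ⋙ Bicategory.postcomp _ (F.map h) :=
  TwoNatTrans.evalApp_precomp (c.comp H) F h

/-- The functorial family given by precomposition with 2-natural transformations. -/
def HetFamily.ofFunctor (c : StrictPseudofunctor C P) (F : StrictPseudofunctor C E)
    (H : StrictPseudofunctor P E) (X : P) :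
    HetFamily c F (c.comp H ⟶ F) (H.obj X) X where
  app d := H.mapFunctor X (c.obj d) ⋙ Bicategory.precomposing _ _ _ ⋙
    (Functor.whiskeringLeft _ _ _).obj (TwoNatTrans.compEval c H F d)
  post {d d'} h τ := by
    change H.mapFunctor X (c.obj d) ⋙
      Bicategory.postcomp (H.obj X) ((TwoNatTrans.compEval c H F d).obj τ) ⋙
      Bicategory.postcomp (H.obj X) (F.map h) = Bicategory.postcomp X (c.map h) ⋙
      H.mapFunctor X (c.obj d') ⋙
      Bicategory.postcomp (H.obj X) ((TwoNatTrans.compEval c H F d').obj τ)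
    rw [← postcomp_functor_comp, ← Functor.assoc, ← mapFunctor_postcomp, Functor.assoc,
      ← TwoNatTrans.compEval_naturality, postcomp_functor_comp]
  post' {d d'} h k := by
    change TwoNatTrans.compEval c H F d ⋙ Bicategory.precomp _ (H.map k) ⋙
      Bicategory.postcomp _ (F.map h) = TwoNatTrans.compEval c H F d' ⋙
      Bicategory.precomp _ (H.map (k ≫ c.map h))
    rw [H.map_comp, precomp_functor_comp, precomp_postcomp, ← Functor.assoc, ← Functor.assoc,
      TwoNatTrans.compEval_precomp]
  pre {d} d' k τ := by
    change F.mapFunctor d d' ⋙ Bicategory.precomp _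
        (H.map k ≫ (TwoNatTrans.compEval c H F d).obj τ) =
      c.mapFunctor d d' ⋙ Bicategory.precomp _ k ⋙ H.mapFunctor _ _ ⋙
        Bicategory.postcomp _ ((TwoNatTrans.compEval c H F d').obj τ)
    rw [precomp_functor_comp, ← Functor.assoc, ← TwoNatTrans.compEval_mapFunctor,
      ← Functor.assoc (Bicategory.precomp _ k), precomp_mapFunctor, Functor.assoc, Functor.assoc,
      Functor.assoc, precomp_postcomp]

/-- A 2-functor preserving small 2-cofiltered pseudolimits is a right Kan extension of its restriction. -/
def Ran.ofPreserves (pres : ∀ X : P, Presentation c X) (H : StrictPseudofunctor P E)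
    (hH : PreservesSmallTwoCofilteredPseudolimits.{w} H) : Ran pres (c.comp H) H where
  het X := Het.ofFunctor c H X
  nat₁ f d := (precomp_mapFunctor H _ f).symm
  nat₂ X _ _ k := mapFunctor_postcomp H X k
  univ X := (hH (pres X).I ((pres X).diagram.comp c) X (pres X).cone
    (pres X).isPseudolimit).reassoc

/-- The component at `d` of a 2-natural transformation between restrictions, as a functor. -/
def TwoNatTrans.resEval (c : StrictPseudofunctor C P) (H H' : StrictPseudofunctor P E) (d : C) :
    (c.comp H ⟶ c.comp H') ⥤ (H.obj (c.obj d) ⟶ H'.obj (c.obj d)) :=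
  TwoNatTrans.evalApp (c.comp H) (c.comp H') d

theorem functor_ext_of_preserves (pres : ∀ X : P, Presentation c X) {H' : StrictPseudofunctor P E}
    (hH' : PreservesSmallTwoCofilteredPseudolimits.{w} H') {Q : Type*} [Category Q] {M : E} {X : P}
    {T U : Q ⥤ (M ⟶ H'.obj X)}
    (h : ∀ d (k : X ⟶ c.obj d), T ⋙ Bicategory.postcomp M (H'.map k) =
      U ⋙ Bicategory.postcomp M (H'.map k))
    (h' : ∀ q d, H'.mapFunctor X (c.obj d) ⋙ Bicategory.precomp _ (T.obj q) =
      H'.mapFunctor X (c.obj d) ⋙ Bicategory.precomp _ (U.obj q)) : T = U :=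
  Het.functor_ext ((Ran.ofPreserves pres H' hH').univ X) h h'

/-- Restriction along `c` is an isomorphism on the categories of 2-natural transformations to a 2-functor
preserving small 2-cofiltered pseudolimits. -/
theorem isIso_precomp_mapFunctor (pres : ∀ X : P, Presentation c X) (H H' : StrictPseudofunctor P E)
    (hH' : PreservesSmallTwoCofilteredPseudolimits.{w} H') :
    ((precomp E c).mapFunctor H H').IsIso := by
  have hl (X) := (Ran.ofPreserves pres H' hH').univ X
  -- `S X` extends a transformation of restrictions to the object X: followed by H' k, for k from X
  -- to c d, the extended component must be H k followed by the given component at d. `hS₁` says so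
  -- functorially in the transformation, `hS₂` functorially in k.
  choose S hS₁ hS₂ using fun X => (HetFamily.ofFunctor c (c.comp H') H X).exists_functor (hl X)
  replace hS₁ (X d) (k : X ⟶ c.obj d) : S X ⋙ Bicategory.postcomp _ (H'.map k) =
      TwoNatTrans.resEval c H H' d ⋙ Bicategory.precomp _ (H.map k) := hS₁ X d k
  replace hS₂ (X τ d) : H'.mapFunctor X (c.obj d) ⋙ Bicategory.precomp _ ((S X).obj τ) =
      H.mapFunctor X (c.obj d) ⋙
        Bicategory.postcomp _ ((TwoNatTrans.resEval c H H' d).obj τ) := hS₂ X τ d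
  have hS₃ (X d) (k : X ⟶ c.obj d) (τ) : (S X).obj τ ≫ H'.map k =
      H.map k ≫ (TwoNatTrans.resEval c H H' d).obj τ := Functor.congr_obj (hS₁ X d k) τ
  have h₁ (X Y : P) (f : X ⟶ Y) (τ) (d) : H'.mapFunctor Y (c.obj d) ⋙
      Bicategory.precomp _ (H.map f ≫ (S Y).obj τ) = H'.mapFunctor Y (c.obj d) ⋙
      Bicategory.precomp _ ((S X).obj τ ≫ H'.map f) := by
    rw [precomp_functor_comp, precomp_functor_comp, ← Functor.assoc, hS₂, ← Functor.assoc,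
      ← precomp_mapFunctor, Functor.assoc, Functor.assoc, hS₂, ← precomp_postcomp, ← Functor.assoc,
      ← precomp_mapFunctor, Functor.assoc]
  -- `h` is 2-naturality of the extended components for a fixed transformation, `h'` is the
  -- modification axiom for the extended modifications. Both are tested after the 1-cells H' k,
  -- where `hS₁` and `hS₂` compute everything.
  have h (τ X Y) : H.mapFunctor X Y ⋙ Bicategory.postcomp _ ((S Y).obj τ) =
      H'.mapFunctor X Y ⋙ Bicategory.precomp _ ((S X).obj τ) := by
    apply functor_ext_of_preserves pres hH'
    · intro d k
      rw [Functor.assoc, ← postcomp_functor_comp, hS₃, postcomp_functor_comp, ← Functor.assoc,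
        mapFunctor_postcomp, Functor.assoc, Functor.assoc, precomp_postcomp,
        ← Functor.assoc (H'.mapFunctor X Y),
        mapFunctor_postcomp, Functor.assoc, hS₂]
    · intro f d
      exact h₁ X Y f τ d
  have h' {X Y : P} (f : X ⟶ Y) : S Y ⋙ Bicategory.precomp _ (H.map f) =
      S X ⋙ Bicategory.postcomp _ (H'.map f) := by
    apply functor_ext_of_preserves pres hH'
    · intro d k
      rw [Functor.assoc, precomp_postcomp, ← Functor.assoc, hS₁, Functor.assoc, Functor.assoc,
        ← precomp_functor_comp, ← postcomp_functor_comp, ← H.map_comp, ← H'.map_comp, hS₁]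
    · intro τ d
      exact h₁ X Y f τ d
  refine isIso_of_inverse _ (TwoNatTrans.functorOf S h h') ?_ ?_
  · apply TwoNatTrans.functor_ext
    intro X
    apply functor_ext_of_preserves pres hH'
    · intro d k
      have := TwoNatTrans.evalApp_precomp H H' k
      refine Eq.trans ?_ this
      exact congrArg ((precomp E c).mapFunctor H H' ⋙ ·) (hS₁ X d k)
    · intro θ d
      refine (hS₂ X (TwoNatTrans.precomp c θ) d).trans ?_
      exact TwoNatTrans.mapFunctor_eq θ X (c.obj d)
  · apply TwoNatTrans.functor_ext
    intro d
    -- At an object c d the test 1-cell may be the identity, which returns the given component.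
    have h₂ := hS₁ (c.obj d) d (𝟙 _)
    rw [H.map_id, H'.map_id, postcomp_functor_id, precomp_functor_id, Functor.comp_id,
      Functor.comp_id] at h₂
    exact h₂

/-- A right Kan extension along a locally fully faithful 2-functor restricts to the given 2-functor. -/
theorem Ran.exists_counit {pres : ∀ X : P, Presentation c X} (ran : Ran pres F R)
    (hc : ∀ a b, (c.mapFunctor a b).IsIso) :
    ∃ (κ : c.comp R ⟶ F) (κ' : F ⟶ c.comp R), κ ≫ κ' = 𝟙 _ ∧ κ' ≫ κ = 𝟙 _ := by
  -- The counit is the universal family evaluated at the identity of c a.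
  let e (a : C) : R.obj (c.obj a) ⟶ F.obj a := ((ran.het (c.obj a)).app a).obj (𝟙 _)
  have he (a b : C) : F.mapFunctor a b ⋙ Bicategory.precomp _ (e a) =
      c.mapFunctor a b ⋙ (ran.het (c.obj a)).app b := by
    have := (ran.het (c.obj a)).pre b (𝟙 _)
    rwa [precomp_functor_id, Functor.id_comp] at this
  have hn (a b : C) : c.mapFunctor a b ⋙ R.mapFunctor _ _ ⋙ Bicategory.postcomp _ (e b) =
      F.mapFunctor a b ⋙ Bicategory.precomp _ (e a) := by
    rw [ran.nat₂, postcomp_functor_id, Functor.id_comp, he]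
  -- Since c is invertible on hom-categories, F itself is a family with vertex F a; the 1-cell that
  -- classifies it is the inverse of e a.
  let μ (a : C) : Het c F (F.obj a) (c.obj a) :=
    { app d := (c.mapFunctor a d).strictInv ⋙ F.mapFunctor a d
      post {d d'} h := by
        apply cancel_left_isIso (c.mapFunctor a d)
        rw [← Functor.assoc, ← Functor.assoc (c.mapFunctor a d), comp_strictInv, Functor.id_comp,
          mapFunctor_postcomp, ← Functor.assoc (c.mapFunctor a d), mapFunctor_postcomp,
          Functor.assoc, ← Functor.assoc (c.mapFunctor a d'), comp_strictInv, Functor.id_comp]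
      pre {d} d' k := by
        obtain ⟨k, rfl⟩ := (c.mapFunctor a d).bijective_obj.2 k
        have h₁ : ((c.mapFunctor a d).strictInv ⋙ F.mapFunctor a d).obj ((c.mapFunctor a d).obj k) =
          F.map k := congrArg (F.mapFunctor a d).obj
            (Functor.congr_obj (comp_strictInv (c.mapFunctor a d)) k)
        have h₂ : (c.mapFunctor a d).obj k = c.map k := rfl
        rw [h₁, h₂, ← Functor.assoc (c.mapFunctor d d'), ← precomp_mapFunctor c, Functor.assoc,
          ← Functor.assoc (c.mapFunctor a d'), comp_strictInv, Functor.id_comp, precomp_mapFunctor] }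
  have hμ (a : C) : ∃ e' : F.obj a ⟶ R.obj (c.obj a), ∀ d,
      (ran.het (c.obj a)).app d ⋙ Bicategory.precomp _ e' = (μ a).app d := by
    have := ran.univ (c.obj a) (F.obj a)
    obtain ⟨e', he'⟩ := ((((ran.het (c.obj a)).mapCone (pres (c.obj a)).cone).precompFunctor
      (F.obj a)).bijective_obj).2 ((μ a).mapCone (pres (c.obj a)).cone)
    refine ⟨e', fun d => ?_⟩
    have := Het.eq_of_mapCone _ ((Het.mapCone_precomp e' _ _).symm.trans he')
    exact congrArg (fun ν => Het.app ν d) this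
  choose e' he' using hμ
  obtain ⟨κ', h⟩ := TwoNatTrans.exists_inverse (TwoNatTrans.ofFunctors (F := c.comp R) (G := F) e hn) e'
    (fun a => by
      change e a ≫ e' a = 𝟙 (R.obj (c.obj a))
      apply Het.hom_ext (ran.univ (c.obj a))
      intro d
      rw [precomp_functor_comp, ← Functor.assoc, he', precomp_functor_id, Functor.comp_id,
        Functor.assoc, he, ← Functor.assoc, strictInv_comp, Functor.id_comp])
    (fun a => by
      have h₁ := Functor.congr_obj (he' a a) ((c.mapFunctor a a).obj (𝟙 a))
      have h₂ : ((μ a).app a).obj ((c.mapFunctor a a).obj (𝟙 a)) = F.map (𝟙 a) :=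
        congrArg (F.mapFunctor a a).obj (Functor.congr_obj (comp_strictInv (c.mapFunctor a a)) (𝟙 a))
      have h₃ : (c.mapFunctor a a).obj (𝟙 a) = 𝟙 _ := c.map_id a
      rw [h₂, h₃, F.map_id] at h₁
      exact h₁)
  exact ⟨_, κ', h⟩

end Ran

end TwoPro

namespace TwoPro

open CategoryTheory Bicategory Opposite

set_option linter.unusedSectionVars false
set_option linter.unusedVariables false

/-! ### Arrows of a 2-filtered pseudocolimit come from stages, and their equality is detected at
stages. -/

theorem op2_eqToHom_of_eq {B : Type*} [Bicategory B] {a b : B} {f g : a ⟶ b} (h : f = g) :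
    _root_.Bicategory.Opposite.op2 (eqToHom h) = eqToHom (congrArg Quiver.Hom.op h) := by
  subst h
  rfl

namespace PseudoColim

variable {C : Type u} [Bicategory.{w, w} C] [Bicategory.Strict C]
  {I : Type w} [Bicategory.{w, w} I] [Bicategory.Strict I]
  {X : StrictPseudofunctor Iᵒᵖ C} {c : C}

/-- The comparison isomorphism `X_a X_u r ≅ X_{u'} r` given by an isomorphism `u ≫ a ≅ u'`. -/
def transport (X : StrictPseudofunctor Iᵒᵖ C) {i j k : I} {u : i ⟶ j} (a : j ⟶ k) {u' : i ⟶ k}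
    (γ : u ≫ a ≅ u') (r : X.obj (op i) ⟶ c) :
    X.map a.op ≫ X.map u.op ≫ r ≅ X.map u'.op ≫ r where
  hom := eqToHom (push_comp_eq X u a r) ≫ X.map₂ (_root_.Bicategory.Opposite.op2 γ.hom) ▷ r
  inv := X.map₂ (_root_.Bicategory.Opposite.op2 γ.inv) ▷ r ≫ eqToHom (push_comp_eq X u a r).symm
  hom_inv_id := by simp [← comp_whiskerRight_assoc, ← X.map₂_comp, ← _root_.Bicategory.Opposite.op2_comp]
  inv_hom_id := by simp [← comp_whiskerRight, ← X.map₂_comp, ← _root_.Bicategory.Opposite.op2_comp]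

theorem transport_hom {i j k : I} {u : i ⟶ j} (a : j ⟶ k) {u' : i ⟶ k}
    (γ : u ≫ a ≅ u') (r : X.obj (op i) ⟶ c) : (transport X a γ r).hom =
    eqToHom (push_comp_eq X u a r) ≫ X.map₂ (_root_.Bicategory.Opposite.op2 γ.hom) ▷ r := rfl

theorem transport_naturality {i j k : I} {u : i ⟶ j} (a : j ⟶ k) {u' : i ⟶ k} (γ : u ≫ a ≅ u')
    {r s : X.obj (op i) ⟶ c} (η : r ⟶ s) :
    X.map a.op ◁ X.map u.op ◁ η ≫ (transport X a γ s).hom =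
      (transport X a γ r).hom ≫ X.map u'.op ◁ η := by
  have := whisker_exchange (X.map₂ (_root_.Bicategory.Opposite.op2 γ.hom)) η
  simp only [transport_hom, Category.assoc, ← this]
  simp [congr_whiskerLeft (X.map_comp a.op u.op), Strict.associator_eqToIso]

theorem transport_transport {i j k l : I} {u : i ⟶ j} (a : j ⟶ k) {u' : i ⟶ k} (γ : u ≫ a ≅ u')
    (b : k ⟶ l) {u'' : i ⟶ l} (γ' : u' ≫ b ≅ u'') (r : X.obj (op i) ⟶ c) :
    X.map b.op ◁ (transport X a γ r).hom ≫ (transport X b γ' r).hom =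
      eqToHom (push_comp_eq X a b (X.map u.op ≫ r)) ≫
        (transport X (a ≫ b) ((α_ u a b).symm ≪≫ whiskerRightIso γ b ≪≫ γ') r).hom := by
  simp [transport_hom, X.mapComp_eq_eqToIso, Strict.associator_eqToIso, PrelaxFunctor.map₂_eqToHom,
    op2_eqToHom_of_eq]

theorem transport_congr {i j k : I} {u : i ⟶ j} {a a' : j ⟶ k} (ξ : a ≅ a') {u' : i ⟶ k}
    (γ : u ≫ a' ≅ u') (r : X.obj (op i) ⟶ c) :
    X.map₂ (_root_.Bicategory.Opposite.op2 ξ.hom) ▷ (X.map u.op ≫ r) ≫ (transport X a' γ r).hom =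
      (transport X a (whiskerLeftIso u ξ ≪≫ γ) r).hom := by
  simp [transport_hom, X.mapComp_eq_eqToIso, Strict.associator_eqToIso]

theorem transport_comp_map₂ {i j k : I} {u : i ⟶ j} (a : j ⟶ k) {u' u'' : i ⟶ k} (γ : u ≫ a ≅ u')
    (δ : u' ≅ u'') (r : X.obj (op i) ⟶ c) :
    (transport X a γ r).hom ≫ X.map₂ (_root_.Bicategory.Opposite.op2 δ.hom) ▷ r =
      (transport X a (γ ≪≫ δ) r).hom := by
  simp [transport_hom]

theorem transport_push {h i j k : I} (w : h ⟶ i) {u : i ⟶ j} (a : j ⟶ k) {u' : i ⟶ k} (γ : u ≫ a ≅ u')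
    (r : X.obj (op h) ⟶ c) :
    (transport X a γ (X.map w.op ≫ r)).hom ≫ eqToHom (push_comp_eq X w u' r) =
      X.map a.op ◁ eqToHom (push_comp_eq X w u r) ≫
        (transport X a (α_ w u a ≪≫ whiskerLeftIso w γ) r).hom := by
  simp [transport_hom, X.mapComp_eq_eqToIso, Strict.associator_eqToIso, PrelaxFunctor.map₂_eqToHom,
    op2_eqToHom_of_eq]

/-- The pseudococone axioms for composition and for 2-cells in one: pushing along u and then a,
corrected by γ, is pushing along u'. -/
theorem push_transport {i j k : I} {u : i ⟶ j} (a : j ⟶ k) {u' : i ⟶ k}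
    (γ : u ≫ a ≅ u') (r : X.obj (op i) ⟶ c) :
    (push u r).hom ≫ (push a _).hom ≫ cell (transport X a γ r).hom = (push u' r).hom := by
  rw [transport_hom, ← cell_comp, ← push_cell γ.hom, push_comp]
  simp

theorem push_transport_hom {i j k : I} {u : i ⟶ j} (a : j ⟶ k) {u' : i ⟶ k}
    (γ : u ≫ a ≅ u') (r : X.obj (op i) ⟶ c) :
    (push a _).hom ≫ cell (transport X a γ r).hom = (push u r).inv ≫ (push u' r).hom := by
  rw [Iso.eq_inv_comp, push_transport]

theorem push_transport_inv {i j k : I} {u : i ⟶ j} (a : j ⟶ k) {u' : i ⟶ k}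
    (γ : u ≫ a ≅ u') (r : X.obj (op i) ⟶ c) :
    (push u' r).hom ≫ cell (transport X a γ r).inv = (push u r).hom ≫ (push a _).hom := by
  rw [← push_transport a γ r]
  simp

/-- Every arrow of the pseudocolimit over a 2-filtered 2-category comes from some stage. -/
theorem exists_push_cell_pull [IsTwoFiltered I] {x y : PseudoColim X c} (f : x ⟶ y) :
    ∃ (k : I) (u : x.idx ⟶ k) (v : y.idx ⟶ k) (θ : X.map u.op ≫ x.arr ⟶ X.map v.op ≫ y.arr),
      f = (push u x.arr).hom ≫ cell θ ≫ (push v y.arr).inv := by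
  induction f using hom_induction with
  | id x => exact ⟨x.idx, 𝟙 _, 𝟙 _, 𝟙 _, by simp⟩
  | cell i θ => exact ⟨i, 𝟙 _, 𝟙 _, X.map _ ◁ θ, by
      rw [← Category.assoc, Iso.eq_comp_inv, push_naturality]⟩
  | push u r => exact ⟨_, u, 𝟙 _, eqToHom (push_id_eq X _), by simp [← push_id]⟩
  | pull u r => exact ⟨_, 𝟙 _, u, eqToHom (push_id_eq X _).symm, by simp [push_id]⟩
  | comp f g hf hg =>
    rename_i x y z
    obtain ⟨k, u, v, θ, rfl⟩ := hf
    obtain ⟨l, u', v', θ', rfl⟩ := hg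
    -- The two legs out of the middle index become isomorphic at a common later stage, where the two
    -- representatives can be composed.
    obtain ⟨m₀, ⟨a₀⟩, ⟨b₀⟩⟩ := IsTwoFiltered.cocone_objs k l
    obtain ⟨m, h, ⟨γ⟩⟩ := IsTwoFiltered.cocone_maps (v ≫ a₀) (u' ≫ b₀)
    let a := a₀ ≫ h
    let b := b₀ ≫ h
    let δ : v ≫ a ≅ u' ≫ b := (α_ _ _ _).symm ≪≫ γ ≪≫ α_ _ _ _
    have e₁ := push_transport_hom a δ y.arr
    have e₂ := push_transport_inv b (Iso.refl (u' ≫ b)) y.arr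
    have e₃ := push_transport_inv a (Iso.refl (u ≫ a)) x.arr
    have e₄ := push_transport_hom b (Iso.refl (v' ≫ b)) z.arr
    refine ⟨m, u ≫ a, v' ≫ b, (transport X a (Iso.refl _) x.arr).inv ≫ X.map a.op ◁ θ ≫
      (transport X a δ y.arr).hom ≫ (transport X b (Iso.refl _) y.arr).inv ≫ X.map b.op ◁ θ' ≫
      (transport X b (Iso.refl _) z.arr).hom, ?_⟩
    simp only [← cell_comp, Category.assoc]
    rw [reassoc_of% e₃, ← push_naturality_assoc, reassoc_of% e₁, reassoc_of% e₂,
      ← push_naturality_assoc, reassoc_of% e₄]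
    simp

section Step

variable {i j : I} {r : X.obj (op i) ⟶ c} {s : X.obj (op j) ⟶ c}

/-- `θ'` is the image of `θ` at a later stage. -/
def IsStep {k k' : I} {u : i ⟶ k} {v : j ⟶ k} {u' : i ⟶ k'} {v' : j ⟶ k'}
    (θ : X.map u.op ≫ r ⟶ X.map v.op ≫ s) (θ' : X.map u'.op ≫ r ⟶ X.map v'.op ≫ s)
    (a : k ⟶ k') (γ : u ≫ a ≅ u') (δ : v ≫ a ≅ v') : Prop :=
  X.map a.op ◁ θ ≫ (transport X a δ s).hom = (transport X a γ r).hom ≫ θ'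

section

variable {k k' k'' : I} {u : i ⟶ k} {v : j ⟶ k} {u' : i ⟶ k'} {v' : j ⟶ k'} {u'' : i ⟶ k''}
  {v'' : j ⟶ k''} {θ : X.map u.op ≫ r ⟶ X.map v.op ≫ s} {θ' : X.map u'.op ≫ r ⟶ X.map v'.op ≫ s}
  {θ'' : X.map u''.op ≫ r ⟶ X.map v''.op ≫ s}

theorem IsStep.trans {a γ δ b γ' δ'} (h : IsStep θ θ' a γ δ) (h' : IsStep θ' θ'' b γ' δ') :
    IsStep θ θ'' (a ≫ b)
      ((α_ _ _ _).symm ≪≫ whiskerRightIso γ b ≪≫ γ') ((α_ _ _ _).symm ≪≫ whiskerRightIso δ b ≪≫ δ') := by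
  unfold IsStep at h h' ⊢
  have e₁ := transport_transport a γ b γ' r
  have e₂ := transport_transport a δ b δ' s
  rw [← cancel_epi (eqToHom (push_comp_eq X a b (X.map u.op ≫ r))), ← reassoc_of% e₁, ← h',
    ← whiskerLeft_comp_assoc, ← h]
  simp [e₂, congr_whiskerLeft (X.map_comp b.op a.op), Strict.associator_eqToIso]

/-- Transports are invertible, so the first of two steps can be cancelled; this closes the squares
in the comparison of representatives. -/
theorem IsStep.of_trans {a γ δ b γ' δ'} (h : IsStep θ θ' a γ δ) (h' : IsStep θ θ'' (a ≫ b)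
      ((α_ _ _ _).symm ≪≫ whiskerRightIso γ b ≪≫ γ') ((α_ _ _ _).symm ≪≫ whiskerRightIso δ b ≪≫ δ')) :
    IsStep θ' θ'' b γ' δ' := by
  unfold IsStep at h h' ⊢
  have e₁ := transport_transport a γ b γ' r
  have e₂ := transport_transport a δ b δ' s
  rw [← cancel_epi (X.map b.op ◁ (transport X a γ r).hom), reassoc_of% e₁, ← h',
    ← whiskerLeft_comp_assoc, ← h]
  simp [e₂, congr_whiskerLeft (X.map_comp b.op a.op), Strict.associator_eqToIso]

theorem IsStep.congr {a a' γ δ} (ξ : a' ≅ a) (h : IsStep θ θ' a γ δ) :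
    IsStep θ θ' a' (whiskerLeftIso _ ξ ≪≫ γ) (whiskerLeftIso _ ξ ≪≫ δ) := by
  unfold IsStep at h ⊢
  rw [← transport_congr, ← transport_congr, Category.assoc, ← h, whisker_exchange_assoc]

theorem exists_isStep (θ : X.map u.op ≫ r ⟶ X.map v.op ≫ s) (a : k ⟶ k') (γ : u ≫ a ≅ u')
    (δ : v ≫ a ≅ v') : ∃ θ' : X.map u'.op ≫ r ⟶ X.map v'.op ≫ s, IsStep θ θ' a γ δ :=
  ⟨(transport X a γ r).inv ≫ X.map a.op ◁ θ ≫ (transport X a δ s).hom, by simp [IsStep]⟩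

theorem transport_rightUnitor {i k : I} (u : i ⟶ k) (r : X.obj (op i) ⟶ c) :
    (transport X (𝟙 k) (ρ_ u) r).hom = eqToHom (push_id_eq X _).symm := by
  simp [transport_hom, Strict.leftUnitor_eqToIso, PrelaxFunctor.map₂_eqToHom]

theorem isStep_id (θ : X.map u.op ≫ r ⟶ X.map v.op ≫ s) : IsStep θ θ (𝟙 _) (ρ_ _) (ρ_ _) := by
  unfold IsStep
  rw [transport_rightUnitor, transport_rightUnitor]
  simp [congr_whiskerLeft (X.map_id (op k)), Strict.leftUnitor_eqToIso]

theorem IsStep.comp {a γ δ} (h : IsStep θ θ' a γ δ) {t : X.obj (op j) ⟶ c} (η : s ⟶ t) :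
    IsStep (θ ≫ X.map v.op ◁ η) (θ' ≫ X.map v'.op ◁ η) a γ δ := by
  unfold IsStep at h ⊢
  rw [whiskerLeft_comp, Category.assoc, transport_naturality, reassoc_of% h]

theorem isStep_map₂ {a : k ⟶ k'} {γ : u ≫ a ≅ u'} {δ : v ≫ a ≅ v'} (h : IsStep θ θ' a γ δ)
    {v₁ : j ⟶ k} (α : v ⟶ v₁) {v₁' : j ⟶ k'} (δ₁ : v₁ ≫ a ≅ v₁') (β : v' ⟶ v₁')
    (e : α ▷ a ≫ δ₁.hom = δ.hom ≫ β) :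
    IsStep (θ ≫ X.map₂ (_root_.Bicategory.Opposite.op2 α) ▷ s)
      (θ' ≫ X.map₂ (_root_.Bicategory.Opposite.op2 β) ▷ s) a γ δ₁ := by
  unfold IsStep at h ⊢
  have e₁ : X.map a.op ◁ X.map₂ (_root_.Bicategory.Opposite.op2 α) ▷ s ≫ (transport X a δ₁ s).hom =
      (transport X a δ s).hom ≫ X.map₂ (_root_.Bicategory.Opposite.op2 β) ▷ s := by
    rw [transport_hom, transport_hom, Category.assoc, ← comp_whiskerRight, ← X.map₂_comp,
      ← _root_.Bicategory.Opposite.op2_comp, ← e]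
    simp [X.mapComp_eq_eqToIso, Strict.associator_eqToIso]
  rw [whiskerLeft_comp, Category.assoc, e₁, reassoc_of% h]

theorem IsStep.comp_map₂ {a γ δ} (h : IsStep θ θ' a γ δ) {v₁ : j ⟶ k'} (κ : v' ≅ v₁) :
    IsStep θ (θ' ≫ X.map₂ (_root_.Bicategory.Opposite.op2 κ.hom) ▷ s) a γ (δ ≪≫ κ) := by
  unfold IsStep at h ⊢
  rw [← transport_comp_map₂, reassoc_of% h]

/-- Absorbing w into the right leg changes representatives by an `eqToHom` only. The converse
direction needs the isomorphism of right legs to be whiskered from one that does not involve w; this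
is the difficulty met in `pull_injective`. -/
theorem isStep_pull_iff {h : I} (w : h ⟶ j) {s : X.obj (op h) ⟶ c}
    {θ : X.map u.op ≫ r ⟶ X.map v.op ≫ X.map w.op ≫ s}
    {θ' : X.map u'.op ≫ r ⟶ X.map v'.op ≫ X.map w.op ≫ s} {a γ δ} :
    IsStep (θ ≫ eqToHom (push_comp_eq X w v s)) (θ' ≫ eqToHom (push_comp_eq X w v' s)) a γ
      (α_ w _ _ ≪≫ whiskerLeftIso w δ) ↔ IsStep θ θ' a γ δ := by
  unfold IsStep
  have := transport_push w a δ s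
  rw [whiskerLeft_comp, Category.assoc, ← this]
  refine Iff.trans ?_ (cancel_mono (eqToHom (push_comp_eq X w v' s)))
  simp only [Category.assoc]

end

/-- A representative of an arrow of the pseudocolimit. -/
structure Roof {i j : I} (r : X.obj (op i) ⟶ c) (s : X.obj (op j) ⟶ c) where
  vertex : I
  left : i ⟶ vertex
  right : j ⟶ vertex
  hom : X.map left.op ≫ r ⟶ X.map right.op ≫ s

namespace Roof

/-- `z'` is the image of `z` at some later stage. -/
def Step (z z' : Roof r s) : Prop := ∃ a γ δ, IsStep z.hom z'.hom a γ δ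

theorem Step.refl (z : Roof r s) : Step z z := ⟨_, _, _, isStep_id z.hom⟩

theorem Step.trans {z z' z'' : Roof r s} (h : Step z z') (h' : Step z' z'') : Step z z'' := by
  obtain ⟨a, γ, δ, h⟩ := h
  obtain ⟨b, γ', δ', h'⟩ := h'
  exact ⟨_, _, _, h.trans h'⟩

/-- The Ore condition: (F0) supplies a common target and (F1) the invertible 2-cell. -/
theorem exists_iso_comp [IsTwoFiltered I] {k l m : I} (v : k ⟶ l) (v' : k ⟶ m) :
    ∃ (n : I) (a : l ⟶ n) (b : m ⟶ n), Nonempty (v ≫ a ≅ v' ≫ b) := by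
  obtain ⟨m₀, ⟨a₀⟩, ⟨b₀⟩⟩ := IsTwoFiltered.cocone_objs l m
  obtain ⟨n, h, ⟨γ⟩⟩ := IsTwoFiltered.cocone_maps (v ≫ a₀) (v' ≫ b₀)
  exact ⟨n, a₀ ≫ h, b₀ ≫ h, ⟨(α_ _ _ _).symm ≪≫ γ ≪≫ α_ _ _ _⟩⟩

/-- Gives transitivity of agreement at a later stage. The two steps are continued to a common stage
by the Ore condition, and `IsStep.of_trans` compares the second continuation with the first. -/
theorem Step.diamond [IsTwoFiltered I] {z z' z'' : Roof r s} (h : Step z z') (h' : Step z z'') :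
    Relation.Join Step z' z'' := by
  obtain ⟨a, γ, δ, h⟩ := h
  obtain ⟨b, γ', δ', h'⟩ := h'
  obtain ⟨m, p, q, ⟨ξ⟩⟩ := exists_iso_comp a b
  obtain ⟨θ, hθ⟩ := exists_isStep z'.hom p (Iso.refl _) (Iso.refl _)
  refine ⟨⟨m, _, _, θ⟩, ⟨p, _, _, hθ⟩, ?_⟩
  have h₁ := (h.trans hθ).congr ξ.symm
  refine ⟨q, (whiskerRightIso γ' q).symm ≪≫ α_ _ _ _ ≪≫ whiskerLeftIso _ ξ.symm ≪≫
      (α_ _ _ _).symm ≪≫ whiskerRightIso γ p,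
    (whiskerRightIso δ' q).symm ≪≫ α_ _ _ _ ≪≫ whiskerLeftIso _ ξ.symm ≪≫
      (α_ _ _ _).symm ≪≫ whiskerRightIso δ p, h'.of_trans ?_⟩
  convert h₁ using 1 <;> ext <;> simp

/-- Two roofs are equivalent if they agree at some later stage. -/
def setoid [IsTwoFiltered I] (r : X.obj (op i) ⟶ c) (s : X.obj (op j) ⟶ c) : Setoid (Roof r s) where
  r := Relation.Join Step
  iseqv :=
    { refl := fun z => ⟨z, Step.refl z, Step.refl z⟩
      symm := fun ⟨t, h, h'⟩ => ⟨t, h', h⟩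
      trans := fun ⟨t, h₁, h₂⟩ ⟨t', h₃, h₄⟩ => by
        obtain ⟨t'', h₅, h₆⟩ := h₂.diamond h₃
        exact ⟨t'', h₁.trans h₅, h₄.trans h₆⟩ }

variable [IsTwoFiltered I]

theorem sound {z z' : Roof r s} (h : Step z z') :
    Quotient.mk (setoid r s) z = Quotient.mk (setoid r s) z' :=
  Quotient.sound ⟨z', h, Step.refl z'⟩

/-- The composite of a class of roofs and a 2-cell. -/
def comp {t : X.obj (op j) ⟶ c} (η : s ⟶ t) (z : Quotient (setoid r s)) : Quotient (setoid r t) :=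
  Quotient.map (sa := setoid r s) (sb := setoid r t)
    (fun z => ⟨z.vertex, z.left, z.right, z.hom ≫ X.map z.right.op ◁ η⟩)
    (fun _ _ ⟨t, ⟨a, γ, δ, h⟩, ⟨a', γ', δ', h'⟩⟩ =>
      ⟨⟨t.vertex, t.left, t.right, t.hom ≫ X.map t.right.op ◁ η⟩, ⟨a, γ, δ, h.comp η⟩,
        ⟨a', γ', δ', h'.comp η⟩⟩) z

/-- The class of roofs obtained by composition of the right leg with a 1-cell. -/
def pull {h : I} (w : h ⟶ j) (s : X.obj (op h) ⟶ c) (z : Quotient (setoid r (X.map w.op ≫ s))) :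
    Quotient (setoid r s) :=
  Quotient.map (sa := setoid r (X.map w.op ≫ s)) (sb := setoid r s)
    (fun z => ⟨z.vertex, z.left, w ≫ z.right, z.hom ≫ eqToHom (push_comp_eq X w z.right s)⟩)
    (fun _ _ ⟨t, ⟨a, γ, δ, h⟩, ⟨a', γ', δ', h'⟩⟩ =>
      ⟨⟨t.vertex, t.left, w ≫ t.right, t.hom ≫ eqToHom (push_comp_eq X w t.right s)⟩,
        ⟨a, γ, _, (isStep_pull_iff w).2 h⟩, ⟨a', γ', _, (isStep_pull_iff w).2 h'⟩⟩) z

/-- A representative can be moved to a later stage until its right leg is isomorphic to a 1-cell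
through w. -/
theorem exists_pull_eq {h : I} (w : h ⟶ j) (s : X.obj (op h) ⟶ c) (z : Quotient (setoid r s)) :
    ∃ z', pull w s z' = z := by
  induction z using Quotient.inductionOn with | _ z
  obtain ⟨m, a, b, ⟨ξ⟩⟩ := exists_iso_comp z.right w
  obtain ⟨θ, hθ⟩ := exists_isStep z.hom a (Iso.refl _) ξ
  refine ⟨Quotient.mk _ ⟨m, z.left ≫ a, b, θ ≫ eqToHom (push_comp_eq X w b s).symm⟩, ?_⟩
  refine Eq.symm (sound ⟨a, Iso.refl _, ξ, ?_⟩)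
  simpa using hθ

/-- The given isomorphism need not come from one between v and v'. By (F1) some isomorphism between
these exists later on, and by (F2) its whiskering with w agrees with the given one later still. -/
theorem exists_iso_whiskerLeft {h j k : I} (w : h ⟶ j) (v : j ⟶ k) (v' : j ⟶ k)
    (ξ : w ≫ v ≅ w ≫ v') : ∃ (l : I) (a : k ⟶ l) (ζ : v ≫ a ≅ v' ≫ a),
      whiskerRightIso ξ a = α_ _ _ _ ≪≫ whiskerLeftIso w ζ ≪≫ (α_ _ _ _).symm := by
  obtain ⟨m, a, ⟨ζ⟩⟩ := IsTwoFiltered.cocone_maps v v'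
  obtain ⟨l, b, e⟩ := IsTwoFiltered.cocone_cells (whiskerRightIso ξ a).hom
    (α_ _ _ _ ≪≫ whiskerLeftIso w ζ ≪≫ (α_ _ _ _).symm).hom
  refine ⟨l, a ≫ b, (α_ _ _ _).symm ≪≫ whiskerRightIso ζ b ≪≫ α_ _ _ _, ?_⟩
  ext
  simp at e
  simp [e]

/-- Agreement of the images identifies right legs only after composition with w.
`exists_iso_whiskerLeft` replaces this identification by one whiskered from the legs themselves, and
`isStep_pull_iff` then lets the comparison descend. -/
theorem pull_injective {h : I} (w : h ⟶ j) (s : X.obj (op h) ⟶ c) :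
    Function.Injective (pull (r := r) w s) := by
  intro z z' e
  induction z using Quotient.inductionOn with | _ z
  induction z' using Quotient.inductionOn with | _ z'
  obtain ⟨⟨l, u₁, v₁, θ₁⟩, ⟨a, γ, δ, h⟩, ⟨a', γ', δ', h'⟩⟩ := Quotient.exact (s := setoid r s) e
  obtain ⟨k, u, v, θ⟩ := z
  obtain ⟨k', u', v', θ'⟩ := z'
  dsimp only at a γ δ h a' γ' δ' h'
  obtain ⟨m, b, ζ, hζ⟩ := exists_iso_whiskerLeft w (v ≫ a) (v' ≫ a')
    ((α_ _ _ _).symm ≪≫ δ ≪≫ δ'.symm ≪≫ α_ _ _ _)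
  obtain ⟨θ₂, h₂⟩ := exists_isStep θ' (a' ≫ b)
    ((α_ _ _ _).symm ≪≫ whiskerRightIso γ' b ≪≫ Iso.refl _) (α_ v' a' b).symm
  have h₃ := (isStep_pull_iff w).2 h₂
  have h₄ : IsStep θ₁ (θ₂ ≫ eqToHom (push_comp_eq X w ((v' ≫ a') ≫ b) s)) b (Iso.refl _)
      ((whiskerRightIso δ' b).symm ≪≫ α_ _ _ _ ≪≫ α_ _ _ _ ≪≫ whiskerLeftIso w (α_ v' a' b).symm) := by
    refine h'.of_trans ?_
    convert h₃ using 1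
    ext
    simp
  refine Quotient.sound ⟨⟨m, u₁ ≫ b, (v' ≫ a') ≫ b, θ₂⟩, ⟨a ≫ b, (α_ _ _ _).symm ≪≫
    whiskerRightIso γ b ≪≫ Iso.refl _, (α_ v a b).symm ≪≫ ζ, ?_⟩, ⟨_, _, _, h₂⟩⟩
  refine (isStep_pull_iff w).1 ?_
  convert h.trans h₄ using 1
  ext
  have := congrArg Iso.hom hζ
  simp at this ⊢
  have e : w ◁ ζ.hom = (α_ w (v ≫ a) b).inv ≫ ((α_ w v a).inv ▷ b ≫ δ.hom ▷ b ≫ δ'.inv ▷ b ≫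
      (α_ w v' a').hom ▷ b) ≫ (α_ w (v' ≫ a') b).hom := by
    rw [this]
    simp
  rw [e]
  simp

theorem pull_comp {h : I} (w : h ⟶ j) {s s' : X.obj (op h) ⟶ c} (η : s ⟶ s')
    (z : Quotient (setoid r (X.map w.op ≫ s))) :
    comp η (pull w s z) = pull w s' (comp (X.map w.op ◁ η) z) := by
  induction z using Quotient.inductionOn with | _ z
  refine congrArg (Quotient.mk _) (congrArg (Roof.mk z.vertex z.left (w ≫ z.right)) ?_)
  simp [congr_whiskerLeft (X.map_comp z.right.op w.op), Strict.associator_eqToIso]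

theorem pull_id {s : X.obj (op j) ⟶ c} (z : Quotient (setoid r s)) :
    pull (𝟙 j) s (comp (eqToHom (push_id_eq X s)) z) = z := by
  induction z using Quotient.inductionOn with | _ z
  refine Eq.symm (sound ⟨𝟙 _, ρ_ _, ρ_ _ ≪≫ (λ_ _).symm, ?_⟩)
  convert (isStep_id z.hom).comp_map₂ (λ_ z.right).symm using 1
  simp [Strict.leftUnitor_eqToIso, PrelaxFunctor.map₂_eqToHom, op2_eqToHom_of_eq]

theorem pull_pull {g h : I} (w : h ⟶ j) (w' : g ⟶ h) {s : X.obj (op g) ⟶ c}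
    (z : Quotient (setoid r (X.map w.op ≫ X.map w'.op ≫ s))) :
    pull (w' ≫ w) s (comp (eqToHom (push_comp_eq X w' w s)) z) = pull w' s (pull w _ z) := by
  induction z using Quotient.inductionOn with | _ z
  refine sound ⟨𝟙 _, ρ_ _, ρ_ _ ≪≫ α_ _ _ _, ?_⟩
  convert (isStep_id (z.hom ≫ X.map z.right.op ◁ eqToHom (push_comp_eq X w' w s) ≫
    eqToHom (push_comp_eq X _ _ s))).comp_map₂ (α_ w' w z.right) using 1
  · simp
  · simp [Strict.associator_eqToIso, PrelaxFunctor.map₂_eqToHom, op2_eqToHom_of_eq]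

/-- Steps use invertible 2-cells, whereas α is arbitrary. By (F1) and (F2), α whiskered with a
sufficiently late 1-cell equals an invertible 2-cell, and this absorbs the correction. -/
theorem pull_map₂ {h : I} {w w' : h ⟶ j} (α : w ⟶ w') {s : X.obj (op h) ⟶ c}
    (z : Quotient (setoid r (X.map w.op ≫ s))) :
    pull w' s (comp (X.map₂ (_root_.Bicategory.Opposite.op2 α) ▷ s) z) = pull w s z := by
  induction z using Quotient.inductionOn with | _ z
  obtain ⟨m, a, ξ, e⟩ : ∃ (m : I) (a : z.vertex ⟶ m) (ξ : (w ≫ z.right) ≫ a ≅ (w' ≫ z.right) ≫ a),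
      ξ.hom = (α ▷ z.right) ▷ a := by
    obtain ⟨m, a, ⟨ξ⟩⟩ := IsTwoFiltered.cocone_maps (w ≫ z.right) (w' ≫ z.right)
    obtain ⟨m', a', e⟩ := IsTwoFiltered.cocone_cells ξ.hom ((α ▷ z.right) ▷ a)
    refine ⟨m', a ≫ a', (α_ _ _ _).symm ≪≫ whiskerRightIso ξ a' ≪≫ α_ _ _ _, ?_⟩
    simp [e]
  obtain ⟨k, u, v, θ⟩ := z
  dsimp only at a ξ e
  obtain ⟨θ', hθ⟩ := exists_isStep (θ ≫ eqToHom (push_comp_eq X w v s)) a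
    (Iso.refl _) (Iso.refl _)
  refine Quotient.sound ⟨⟨m, u ≫ a, (w' ≫ v) ≫ a, _⟩, ⟨a, Iso.refl _, Iso.refl _, ?_⟩,
    ⟨a, Iso.refl _, _, hθ.comp_map₂ ξ⟩⟩
  convert isStep_map₂ hθ (α ▷ v) (Iso.refl _) ξ.hom (by simp [e]) using 1
  simp [X.mapComp_eq_eqToIso, Strict.associator_eqToIso]

/-- Composition with a 1-cell is a bijection on classes of roofs. -/
noncomputable def pullIso {h : I} (r : X.obj (op i) ⟶ c) (w : h ⟶ j) (s : X.obj (op h) ⟶ c) :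
    Quotient (setoid r (X.map w.op ≫ s)) ≅ Quotient (setoid r s) :=
  (Equiv.ofBijective (pull (r := r) w s) ⟨pull_injective w s, exists_pull_eq w s⟩).toIso

theorem comp_id (z : Quotient (setoid r s)) : comp (𝟙 s) z = z := by
  induction z using Quotient.inductionOn with | _ z
  refine congrArg (Quotient.mk _) (congrArg (Roof.mk z.vertex z.left z.right) ?_)
  simp

theorem comp_comp {t t' : X.obj (op j) ⟶ c} (η : s ⟶ t) (κ : t ⟶ t') (z : Quotient (setoid r s)) :
    comp (η ≫ κ) z = comp κ (comp η z) := by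
  induction z using Quotient.inductionOn with | _ z
  refine congrArg (Quotient.mk _) (congrArg (Roof.mk z.vertex z.left z.right) ?_)
  simp

/-- The functor represented by `(i, r)`, described by classes of roofs. -/
noncomputable def functor (r : X.obj (op i) ⟶ c) : PseudoColim X c ⥤ Type w :=
  CoconeData.functor
    { obj j s := Quotient (setoid r s)
      cell j _ _ η := TypeCat.ofHom (comp η)
      push w s := (pullIso r w s).symm
      cell_id j s := by
        ext z
        exact comp_id z
      cell_comp j _ _ _ η κ := by
        ext z
        exact comp_comp η κ z
      push_naturality {_ _} w {s s'} η := by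
        change _ ≫ (pullIso r w s').inv = (pullIso r w s).inv ≫ _
        rw [Iso.comp_inv_eq, Category.assoc, Iso.eq_inv_comp]
        ext z
        exact pull_comp w η z
      push_id j s := by
        change (pullIso r (𝟙 j) s).inv = _
        rw [← cancel_mono (pullIso r (𝟙 j) s).hom, Iso.inv_hom_id]
        ext z
        exact (pull_id z).symm
      push_comp {_ _ _} u v s := by
        change (pullIso r (u ≫ v) s).inv = (pullIso r u s).inv ≫ (pullIso r v _).inv ≫ _
        have : TypeCat.ofHom (comp (eqToHom (push_comp_eq X u v s))) ≫ (pullIso r (u ≫ v) s).hom =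
            (pullIso r v _).hom ≫ (pullIso r u s).hom := by
          ext z
          exact pull_pull v u z
        rw [← cancel_mono (pullIso r (u ≫ v) s).hom, Category.assoc, Category.assoc, this]
        simp
      push_cell {j k w w'} α s := by
        change (pullIso r w s).inv ≫ _ = (pullIso r w' s).inv
        rw [Iso.inv_comp_eq, Iso.eq_comp_inv]
        ext z
        exact pull_map₂ α z }

end Roof

end Step

/-- 2-cells that are identified in the pseudocolimit agree at some stage. -/
theorem exists_whiskerLeft_eq [IsTwoFiltered I] {i : I} {r s : X.obj (op i) ⟶ c} {θ θ' : r ⟶ s}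
    (h : cell θ = cell θ') : ∃ (k : I) (u : i ⟶ k), X.map u.op ◁ θ = X.map u.op ◁ θ' := by
  -- Arrows of the pseudocolimit are classes of formal words, so equality cannot be read off them.
  -- The functor of roofs turns it into equality of roofs when applied to the identity roof.
  have := congrArg (fun f => (Roof.functor r).map f
    (show (Roof.functor r).obj ⟨i, r⟩ from Quotient.mk (Roof.setoid r r) ⟨i, 𝟙 i, 𝟙 i, 𝟙 _⟩)) h
  obtain ⟨⟨l, u, v, ζ⟩, ⟨a, γ, δ, h⟩, ⟨a', γ', δ', h'⟩⟩ := Quotient.exact (s := Roof.setoid r s) this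
  dsimp only at a γ δ h a' γ' δ' h'
  have h₁ := h'.congr ((λ_ a).symm ≪≫ γ ≪≫ γ'.symm ≪≫ λ_ a')
  have e₁ : whiskerLeftIso (𝟙 i) ((λ_ a).symm ≪≫ γ ≪≫ γ'.symm ≪≫ λ_ a') ≪≫ γ' = γ := by
    ext
    simp
  rw [e₁] at h₁
  -- The left isomorphisms now coincide; (F2) makes the right ones coincide at a later stage, after
  -- which the two step equations have the same transport, and it cancels.
  obtain ⟨m, b, e⟩ := IsTwoFiltered.cocone_cells δ.hom
    (whiskerLeftIso (𝟙 i) ((λ_ a).symm ≪≫ γ ≪≫ γ'.symm ≪≫ λ_ a') ≪≫ δ').hom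
  obtain ⟨ζ', h₂⟩ := exists_isStep ζ b (Iso.refl _) (Iso.refl _)
  have h₃ := h.trans h₂
  have h₄ := h₁.trans h₂
  have e₂ : whiskerRightIso δ b = whiskerRightIso
    (whiskerLeftIso (𝟙 i) ((λ_ a).symm ≪≫ γ ≪≫ γ'.symm ≪≫ λ_ a') ≪≫ δ') b := Iso.ext e
  rw [← e₂] at h₄
  unfold IsStep at h₃ h₄
  have h₅ := h₃.trans h₄.symm
  rw [cancel_mono] at h₅
  refine ⟨m, 𝟙 i ≫ a ≫ b, ?_⟩
  have e₃ : X.map (𝟙 i ≫ a ≫ b).op = X.map (a ≫ b).op ≫ X.map (𝟙 i).op := X.map_comp _ _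
  rw [congr_whiskerLeft e₃, congr_whiskerLeft e₃, comp_whiskerLeft, comp_whiskerLeft]
  rw [Category.id_comp, Category.id_comp] at h₅
  rw [h₅]

end PseudoColim

end TwoPro

namespace TwoPro

open CategoryTheory Bicategory Opposite

set_option linter.unusedSectionVars false
set_option linter.unusedVariables false

/-! ### Pasting of squares in P whose horizontal sides come from C. -/

section Paste

variable {C : Type u} [Bicategory.{w, w} C] [Bicategory.Strict C]
  {P : Type u₂} [Bicategory.{w₂, v₂} P] [Bicategory.Strict P]
  {c : StrictPseudofunctor C P}

section

variable {x y z : P} {a b e : C} {p : x ⟶ c.obj a} {q : y ⟶ c.obj b} {t : z ⟶ c.obj e}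

theorem paste_eq₁ (t : z ⟶ c.obj e) (s : e ⟶ b) (r : b ⟶ a) :
    t ≫ c.map (s ≫ r) = (t ≫ c.map s) ≫ c.map r := by
  rw [c.map_comp, Strict.assoc]

theorem paste_eq₂ {V : z ⟶ y} {U : y ⟶ x} {W : z ⟶ x} (h : W = V ≫ U) (p : x ⟶ c.obj a) :
    V ≫ U ≫ p = W ≫ p := by
  rw [h, Strict.assoc]

/-- Pasting of two squares commuting up to isomorphism. -/
def paste {r : b ⟶ a} {s : e ⟶ b} {U : y ⟶ x} {V : z ⟶ y} (φ : q ≫ c.map r ≅ U ≫ p)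
    (ψ : t ≫ c.map s ≅ V ≫ q) {W : z ⟶ x} (h : W = V ≫ U) : t ≫ c.map (s ≫ r) ≅ W ≫ p :=
  eqToIso (paste_eq₁ t s r) ≪≫ whiskerRightIso ψ (c.map r) ≪≫ eqToIso (Strict.assoc _ _ _) ≪≫
    whiskerLeftIso V φ ≪≫ eqToIso (paste_eq₂ h p)

/-- With `paste_whiskerRight`: a pair of 2-cells compatible with two squares stays compatible after
pasting a third square. This is what defines whiskering in `Idx`. -/
theorem paste_whiskerLeft {r r' : b ⟶ a} {s : e ⟶ b} {U U' : y ⟶ x} {V : z ⟶ y}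
    {φ : q ≫ c.map r ≅ U ≫ p} {φ' : q ≫ c.map r' ≅ U' ≫ p} (θ : r ⟶ r') (β : U ⟶ U')
    (ψ : t ≫ c.map s ≅ V ≫ q) {W W' : z ⟶ x} (h : W = V ≫ U) (h' : W' = V ≫ U')
    (w : q ◁ c.map₂ θ ≫ φ'.hom = φ.hom ≫ β ▷ p) :
    t ◁ c.map₂ (s ◁ θ) ≫ (paste φ' ψ h').hom =
      (paste φ ψ h).hom ≫ (eqToHom h ≫ V ◁ β ≫ eqToHom h'.symm) ▷ p := by
  subst h h'
  have e := whisker_exchange ψ.hom (c.map₂ θ)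
  have w' := congrArg (V ◁ ·) w
  simp only [whiskerLeft_comp] at w'
  simp [paste, c.mapComp_eq_eqToIso, Strict.associator_eqToIso] at e w' ⊢
  replace e := congrArg (eqToHom (Strict.assoc t (c.map s) (c.map r)).symm ≫ ·) e
  simp at e
  rw [reassoc_of% e, ← reassoc_of% w']
  simp

theorem paste_whiskerRight {r : b ⟶ a} {s s' : e ⟶ b} {U : y ⟶ x} {V V' : z ⟶ y}
    (φ : q ≫ c.map r ≅ U ≫ p) {ψ : t ≫ c.map s ≅ V ≫ q} {ψ' : t ≫ c.map s' ≅ V' ≫ q}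
    (θ : s ⟶ s') (β : V ⟶ V') {W W' : z ⟶ x} (h : W = V ≫ U) (h' : W' = V' ≫ U)
    (w : t ◁ c.map₂ θ ≫ ψ'.hom = ψ.hom ≫ β ▷ q) :
    t ◁ c.map₂ (θ ▷ r) ≫ (paste φ ψ' h').hom =
      (paste φ ψ h).hom ≫ (eqToHom h ≫ β ▷ U ≫ eqToHom h'.symm) ▷ p := by
  subst h h'
  have e := whisker_exchange β φ.hom
  have w' := congrArg (· ▷ c.map r) w
  simp only [comp_whiskerRight] at w'
  simp [paste, c.mapComp_eq_eqToIso, Strict.associator_eqToIso] at e w' ⊢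
  replace e := congrArg (eqToHom (Strict.assoc V q (c.map r)) ≫ ·) e
  simp at e
  replace w' := congrArg (eqToHom (Strict.assoc t (c.map s) (c.map r)).symm ≫ ·) w'
  simp at w'
  rw [reassoc_of% w', ← reassoc_of% e]
  simp

end

/-- Pasting is associative up to the identifications of strict associativity in P and C, in the form
that makes the associator of `Idx` a compatible pair of 2-cells. -/
theorem paste_assoc {x₁ x₂ x₃ x₄ : P} {a₁ a₂ a₃ a₄ : C} {p₁ : x₁ ⟶ c.obj a₁} {p₂ : x₂ ⟶ c.obj a₂}
    {p₃ : x₃ ⟶ c.obj a₃} {p₄ : x₄ ⟶ c.obj a₄} {r₁ : a₂ ⟶ a₁} {r₂ : a₃ ⟶ a₂} {r₃ : a₄ ⟶ a₃}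
    {U₁ : x₂ ⟶ x₁} {U₂ : x₃ ⟶ x₂} {U₃ : x₄ ⟶ x₃} (φ₁ : p₂ ≫ c.map r₁ ≅ U₁ ≫ p₁)
    (φ₂ : p₃ ≫ c.map r₂ ≅ U₂ ≫ p₂) (φ₃ : p₄ ≫ c.map r₃ ≅ U₃ ≫ p₃) {W₁ : x₃ ⟶ x₁} {W₂ : x₄ ⟶ x₂}
    {W W' : x₄ ⟶ x₁} (h₁ : W₁ = U₂ ≫ U₁) (h₂ : W = U₃ ≫ W₁) (h₃ : W₂ = U₃ ≫ U₂) (h₄ : W' = W₂ ≫ U₁)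
    (h : W = W') :
    p₄ ◁ c.map₂ (eqToHom (Strict.assoc r₃ r₂ r₁).symm) ≫ (paste φ₁ (paste φ₂ φ₃ h₃) h₄).hom =
      (paste (paste φ₁ φ₂ h₁) φ₃ h₂).hom ≫ eqToHom h ▷ p₁ := by
  subst h₁ h₂ h₃ h₄
  simp [paste, PrelaxFunctor.map₂_eqToHom, whiskerRight_congr (c.map_comp r₂ r₁),
    Strict.associator_eqToIso]

theorem paste_id_left {x y : P} {a b : C} {p : x ⟶ c.obj a} {q : y ⟶ c.obj b} {r : b ⟶ a} {U : y ⟶ x}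
    (φ : q ≫ c.map r ≅ U ≫ p) {i : x ⟶ x} (hi : p ≫ c.map (𝟙 a) = i ≫ p) {W : y ⟶ x} (h : W = U ≫ i)
    (hi' : i = 𝟙 x) (e : U = W) :
    q ◁ c.map₂ (eqToHom (Strict.comp_id r).symm) ≫ (paste (eqToIso hi) φ h).hom =
      φ.hom ≫ eqToHom e ▷ p := by
  subst hi' e
  simp [paste, PrelaxFunctor.map₂_eqToHom, whiskerRight_congr (c.map_id a), Strict.rightUnitor_eqToIso]

theorem paste_id_right {x y : P} {a b : C} {p : x ⟶ c.obj a} {q : y ⟶ c.obj b} {r : b ⟶ a} {U : y ⟶ x}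
    (φ : q ≫ c.map r ≅ U ≫ p) {i : y ⟶ y} (hi : q ≫ c.map (𝟙 b) = i ≫ q) {W : y ⟶ x} (h : W = i ≫ U)
    (hi' : i = 𝟙 y) (e : U = W) :
    q ◁ c.map₂ (eqToHom (Strict.id_comp r).symm) ≫ (paste φ (eqToIso hi) h).hom =
      φ.hom ≫ eqToHom e ▷ p := by
  subst hi' e
  simp [paste, PrelaxFunctor.map₂_eqToHom, Strict.leftUnitor_eqToIso]

theorem paste_symm_eqToIso {x y : P} {a b e : C} {p : x ⟶ c.obj a} {q : y ⟶ c.obj b} {r : b ⟶ a}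
    {U : y ⟶ x} (φ : q ≫ c.map r ≅ U ≫ p) {t : y ⟶ c.obj e} {s : e ⟶ b} (π : q ≅ t ≫ c.map s) {i : y ⟶ y}
    (hi : q = i ≫ q) {W : y ⟶ x} (h : W = i ≫ U) (hi' : i = 𝟙 y) (e : U = W) :
    (π.hom ▷ c.map r ≫ eqToHom (paste_eq₁ t s r).symm) ≫ (paste φ (π.symm ≪≫ eqToIso hi) h).hom =
      φ.hom ≫ eqToHom e ▷ p := by
  subst hi' e
  simp [paste, Strict.leftUnitor_eqToIso, ← comp_whiskerRight_assoc]

end Paste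

end TwoPro

namespace TwoPro

open CategoryTheory Bicategory Opposite

set_option linter.unusedSectionVars false
set_option linter.unusedVariables false

/-! ### The index 2-category of a diagram of presented objects. -/

section Idx

variable {C : Type u} [Bicategory.{w, w} C] [Bicategory.Strict C]
  {P : Type u₂} [Bicategory.{w₂, v₂} P] [Bicategory.Strict P]
  {c : StrictPseudofunctor C P}

namespace Presentation

/-- The 1-cells of the index 2-category contain isomorphisms of P, whose hom-categories may lie in a
larger universe. The inverse of `ev d` embeds these isomorphisms in hom-sets of the pseudocolimit,
which are small. -/
theorem small_iso {Z : P} (p : Presentation c Z) {d : C} (k l : Z ⟶ c.obj d) : Small.{w} (k ≅ l) := by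
  have : Function.Injective (fun e : k ≅ l => (p.cone.ev d).strictInv.map e.hom) := by
    intro e e' h
    apply Iso.ext
    have h' := Functor.congr_hom (strictInv_comp (p.cone.ev d)) e.hom
    have h'' := Functor.congr_hom (strictInv_comp (p.cone.ev d)) e'.hom
    simp only [Functor.comp_map, h] at h' h''
    rw [h''] at h'
    exact (cancel_mono _).1 ((cancel_epi _).1 h'.symm)
  exact small_of_injective this

/-- A model, in the universe of the index 2-category, of the type of isomorphisms between 1-cells with
target in the image of `c`. -/
def IsoS {Z : P} (p : Presentation c Z) {d : C} (k l : Z ⟶ c.obj d) : Type w :=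
  @Shrink.{w} (k ≅ l) (p.small_iso k l)

/-- The comparison of `IsoS` with the type of isomorphisms. -/
noncomputable def isoSEquiv {Z : P} (p : Presentation c Z) {d : C} (k l : Z ⟶ c.obj d) :
    (k ≅ l) ≃ p.IsoS k l :=
  @equivShrink.{w} (k ≅ l) (p.small_iso k l)

end Presentation

variable {I : Type w} [Bicategory.{w, w} I] [Bicategory.Strict I]

/-- The objects of the 2-category that indexes a diagram in `C` with the same pseudolimit as a diagram `X`
in `P`: pairs of an index of `X` and an index of the presentation of `X_i`. -/
structure Idx (pres : ∀ X : P, Presentation c X) (X : StrictPseudofunctor Iᵒᵖ P) : Type w where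
  base : I
  fib : (pres (X.obj (op base))).I

namespace Idx

variable {pres : ∀ X : P, Presentation c X} {X : StrictPseudofunctor Iᵒᵖ P}

/-- The object of `C` at an index. -/
def val (a : Idx pres X) : C := (pres (X.obj (op a.base))).diagram.obj (op a.fib)

/-- The projection to the object at an index. -/
def proj (a : Idx pres X) : X.obj (op a.base) ⟶ c.obj a.val := (pres (X.obj (op a.base))).cone.leg a.fib

/-- The 1-cells between indices: a 1-cell of `I` and a 1-cell of `C`, with an isomorphism that makes the
square formed by the projections commute. -/
structure Hom (a b : Idx pres X) : Type w where
  base : a.base ⟶ b.base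
  val : b.val ⟶ a.val
  isoS : (pres (X.obj (op b.base))).IsoS (b.proj ≫ c.map val) (X.map base.op ≫ a.proj)

namespace Hom

variable {a b : Idx pres X}

/-- The isomorphism of a 1-cell between indices. -/
noncomputable def iso (f : Hom a b) : b.proj ≫ c.map f.val ≅ X.map f.base.op ≫ a.proj :=
  (Presentation.isoSEquiv _ _ _).symm f.isoS

/-- Constructor of 1-cells between indices. -/
noncomputable def of (base : a.base ⟶ b.base) (val : b.val ⟶ a.val)
    (iso : b.proj ≫ c.map val ≅ X.map base.op ≫ a.proj) : Hom a b :=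
  ⟨base, val, Presentation.isoSEquiv _ _ _ iso⟩

@[simp] theorem of_iso (u : a.base ⟶ b.base) (v : b.val ⟶ a.val)
    (φ : b.proj ≫ c.map v ≅ X.map u.op ≫ a.proj) : (of u v φ).iso = φ :=
  Equiv.symm_apply_apply _ _

/-- Compatibility of a pair of 2-cells with the isomorphisms of two 1-cells. -/
def Compat (f g : Hom a b) (β : f.base ⟶ g.base) (η : f.val ⟶ g.val) : Prop :=
  b.proj ◁ c.map₂ η ≫ g.iso.hom =
    f.iso.hom ≫ X.map₂ (_root_.Bicategory.Opposite.op2 β) ▷ a.proj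

theorem ext_of_compat {f g : Hom a b} (h : f.base = g.base) (h' : f.val = g.val)
    (H : Compat f g (eqToHom h) (eqToHom h')) : f = g := by
  obtain ⟨u, v, φ⟩ := f
  obtain ⟨u', v', φ'⟩ := g
  dsimp only at h h'
  subst h h'
  obtain ⟨φ, rfl⟩ := (Presentation.isoSEquiv _ _ _).surjective φ
  obtain ⟨φ', rfl⟩ := (Presentation.isoSEquiv _ _ _).surjective φ'
  have H' : b.proj ◁ c.map₂ (𝟙 v) ≫ φ'.hom =
      φ.hom ≫ X.map₂ (_root_.Bicategory.Opposite.op2 (𝟙 u)) ▷ a.proj := by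
    have := H
    unfold Compat at this
    rw [show iso ⟨u, v, _⟩ = φ from of_iso u v φ, show iso ⟨u, v, _⟩ = φ' from of_iso u v φ'] at this
    exact this
  have : φ = φ' := by
    ext
    simpa using H'.symm
  rw [this]

end Hom

/-- The 2-cells between 1-cells of indices. -/
@[ext]
structure Hom₂ {a b : Idx pres X} (f g : Hom a b) : Type w where
  base : f.base ⟶ g.base
  val : f.val ⟶ g.val
  compat : Hom.Compat f g base val

theorem op_comp_eq {i j k : I} (X : StrictPseudofunctor Iᵒᵖ P) (u : i ⟶ j) (v : j ⟶ k) :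
    X.map (u ≫ v).op = X.map v.op ≫ X.map u.op := X.map_comp v.op u.op

theorem op_id_eq (X : StrictPseudofunctor Iᵒᵖ P) (i : I) :
    X.map (𝟙 i : i ⟶ i).op = 𝟙 (X.obj (op i)) := X.map_id (op i)

theorem id_iso_eq (a : Idx pres X) :
    a.proj ≫ c.map (𝟙 a.val) = X.map (𝟙 a.base : a.base ⟶ a.base).op ≫ a.proj := by
  rw [c.map_id, op_id_eq, Strict.comp_id, Strict.id_comp]

noncomputable instance : CategoryStruct (Idx pres X) where
  Hom a b := Hom a b
  id a := Hom.of (𝟙 a.base) (𝟙 a.val) (eqToIso (id_iso_eq a))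
  comp f g := Hom.of (f.base ≫ g.base) (g.val ≫ f.val)
    (paste f.iso g.iso (op_comp_eq X f.base g.base))

variable {a b d e : Idx pres X}

/-- The underlying 1-cell of `I`. -/
def base₁ (f : a ⟶ b) : a.base ⟶ b.base := Hom.base f

/-- The underlying 1-cell of `C`. -/
def val₁ (f : a ⟶ b) : b.val ⟶ a.val := Hom.val f

/-- The isomorphism of a 1-cell. -/
noncomputable def iso₁ (f : a ⟶ b) : b.proj ≫ c.map (val₁ f) ≅ X.map (base₁ f).op ≫ a.proj := Hom.iso f

/-- Constructor of 1-cells. -/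
noncomputable def hom₁ (base : a.base ⟶ b.base) (val : b.val ⟶ a.val)
    (iso : b.proj ≫ c.map val ≅ X.map base.op ≫ a.proj) : a ⟶ b := Hom.of base val iso

@[simp] theorem hom₁_iso (u : a.base ⟶ b.base) (v : b.val ⟶ a.val)
    (φ : b.proj ≫ c.map v ≅ X.map u.op ≫ a.proj) : iso₁ (hom₁ u v φ) = φ := Hom.of_iso u v φ

@[simp] theorem id_base (a : Idx pres X) : base₁ (𝟙 a) = 𝟙 a.base := rfl
@[simp] theorem id_val (a : Idx pres X) : val₁ (𝟙 a) = 𝟙 a.val := rfl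
@[simp] theorem id_iso (a : Idx pres X) : iso₁ (𝟙 a) = eqToIso (id_iso_eq a) := Hom.of_iso _ _ _
@[simp] theorem comp_base (f : a ⟶ b) (g : b ⟶ d) : base₁ (f ≫ g) = base₁ f ≫ base₁ g := rfl
theorem comp_iso (f : a ⟶ b) (g : b ⟶ d) :
    iso₁ (f ≫ g) = paste (iso₁ f) (iso₁ g) (op_comp_eq X (base₁ f) (base₁ g)) := Hom.of_iso _ _ _

/-- Compatibility of a pair of 2-cells with the isomorphisms of two 1-cells. -/
def Compat (f g : a ⟶ b) (β : base₁ f ⟶ base₁ g) (η : val₁ f ⟶ val₁ g) : Prop :=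
  b.proj ◁ c.map₂ η ≫ (iso₁ g).hom =
    (iso₁ f).hom ≫ X.map₂ (_root_.Bicategory.Opposite.op2 β) ▷ a.proj

theorem hom₁_ext {f g : a ⟶ b} (h : base₁ f = base₁ g) (h' : val₁ f = val₁ g)
    (H : Compat f g (eqToHom h) (eqToHom h')) : f = g :=
  Hom.ext_of_compat h h' H

theorem Compat.comp {f g h : a ⟶ b} {β : base₁ f ⟶ base₁ g} {η : val₁ f ⟶ val₁ g}
    {β' : base₁ g ⟶ base₁ h} {η' : val₁ g ⟶ val₁ h} (H : Compat f g β η) (H' : Compat g h β' η') :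
    Compat f h (β ≫ β') (η ≫ η') := by
  unfold Compat at H H' ⊢
  simp [H', reassoc_of% H]

theorem Compat.inv {f g : a ⟶ b} {β : base₁ f ≅ base₁ g} {η : val₁ f ≅ val₁ g}
    (H : Compat f g β.hom η.hom) : Compat g f β.inv η.inv := by
  unfold Compat at H ⊢
  have e₁ : b.proj ◁ c.map₂ η.hom ≫ b.proj ◁ c.map₂ η.inv = 𝟙 _ := by
    rw [← whiskerLeft_comp, ← c.map₂_comp]
    simp
  have e₁' : b.proj ◁ c.map₂ η.inv ≫ b.proj ◁ c.map₂ η.hom = 𝟙 _ := by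
    rw [← whiskerLeft_comp, ← c.map₂_comp]
    simp
  have e₂ : X.map₂ (_root_.Bicategory.Opposite.op2 β.hom) ▷ a.proj ≫
      X.map₂ (_root_.Bicategory.Opposite.op2 β.inv) ▷ a.proj = 𝟙 _ := by
    rw [← comp_whiskerRight, ← X.map₂_comp, ← _root_.Bicategory.Opposite.op2_comp]
    simp
  calc _ = b.proj ◁ c.map₂ η.inv ≫ ((iso₁ f).hom ≫ X.map₂ (_root_.Bicategory.Opposite.op2 β.hom) ▷ a.proj) ≫
      X.map₂ (_root_.Bicategory.Opposite.op2 β.inv) ▷ a.proj := by rw [Category.assoc, e₂, Category.comp_id]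
    _ = _ := by rw [← H, Category.assoc, reassoc_of% e₁']

theorem Compat.id (f : a ⟶ b) : Compat f f (𝟙 _) (𝟙 _) := by
  simp [Compat]

instance : Category (a ⟶ b) where
  Hom f g := Hom₂ f g
  id f := ⟨𝟙 (base₁ f), 𝟙 (val₁ f), Compat.id f⟩
  comp α β := ⟨α.base ≫ β.base, α.val ≫ β.val, Compat.comp α.compat β.compat⟩
  id_comp _ := Hom₂.ext (Category.id_comp _) (Category.id_comp _)
  comp_id _ := Hom₂.ext (Category.comp_id _) (Category.comp_id _)
  assoc _ _ _ := Hom₂.ext (Category.assoc _ _ _) (Category.assoc _ _ _)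

/-- The underlying 2-cell of `I`. -/
def base₂ {f g : a ⟶ b} (α : f ⟶ g) : base₁ f ⟶ base₁ g := Hom₂.base α

/-- The underlying 2-cell of `C`. -/
def val₂ {f g : a ⟶ b} (α : f ⟶ g) : val₁ f ⟶ val₁ g := Hom₂.val α

theorem compat {f g : a ⟶ b} (α : f ⟶ g) : Compat f g (base₂ α) (val₂ α) := Hom₂.compat α

/-- Constructor of 2-cells. -/
def hom₂ {f g : a ⟶ b} (β : base₁ f ⟶ base₁ g) (η : val₁ f ⟶ val₁ g) (H : Compat f g β η) : f ⟶ g :=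
  show Hom₂ f g from ⟨β, η, H⟩

theorem hom₂_ext {f g : a ⟶ b} {α β : f ⟶ g} (h : base₂ α = base₂ β) (h' : val₂ α = val₂ β) : α = β :=
  Hom₂.ext h h'

/-- Constructor of invertible 2-cells. -/
def iso₂ {f g : a ⟶ b} (β : base₁ f ≅ base₁ g) (η : val₁ f ≅ val₁ g) (H : Compat f g β.hom η.hom) :
    f ≅ g where
  hom := hom₂ β.hom η.hom H
  inv := hom₂ β.inv η.inv (Compat.inv H)
  hom_inv_id := hom₂_ext β.hom_inv_id η.hom_inv_id
  inv_hom_id := hom₂_ext β.inv_hom_id η.inv_hom_id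

theorem Compat.whiskerLeft (f : a ⟶ b) {g h : b ⟶ d} {β : base₁ g ⟶ base₁ h} {η : val₁ g ⟶ val₁ h}
    (H : Compat g h β η) : Compat (f ≫ g) (f ≫ h) (base₁ f ◁ β) (η ▷ val₁ f) := by
  unfold Compat at H ⊢
  rw [comp_iso, comp_iso]
  refine (paste_whiskerRight (iso₁ f) η _ _ _ H).trans (congrArg (_ ≫ · ▷ a.proj) ?_)
  have := X.map₂_whisker_right (_root_.Bicategory.Opposite.op2 β) (base₁ f).op
  simp only [X.mapComp_eq_eqToIso] at this
  exact this.symm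

theorem Compat.whiskerRight {f g : a ⟶ b} (h : b ⟶ d) {β : base₁ f ⟶ base₁ g} {η : val₁ f ⟶ val₁ g}
    (H : Compat f g β η) : Compat (f ≫ h) (g ≫ h) (β ▷ base₁ h) (val₁ h ◁ η) := by
  unfold Compat at H ⊢
  rw [comp_iso, comp_iso]
  refine (paste_whiskerLeft η _ (iso₁ h) _ _ H).trans (congrArg (_ ≫ · ▷ a.proj) ?_)
  simp [X.mapComp_eq_eqToIso]

theorem map₂_op2_eqToHom {i j : I} (X : StrictPseudofunctor Iᵒᵖ P) {u v : i ⟶ j} (h : u = v) :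
    X.map₂ (_root_.Bicategory.Opposite.op2 (eqToHom h)) = eqToHom (congrArg (fun r => X.map r.op) h) := by
  subst h
  exact X.map₂_id _

theorem compat_assoc (f : a ⟶ b) (g : b ⟶ d) (h : d ⟶ e) :
    Compat ((f ≫ g) ≫ h) (f ≫ g ≫ h) (α_ (base₁ f) (base₁ g) (base₁ h)).hom
      (α_ (val₁ h) (val₁ g) (val₁ f)).inv := by
  unfold Compat
  rw [comp_iso, comp_iso]
  simp only [comp_iso]
  have := paste_assoc (iso₁ f) (iso₁ g) (iso₁ h) (op_comp_eq X (base₁ f) (base₁ g))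
    (op_comp_eq X (base₁ f ≫ base₁ g) (base₁ h)) (op_comp_eq X (base₁ g) (base₁ h))
    (op_comp_eq X (base₁ f) (base₁ g ≫ base₁ h))
    (congrArg (fun r => X.map r.op) (Strict.assoc (base₁ f) (base₁ g) (base₁ h)))
  rw [Strict.associator_eqToIso, Strict.associator_eqToIso, eqToIso.inv, eqToIso.hom]
  refine this.trans (congrArg (_ ≫ · ▷ a.proj) ?_)
  exact (map₂_op2_eqToHom X _).symm

theorem compat_leftUnitor (f : a ⟶ b) :
    Compat f (𝟙 a ≫ f) (λ_ (base₁ f)).inv (ρ_ (val₁ f)).inv := by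
  unfold Compat
  rw [comp_iso, id_iso, Strict.rightUnitor_eqToIso, Strict.leftUnitor_eqToIso, eqToIso.inv, eqToIso.inv]
  refine (paste_id_left (iso₁ f) (id_iso_eq a) _ (op_id_eq X _)
    (congrArg (fun r => X.map r.op) (Strict.id_comp (base₁ f)).symm)).trans
    (congrArg (_ ≫ · ▷ a.proj) (map₂_op2_eqToHom X _).symm)

theorem compat_rightUnitor (f : a ⟶ b) :
    Compat f (f ≫ 𝟙 b) (ρ_ (base₁ f)).inv (λ_ (val₁ f)).inv := by
  unfold Compat
  rw [comp_iso, id_iso, Strict.rightUnitor_eqToIso, Strict.leftUnitor_eqToIso, eqToIso.inv, eqToIso.inv]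
  refine (paste_id_right (iso₁ f) (id_iso_eq b) _ (op_id_eq X _)
    (congrArg (fun r => X.map r.op) (Strict.comp_id (base₁ f)).symm)).trans
    (congrArg (_ ≫ · ▷ a.proj) (map₂_op2_eqToHom X _).symm)

/-- Left whiskering. -/
noncomputable def whiskerL (f : a ⟶ b) {g h : b ⟶ d} (α : g ⟶ h) : f ≫ g ⟶ f ≫ h :=
  hom₂ (base₁ f ◁ base₂ α) (val₂ α ▷ val₁ f) (Compat.whiskerLeft f (compat α))

/-- Right whiskering. -/
noncomputable def whiskerR {f g : a ⟶ b} (α : f ⟶ g) (h : b ⟶ d) : f ≫ h ⟶ g ≫ h :=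
  hom₂ (base₂ α ▷ base₁ h) (val₁ h ◁ val₂ α) (Compat.whiskerRight h (compat α))

noncomputable instance : Bicategory (Idx pres X) where
  whiskerLeft f _ _ α := whiskerL f α
  whiskerRight α h := whiskerR α h
  associator f g h := iso₂ (f := (f ≫ g) ≫ h) (g := f ≫ g ≫ h) (α_ _ _ _) (α_ _ _ _).symm (compat_assoc f g h)
  leftUnitor f := (iso₂ (f := f) (g := 𝟙 _ ≫ f) (λ_ _).symm (ρ_ _).symm (compat_leftUnitor f)).symm
  rightUnitor f := (iso₂ (f := f) (g := f ≫ 𝟙 _) (ρ_ _).symm (λ_ _).symm (compat_rightUnitor f)).symm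
  whiskerLeft_id f g := by
    refine hom₂_ext ?_ ?_
    · exact whiskerLeft_id (base₁ f) (base₁ g)
    · exact id_whiskerRight (val₁ g) (val₁ f)
  whiskerLeft_comp f _ _ _ α β :=
    by
    refine hom₂_ext ?_ ?_
    · exact whiskerLeft_comp (base₁ f) (base₂ α) (base₂ β)
    · exact comp_whiskerRight (val₂ α) (val₂ β) (val₁ f)
  id_whiskerLeft α := by
    refine hom₂_ext ?_ ?_
    · exact id_whiskerLeft (base₂ α)
    · exact whiskerRight_id (val₂ α)
  comp_whiskerLeft f g _ _ α :=
    by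
    refine hom₂_ext ?_ ?_
    · exact comp_whiskerLeft (base₁ f) (base₁ g) (base₂ α)
    · exact whiskerRight_comp (val₂ α) (val₁ g) (val₁ f)
  id_whiskerRight f g := by
    refine hom₂_ext ?_ ?_
    · exact id_whiskerRight (base₁ f) (base₁ g)
    · exact whiskerLeft_id (val₁ g) (val₁ f)
  comp_whiskerRight α β g :=
    by
    refine hom₂_ext ?_ ?_
    · exact comp_whiskerRight (base₂ α) (base₂ β) (base₁ g)
    · exact whiskerLeft_comp (val₁ g) (val₂ α) (val₂ β)
  whiskerRight_id α := by
    refine hom₂_ext ?_ ?_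
    · exact whiskerRight_id (base₂ α)
    · exact id_whiskerLeft (val₂ α)
  whiskerRight_comp α g h :=
    by
    refine hom₂_ext ?_ ?_
    · exact whiskerRight_comp (base₂ α) (base₁ g) (base₁ h)
    · exact comp_whiskerLeft (val₁ h) (val₁ g) (val₂ α)
  whisker_assoc f _ _ α h :=
    by
    refine hom₂_ext ?_ ?_
    · exact whisker_assoc (base₁ f) (base₂ α) (base₁ h)
    · exact whisker_assoc_symm (val₁ h) (val₂ α) (val₁ f)
  whisker_exchange α β :=
    by
    refine hom₂_ext ?_ ?_
    · exact whisker_exchange (base₂ α) (base₂ β)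
    · exact (whisker_exchange (val₂ β) (val₂ α)).symm
  pentagon f g h i := by
    refine hom₂_ext ?_ ?_
    · exact pentagon (base₁ f) (base₁ g) (base₁ h) (base₁ i)
    · exact pentagon_inv (val₁ i) (val₁ h) (val₁ g) (val₁ f)
  triangle f g := by
    refine hom₂_ext ?_ ?_
    · exact triangle (base₁ f) (base₁ g)
    · exact triangle_assoc_comp_right (val₁ g) (val₁ f)

@[simp] theorem whiskerRight_base₂ {f g : a ⟶ b} (α : f ⟶ g) (h : b ⟶ d) :
    base₂ (α ▷ h : f ≫ h ⟶ g ≫ h) = base₂ α ▷ base₁ h := rfl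

/-- A 1-cell also carries an isomorphism, so equal components are not enough for strictness.
Compatibility of a 2-cell with identity components is precisely the equality of the isomorphisms
carried. -/
theorem eq_of_iso₂ {f g : a ⟶ b} (α : f ≅ g) (h : base₁ f = base₁ g) (h' : val₁ f = val₁ g)
    (e : base₂ α.hom = eqToHom h) (e' : val₂ α.hom = eqToHom h') : ∃ h : f = g, α = eqToIso h := by
  have : f = g := by
    refine hom₁_ext h h' ?_
    rw [← e, ← e']
    exact compat α.hom
  subst this
  refine ⟨rfl, Iso.ext (hom₂_ext ?_ ?_)⟩
  · exact e
  · exact e'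

instance : Bicategory.Strict (Idx pres X) where
  id_comp f := (eq_of_iso₂ (λ_ f) (Strict.id_comp _) (Strict.comp_id _)
    (congrArg Iso.hom (Strict.leftUnitor_eqToIso (base₁ f)))
    (congrArg Iso.hom (Strict.rightUnitor_eqToIso (val₁ f)))).choose
  comp_id f := (eq_of_iso₂ (ρ_ f) (Strict.comp_id _) (Strict.id_comp _)
    (congrArg Iso.hom (Strict.rightUnitor_eqToIso (base₁ f)))
    (congrArg Iso.hom (Strict.leftUnitor_eqToIso (val₁ f)))).choose
  assoc f g h := (eq_of_iso₂ (α_ f g h) (Strict.assoc _ _ _) (Strict.assoc _ _ _).symm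
    (congrArg Iso.hom (Strict.associator_eqToIso (base₁ f) (base₁ g) (base₁ h)))
    (congrArg Iso.inv (Strict.associator_eqToIso (val₁ h) (val₁ g) (val₁ f)))).choose
  leftUnitor_eqToIso f := (eq_of_iso₂ (λ_ f) (Strict.id_comp _) (Strict.comp_id _)
    (congrArg Iso.hom (Strict.leftUnitor_eqToIso (base₁ f)))
    (congrArg Iso.hom (Strict.rightUnitor_eqToIso (val₁ f)))).choose_spec
  rightUnitor_eqToIso f := (eq_of_iso₂ (ρ_ f) (Strict.comp_id _) (Strict.id_comp _)
    (congrArg Iso.hom (Strict.rightUnitor_eqToIso (base₁ f)))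
    (congrArg Iso.hom (Strict.leftUnitor_eqToIso (val₁ f)))).choose_spec
  associator_eqToIso f g h := (eq_of_iso₂ (α_ f g h) (Strict.assoc _ _ _) (Strict.assoc _ _ _).symm
    (congrArg Iso.hom (Strict.associator_eqToIso (base₁ f) (base₁ g) (base₁ h)))
    (congrArg Iso.inv (Strict.associator_eqToIso (val₁ h) (val₁ g) (val₁ f)))).choose_spec

/-- The diagram in `C` indexed by `Idx`. -/
noncomputable def diagram (pres : ∀ X : P, Presentation c X) (X : StrictPseudofunctor Iᵒᵖ P) :
    StrictPseudofunctor (Idx pres X)ᵒᵖ C :=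
  StrictPseudofunctor.mk''
    { obj a := a.unop.val
      map {a b} f := val₁ (a := b.unop) (b := a.unop) f.unop
      map₂ {a b f g} α := val₂ (a := b.unop) (b := a.unop) (f := f.unop) (g := g.unop) α.unop2
      map₂_id _ := rfl
      map₂_comp _ _ := rfl
      map_id _ := rfl
      map_comp _ _ := rfl
      map₂_whisker_left _ _ _ _ := ((Category.id_comp _).trans (Category.comp_id _)).symm
      map₂_whisker_right _ _ := ((Category.id_comp _).trans (Category.comp_id _)).symm }

end Idx

end Idx

end TwoPro

namespace TwoPro

open CategoryTheory Bicategory Opposite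

set_option linter.unusedSectionVars false
set_option linter.unusedVariables false

/-! ### The index 2-category is 2-filtered. -/

section Filtered

variable {C : Type u} [Bicategory.{w, w} C] [Bicategory.Strict C]

/-- Every arrow of the pseudocolimit between objects at the same index comes from some stage, by means of
a single 1-cell. -/
theorem PseudoColim.exists_comp_push_eq {I : Type w} [Bicategory.{w, w} I] [Bicategory.Strict I]
    [IsTwoFiltered I] {X : StrictPseudofunctor Iᵒᵖ C} {d : C} {i : I} {r s : X.obj (op i) ⟶ d}
    (f : (⟨i, r⟩ : PseudoColim X d) ⟶ ⟨i, s⟩) :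
    ∃ (k : I) (u : i ⟶ k) (θ : X.map u.op ≫ r ⟶ X.map u.op ≫ s),
      f ≫ (push u s).hom = (push u r).hom ≫ cell θ := by
  obtain ⟨k, u, v, θ, hf⟩ := exists_push_cell_pull f
  dsimp only at u v θ hf
  -- The two legs are parallel here, hence isomorphic at a later stage, and a single 1-cell can
  -- serve for both.
  obtain ⟨l, h, ⟨γ⟩⟩ := IsTwoFiltered.cocone_maps u v
  have e₁ := push_transport_inv h (Iso.refl (u ≫ h)) r
  have e₂ := push_transport_hom h γ.symm s
  refine ⟨l, u ≫ h, (transport X h (Iso.refl _) r).inv ≫ X.map h.op ◁ θ ≫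
    (transport X h γ.symm s).hom, ?_⟩
  rw [hf, ← cell_comp, ← cell_comp, reassoc_of% e₁, ← push_naturality_assoc, e₂]
  simp

variable {P : Type u₂} [Bicategory.{w₂, v₂} P] [Bicategory.Strict P]
  {c : StrictPseudofunctor C P}

namespace Presentation

variable {Z : P} (p : Presentation c Z)

/-- Fullness of `ev d` brings a 2-cell of P into the pseudocolimit, where it comes from a later
stage. -/
theorem exists_push_eq {d : C} {k : p.I} {r s : p.diagram.obj (op k) ⟶ d}
    (m : p.cone.leg k ≫ c.map r ⟶ p.cone.leg k ≫ c.map s) :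
    ∃ (l : p.I) (w : k ⟶ l) (θ : p.diagram.map w.op ≫ r ⟶ p.diagram.map w.op ≫ s),
      m ≫ (p.cone.legIso w).hom ▷ c.map s ≫ eqToHom (PseudoCone.ev_eq (p.cone.leg l) w s) =
        ((p.cone.legIso w).hom ▷ c.map r ≫ eqToHom (PseudoCone.ev_eq (p.cone.leg l) w r)) ≫
          p.cone.leg l ◁ c.map₂ θ := by
  obtain ⟨f, hf⟩ : ∃ f : (⟨k, r⟩ : PseudoColim p.diagram d) ⟶ ⟨k, s⟩, (p.cone.ev d).map f = m :=
    Functor.Full.map_surjective (F := p.cone.ev d) (X := ⟨k, r⟩) (Y := ⟨k, s⟩) m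
  obtain ⟨l, w, θ, e⟩ := PseudoColim.exists_comp_push_eq f
  refine ⟨l, w, θ, ?_⟩
  have := congrArg (p.cone.ev d).map e
  rw [Functor.map_comp, Functor.map_comp, hf] at this
  exact this

/-- Faithfulness of `ev d`, followed by detection of equality at a stage. -/
theorem exists_whiskerLeft_eq {d : C} {k : p.I} {r s : p.diagram.obj (op k) ⟶ d} {θ θ' : r ⟶ s}
    (h : p.cone.leg k ◁ c.map₂ θ = p.cone.leg k ◁ c.map₂ θ') :
    ∃ (l : p.I) (w : k ⟶ l), p.diagram.map w.op ◁ θ = p.diagram.map w.op ◁ θ' :=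
  PseudoColim.exists_whiskerLeft_eq ((p.cone.ev d).map_injective h)

end Presentation

/-- In the presence of (F2), condition (F1) needs only a 2-cell in each direction: two applications
of (F2), to the two composites and the identities, make them mutually inverse after whiskering. -/
theorem exists_iso_comp_of_hom {K : Type u₁} [Bicategory.{w₁, v₁} K]
    (H : ∀ {i j : K} {f g : i ⟶ j} (α β : f ⟶ g), ∃ (k : K) (h : j ⟶ k), α ▷ h = β ▷ h)
    {i j : K} {f g : i ⟶ j} (γ : f ⟶ g) (γ' : g ⟶ f) :
    ∃ (k : K) (h : j ⟶ k), Nonempty (f ≫ h ≅ g ≫ h) := by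
  obtain ⟨k, h, e⟩ := H (γ ≫ γ') (𝟙 f)
  obtain ⟨l, h', e'⟩ := H ((γ' ≫ γ) ▷ h) (𝟙 (g ≫ h))
  refine ⟨l, h ≫ h', ⟨⟨γ ▷ (h ≫ h'), γ' ▷ (h ≫ h'), ?_, ?_⟩⟩⟩
  · rw [← comp_whiskerRight, whiskerRight_comp, e]
    simp
  · rw [← comp_whiskerRight, whiskerRight_comp, e']
    simp

namespace Idx

variable {I : Type w} [Bicategory.{w, w} I] [Bicategory.Strict I]
  {pres : ∀ X : P, Presentation c X} {X : StrictPseudofunctor Iᵒᵖ P} {a b d e : Idx pres X}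

/-- The index over the same object of `I` given by another index of the presentation. -/
abbrev move (a : Idx pres X) (l : (pres (X.obj (op a.base))).I) : Idx pres X := ⟨a.base, l⟩

theorem eq_map_id_comp (X : StrictPseudofunctor Iᵒᵖ P) {i : I} {z : P} (f : X.obj (op i) ⟶ z) :
    f = X.map (𝟙 i : i ⟶ i).op ≫ f := by
  rw [op_id_eq, Strict.id_comp]

/-- The 1-cell of `C` given by a 1-cell between indices of the presentation. -/
def valMap (b : Idx pres X) {l : (pres (X.obj (op b.base))).I} (w : b.fib ⟶ l) : (b.move l).val ⟶ b.val :=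
  (pres (X.obj (op b.base))).diagram.map w.op

/-- The structure isomorphism of the presentation. -/
def projIso (b : Idx pres X) {l : (pres (X.obj (op b.base))).I} (w : b.fib ⟶ l) :
    b.proj ≅ (b.move l).proj ≫ c.map (b.valMap w) :=
  (pres (X.obj (op b.base))).cone.legIso w

/-- The 1-cell of indices given by a 1-cell between indices of the presentation. -/
noncomputable def incl (b : Idx pres X) {l : (pres (X.obj (op b.base))).I} (w : b.fib ⟶ l) :
    b ⟶ b.move l :=
  hom₁ (b := b.move l) (𝟙 b.base) (b.valMap w)
    ((b.projIso w).symm ≪≫ eqToIso (eq_map_id_comp X b.proj))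

@[simp] theorem incl_base (b : Idx pres X) {l : (pres (X.obj (op b.base))).I} (w : b.fib ⟶ l) :
    base₁ (b.incl w) = 𝟙 b.base := rfl

theorem incl_iso (b : Idx pres X) {l : (pres (X.obj (op b.base))).I} (w : b.fib ⟶ l) :
    iso₁ (b.incl w) = (b.projIso w).symm ≪≫ eqToIso (eq_map_id_comp X b.proj) := hom₁_iso _ _ _

theorem exists_push_eq (b : Idx pres X) {d : C} {r s : b.val ⟶ d}
    (m : b.proj ≫ c.map r ⟶ b.proj ≫ c.map s) :
    ∃ (l : (pres (X.obj (op b.base))).I) (w : b.fib ⟶ l) (θ : b.valMap w ≫ r ⟶ b.valMap w ≫ s),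
      m ≫ (b.projIso w).hom ▷ c.map s ≫ eqToHom (paste_eq₁ (b.move l).proj (b.valMap w) s).symm =
        ((b.projIso w).hom ▷ c.map r ≫ eqToHom (paste_eq₁ (b.move l).proj (b.valMap w) r).symm) ≫
          (b.move l).proj ◁ c.map₂ θ :=
  (pres (X.obj (op b.base))).exists_push_eq m

theorem exists_valMap_whiskerLeft_eq (b : Idx pres X) {d : C} {r s : b.val ⟶ d} {θ θ' : r ⟶ s}
    (h : b.proj ◁ c.map₂ θ = b.proj ◁ c.map₂ θ') :
    ∃ (l : (pres (X.obj (op b.base))).I) (w : b.fib ⟶ l), b.valMap w ◁ θ = b.valMap w ◁ θ' :=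
  (pres (X.obj (op b.base))).exists_whiskerLeft_eq h

/-- `ev` is surjective on objects, so the composite of X_u with a projection is equal, not merely
isomorphic, to a projection of X_i followed by a 1-cell of C; hence the witness `eqToIso h`. -/
theorem exists_lift (a : Idx pres X) {i : I} (u : a.base ⟶ i) :
    ∃ (k : (pres (X.obj (op i))).I) (f : a ⟶ ⟨i, k⟩), base₁ f = u := by
  obtain ⟨⟨k, r⟩, h⟩ := ((pres (X.obj (op i))).cone.ev a.val).bijective_obj.2 (X.map u.op ≫ a.proj)
  exact ⟨k, hom₁ (b := ⟨i, k⟩) u r (eqToIso h), rfl⟩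

theorem map_base_comp_incl (f : a ⟶ b) {l : (pres (X.obj (op b.base))).I} (w : b.fib ⟶ l) :
    X.map (base₁ f).op = X.map (base₁ (f ≫ b.incl w)).op := by
  rw [comp_base, incl_base, Strict.comp_id]

theorem comp_incl_iso (f : a ⟶ b) {l : (pres (X.obj (op b.base))).I} (w : b.fib ⟶ l) :
    ((b.projIso w).hom ▷ c.map (val₁ f) ≫
        eqToHom (paste_eq₁ (b.move l).proj (b.valMap w) (val₁ f)).symm) ≫ (iso₁ (f ≫ b.incl w)).hom =
      (iso₁ f).hom ≫ eqToHom (map_base_comp_incl f w) ▷ a.proj := by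
  rw [comp_iso, incl_iso]
  exact paste_symm_eqToIso (iso₁ f) (b.projIso w) _ _ (op_id_eq X b.base) _

theorem map₂_op2_conj {i j : I} {u u' v v' : i ⟶ j} (h : u = u') (α : u' ⟶ v') (h' : v' = v) :
    X.map₂ (_root_.Bicategory.Opposite.op2 (eqToHom h ≫ α ≫ eqToHom h')) =
      eqToHom (congrArg (fun r => X.map r.op) h) ≫ X.map₂ (_root_.Bicategory.Opposite.op2 α) ≫
        eqToHom (congrArg (fun r => X.map r.op) h') := by
  subst h h'
  simp

theorem map₂_op2_whiskerRight_id {i j : I} {u v : i ⟶ j} (α : u ⟶ v) {u' v' : i ⟶ j} (h : u ≫ 𝟙 j = u')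
    (h' : v ≫ 𝟙 j = v') : X.map₂ (_root_.Bicategory.Opposite.op2 (eqToHom h.symm ≫ α ▷ 𝟙 j ≫ eqToHom h')) =
      eqToHom (congrArg (fun r => X.map r.op) (h.symm.trans (Strict.comp_id u))) ≫
        X.map₂ (_root_.Bicategory.Opposite.op2 α) ≫
        eqToHom (congrArg (fun r => X.map r.op) ((Strict.comp_id v).symm.trans h')) := by
  subst h h'
  rw [← map₂_op2_conj (Strict.comp_id u) α (Strict.comp_id v).symm]
  congr 2
  simp [Strict.rightUnitor_eqToIso]

theorem comp_eq_of_conj {K : Type*} [Category K] {x x' y y' x₀ y₀ x₁ y₁ : K} {A : x ⟶ x'} [Epi A]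
    {A' : y ⟶ y'} {F : x ⟶ x₀} {B : x₀ ⟶ y₀} {G : y ≅ y₀} {θ : x' ⟶ y'} {φ : x' ⟶ x₁} {φ' : y' ⟶ y₁}
    {E : x₀ ⟶ x₁} {E' : y₀ ⟶ y₁} {Einv : x₁ ⟶ x₀} (h : (F ≫ B ≫ G.inv) ≫ A' = A ≫ θ)
    (h₁ : A ≫ φ = F ≫ E) (h₂ : A' ≫ φ' = G.hom ≫ E') (hE : E ≫ Einv = 𝟙 _) :
    θ ≫ φ' = φ ≫ Einv ≫ B ≫ E' := by
  rw [← cancel_epi A, ← reassoc_of% h, h₂, reassoc_of% h₁, reassoc_of% hE]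
  simp

/-- Conjugating α by the isomorphisms of f and g gives a 2-cell of P between composites of the
projection with 1-cells of C, and such a 2-cell comes from C at a later index over the same object.
The identity whiskered to α is the base of the inclusion. -/
theorem exists_comp_incl (f g : a ⟶ b) (α : base₁ f ⟶ base₁ g) :
    ∃ (l : (pres (X.obj (op b.base))).I) (w : b.fib ⟶ l) (γ : f ≫ b.incl w ⟶ g ≫ b.incl w),
      base₂ γ = α ▷ 𝟙 b.base := by
  obtain ⟨l, w, θ, h⟩ := b.exists_push_eq
    ((iso₁ f).hom ≫ X.map₂ (_root_.Bicategory.Opposite.op2 α) ▷ a.proj ≫ (iso₁ g).inv)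
  refine ⟨l, w, hom₂ (α ▷ 𝟙 b.base) θ ?_, rfl⟩
  have h₁ := comp_incl_iso f w
  have h₂ := comp_incl_iso g w
  have h₃ : X.map₂ (_root_.Bicategory.Opposite.op2 (α ▷ 𝟙 b.base)) =
      eqToHom (map_base_comp_incl f w).symm ≫ X.map₂ (_root_.Bicategory.Opposite.op2 α) ≫
        eqToHom (map_base_comp_incl g w) := by
    refine Eq.trans ?_ (map₂_op2_whiskerRight_id α rfl rfl)
    simp
  refine (comp_eq_of_conj h h₁ h₂ (Einv := eqToHom (map_base_comp_incl f w).symm ▷ a.proj)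
    (by rw [← comp_whiskerRight, eqToHom_trans, eqToHom_refl, id_whiskerRight])).trans ?_
  refine congrArg ((iso₁ (f ≫ b.incl w)).hom ≫ ·) ?_
  rw [← comp_whiskerRight, ← comp_whiskerRight]
  exact congrArg (fun β => β ▷ a.proj) h₃.symm

/-- (F2) in `I` equates the base parts. Compatibility then equates the parts in C after c and the
projection, and these become equal in C at a later index of the same presentation. -/
theorem exists_whiskerRight_eq [IsTwoFiltered I] {f g : a ⟶ b} (α β : f ⟶ g) :
    ∃ (d : Idx pres X) (h : b ⟶ d), α ▷ h = β ▷ h := by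
  obtain ⟨i, u, e⟩ := IsTwoFiltered.cocone_cells (base₂ α) (base₂ β)
  obtain ⟨k, h, rfl⟩ := exists_lift b u
  have e₁ : (⟨i, k⟩ : Idx pres X).proj ◁ c.map₂ (val₂ (α ▷ h)) =
      (⟨i, k⟩ : Idx pres X).proj ◁ c.map₂ (val₂ (β ▷ h)) := by
    have h₁ := compat (α ▷ h)
    have h₂ := compat (β ▷ h)
    unfold Compat at h₁ h₂
    rw [whiskerRight_base₂] at h₁ h₂
    rw [e, ← h₂] at h₁
    exact (cancel_mono _).1 h₁
  obtain ⟨l, w, e₂⟩ := exists_valMap_whiskerLeft_eq _ e₁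
  refine ⟨_, h ≫ incl _ w, ?_⟩
  have : (α ▷ h) ▷ incl _ w = (β ▷ h) ▷ incl _ w :=
    hom₂_ext (congrArg (· ▷ _) e) e₂
  rw [whiskerRight_comp, this, ← whiskerRight_comp]

instance [IsTwoFiltered I] : IsTwoFiltered (Idx pres X) where
  cocone_objs a b := by
    obtain ⟨i, ⟨u⟩, ⟨v⟩⟩ := IsTwoFiltered.cocone_objs a.base b.base
    obtain ⟨k, f, hf⟩ := exists_lift a u
    obtain ⟨k', g, hg⟩ := exists_lift b v
    obtain ⟨l, ⟨x⟩, ⟨y⟩⟩ := IsTwoFiltered.cocone_objs k k'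
    exact ⟨⟨i, l⟩, ⟨f ≫ incl ⟨i, k⟩ x⟩, ⟨g ≫ incl ⟨i, k'⟩ y⟩⟩
  cocone_maps f g := by
    obtain ⟨i, u, ⟨ζ⟩⟩ := IsTwoFiltered.cocone_maps (base₁ f) (base₁ g)
    obtain ⟨k, h, rfl⟩ := exists_lift _ u
    -- A 2-cell is lifted in each direction; `exists_iso_comp_of_hom` makes the two lifts inverse,
    -- so their base parts can be forgotten.
    obtain ⟨l, x, γ, -⟩ := exists_comp_incl (f ≫ h) (g ≫ h) ζ.hom
    obtain ⟨m, y, γ', -⟩ := exists_comp_incl ((g ≫ h) ≫ incl _ x) ((f ≫ h) ≫ incl _ x)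
      (show (base₁ g ≫ base₁ h) ≫ 𝟙 i ⟶ (base₁ f ≫ base₁ h) ≫ 𝟙 i from ζ.inv ▷ 𝟙 i)
    obtain ⟨d, h', ⟨e⟩⟩ := exists_iso_comp_of_hom exists_whiskerRight_eq (γ ▷ incl _ y) γ'
    exact ⟨d, h ≫ incl _ x ≫ incl _ y ≫ h', ⟨eqToIso (by simp only [Strict.assoc]) ≪≫ e ≪≫
      eqToIso (by simp only [Strict.assoc])⟩⟩
  cocone_cells α β := exists_whiskerRight_eq α β

end Idx

end Filtered

end TwoPro

namespace TwoPro

open CategoryTheory Bicategory Opposite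

set_option linter.unusedSectionVars false
set_option linter.unusedVariables false

/-! ### Comparison 2-cells between composites with projections. -/

section Chi

variable {C : Type u} [Bicategory.{w, w} C] [Bicategory.Strict C]
  {P : Type u₂} [Bicategory.{w₂, v₂} P] [Bicategory.Strict P]
  {c : StrictPseudofunctor C P}

section

variable {x y z : P} {a b : C} {A : z ⟶ c.obj a} {B : z ⟶ c.obj b} {p : x ⟶ c.obj a} {q : y ⟶ c.obj b}
  {r : b ⟶ a} {U : y ⟶ x}

/-- The isomorphism of 1-cells to `c a` induced by an isomorphism `A ≅ B ≫ c r`, a square, and a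
factorization of `B`. -/
def chi (l : A ≅ B ≫ c.map r) {v : z ⟶ y} (hv : v ≫ q = B) (φ : q ≫ c.map r ≅ U ≫ p) :
    A ≅ (v ≫ U) ≫ p :=
  l ≪≫ eqToIso (by rw [← hv, Strict.assoc]) ≪≫ whiskerLeftIso v φ ≪≫ eqToIso (Strict.assoc v U p).symm

theorem chi_whisker {r' : b ⟶ a} {U' : y ⟶ x} {l : A ≅ B ≫ c.map r} {l' : A ≅ B ≫ c.map r'} {v : z ⟶ y}
    (hv : v ≫ q = B) {φ : q ≫ c.map r ≅ U ≫ p} {φ' : q ≫ c.map r' ≅ U' ≫ p} (η : r ⟶ r') (β : U ⟶ U')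
    (h : l.hom ≫ B ◁ c.map₂ η = l'.hom) (h' : q ◁ c.map₂ η ≫ φ'.hom = φ.hom ≫ β ▷ p) :
    (chi l hv φ).hom ≫ (v ◁ β) ▷ p = (chi l' hv φ').hom := by
  subst hv
  have e := congrArg (v ◁ ·) h'
  simp only [whiskerLeft_comp] at e
  simp [chi, ← h, Strict.associator_eqToIso]
  rw [reassoc_of% e]

theorem chi_paste {e : C} {w : P} {D : z ⟶ c.obj e} {t : w ⟶ c.obj e} {s : e ⟶ b} {V : w ⟶ y}
    {l : A ≅ B ≫ c.map r} {l' : B ≅ D ≫ c.map s} {l'' : A ≅ D ≫ c.map (s ≫ r)}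
    (hl : l''.hom = l.hom ≫ l'.hom ▷ c.map r ≫ eqToHom (paste_eq₁ D s r).symm)
    {v : z ⟶ y} (hv : v ≫ q = B) {v' : z ⟶ w} (hv' : v' ≫ t = D) (φ : q ≫ c.map r ≅ U ≫ p)
    (ψ : t ≫ c.map s ≅ V ≫ q) {W : w ⟶ x} (h : W = V ≫ U) :
    (chi l'' hv' (paste φ ψ h)).hom = l.hom ≫ (chi l' hv' ψ).hom ▷ c.map r ≫
      eqToHom (Strict.assoc (v' ≫ V) q (c.map r)) ≫ (v' ≫ V) ◁ φ.hom ≫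
        eqToHom (by rw [h]; simp only [Strict.assoc]) := by
  subst hv' h
  simp [chi, paste, hl, Strict.associator_eqToIso]

/-- When the comparison of the second square is the projection of a 2-cell κ, the comparison of the
pasted square is that of the first one followed by a whiskering of κ. This is the source of the
composition axiom of the lifted pseudocone. -/
theorem chi_paste_of_whiskerRight {e : C} {w : P} {D : z ⟶ c.obj e} {t : w ⟶ c.obj e} {s : e ⟶ b}
    {V : w ⟶ y} {l : A ≅ B ≫ c.map r} {l' : B ≅ D ≫ c.map s} {l'' : A ≅ D ≫ c.map (s ≫ r)}
    (hl : l''.hom = l.hom ≫ l'.hom ▷ c.map r ≫ eqToHom (paste_eq₁ D s r).symm)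
    {v : z ⟶ y} (hv : v ≫ q = B) {v' : z ⟶ w} (hv' : v' ≫ t = D) (φ : q ≫ c.map r ≅ U ≫ p)
    (ψ : t ≫ c.map s ≅ V ≫ q) {W : w ⟶ x} (h : W = V ≫ U) (κ : v ⟶ v' ≫ V)
    (hκ : κ ▷ q = eqToHom hv ≫ (chi l' hv' ψ).hom) :
    (chi l'' hv' (paste φ ψ h)).hom = (chi l hv φ).hom ≫ κ ▷ U ▷ p ≫
      eqToHom (by rw [h, Strict.assoc v' V U]) := by
  rw [chi_paste hl hv]
  subst hv
  rw [eqToHom_refl, Category.id_comp] at hκ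
  rw [← hκ]
  have := whisker_exchange κ φ.hom
  simp [chi, Strict.associator_eqToIso] at this ⊢
  have h' : (v' ≫ V) ≫ U ≫ p = (v' ≫ W) ≫ p := by
    rw [h]
    simp only [Strict.assoc]
  have := congrArg (eqToHom (Strict.assoc v q (c.map r)) ≫ · ≫ eqToHom h') this
  simpa using this.symm

theorem chi_id {i : x ⟶ x} {p : x ⟶ c.obj a} (l : A ≅ A ≫ c.map (𝟙 a)) (hl : l.hom = eqToHom (by rw [c.map_id, Strict.comp_id]))
    {v : z ⟶ x} (hv : v ≫ p = A) (hi : i = 𝟙 x) (h : p ≫ c.map (𝟙 a) = i ≫ p) :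
    (chi l hv (eqToIso h)).hom = eqToHom (by rw [hi, Strict.comp_id, hv]) := by
  subst hi
  simp [chi, hl]

/-- For the square of an inclusion, l is the whiskering of the structure 2-cell π of the
presentation, and the inverse of π in the square cancels it. -/
theorem chi_incl {p : x ⟶ c.obj a} {q : x ⟶ c.obj b} (l : A ≅ B ≫ c.map r) (π : p ≅ q ≫ c.map r) {v : z ⟶ x}
    (hv : v ≫ p = A) (hv' : v ≫ q = B)
    (H : v ◁ π.hom ≫ eqToHom (by rw [← hv', Strict.assoc]) = eqToHom hv ≫ l.hom)
    {i : x ⟶ x} (hi : i = 𝟙 x) (h : p = i ≫ p) :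
    (chi l hv' (π.symm ≪≫ eqToIso h)).hom = eqToHom (by rw [hi, Strict.comp_id, hv]) := by
  subst hi hv hv'
  simp at H
  simp [chi, ← H]

end

end Chi

end TwoPro

namespace TwoPro

open CategoryTheory Bicategory Opposite

set_option linter.unusedSectionVars false
set_option linter.unusedVariables false

/-! ### Restriction of a pseudocone over `Idx` to the indices over one object of `I`. -/

section Fibre

variable {C : Type u} [Bicategory.{w, w} C] [Bicategory.Strict C]
  {P : Type u₂} [Bicategory.{w₂, v₂} P] [Bicategory.Strict P]
  {E : Type u₁} [Bicategory.{w₁, v₁} E] [Bicategory.Strict E]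
  {c : StrictPseudofunctor C P} {F : StrictPseudofunctor C E}
  {I : Type w} [Bicategory.{w, w} I] [Bicategory.Strict I]
  {pres : ∀ X : P, Presentation c X} {X : StrictPseudofunctor Iᵒᵖ P}

namespace Idx

variable {a b d : Idx pres X}

theorem valMap_id (b : Idx pres X) : b.valMap (𝟙 b.fib) = 𝟙 b.val :=
  (pres (X.obj (op b.base))).diagram.map_id (op b.fib)

theorem valMap_comp (b : Idx pres X) {l m : (pres (X.obj (op b.base))).I} (x : b.fib ⟶ l) (y : l ⟶ m) :
    b.valMap (x ≫ y) = (b.move l).valMap y ≫ b.valMap x :=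
  (pres (X.obj (op b.base))).diagram.map_comp y.op x.op

theorem projIso_id_eq (b : Idx pres X) : b.proj = b.proj ≫ c.map (b.valMap (𝟙 b.fib)) := by
  rw [valMap_id, c.map_id, Strict.comp_id]

theorem projIso_id (b : Idx pres X) : (b.projIso (𝟙 b.fib)).hom = eqToHom (projIso_id_eq b) :=
  (pres (X.obj (op b.base))).cone.legIso_id b.fib

theorem projIso_comp_eq (b : Idx pres X) {l m : (pres (X.obj (op b.base))).I} (x : b.fib ⟶ l) (y : l ⟶ m) :
    ((b.move m).proj ≫ c.map ((b.move l).valMap y)) ≫ c.map (b.valMap x) =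
      (b.move m).proj ≫ c.map (b.valMap (x ≫ y)) := by
  rw [valMap_comp, c.map_comp, Strict.assoc]

theorem projIso_comp (b : Idx pres X) {l m : (pres (X.obj (op b.base))).I} (x : b.fib ⟶ l) (y : l ⟶ m) :
    (b.projIso (x ≫ y)).hom = (b.projIso x).hom ≫ ((b.move l).projIso y).hom ▷ c.map (b.valMap x) ≫
      eqToHom (projIso_comp_eq b x y) :=
  (pres (X.obj (op b.base))).cone.legIso_comp x y

/-- The 2-cell of `C` given by a 2-cell between indices of the presentation. -/
def valMap₂ (b : Idx pres X) {l : (pres (X.obj (op b.base))).I} {x y : b.fib ⟶ l} (α : x ⟶ y) :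
    b.valMap x ⟶ b.valMap y :=
  (pres (X.obj (op b.base))).diagram.map₂ (_root_.Bicategory.Opposite.op2 α)

theorem projIso_naturality (b : Idx pres X) {l : (pres (X.obj (op b.base))).I} {x y : b.fib ⟶ l}
    (α : x ⟶ y) :
    (b.projIso x).hom ≫ (b.move l).proj ◁ c.map₂ (b.valMap₂ α) = (b.projIso y).hom :=
  (pres (X.obj (op b.base))).cone.legIso_naturality α

theorem incl_id_aux {x : P} {a : C} {p : x ⟶ c.obj a} {s : a ⟶ a} (hs : s = 𝟙 a) (π : p ≅ p ≫ c.map s)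
    {h : p = p ≫ c.map s} (hπ : π.hom = eqToHom h) {i : x ⟶ x} (hi : p = i ≫ p)
    (h₁ : p ≫ c.map (𝟙 a) = i ≫ p) {β : i ⟶ i} (hβ : β = 𝟙 i) :
    p ◁ c.map₂ (eqToHom hs) ≫ (eqToIso h₁).hom = (π.symm ≪≫ eqToIso hi).hom ≫ β ▷ p := by
  obtain rfl : π = eqToIso h := Iso.ext hπ
  subst hβ
  simp [PrelaxFunctor.map₂_eqToHom]

theorem incl_comp_aux {x : P} {a b e : C} {p : x ⟶ c.obj a} {q : x ⟶ c.obj b} {t : x ⟶ c.obj e} {r : b ⟶ a}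
    {s : e ⟶ b} {s' : e ⟶ a} (hs : s' = s ≫ r) {π : p ≅ q ≫ c.map r} {π' : q ≅ t ≫ c.map s}
    {π'' : p ≅ t ≫ c.map s'} {h : (t ≫ c.map s) ≫ c.map r = t ≫ c.map s'}
    (hπ : π''.hom = π.hom ≫ π'.hom ▷ c.map r ≫ eqToHom h) {i j : x ⟶ x} {φ : t ≫ c.map (s ≫ r) ≅ j ≫ p}
    {hp : p = i ≫ p} {β : i ⟶ j} (hφ : (π'.hom ▷ c.map r ≫ eqToHom (paste_eq₁ t s r).symm) ≫ φ.hom =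
      (π.symm ≪≫ eqToIso hp).hom ≫ β ▷ p) :
    t ◁ c.map₂ (eqToHom hs) ≫ φ.hom = (π''.symm ≪≫ eqToIso hp).hom ≫ β ▷ p := by
  subst hs
  have e : π''.hom ≫ (π''.symm ≪≫ eqToIso hp).hom = eqToHom hp := by simp
  rw [Category.assoc] at hφ
  rw [← cancel_epi π''.hom, reassoc_of% e, hπ]
  simp [hφ]

theorem incl₂_aux {x : P} {a b : C} {p : x ⟶ c.obj a} {q : x ⟶ c.obj b} {r r' : b ⟶ a}
    {π : p ≅ q ≫ c.map r} {π' : p ≅ q ≫ c.map r'} (η : r ⟶ r') (h : π.hom ≫ q ◁ c.map₂ η = π'.hom)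
    {i : x ⟶ x} {hp : p = i ≫ p} {β : i ⟶ i} (hβ : β = 𝟙 i) :
    q ◁ c.map₂ η ≫ (π'.symm ≪≫ eqToIso hp).hom = (π.symm ≪≫ eqToIso hp).hom ≫ β ▷ p := by
  subst hβ
  rw [← Iso.eq_inv_comp] at h
  simp [h]

/-- With the two facts that follow: `incl` respects identities, composition and 2-cells of the
indices of X_i, as the restriction of a pseudocone to a fibre requires. -/
theorem compat_incl_id (b : Idx pres X) :
    Compat (b.incl (𝟙 b.fib)) (𝟙 b) (𝟙 (𝟙 b.base)) (eqToHom (valMap_id b)) := by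
  unfold Compat
  rw [id_iso]
  have := incl_iso b (𝟙 b.fib)
  refine Eq.trans ?_ (congrArg (fun e => e.hom ≫ _) this).symm
  exact incl_id_aux (valMap_id b) (b.projIso (𝟙 b.fib)) (projIso_id b) _ _ (X.map₂_id _)

theorem compat_incl_comp (b : Idx pres X) {l m : (pres (X.obj (op b.base))).I} (x : b.fib ⟶ l) (y : l ⟶ m) :
    Compat (b.incl (x ≫ y)) (b.incl x ≫ (b.move l).incl y) (λ_ (𝟙 b.base)).inv
      (eqToHom (valMap_comp b x y)) := by
  have h := comp_incl_iso (b.incl x) y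
  have h₂ : X.map₂ (_root_.Bicategory.Opposite.op2 (λ_ (𝟙 b.base)).inv) =
      eqToHom (map_base_comp_incl (b.incl x) y) := by
    rw [Strict.leftUnitor_eqToIso]
    exact map₂_op2_eqToHom X (Strict.id_comp (𝟙 b.base)).symm
  rw [incl_iso, ← h₂] at h
  unfold Compat
  refine Eq.trans ?_ (congrArg (fun e => e.hom ≫ _) (incl_iso b (x ≫ y))).symm
  exact incl_comp_aux (valMap_comp b x y) (projIso_comp b x y) h

theorem compat_incl₂ (b : Idx pres X) {l : (pres (X.obj (op b.base))).I} {x y : b.fib ⟶ l} (α : x ⟶ y) :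
    Compat (b.incl x) (b.incl y) (𝟙 (𝟙 b.base)) (b.valMap₂ α) := by
  unfold Compat
  rw [incl_iso, incl_iso]
  exact incl₂_aux _ (projIso_naturality b α) (X.map₂_id _)

end Idx

namespace PseudoCone

open Idx

variable {M : E} {a b d : Idx pres X}

/-- The component at an index of a pseudocone over `Idx`. -/
noncomputable def at₁ (π : PseudoCone ((Idx.diagram pres X).comp F) M) (a : Idx pres X) : M ⟶ F.obj a.val := π.leg a

/-- The structure 2-cell of a pseudocone over `Idx`. -/
noncomputable def atIso (π : PseudoCone ((Idx.diagram pres X).comp F) M) (f : a ⟶ b) :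
    π.at₁ a ≅ π.at₁ b ≫ F.map (val₁ f) := π.legIso f

variable (π : PseudoCone ((Idx.diagram pres X).comp F) M)

theorem atIso_id_eq (a : Idx pres X) : π.at₁ a = π.at₁ a ≫ F.map (𝟙 a.val) := by
  rw [F.map_id, Strict.comp_id]

theorem atIso_id (a : Idx pres X) : (π.atIso (𝟙 a)).hom = eqToHom (π.atIso_id_eq a) :=
  π.legIso_id a

theorem atIso_comp (f : a ⟶ b) (g : b ⟶ d) : (π.atIso (f ≫ g)).hom = (π.atIso f).hom ≫
    (π.atIso g).hom ▷ F.map (val₁ f) ≫ eqToHom (paste_eq₁ (π.at₁ d) (val₁ g) (val₁ f)).symm :=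
  π.legIso_comp f g

theorem atIso_naturality {f g : a ⟶ b} (α : f ⟶ g) :
    (π.atIso f).hom ≫ π.at₁ b ◁ F.map₂ (val₂ α) = (π.atIso g).hom :=
  π.legIso_naturality α

theorem atIso_congr {f g : a ⟶ b} {η : val₁ f ⟶ val₁ g} {β : base₁ f ⟶ base₁ g} (H : Compat f g β η) :
    (π.atIso f).hom ≫ π.at₁ b ◁ F.map₂ η = (π.atIso g).hom :=
  π.atIso_naturality (hom₂ β η H)

theorem eq_comp_eqToHom_of_whiskerLeft {a b : C} {A : M ⟶ F.obj a} {B : M ⟶ F.obj b} {r r' : b ⟶ a}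
    (h : r = r') {x : A ⟶ B ≫ F.map r} {y : A ⟶ B ≫ F.map r'} (e : x ≫ B ◁ F.map₂ (eqToHom h) = y) :
    x = y ≫ eqToHom (by rw [h]) := by
  subst h
  simpa using e

theorem comp_comp_eqToHom_trans {K : Type*} [Category K] {k l m n o : K} (x : k ⟶ l) (y : l ⟶ m)
    (h : m = n) (h' : n = o) : (x ≫ y ≫ eqToHom h) ≫ eqToHom h' = x ≫ y ≫ eqToHom (h.trans h') := by
  simp

/-- The restriction of a pseudocone over `Idx` to the indices over an object of `I`. -/
noncomputable def fibre (i : I) : PseudoCone ((pres (X.obj (op i))).diagram.comp F) M :=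
  PseudoCone.ofLegs (fun k => π.at₁ ⟨i, k⟩) (fun {k l} x => π.atIso (incl ⟨i, k⟩ x))
    (fun k => (eq_comp_eqToHom_of_whiskerLeft (valMap_id (⟨i, k⟩ : Idx pres X))
        (π.atIso_congr (compat_incl_id ⟨i, k⟩))).trans
      ((congrArg (· ≫ _) (π.atIso_id ⟨i, k⟩)).trans (eqToHom_trans _ _)))
    (fun {k l m} x y => (eq_comp_eqToHom_of_whiskerLeft (valMap_comp (⟨i, k⟩ : Idx pres X) x y)
        (π.atIso_congr (compat_incl_comp ⟨i, k⟩ x y))).trans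
      ((congrArg (· ≫ _) (π.atIso_comp _ _)).trans (comp_comp_eqToHom_trans _ _ _ _)))
    (fun {k l x y} α => π.atIso_congr (compat_incl₂ ⟨i, k⟩ α))

theorem legIso_congr {A : Type u₃} [Bicategory.{w₃, v₃} A] [Bicategory.Strict A]
    {D : StrictPseudofunctor Aᵒᵖ C} {θ η : PseudoCone (D.comp F) M} (h : θ = η) {i j : A} (u : i ⟶ j) :
    (θ.legIso u).hom ≫ eqToHom (by rw [h]) = eqToHom (by rw [h]) ≫ (η.legIso u).hom := by
  subst h
  simp

end PseudoCone

end Fibre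

end TwoPro

namespace TwoPro

open CategoryTheory Bicategory Opposite

set_option linter.unusedSectionVars false
set_option linter.unusedVariables false

/-! ### Factorization of a pseudocone over `Idx` through the objects X_i. -/

section LimitCone

variable {C : Type u} [Bicategory.{w, w} C] [Bicategory.Strict C]
  {P : Type u₂} [Bicategory.{w₂, v₂} P] [Bicategory.Strict P]
  {c : StrictPseudofunctor C P}

theorem Presentation.hom_ext {Z : P} (p : Presentation c Z) {M : P} {g h : M ⟶ Z} {α β : g ⟶ h}
    (H : ∀ k, α ▷ p.cone.leg k = β ▷ p.cone.leg k) : α = β := by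
  have := p.isPseudolimit M
  exact (p.cone.precompFunctor M).map_injective (PseudoCone.hom_ext_legs H)

variable {I : Type w} [Bicategory.{w, w} I] [Bicategory.Strict I]
  {pres : ∀ X : P, Presentation c X} {X : StrictPseudofunctor Iᵒᵖ P} {Y : P}

open Idx

/-- The data of 1-cells `Y ⟶ X i` whose composites with the projections form the restrictions of a given
pseudocone over `Idx`. -/
structure Factorization (π : PseudoCone ((Idx.diagram pres X).comp c) Y) where
  hom (i : I) : Y ⟶ X.obj (op i)
  precomp_hom (i : I) : (pres (X.obj (op i))).cone.precomp (hom i) = π.fibre i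

/-- X_i is the pseudolimit of its projections, and bijectivity on objects gives an equality of
pseudocones rather than an isomorphism. -/
theorem exists_factorization (π : PseudoCone ((Idx.diagram pres X).comp c) Y) :
    Nonempty (Factorization π) := by
  have (i : I) : ∃ f : Y ⟶ X.obj (op i), (pres (X.obj (op i))).cone.precomp f = π.fibre i := by
    have := (pres (X.obj (op i))).isPseudolimit Y
    exact ((pres (X.obj (op i))).cone.precompFunctor Y).bijective_obj.2 _
  choose v hv using this
  exact ⟨⟨v, hv⟩⟩

namespace Factorization

variable {π : PseudoCone ((Idx.diagram pres X).comp c) Y} (v : Factorization π) {a b d : Idx pres X}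

theorem hom_proj (a : Idx pres X) : v.hom a.base ≫ a.proj = π.at₁ a :=
  congrArg (fun θ => PseudoCone.leg θ a.fib) (v.precomp_hom a.base)

theorem comp_eqToHom_of_eq {K : Type*} [Category K] {k l m' n : K} {m : k ⟶ l} {h : l = m'} {h' : m' = n}
    {h'' : l = n} {r : k ⟶ n} (e : (m ≫ eqToHom h) ≫ eqToHom h' = r) : m ≫ eqToHom h'' = r := by
  simpa using e

theorem whiskerLeft_projIso (a : Idx pres X) {l : (pres (X.obj (op a.base))).I} (x : a.fib ⟶ l) :
    v.hom a.base ◁ (a.projIso x).hom ≫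
      eqToHom (by rw [← v.hom_proj (a.move l), Strict.assoc] :
        v.hom a.base ≫ (a.move l).proj ≫ c.map (a.valMap x) = π.at₁ (a.move l) ≫ c.map (a.valMap x)) =
      eqToHom (v.hom_proj a) ≫ (π.atIso (a.incl x)).hom := by
  exact comp_eqToHom_of_eq (m := v.hom a.base ◁ (a.projIso x).hom) (h := (Strict.assoc _ _ _).symm)
    (PseudoCone.legIso_congr (v.precomp_hom a.base) x)

/-- The isomorphism between projections given by a 1-cell of indices. -/
noncomputable def chi₁ (f : a ⟶ b) : π.at₁ a ≅ (v.hom b.base ≫ X.map (base₁ f).op) ≫ a.proj :=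
  chi (π.atIso f) (v.hom_proj b) (iso₁ f)

theorem chi₁_comp (f : a ⟶ b) (g : b ⟶ d) : (v.chi₁ (f ≫ g)).hom = (π.atIso f).hom ≫
    (v.chi₁ g).hom ▷ c.map (val₁ f) ≫
      eqToHom (Strict.assoc (v.hom d.base ≫ X.map (base₁ g).op) b.proj (c.map (val₁ f))) ≫
      (v.hom d.base ≫ X.map (base₁ g).op) ◁ (iso₁ f).hom ≫
        eqToHom (by rw [comp_base, op_comp_eq X (base₁ f) (base₁ g)]; simp only [Strict.assoc]) := by
  unfold chi₁
  rw [comp_iso]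
  exact chi_paste (π.atIso_comp f g) (v.hom_proj b) (v.hom_proj d) (iso₁ f) (iso₁ g) _

theorem chi₁_comp_of_whiskerRight (f : a ⟶ b) (g : b ⟶ d)
    (κ : v.hom b.base ⟶ v.hom d.base ≫ X.map (base₁ g).op)
    (hκ : κ ▷ b.proj = eqToHom (v.hom_proj b) ≫ (v.chi₁ g).hom) :
    (v.chi₁ (f ≫ g)).hom = (v.chi₁ f).hom ≫ κ ▷ X.map (base₁ f).op ▷ a.proj ≫
      eqToHom (by
        rw [comp_base, op_comp_eq X (base₁ f) (base₁ g)]; simp only [Strict.assoc]) := by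
  unfold chi₁
  rw [comp_iso]
  exact chi_paste_of_whiskerRight (π.atIso_comp f g) (v.hom_proj b) (v.hom_proj d) (iso₁ f) (iso₁ g)
    (op_comp_eq X (base₁ f) (base₁ g)) κ hκ

theorem chi₁_naturality {f g : a ⟶ b} (γ : f ⟶ g) :
    (v.chi₁ f).hom ≫ (v.hom b.base ◁ X.map₂ (_root_.Bicategory.Opposite.op2 (base₂ γ))) ▷ a.proj =
      (v.chi₁ g).hom :=
  chi_whisker (v.hom_proj b) (val₂ γ) _ (π.atIso_naturality γ) (compat γ)

theorem chi₁_id (a : Idx pres X) : (v.chi₁ (𝟙 a)).hom =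
    eqToHom (by rw [id_base, op_id_eq, Strict.comp_id, v.hom_proj]) := by
  unfold chi₁
  rw [id_iso]
  exact chi_id (π.atIso (𝟙 a)) (π.atIso_id a) (v.hom_proj a) (op_id_eq X a.base) _

theorem chi₁_incl (a : Idx pres X) {l : (pres (X.obj (op a.base))).I} (x : a.fib ⟶ l) :
    (v.chi₁ (a.incl x)).hom =
      eqToHom (by rw [incl_base, op_id_eq, Strict.comp_id]; exact (v.hom_proj a).symm) := by
  unfold chi₁
  rw [incl_iso]
  exact chi_incl (π.atIso (a.incl x)) (a.projIso x) (v.hom_proj a) (v.hom_proj (a.move l))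
    (v.whiskerLeft_projIso a x) (op_id_eq X a.base) _

theorem eqToHom_whiskerRight_aux {x y z w : P} {f g : x ⟶ y} (h : f = g) {s : y ⟶ z} {p : z ⟶ w}
    {k : x ⟶ w} (h' : (g ≫ s) ≫ p = k) (h'' : (f ≫ s) ≫ p = k) :
    eqToHom h ▷ s ▷ p ≫ eqToHom h' = eqToHom h'' := by
  subst h
  simp

/-- An inclusion contributes an identity, so two 1-cells may be compared after moving to a later
index, where `exists_comp_incl` provides 2-cells. -/
theorem chi₁_comp_incl (f : a ⟶ b) {l : (pres (X.obj (op b.base))).I} (x : b.fib ⟶ l) :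
    (v.chi₁ (f ≫ b.incl x)).hom = (v.chi₁ f).hom ≫
      eqToHom (congrArg (fun r => (v.hom b.base ≫ r) ≫ a.proj) (map_base_comp_incl f x)) := by
  have h : v.hom b.base = v.hom b.base ≫ X.map (base₁ (b.incl x)).op := by
    rw [incl_base, op_id_eq, Strict.comp_id]
  rw [v.chi₁_comp_of_whiskerRight f (b.incl x) (eqToHom h) (by
    rw [chi₁_incl, eqToHom_trans, eqToHom_whiskerRight])]
  exact congrArg _ (eqToHom_whiskerRight_aux h _ _)

theorem of_conj_whisker {x y z w : P} {A : z ⟶ w} {v : z ⟶ y} {p : x ⟶ w} {U U' W W' : y ⟶ x} (h : U = W)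
    (h' : U' = W') {χ : A ⟶ (v ≫ U) ≫ p} {χ' : A ⟶ (v ≫ U') ≫ p} {β : U ⟶ U'} {δ : W ⟶ W'}
    (hδ : δ = eqToHom h.symm ≫ β ≫ eqToHom h')
    (H : (χ ≫ eqToHom (congrArg (fun r => (v ≫ r) ≫ p) h)) ≫ (v ◁ δ) ▷ p =
      χ' ≫ eqToHom (congrArg (fun r => (v ≫ r) ≫ p) h')) : χ ≫ (v ◁ β) ▷ p = χ' := by
  subst h h' hδ
  simpa using H

theorem map₂_op2_whiskerRight_id_eq {i j : I} {u v : i ⟶ j} (α : u ⟶ v) :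
    X.map₂ (_root_.Bicategory.Opposite.op2 (α ▷ 𝟙 j)) =
      eqToHom (congrArg (fun r => X.map r.op) (Strict.comp_id u)) ≫
        X.map₂ (_root_.Bicategory.Opposite.op2 α) ≫
        eqToHom (congrArg (fun r => X.map r.op) (Strict.comp_id v).symm) := by
  refine Eq.trans ?_ (map₂_op2_whiskerRight_id α rfl rfl)
  simp

theorem chi₁_whisker_of_comp_incl {f g : a ⟶ b} (α : base₁ f ⟶ base₁ g)
    {l : (pres (X.obj (op b.base))).I} (x : b.fib ⟶ l)
    (H : (v.chi₁ (f ≫ b.incl x)).hom ≫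
      (v.hom b.base ◁ X.map₂ (_root_.Bicategory.Opposite.op2 (α ▷ 𝟙 b.base))) ▷ a.proj =
        (v.chi₁ (g ≫ b.incl x)).hom) :
    (v.chi₁ f).hom ≫ (v.hom b.base ◁ X.map₂ (_root_.Bicategory.Opposite.op2 α)) ▷ a.proj =
      (v.chi₁ g).hom :=
  of_conj_whisker (map_base_comp_incl f x) (map_base_comp_incl g x) (map₂_op2_whiskerRight_id_eq α)
    ((congrArg (· ≫ _) (v.chi₁_comp_incl f x).symm).trans (H.trans (v.chi₁_comp_incl g x)))

/-- The isomorphisms given by two 1-cells are compatible with the 2-cells between their projections. -/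
theorem chi₁_whisker {f g : a ⟶ b} (α : base₁ f ⟶ base₁ g) :
    (v.chi₁ f).hom ≫ (v.hom b.base ◁ X.map₂ (_root_.Bicategory.Opposite.op2 α)) ▷ a.proj =
      (v.chi₁ g).hom := by
  -- α need not underlie a 2-cell from f to g, but it does after an inclusion; naturality applies
  -- there and the inclusion is then removed.
  obtain ⟨l, x, γ, hγ⟩ := exists_comp_incl f g α
  refine v.chi₁_whisker_of_comp_incl α x ?_
  rw [← hγ]
  exact v.chi₁_naturality γ

/-- The isomorphisms given by 1-cells to indices over the same object are compatible with the 2-cells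
between their projections. -/
theorem chi₁_base {i : I} {k k' : (pres (X.obj (op i))).I} (f : a ⟶ ⟨i, k⟩) (g : a ⟶ ⟨i, k'⟩)
    {u u' : a.base ⟶ i} (hf : base₁ f = u) (hg : base₁ g = u') (α : u ⟶ u') :
    (v.chi₁ f).hom ≫ eqToHom (congrArg (fun r => (v.hom i ≫ X.map r.op) ≫ a.proj) hf) ≫
        (v.hom i ◁ X.map₂ (_root_.Bicategory.Opposite.op2 α)) ▷ a.proj =
      (v.chi₁ g).hom ≫ eqToHom (congrArg (fun r => (v.hom i ≫ X.map r.op) ≫ a.proj) hg) := by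
  subst hf hg
  -- The targets may be different indices over i; moving both to a common one reduces to parallel
  -- 1-cells.
  obtain ⟨l, ⟨x⟩, ⟨x'⟩⟩ := IsTwoFiltered.cocone_objs k k'
  rw [eqToHom_refl, Category.id_comp, eqToHom_refl, Category.comp_id]
  exact of_conj_whisker (map_base_comp_incl f x) (map_base_comp_incl g x')
    (map₂_op2_whiskerRight_id_eq α)
    ((congrArg (· ≫ _) (v.chi₁_comp_incl f x).symm).trans
      ((v.chi₁_whisker (f := f ≫ incl ⟨i, k⟩ x) (g := g ≫ incl ⟨i, k'⟩ x')
        (show base₁ f ≫ 𝟙 i ⟶ base₁ g ≫ 𝟙 i from α ▷ 𝟙 i)).trans (v.chi₁_comp_incl g x')))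

end Factorization

end LimitCone

end TwoPro

namespace TwoPro

open CategoryTheory Bicategory Opposite

set_option linter.unusedSectionVars false
set_option linter.unusedVariables false

section

variable {A : Type u₃} [Bicategory.{w₃, v₃} A] [Bicategory.Strict A]
  {B : Type u₂} [Bicategory.{w₂, v₂} B] [Bicategory.Strict B]
  {E : Type u₁} [Bicategory.{w₁, v₁} E] [Bicategory.Strict E]
  {D : StrictPseudofunctor Aᵒᵖ B} {F : StrictPseudofunctor B E} {M : E}

/-- Constructor of isomorphisms of pseudocones on a composite diagram. -/
def PseudoCone.isoOfLegs {θ η : PseudoCone (D.comp F) M} (ρ : ∀ i, θ.leg i ≅ η.leg i)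
    (h : ∀ {i j : A} (u : i ⟶ j), (ρ i).hom ≫ (η.legIso u).hom =
      (θ.legIso u).hom ≫ (ρ j).hom ▷ F.map (D.map u.op)) : θ ≅ η where
  hom := homOfLegs (fun i => (ρ i).hom) h
  inv := homOfLegs (fun i => (ρ i).inv) fun {i j} u => by
    rw [Iso.inv_comp_eq, ← Category.assoc, h, Category.assoc, ← comp_whiskerRight, Iso.hom_inv_id,
      id_whiskerRight, Category.comp_id]
  hom_inv_id := hom_ext_legs fun i => (ρ i).hom_inv_id
  inv_hom_id := hom_ext_legs fun i => (ρ i).inv_hom_id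

end

/-! ### The pseudocone on X lifted from a pseudocone over `Idx`. -/

section LimitCone

variable {C : Type u} [Bicategory.{w, w} C] [Bicategory.Strict C]
  {P : Type u₂} [Bicategory.{w₂, v₂} P] [Bicategory.Strict P]
  {c : StrictPseudofunctor C P}

theorem eqToHom_comp_comp_eqToHom {K : Type*} [Category K] {k l m n : K} {χ : l ⟶ m} {h : l = m}
    (hχ : χ = eqToHom h) {h₁ : k = l} (h₂ : m = n) {h₃ : k = n} :
    eqToHom h₁ ≫ χ ≫ eqToHom h₂ = eqToHom h₃ := by
  subst hχ
  simp

theorem comp_comp_assoc {K : Type*} [Category K] {k l m n o : K} (x : k ⟶ l) (y : l ⟶ m) (z : m ⟶ n)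
    (t : n ⟶ o) : (x ≫ y ≫ z) ≫ t = x ≫ y ≫ z ≫ t := by
  simp

theorem chi_natural {x z : P} {a b : C} {p : x ⟶ c.obj a} {q : x ⟶ c.obj b} {r : b ⟶ a}
    (π : p ≅ q ≫ c.map r) {v : z ⟶ x} {A : z ⟶ c.obj a} {B : z ⟶ c.obj b} (hv : v ≫ p = A)
    (hv' : v ≫ q = B) {l : A ≅ B ≫ c.map r} {h₁ : v ≫ q ≫ c.map r = B ≫ c.map r}
    (H : v ◁ π.hom ≫ eqToHom h₁ = eqToHom hv ≫ l.hom)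
    {V V' W : z ⟶ x} (hV : V = V') {i : x ⟶ x} (hi : i = 𝟙 x) (hp : p = i ≫ p)
    {h₂ : V ≫ i ≫ p = W ≫ p} (hW : W = V') {χ : B ⟶ V ≫ q} {χ' : A ⟶ W ≫ p}
    (H' : χ' = l.hom ≫ χ ▷ c.map r ≫ eqToHom (Strict.assoc V q (c.map r)) ≫
      V ◁ (π.symm ≪≫ eqToIso hp).hom ≫ eqToHom h₂) :
    (eqToHom hv ≫ χ' ≫ eqToHom (congrArg (· ≫ p) hW)) ≫ V' ◁ π.hom ≫
        eqToHom (Strict.assoc V' q (c.map r)).symm =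
      (v ◁ π.hom ≫ eqToHom (Strict.assoc v q (c.map r)).symm) ≫
        (eqToHom hv' ≫ χ ≫ eqToHom (congrArg (· ≫ q) hV)) ▷ c.map r := by
  subst hv hv' hV hi hW H'
  simp at H
  simp [← H]

variable {I : Type w} [Bicategory.{w, w} I] [Bicategory.Strict I]
  {pres : ∀ X : P, Presentation c X} {X : StrictPseudofunctor Iᵒᵖ P} {Y : P}

open Idx

namespace Factorization

variable {π : PseudoCone ((Idx.diagram pres X).comp c) Y} (v : Factorization π) {a b d : Idx pres X}

/-- The isomorphism between composites with a projection given by a 1-cell of indices over `u`. -/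
noncomputable def lift (f : a ⟶ b) {u : a.base ⟶ b.base} (hf : base₁ f = u) :
    v.hom a.base ≫ a.proj ≅ (v.hom b.base ≫ X.map u.op) ≫ a.proj :=
  eqToIso (v.hom_proj a) ≪≫ v.chi₁ f ≪≫
    eqToIso (congrArg (fun r => (v.hom b.base ≫ X.map r.op) ≫ a.proj) hf)

theorem lift_base {i : I} {k k' : (pres (X.obj (op i))).I} (f : a ⟶ ⟨i, k⟩) (g : a ⟶ ⟨i, k'⟩)
    {u u' : a.base ⟶ i} (hf : base₁ f = u) (hg : base₁ g = u') (α : u ⟶ u') :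
    (v.lift f hf).hom ≫ (v.hom i ◁ X.map₂ (_root_.Bicategory.Opposite.op2 α)) ▷ a.proj =
      (v.lift g hg).hom := by
  exact (comp_comp_assoc _ _ _ _).trans (congrArg (_ ≫ ·) (v.chi₁_base f g hf hg α))

/-- The case of an identity 2-cell in `lift_base`: the comparison depends on u alone and not on the
chosen 1-cell of indices over it. -/
theorem lift_eq {i : I} {k k' : (pres (X.obj (op i))).I} (f : a ⟶ ⟨i, k⟩) (g : a ⟶ ⟨i, k'⟩)
    {u : a.base ⟶ i} (hf : base₁ f = u) (hg : base₁ g = u) : v.lift f hf = v.lift g hg := by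
  have := v.lift_base f g hf hg (𝟙 u)
  ext
  rw [← this]
  have h : X.map₂ (_root_.Bicategory.Opposite.op2 (𝟙 u)) = 𝟙 _ := X.map₂_id _
  rw [h, Bicategory.whiskerLeft_id, id_whiskerRight]
  exact (Category.comp_id _).symm

theorem incl_comp_base {l : (pres (X.obj (op a.base))).I} (x : a.fib ⟶ l) (g : a.move l ⟶ b)
    {u : a.base ⟶ b.base} (hg : base₁ g = u) : base₁ (a.incl x ≫ g) = u := by
  rw [comp_base, incl_base]
  exact (Strict.id_comp _).trans hg

/-- Naturality along a 1-cell x of the presentation, for the pair of lifts `incl x ≫ g` and g; by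
`lift_eq` this covers every choice of lifts. -/
theorem lift_incl_comp {l : (pres (X.obj (op a.base))).I} (x : a.fib ⟶ l) (g : a.move l ⟶ b)
    {u : a.base ⟶ b.base} (hg : base₁ g = u) :
    (v.lift (a.incl x ≫ g) (incl_comp_base x g hg)).hom ≫
        (v.hom b.base ≫ X.map u.op) ◁ (a.projIso x).hom ≫
        eqToHom (Strict.assoc (v.hom b.base ≫ X.map u.op) (a.move l).proj (c.map (a.valMap x))).symm =
      (v.hom a.base ◁ (a.projIso x).hom ≫
        eqToHom (Strict.assoc (v.hom a.base) (a.move l).proj (c.map (a.valMap x))).symm) ≫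
        (v.lift g hg).hom ▷ c.map (a.valMap x) := by
  have h := v.chi₁_comp (a.incl x) g
  rw [incl_iso] at h
  exact chi_natural (a.projIso x) (v.hom_proj a) (v.hom_proj (a.move l)) (v.whiskerLeft_projIso a x)
    (congrArg (fun r => v.hom b.base ≫ X.map r.op) hg) (op_id_eq X a.base) _
    (congrArg (fun r => v.hom b.base ≫ X.map r.op) (incl_comp_base x g hg)) h

/-- Choosing a 1-cell of indices over u for each k gives isomorphisms after every projection. They
form an isomorphism of pseudocones by `lift_eq`, and X_i being a pseudolimit, this comes from an
isomorphism κ. That all f over u are allowed in the conclusion makes the axioms below checkable with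
convenient lifts. -/
theorem exists_cell {i j : I} (u : i ⟶ j) : ∃ κ : v.hom i ≅ v.hom j ≫ X.map u.op,
    ∀ (k : (pres (X.obj (op i))).I) (l : (pres (X.obj (op j))).I) (f : (⟨i, k⟩ : Idx pres X) ⟶ ⟨j, l⟩)
      (hf : base₁ f = u), κ.hom ▷ (pres (X.obj (op i))).cone.leg k = (v.lift f hf).hom := by
  have hp := (pres (X.obj (op i))).isPseudolimit Y
  choose l f hf using fun k => exists_lift (⟨i, k⟩ : Idx pres X) u
  let e : (pres (X.obj (op i))).cone.precomp (v.hom i) ≅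
      (pres (X.obj (op i))).cone.precomp (v.hom j ≫ X.map u.op) :=
    PseudoCone.isoOfLegs (fun k => v.lift (f k) (hf k)) fun {k k'} x => by
      rw [v.lift_eq (f k) (incl ⟨i, k⟩ x ≫ f k') (hf k)
        (incl_comp_base (a := ⟨i, k⟩) x (f k') (hf k'))]
      exact v.lift_incl_comp (a := ⟨i, k⟩) x (f k') (hf k')
  refine ⟨((pres (X.obj (op i))).cone.precompFunctor Y).preimageIso e, fun k m g hg => ?_⟩
  have h₁ := congrArg (fun ρ => PseudoCone.legHom ρ k)
    (((pres (X.obj (op i))).cone.precompFunctor Y).map_preimage e.hom)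
  refine Eq.trans h₁ ?_
  exact congrArg (·.hom) (v.lift_eq (f k) g (hf k) hg)

theorem chi_comp_aux {x y z w t : P} {f : w ⟶ x} {g : w ⟶ y} {h : w ⟶ z} {U : y ⟶ x} {V : z ⟶ y} {W : z ⟶ x}
    (p : x ⟶ t) {A : w ⟶ t} {k₁ : f ⟶ g ≫ U} {k₂ : g ⟶ h ≫ V} (hW : (h ≫ V) ≫ U = h ≫ W)
    {hA : f ≫ p = A} {χ : A ⟶ (g ≫ U) ≫ p} (hk : k₁ ▷ p = eqToHom hA ≫ χ ≫ eqToHom rfl)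
    {χ' : A ⟶ (h ≫ W) ≫ p} {hW' : ((h ≫ V) ≫ U) ≫ p = (h ≫ W) ≫ p} (h' : χ' = χ ≫ k₂ ▷ U ▷ p ≫ eqToHom hW') :
    eqToHom hA ≫ χ' ≫ eqToHom rfl = (k₁ ≫ k₂ ▷ U ≫ eqToHom hW) ▷ p := by
  subst h' hA
  simp at hk
  simp [hk]

variable {v} in
-- Here and in the next two results, the pseudocone axioms are tested on projections, where the cell
-- may be computed with any 1-cell of indices above: an identity, a composite, or two lifts compared
-- by `lift_base`.
theorem cell_id {i : I} {κ : v.hom i ≅ v.hom i ≫ X.map (𝟙 i : i ⟶ i).op}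
    (hκ : ∀ (k l : (pres (X.obj (op i))).I) (f : (⟨i, k⟩ : Idx pres X) ⟶ ⟨i, l⟩) (hf : base₁ f = 𝟙 i),
      κ.hom ▷ (pres (X.obj (op i))).cone.leg k = (v.lift f hf).hom) :
    κ.hom = eqToHom (by rw [op_id_eq, Strict.comp_id]) := by
  apply (pres (X.obj (op i))).hom_ext
  intro k
  have h := v.chi₁_id ⟨i, k⟩
  refine (hκ k k (𝟙 _) (id_base _)).trans ?_
  rw [eqToHom_whiskerRight]
  exact eqToHom_comp_comp_eqToHom (h₁ := v.hom_proj ⟨i, k⟩) h (congrArg (fun r =>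
    (v.hom i ≫ X.map r.op) ≫ (⟨i, k⟩ : Idx pres X).proj) (id_base (⟨i, k⟩ : Idx pres X)))

variable {v} in
theorem cell_comp {i j m : I} {u : i ⟶ j} {w : j ⟶ m} {κ : v.hom i ≅ v.hom j ≫ X.map u.op}
    {κ' : v.hom j ≅ v.hom m ≫ X.map w.op} {κ'' : v.hom i ≅ v.hom m ≫ X.map (u ≫ w).op}
    (hκ : ∀ (k) (l) (f : (⟨i, k⟩ : Idx pres X) ⟶ ⟨j, l⟩) (hf : base₁ f = u),
      κ.hom ▷ (pres (X.obj (op i))).cone.leg k = (v.lift f hf).hom)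
    (hκ' : ∀ (k) (l) (f : (⟨j, k⟩ : Idx pres X) ⟶ ⟨m, l⟩) (hf : base₁ f = w),
      κ'.hom ▷ (pres (X.obj (op j))).cone.leg k = (v.lift f hf).hom)
    (hκ'' : ∀ (k) (l) (f : (⟨i, k⟩ : Idx pres X) ⟶ ⟨m, l⟩) (hf : base₁ f = u ≫ w),
      κ''.hom ▷ (pres (X.obj (op i))).cone.leg k = (v.lift f hf).hom) :
    κ''.hom = κ.hom ≫ κ'.hom ▷ X.map u.op ≫
      eqToHom ((Strict.assoc _ _ _).trans (congrArg (v.hom m ≫ ·) (op_comp_eq X u w).symm)) := by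
  apply (pres (X.obj (op i))).hom_ext
  intro k
  obtain ⟨l, f, rfl⟩ := exists_lift (⟨i, k⟩ : Idx pres X) u
  obtain ⟨n, g, rfl⟩ := exists_lift (⟨j, l⟩ : Idx pres X) w
  have h := v.chi₁_comp_of_whiskerRight f g κ'.hom
    ((hκ' l n g rfl).trans (congrArg (_ ≫ ·) (Category.comp_id _)))
  refine (hκ'' k n (f ≫ g) (comp_base _ _)).trans ?_
  exact chi_comp_aux _ _ (hA := v.hom_proj ⟨i, k⟩) (hκ k l f rfl) h

variable {v} in
theorem cell_naturality {i j : I} {u u' : i ⟶ j} {κ : v.hom i ≅ v.hom j ≫ X.map u.op}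
    {κ' : v.hom i ≅ v.hom j ≫ X.map u'.op}
    (hκ : ∀ (k) (l) (f : (⟨i, k⟩ : Idx pres X) ⟶ ⟨j, l⟩) (hf : base₁ f = u),
      κ.hom ▷ (pres (X.obj (op i))).cone.leg k = (v.lift f hf).hom)
    (hκ' : ∀ (k) (l) (f : (⟨i, k⟩ : Idx pres X) ⟶ ⟨j, l⟩) (hf : base₁ f = u'),
      κ'.hom ▷ (pres (X.obj (op i))).cone.leg k = (v.lift f hf).hom) (α : u ⟶ u') :
    κ.hom ≫ v.hom j ◁ X.map₂ (_root_.Bicategory.Opposite.op2 α) = κ'.hom := by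
  apply (pres (X.obj (op i))).hom_ext
  intro k
  obtain ⟨l, f, hf⟩ := exists_lift (⟨i, k⟩ : Idx pres X) u
  obtain ⟨l', f', hf'⟩ := exists_lift (⟨i, k⟩ : Idx pres X) u'
  rw [comp_whiskerRight, hκ k l f hf, hκ' k l' f' hf']
  exact v.lift_base f f' hf hf' α

end Factorization

/-- A pseudocone `ϖ` on `X` is compatible with a pseudocone over `Idx` if it induces it by composition
with the projections. -/
structure IsLift (π : PseudoCone ((Idx.diagram pres X).comp c) Y) (ϖ : PseudoCone X Y) : Prop where
  app_proj (a : Idx pres X) : ϖ.app (op a.base) ≫ a.proj = π.at₁ a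
  iso_proj {a b : Idx pres X} (f : a ⟶ b) : (ϖ.iso (base₁ f).op).hom ▷ a.proj =
    eqToHom (app_proj a) ≫ (chi (π.atIso f) (app_proj b) (iso₁ f)).hom

theorem exists_isLift (π : PseudoCone ((Idx.diagram pres X).comp c) Y) :
    ∃ ϖ : PseudoCone X Y, IsLift π ϖ := by
  obtain ⟨v⟩ := exists_factorization π
  choose κ hκ using fun (i j : I) (u : i ⟶ j) => v.exists_cell u
  refine ⟨{ app i := v.hom i.unop
            iso {j i} u := κ i.unop j.unop u.unop
            iso_id i := Factorization.cell_id (hκ i.unop i.unop (𝟙 _))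
            iso_comp {k j i} u w := Factorization.cell_comp (hκ i.unop j.unop w.unop)
              (hκ j.unop k.unop u.unop) (hκ i.unop k.unop (w.unop ≫ u.unop))
            iso_naturality {j i} u u' α := Factorization.cell_naturality (hκ i.unop j.unop u.unop)
              (hκ i.unop j.unop u'.unop) α.unop2 }, ⟨v.hom_proj, fun {a b} f => ?_⟩⟩
  exact (hκ a.base b.base (base₁ f) a.fib b.fib f rfl).trans (congrArg (_ ≫ ·) (Category.comp_id _))

end LimitCone

end TwoPro

namespace TwoPro

open CategoryTheory Bicategory Opposite

set_option linter.unusedSectionVars false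
set_option linter.unusedVariables false

/-! ### Pasting of triangles and squares in a strict 2-category. -/

section Squares

variable {E : Type u₁} [Bicategory.{w₁, v₁} E] [Bicategory.Strict E]
  {z x y t a b d : E} {A : z ⟶ x} {B : z ⟶ y} {D : z ⟶ t} {p : x ⟶ a} {q : y ⟶ b} {k : t ⟶ d}
  {r : b ⟶ a} {s : d ⟶ b} {U : y ⟶ x} {V : t ⟶ y}

/-- The vertical composite of two squares. -/
def pasteSquares (φ : q ≫ r ≅ U ≫ p) (ψ : k ≫ s ≅ V ≫ q) {W : t ⟶ x} (hW : W = V ≫ U) {l : d ⟶ a}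
    (hl : l = s ≫ r) : k ≫ l ≅ W ≫ p :=
  eqToIso (by rw [hl, Strict.assoc]) ≪≫ whiskerRightIso ψ r ≪≫ eqToIso (Strict.assoc V q r) ≪≫
    whiskerLeftIso V φ ≪≫ eqToIso (by rw [hW, Strict.assoc])

/-- The isomorphism obtained by pasting a triangle and a square. -/
def pasteTriangle (l : A ≅ B ≫ U) (φ : q ≫ r ≅ U ≫ p) : A ≫ p ≅ (B ≫ q) ≫ r :=
  whiskerRightIso l p ≪≫ eqToIso (Strict.assoc B U p) ≪≫ whiskerLeftIso B φ.symm ≪≫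
    eqToIso (Strict.assoc B q r).symm

theorem pasteTriangle_id {i : x ⟶ x} (hi : i = 𝟙 x) {o : a ⟶ a} (ho : o = 𝟙 a) {l : A ≅ A ≫ i}
    (hl : l.hom = eqToHom (by rw [hi, Strict.comp_id])) {φ : p ≫ o ≅ i ≫ p} {hφ : p ≫ o = i ≫ p}
    (h : φ = eqToIso hφ) : (pasteTriangle l φ).hom = eqToHom (by rw [ho, Strict.comp_id]) := by
  subst hi ho h
  simp [pasteTriangle, hl]

theorem pasteTriangle_comp {l : A ≅ B ≫ U} {l' : B ≅ D ≫ V} {W : t ⟶ x} (hW : W = V ≫ U)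
    {l'' : A ≅ D ≫ W} {h₁ : (D ≫ V) ≫ U = D ≫ W} (hl : l''.hom = l.hom ≫ l'.hom ▷ U ≫ eqToHom h₁)
    (φ : q ≫ r ≅ U ≫ p) (ψ : k ≫ s ≅ V ≫ q) {o : d ⟶ a} (ho : o = s ≫ r) {χ : k ≫ o ≅ W ≫ p}
    (hχ : χ = pasteSquares φ ψ hW ho) : (pasteTriangle l'' χ).hom = (pasteTriangle l φ).hom ≫
      (pasteTriangle l' ψ).hom ▷ r ≫ eqToHom (by rw [ho, Strict.assoc (D ≫ k)]) := by
  subst hW ho hχ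
  have e := whisker_exchange l'.hom φ.inv
  have h : D ≫ V ≫ q ≫ r = D ≫ (V ≫ q) ≫ r := by rw [Strict.assoc V]
  have e' := congrArg (eqToHom (Strict.assoc B U p) ≫ · ≫ eqToHom (Strict.assoc D V (q ≫ r)) ≫ eqToHom h) e
  simp [pasteTriangle, pasteSquares, hl, Strict.associator_eqToIso] at e' ⊢
  rw [reassoc_of% e']

theorem pasteTriangle_naturality {U' : y ⟶ x} {r' : b ⟶ a} {l : A ≅ B ≫ U} {l' : A ≅ B ≫ U'} {β : U ⟶ U'}
    (hl : l.hom ≫ B ◁ β = l'.hom) {φ : q ≫ r ≅ U ≫ p} {φ' : q ≫ r' ≅ U' ≫ p} {η : r ⟶ r'}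
    (h : q ◁ η ≫ φ'.hom = φ.hom ≫ β ▷ p) :
    (pasteTriangle l φ).hom ≫ (B ≫ q) ◁ η = (pasteTriangle l' φ').hom := by
  have e : φ.inv ≫ q ◁ η = β ▷ p ≫ φ'.inv := by
    rw [Iso.inv_comp_eq, ← Category.assoc, ← h, Category.assoc, Iso.hom_inv_id, Category.comp_id]
  have e' := congrArg (B ◁ ·) e
  simp only [Bicategory.whiskerLeft_comp] at e'
  simp [pasteTriangle, ← hl, Strict.associator_eqToIso]
  rw [reassoc_of% e']

/-- The square is invertible, so pasting determines the triangle up to whiskering with p; needed to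
recover a pseudocone on R X from the pseudocone over `Idx` that it induces. -/
theorem pasteTriangle_cancel {A' : z ⟶ x} {B' : z ⟶ y} (hA : A = A') (hB : B = B') {l : A ≅ B ≫ U}
    {l' : A' ≅ B' ≫ U} {φ : q ≫ r ≅ U ≫ p} {h₁ : (B ≫ q) ≫ r = (B' ≫ q) ≫ r} {h₂ : A ≫ p = A' ≫ p}
    (h : (pasteTriangle l φ).hom ≫ eqToHom h₁ = eqToHom h₂ ≫ (pasteTriangle l' φ).hom) :
    (l.hom ≫ eqToHom (congrArg (· ≫ U) hB)) ▷ p = (eqToHom hA ≫ l'.hom) ▷ p := by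
  subst hA hB
  simp only [pasteTriangle, Iso.trans_hom, whiskerRightIso_hom, eqToHom_refl, Category.comp_id,
    Category.id_comp, cancel_mono] at h ⊢
  exact h

theorem pasteTriangle_precomp {z' : E} (g : z' ⟶ z) (l : A ≅ B ≫ U) (φ : q ≫ r ≅ U ≫ p)
    {l' : g ≫ A ≅ (g ≫ B) ≫ U} (hl : l'.hom = g ◁ l.hom ≫ eqToHom (Strict.assoc g B U).symm) :
    (pasteTriangle l' φ).hom ≫ eqToHom (congrArg (· ≫ r) (Strict.assoc g B q)) =
      eqToHom (Strict.assoc g A p) ≫ g ◁ (pasteTriangle l φ).hom ≫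
        eqToHom (Strict.assoc g (B ≫ q) r).symm := by
  simp [pasteTriangle, hl, Strict.associator_eqToIso]

end Squares

/-! ### The action of a Kan extension on squares of P. -/

section RanSquares

variable {C : Type u} [Bicategory.{w, w} C] [Bicategory.Strict C]
  {P : Type u₂} [Bicategory.{w₂, v₂} P] [Bicategory.Strict P]
  {E : Type u₁} [Bicategory.{w₁, v₁} E] [Bicategory.Strict E]
  {c : StrictPseudofunctor C P} {F : StrictPseudofunctor C E} {R : StrictPseudofunctor P E}
  {pres : ∀ X : P, Presentation c X}

namespace Ran

variable (ran : Ran pres F R)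

/-- The 1-cell of `E` given by a 1-cell to an object `c a`. -/
def hom {x : P} {a : C} (p : x ⟶ c.obj a) : R.obj x ⟶ F.obj a := ((ran.het x).app a).obj p

/-- The 2-cell of `E` given by a 2-cell between 1-cells to an object `c a`. -/
def hom₂ {x : P} {a : C} {p p' : x ⟶ c.obj a} (α : p ⟶ p') : ran.hom p ⟶ ran.hom p' :=
  ((ran.het x).app a).map α

variable {x y t : P} {a b d : C}

theorem hom₂_comp {p p' p'' : x ⟶ c.obj a} (α : p ⟶ p') (β : p' ⟶ p'') :
    ran.hom₂ (α ≫ β) = ran.hom₂ α ≫ ran.hom₂ β := ((ran.het x).app a).map_comp α β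

@[simp] theorem hom₂_eqToHom {p p' : x ⟶ c.obj a} (h : p = p') :
    ran.hom₂ (eqToHom h) = eqToHom (congrArg ran.hom h) := by
  subst h
  exact ((ran.het x).app a).map_id p

theorem hom_comp_map (q : y ⟶ c.obj b) (r : b ⟶ a) : ran.hom q ≫ F.map r = ran.hom (q ≫ c.map r) :=
  (ran.het y).post_obj q r

theorem map_comp_hom (U : y ⟶ x) (p : x ⟶ c.obj a) : R.map U ≫ ran.hom p = ran.hom (U ≫ p) :=
  Functor.congr_obj (ran.nat₁ U a) p

theorem hom₂_whiskerRight_map {q q' : y ⟶ c.obj b} (α : q ⟶ q') (r : b ⟶ a) :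
    ran.hom₂ (α ▷ c.map r) = eqToHom (ran.hom_comp_map q r).symm ≫ ran.hom₂ α ▷ F.map r ≫
      eqToHom (ran.hom_comp_map q' r) := (ran.het y).map_whiskerRight α r

theorem hom₂_whiskerLeft_map (q : y ⟶ c.obj b) {r r' : b ⟶ a} (η : r ⟶ r') :
    ran.hom₂ (q ◁ c.map₂ η) = eqToHom (ran.hom_comp_map q r).symm ≫ ran.hom q ◁ F.map₂ η ≫
      eqToHom (ran.hom_comp_map q r') := (ran.het y).map_whiskerLeft q η

theorem hom₂_whiskerLeft (U : y ⟶ x) {p p' : x ⟶ c.obj a} (α : p ⟶ p') :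
    ran.hom₂ (U ◁ α) = eqToHom (ran.map_comp_hom U p).symm ≫ R.map U ◁ ran.hom₂ α ≫
      eqToHom (ran.map_comp_hom U p') := Functor.congr_hom (ran.nat₁ U a).symm α

theorem hom₂_whiskerRight {U U' : y ⟶ x} (β : U ⟶ U') (p : x ⟶ c.obj a) :
    ran.hom₂ (β ▷ p) = eqToHom (ran.map_comp_hom U p).symm ≫ R.map₂ β ▷ ran.hom p ≫
      eqToHom (ran.map_comp_hom U' p) := Functor.congr_hom (ran.nat₂ y p).symm β

variable {p : x ⟶ c.obj a} {q : y ⟶ c.obj b} {k : t ⟶ c.obj d} {r : b ⟶ a} {s : d ⟶ b} {U : y ⟶ x}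
  {V : t ⟶ y}

/-- The square in `E` given by a square in `P`. -/
def square (φ : q ≫ c.map r ≅ U ≫ p) : ran.hom q ≫ F.map r ≅ R.map U ≫ ran.hom p :=
  eqToIso (ran.hom_comp_map q r) ≪≫ ((ran.het y).app a).mapIso φ ≪≫ eqToIso (ran.map_comp_hom U p).symm

theorem square_hom (φ : q ≫ c.map r ≅ U ≫ p) : (ran.square φ).hom =
    eqToHom (ran.hom_comp_map q r) ≫ ran.hom₂ φ.hom ≫ eqToHom (ran.map_comp_hom U p).symm := rfl

theorem square_eqToIso (h : q ≫ c.map r = U ≫ p) : ran.square (eqToIso h) =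
    eqToIso (by rw [hom_comp_map, h, map_comp_hom]) := by
  ext
  simp [square_hom]

/-- Follows from functoriality of the universal families and their naturality in both variables; it
gives the composition axiom for the induced pseudocone over `Idx`. -/
theorem square_paste (φ : q ≫ c.map r ≅ U ≫ p) (ψ : k ≫ c.map s ≅ V ≫ q) {W : t ⟶ x} (h : W = V ≫ U) :
    ran.square (paste φ ψ h) = pasteSquares (ran.square φ) (ran.square ψ)
      ((congrArg (fun r => R.map r) h).trans (R.map_comp V U)) (F.map_comp s r) := by
  subst h
  ext
  simp [square_hom, paste, pasteSquares, hom₂_comp, hom₂_whiskerRight_map, hom₂_whiskerLeft]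

theorem square_compat {φ : q ≫ c.map r ≅ U ≫ p} {U' : y ⟶ x} {r' : b ⟶ a} {φ' : q ≫ c.map r' ≅ U' ≫ p}
    {η : r ⟶ r'} {β : U ⟶ U'} (h : q ◁ c.map₂ η ≫ φ'.hom = φ.hom ≫ β ▷ p) :
    ran.hom q ◁ F.map₂ η ≫ (ran.square φ').hom = (ran.square φ).hom ≫ R.map₂ β ▷ ran.hom p := by
  have e := congrArg ran.hom₂ h
  rw [hom₂_comp, hom₂_comp, hom₂_whiskerLeft_map, hom₂_whiskerRight] at e
  have e' := congrArg (eqToHom (ran.hom_comp_map q r) ≫ · ≫ eqToHom (ran.map_comp_hom U' p).symm) e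
  simpa [square_hom] using e'

end Ran

end RanSquares

end TwoPro

namespace TwoPro

open CategoryTheory Bicategory Opposite

set_option linter.unusedSectionVars false
set_option linter.unusedVariables false

section Squares

theorem pasteTriangle_whisker {E : Type u₁} [Bicategory.{w₁, v₁} E] [Bicategory.Strict E] {z x y a b : E} {A A' : z ⟶ x} {B B' : z ⟶ y} {p : x ⟶ a} {q : y ⟶ b}
    {r : b ⟶ a} {U : y ⟶ x} {l : A ≅ B ≫ U} {l' : A' ≅ B' ≫ U} (φ : q ≫ r ≅ U ≫ p) {α : A ⟶ A'} {β : B ⟶ B'}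
    (h : α ≫ l'.hom = l.hom ≫ β ▷ U) : α ▷ p ≫ (pasteTriangle l' φ).hom =
      (pasteTriangle l φ).hom ≫ (β ▷ q) ▷ r := by
  have e := congrArg (· ▷ p) h
  have e' := whisker_exchange β φ.inv
  simp only [comp_whiskerRight] at e
  have h : B ≫ U ≫ p = (B ≫ U) ≫ p := by rw [Strict.assoc]
  have e'' := congrArg (eqToHom h.symm ≫ · ≫ eqToHom (Strict.assoc B' q r).symm) e'
  simp [pasteTriangle, Strict.associator_eqToIso, reassoc_of% e] at e'' ⊢
  rw [e'']

theorem pasteTriangle_incl {E : Type u₁} [Bicategory.{w₁, v₁} E] [Bicategory.Strict E] {z x a b : E} {A : z ⟶ x} {p : x ⟶ a} {q : x ⟶ b} {r : b ⟶ a} {i : x ⟶ x}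
    (hi : i = 𝟙 x) {l : A ≅ A ≫ i} {h : A = A ≫ i} (hl : l.hom = eqToHom h) {φ : q ≫ r ≅ i ≫ p}
    {π : p ⟶ q ≫ r} {hp : p = i ≫ p} (hφ : π ≫ φ.hom = eqToHom hp) :
    (pasteTriangle l φ).hom = A ◁ π ≫ eqToHom (Strict.assoc A q r).symm := by
  subst hi
  rw [← Iso.eq_comp_inv] at hφ
  simp [pasteTriangle, hl, hφ]

/-- Bijectivity on objects and fullness of `S` are inherited from the composite by cancelling `T`.
Hence the image of the comparison functor on pseudocones never has to be determined. -/
theorem isIso_of_comp {K : Type*} [Category K] {K' : Type*} [Category K'] {K'' : Type*} [Category K'']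
    (S : K ⥤ K') (T : K' ⥤ K'') [h : (S ⋙ T).IsIso] (hT : Function.Injective T.obj)
    (hT' : ∀ (a b : K') (f g : a ⟶ b), T.map f = T.map g → f = g) : S.IsIso where
  bijective_obj := by
    refine ⟨fun a b e => (S ⋙ T).bijective_obj.1 (congrArg T.obj e), fun a => ?_⟩
    obtain ⟨b, hb⟩ := (S ⋙ T).bijective_obj.2 (T.obj a)
    exact ⟨b, hT hb⟩
  faithful := ⟨fun {a b f g} e => (S ⋙ T).map_injective (congrArg T.map e)⟩
  full := ⟨fun {a b} f => ⟨(S ⋙ T).preimage (T.map f), hT' _ _ _ _ ((S ⋙ T).map_preimage (T.map f))⟩⟩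

end Squares

/-! ### Pseudocones on R X compared with pseudocones over `Idx`. -/

section IdxCone

variable {C : Type u} [Bicategory.{w, w} C] [Bicategory.Strict C]
  {P : Type u₂} [Bicategory.{w₂, v₂} P] [Bicategory.Strict P]
  {E : Type u₁} [Bicategory.{w₁, v₁} E] [Bicategory.Strict E]
  {c : StrictPseudofunctor C P} {F : StrictPseudofunctor C E} {R : StrictPseudofunctor P E}
  {pres : ∀ X : P, Presentation c X}
  {I : Type w} [Bicategory.{w, w} I] [Bicategory.Strict I] {X : StrictPseudofunctor Iᵒᵖ P}

open Idx

namespace Ran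

variable (ran : Ran pres F R) {M M' : E} (θ : PseudoCone (X.comp R) M)

/-- The leg at an index of the pseudocone over `Idx` given by a pseudocone on `R X`. -/
def idxLeg (a : Idx pres X) : M ⟶ F.obj a.val := θ.leg a.base ≫ ran.hom a.proj

/-- The structure 2-cell of the pseudocone over `Idx` given by a pseudocone on `R X`. -/
noncomputable def idxIso {a b : Idx pres X} (f : a ⟶ b) :
    ran.idxLeg θ a ≅ ran.idxLeg θ b ≫ F.map (val₁ f) :=
  pasteTriangle (θ.legIso (base₁ f)) (ran.square (iso₁ f))

theorem idxIso_id (a : Idx pres X) : (ran.idxIso θ (𝟙 a)).hom =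
    eqToHom (by rw [id_val, F.map_id, Strict.comp_id]) := by
  exact pasteTriangle_id ((congrArg (fun r => R.map r) (op_id_eq X a.base)).trans (R.map_id _))
    (F.map_id a.val) (θ.legIso_id a.base) (φ := ran.square (iso₁ (𝟙 a)))
    (hφ := (ran.hom_comp_map _ _).trans ((congrArg ran.hom (id_iso_eq a)).trans (ran.map_comp_hom _ _).symm))
    ((congrArg ran.square (id_iso a)).trans (ran.square_eqToIso _))

theorem idxIso_comp {a b d : Idx pres X} (f : a ⟶ b) (g : b ⟶ d) : (ran.idxIso θ (f ≫ g)).hom =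
    (ran.idxIso θ f).hom ≫ (ran.idxIso θ g).hom ▷ F.map (val₁ f) ≫
      eqToHom (paste_eq₁ (ran.idxLeg θ d) (val₁ g) (val₁ f)).symm := by
  refine pasteTriangle_comp ((congrArg (fun r => R.map r) (op_comp_eq X (base₁ f) (base₁ g))).trans
    (R.map_comp _ _)) (θ.legIso_comp (base₁ f) (base₁ g)) (ran.square (iso₁ f)) (ran.square (iso₁ g))
    (F.map_comp (val₁ g) (val₁ f)) (χ := ran.square (iso₁ (f ≫ g))) ?_
  rw [comp_iso]
  exact ran.square_paste (iso₁ f) (iso₁ g) (op_comp_eq X (base₁ f) (base₁ g))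

theorem idxIso_naturality {a b : Idx pres X} {f g : a ⟶ b} (α : f ⟶ g) :
    (ran.idxIso θ f).hom ≫ ran.idxLeg θ b ◁ F.map₂ (val₂ α) = (ran.idxIso θ g).hom :=
  pasteTriangle_naturality (θ.legIso_naturality (base₂ α)) (ran.square_compat (compat α))

/-- The pseudocone over `Idx` given by a pseudocone on `R X`. -/
noncomputable def idxCone : PseudoCone ((Idx.diagram pres X).comp F) M :=
  PseudoCone.ofLegs (ran.idxLeg θ) (fun f => ran.idxIso θ f) (ran.idxIso_id θ) (ran.idxIso_comp θ)
    (ran.idxIso_naturality θ)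

/-- The pseudocones over `Idx` given by pseudocones on `R X`, as a functor. -/
noncomputable def idxFunctor (X : StrictPseudofunctor Iᵒᵖ P) (M : E) :
    PseudoCone (X.comp R) M ⥤ PseudoCone ((Idx.diagram pres X).comp F) M where
  obj θ := ran.idxCone θ
  map ρ := PseudoCone.homOfLegs (fun a => PseudoCone.legHom ρ a.base ▷ ran.hom a.proj)
    (fun f => pasteTriangle_whisker _ (PseudoCone.legHom_naturality ρ (base₁ f)))
  map_id θ := PseudoCone.hom_ext_legs fun a => id_whiskerRight _ _
  map_comp ρ σ := PseudoCone.hom_ext_legs fun a => comp_whiskerRight _ _ _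

theorem cell_ext {x : P} {g h : M ⟶ R.obj x} {α β : g ⟶ h}
    (H : ∀ k, α ▷ ran.hom ((pres x).cone.leg k) = β ▷ ran.hom ((pres x).cone.leg k)) : α = β := by
  have := ran.univ x M
  exact (((ran.het x).mapCone (pres x).cone).precompFunctor M).map_injective
    (PseudoCone.hom_ext_legs H)

theorem hom₂_hom_inv {x : P} {a : C} {p p' : x ⟶ c.obj a} (π : p ≅ p') :
    ran.hom₂ π.hom ≫ ran.hom₂ π.inv = 𝟙 _ := by
  rw [← hom₂_comp, Iso.hom_inv_id]
  exact ran.hom₂_eqToHom rfl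

theorem square_inv {x y : P} {a b : C} {p : x ⟶ c.obj a} {q : y ⟶ c.obj b} {r : b ⟶ a} {U : y ⟶ x}
    (φ : q ≫ c.map r ≅ U ≫ p) : (ran.square φ).inv =
    eqToHom (ran.map_comp_hom U p) ≫ ran.hom₂ φ.inv ≫ eqToHom (ran.hom_comp_map q r).symm :=
  Category.assoc _ _ _

theorem square_symm_trans {x : P} {a b : C} {p : x ⟶ c.obj a} {q : x ⟶ c.obj b} {r : b ⟶ a} {U : x ⟶ x}
    (π : p ≅ q ≫ c.map r) (h : p = U ≫ p) {h' : ran.hom p = R.map U ≫ ran.hom p} :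
    (ran.hom₂ π.hom ≫ eqToHom (ran.hom_comp_map q r).symm) ≫ (ran.square (π.symm ≪≫ eqToIso h)).hom =
      eqToHom h' := by
  have e := ran.hom₂_hom_inv π
  simp [square_hom, hom₂_comp, reassoc_of% e]

theorem square_incl (a : Idx pres X) {l : (pres (X.obj (op a.base))).I} (x : a.fib ⟶ l) :
    (ran.hom₂ (a.projIso x).hom ≫ eqToHom (ran.hom_comp_map _ _).symm) ≫
      (ran.square (iso₁ (a.incl x))).hom =
        eqToHom (by rw [incl_base, op_id_eq, R.map_id]; exact (Strict.id_comp _).symm) := by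
  rw [incl_iso]
  exact ran.square_symm_trans (a.projIso x) _

/-- Over one object i the induced pseudocone is the universal one of R X_i composed with the leg, so
the leg can be recovered from it. -/
theorem idxCone_fibre (i : I) : (ran.idxCone θ).fibre i =
    ((ran.het (X.obj (op i))).mapCone (pres (X.obj (op i))).cone).precomp (θ.leg i) :=
  PseudoCone.ext_legs (fun k => rfl) fun {k l} x => by
    have e := ran.square_incl (⟨i, k⟩ : Idx pres X) x
    have := pasteTriangle_incl ((congrArg (fun r => R.map r) (op_id_eq X i)).trans (R.map_id _))
      (θ.legIso_id i) (φ := ran.square (iso₁ (incl ⟨i, k⟩ x))) e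
    refine (Category.comp_id _).trans (Eq.trans this (Category.id_comp _).symm)

/-- Legs are recovered from the fibres by the universal property of R X_i. Structure 2-cells are
tested on the projections of X_i, after lifting u to a 1-cell of `Idx`. -/
theorem idxCone_injective {θ η : PseudoCone (X.comp R) M} (h : ran.idxCone θ = ran.idxCone η) : θ = η := by
  have hl (i : I) : θ.leg i = η.leg i := by
    have := ran.univ (X.obj (op i)) M
    apply (((ran.het (X.obj (op i))).mapCone (pres (X.obj (op i))).cone).precompFunctor M).bijective_obj.1
    exact (ran.idxCone_fibre θ i).symm.trans ((congrArg (fun ξ => ξ.fibre i) h).trans (ran.idxCone_fibre η i))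
  refine PseudoCone.ext_legs hl fun {i j} u => ran.cell_ext fun k => ?_
  obtain ⟨l, f, rfl⟩ := exists_lift (⟨i, k⟩ : Idx pres X) u
  exact pasteTriangle_cancel (hl i) (hl j) (PseudoCone.legIso_congr h f)

theorem idxFunctor_map_injective {θ η : PseudoCone (X.comp R) M} {ρ σ : θ ⟶ η}
    (h : (ran.idxFunctor X M).map ρ = (ran.idxFunctor X M).map σ) : ρ = σ :=
  PseudoCone.hom_ext_legs fun i => ran.cell_ext fun k =>
    congrArg (fun ζ => PseudoCone.legHom ζ (⟨i, k⟩ : Idx pres X)) h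

theorem idxCone_precomp (g : M' ⟶ M) : ran.idxCone (θ.precomp g) = (ran.idxCone θ).precomp g :=
  PseudoCone.ext_legs (fun a => Strict.assoc _ _ _) fun {a b} f =>
    pasteTriangle_precomp g (θ.legIso (base₁ f)) (ran.square (iso₁ f)) (PseudoCone.precomp_legIso θ g _)

theorem pasteTriangle_square {z x y : P} {a b : C} {A : z ⟶ c.obj a} {B : z ⟶ c.obj b} {p : x ⟶ c.obj a}
    {q : y ⟶ c.obj b} {r : b ⟶ a} {U : y ⟶ x} {l : A ≅ B ≫ c.map r} {φ : q ≫ c.map r ≅ U ≫ p} {v : z ⟶ x}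
    {v' : z ⟶ y} {κ : v ≅ v' ≫ U} {hv : v ≫ p = A} {hv' : v' ≫ q = B}
    (H : κ.hom ▷ p = eqToHom hv ≫ (chi l hv' φ).hom) {κ' : R.map v ≅ R.map v' ≫ R.map U}
    (hκ : κ'.hom = R.map₂ κ.hom ≫ eqToHom (R.map_comp v' U)) {h₁ : R.map v ≫ ran.hom p = ran.hom A}
    {h₂ : (R.map v' ≫ ran.hom q) ≫ F.map r = ran.hom B ≫ F.map r} :
    (pasteTriangle κ' (ran.square φ)).hom ≫ eqToHom h₂ =
      eqToHom h₁ ≫ ran.hom₂ l.hom ≫ eqToHom (ran.hom_comp_map B r).symm := by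
  subst hv hv'
  have e := congrArg ran.hom₂ H
  simp only [hom₂_whiskerRight, chi, Iso.trans_hom, hom₂_comp, whiskerLeftIso_hom, hom₂_whiskerLeft, eqToIso.hom, hom₂_eqToHom] at e
  have e₁ := congrArg (R.map v' ◁ ·) (ran.hom₂_hom_inv φ)
  simp only [Bicategory.whiskerLeft_comp] at e₁
  have e' := congrArg (eqToHom h₁ ≫ · ≫ eqToHom (ran.map_comp_hom (v' ≫ U) p).symm) e
  simp at e' e₁
  simp [pasteTriangle, hκ, e', square_inv, reassoc_of% e₁]

/-- The link between the two cones: the condition `iso_proj` is what matches their structure 2-cells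
once R has been applied. -/
theorem idxCone_map {Y : P} {π : PseudoCone ((Idx.diagram pres X).comp c) Y} {ϖ : PseudoCone X Y}
    (h : IsLift π ϖ) : ran.idxCone (ϖ.map R) = (ran.het Y).mapCone π :=
  PseudoCone.ext_legs (fun a => (ran.map_comp_hom _ _).trans (congrArg ran.hom (h.app_proj a)))
    fun {a b} f => ran.pasteTriangle_square (h.iso_proj f) rfl

/-- The comparison `idxFunctor` carries precomposition with R ϖ to precomposition with the image of
π, which is an isomorphism by hypothesis. Being injective on objects and faithful, it can be
cancelled by `isIso_of_comp`. -/
theorem isPseudolimit_map {Y : P} {π : PseudoCone ((Idx.diagram pres X).comp c) Y} {ϖ : PseudoCone X Y}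
    (h : IsLift π ϖ) (hπ : ((ran.het Y).mapCone π).IsPseudolimit) : (ϖ.map R).IsPseudolimit := by
  intro M
  have := hπ M
  have e : (ϖ.map R).precompFunctor M ⋙ ran.idxFunctor X M = ((ran.het Y).mapCone π).precompFunctor M := by
    refine PseudoCone.functor_ext (fun a => ?_) fun g => ?_
    · refine (postcomp_functor_comp M (R.map (ϖ.app (op a.base))) (ran.hom a.proj)).symm.trans ?_
      exact congrArg (Bicategory.postcomp M) ((ran.map_comp_hom _ _).trans (congrArg ran.hom (h.app_proj a)))
    · exact (ran.idxCone_precomp (ϖ.map R) g).trans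
        (congrArg (fun ξ => PseudoCone.precomp ξ g) (ran.idxCone_map h))
  rw [← e] at this
  exact isIso_of_comp _ (ran.idxFunctor X M) (fun _ _ h => ran.idxCone_injective h)
    fun _ _ _ _ h => ran.idxFunctor_map_injective h

end Ran

end IdxCone

end TwoPro

namespace TwoPro

open CategoryTheory Bicategory Opposite

set_option linter.unusedSectionVars false
set_option linter.unusedVariables false

/-! ### Uniqueness of pseudolimits, and the identity 2-functor as a Kan extension. -/

section Uniqueness

namespace PseudoCone

variable {A : Type u₃} [Bicategory.{w₃, v₃} A] [Bicategory.Strict A]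
  {B : Type u₂} [Bicategory.{w₂, v₂} B] [Bicategory.Strict B]
  {E : Type u₁} [Bicategory.{w₁, v₁} E] [Bicategory.Strict E]
  {X : StrictPseudofunctor A B} {L L' L'' : B}

theorem ext_app {θ η : PseudoCone X L} (h : ∀ i, θ.app i = η.app i)
    (h' : ∀ {i j : A} (u : i ⟶ j), (θ.iso u).hom ≫ eqToHom (congrArg (· ≫ X.map u) (h i)) =
      eqToHom (h j) ≫ (η.iso u).hom) : θ = η := by
  obtain ⟨θ₀, θ₁, _, _, _⟩ := θ
  obtain ⟨η₀, η₁, _, _, _⟩ := η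
  obtain rfl : θ₀ = η₀ := funext h
  obtain rfl : @θ₁ = @η₁ := by
    funext i j u
    apply Iso.ext
    have : (θ₁ u).hom ≫ 𝟙 _ = 𝟙 _ ≫ (η₁ u).hom := h' u
    rwa [Category.comp_id, Category.id_comp] at this
  rfl

theorem precomp_comp (θ : PseudoCone X L) (g : L' ⟶ L) (h : L'' ⟶ L') :
    θ.precomp (h ≫ g) = (θ.precomp g).precomp h :=
  (ext_app (fun i => (Strict.assoc h g (θ.app i)).symm) fun u =>
    precomp_precomp_aux h g (θ.iso u).hom).symm

theorem precomp_id_aux {a b c : B} {p : a ⟶ c} {q : a ⟶ b} {r : b ⟶ c} (x : p ⟶ q ≫ r) :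
    (𝟙 a ◁ x ≫ eqToHom (Strict.assoc _ _ _).symm) ≫ eqToHom (congrArg (· ≫ r) (Strict.id_comp q)) =
      eqToHom (Strict.id_comp p) ≫ x := by
  simp [Strict.leftUnitor_eqToIso]

theorem precomp_id (θ : PseudoCone X L) : θ.precomp (𝟙 L) = θ :=
  ext_app (fun i => Strict.id_comp _) fun u => precomp_id_aux (θ.iso u).hom

theorem map_precomp_aux (H : StrictPseudofunctor B E) {a b c d : B} {e : d ⟶ a} {p : a ⟶ c} {q : a ⟶ b}
    {r : b ⟶ c} (x : p ⟶ q ≫ r) :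
    (H.map₂ (e ◁ x ≫ eqToHom (Strict.assoc e q r).symm) ≫ eqToHom (H.map_comp (e ≫ q) r)) ≫
        eqToHom (congrArg (· ≫ H.map r) (H.map_comp e q)) =
      eqToHom (H.map_comp e p) ≫ H.map e ◁ (H.map₂ x ≫ eqToHom (H.map_comp q r)) ≫
        eqToHom (Strict.assoc (H.map e) (H.map q) (H.map r)).symm := by
  simp [H.mapComp_eq_eqToIso, PrelaxFunctor.map₂_eqToHom, H.map₂_whisker_left]

theorem map_precomp (H : StrictPseudofunctor B E) (θ : PseudoCone X L) (g : L' ⟶ L) :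
    (θ.precomp g).map H = (θ.map H).precomp (H.map g) :=
  ext_app (fun i => H.map_comp g (θ.app i)) fun u => map_precomp_aux H (θ.iso u).hom

/-- The usual uniqueness argument. As factorizations are equalities and are unique, the comparison
1-cells are strictly inverse. -/
theorem IsPseudolimit.exists_equiv {θ : PseudoCone X L} (hθ : θ.IsPseudolimit) {η : PseudoCone X L'}
    (hη : η.IsPseudolimit) : ∃ (e : L' ⟶ L) (e' : L ⟶ L'), e ≫ e' = 𝟙 _ ∧ e' ≫ e = 𝟙 _ ∧ θ.precomp e = η := by
  have h₁ := hθ L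
  have h₂ := hθ L'
  have h₃ := hη L
  have h₄ := hη L'
  obtain ⟨e, he⟩ : ∃ e, θ.precomp e = η := (θ.precompFunctor L').bijective_obj.2 η
  obtain ⟨e', he'⟩ : ∃ e, η.precomp e = θ := (η.precompFunctor L).bijective_obj.2 θ
  refine ⟨e, e', (η.precompFunctor L').bijective_obj.1 ?_, (θ.precompFunctor L).bijective_obj.1 ?_, he⟩
  · change η.precomp (e ≫ e') = η.precomp (𝟙 _)
    rw [precomp_comp, he', he, precomp_id]
  · change θ.precomp (e' ≫ e) = θ.precomp (𝟙 _)
    rw [precomp_comp, he, he', precomp_id]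

theorem IsPseudolimit.precomp {D : StrictPseudofunctor Aᵒᵖ B} {F : StrictPseudofunctor B E} {M M' : E}
    {θ : PseudoCone (D.comp F) M} (hθ : θ.IsPseudolimit) {e : M' ⟶ M} {e' : M ⟶ M'} (h : e ≫ e' = 𝟙 _)
    (h' : e' ≫ e = 𝟙 _) : (θ.precomp e).IsPseudolimit := by
  intro N
  have := hθ N
  have : (Bicategory.postcomp N e).IsIso :=
    isIso_of_inverse _ (Bicategory.postcomp N e') (postcomp_cancel N e e' h) (postcomp_cancel N e' e h')
  have e₁ : (θ.precomp e).precompFunctor N = Bicategory.postcomp N e ⋙ θ.precompFunctor N :=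
    functor_ext (fun i => postcomp_functor_comp N e (θ.leg i)) fun g => (precomp_comp θ e g).symm
  rw [e₁]
  exact isIso_comp _ _

end PseudoCone

end Uniqueness

section

variable {C : Type u} [Bicategory.{w, w} C] [Bicategory.Strict C]
  {P : Type u₂} [Bicategory.{w₂, v₂} P] [Bicategory.Strict P]
  {c : StrictPseudofunctor C P} {pres : ∀ X : P, Presentation c X}

/-- The identity 2-natural family. -/
def Het.id (c : StrictPseudofunctor C P) (X : P) : Het c c X X where
  app d := 𝟭 _
  post h := rfl
  pre d' k := rfl

theorem Het.id_mapCone {A : Type u₃} [Bicategory.{w₃, v₃} A] [Bicategory.Strict A]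
    {D : StrictPseudofunctor Aᵒᵖ C} {X : P} (θ : PseudoCone (D.comp c) X) : (Het.id c X).mapCone θ = θ :=
  PseudoCone.ext_legs (fun i => rfl) fun u =>
    (Category.comp_id _).trans ((Category.comp_id _).trans (Category.id_comp _).symm)

/-- The identity 2-functor is a right Kan extension of `c` along itself. -/
def Ran.id (pres : ∀ X : P, Presentation c X) : Ran pres c (StrictPseudofunctor.id P) where
  het X := Het.id c X
  nat₁ f d := rfl
  nat₂ X {Y d} k := rfl
  univ X := by
    have := (pres X).isPseudolimit
    rw [← Het.id_mapCone (pres X).cone] at this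
    exact this

variable {A : Type u₃} [Bicategory.{w₃, v₃} A] [Bicategory.Strict A] {X : StrictPseudofunctor Aᵒᵖ P}

/-- Composition of the diagram of a pseudocone with the identity. -/
def PseudoCone.compId (θ : PseudoCone X M) : PseudoCone (X.comp (StrictPseudofunctor.id P)) M where
  app i := θ.app i
  iso u := θ.iso u
  iso_id i := θ.iso_id i
  iso_comp u v := θ.iso_comp u v
  iso_naturality α := θ.iso_naturality α

/-- Removal of the identity from the diagram of a pseudocone. -/
def PseudoCone.ofCompId (θ : PseudoCone (X.comp (StrictPseudofunctor.id P)) M) : PseudoCone X M where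
  app i := θ.app i
  iso u := θ.iso u
  iso_id i := θ.iso_id i
  iso_comp u v := θ.iso_comp u v
  iso_naturality α := θ.iso_naturality α

/-- Composition of the diagram of a pseudocone with the identity, as a functor. -/
def PseudoCone.compIdFunctor (X : StrictPseudofunctor Aᵒᵖ P) (M : P) :
    PseudoCone X M ⥤ PseudoCone (X.comp (StrictPseudofunctor.id P)) M where
  obj θ := θ.compId
  map ρ := show PseudoCone.Hom _ _ from ⟨fun i => PseudoCone.Hom.app ρ i,
    fun u => PseudoCone.Hom.naturality ρ u⟩
  map_id _ := rfl
  map_comp _ _ := rfl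

theorem whiskerLeft_comp_id_aux {x y z t : P} (g : x ⟶ y) {p : y ⟶ z} {q : y ⟶ t} {r : t ⟶ z}
    (κ : p ⟶ q ≫ r) {h₁ : (g ≫ q) ≫ r = (g ≫ q) ≫ r} {h₂ : g ≫ p = g ≫ p} {h₃ : q ≫ r = q ≫ r} :
    (g ◁ κ ≫ eqToHom (Strict.assoc g q r).symm) ≫ eqToHom h₁ =
      eqToHom h₂ ≫ g ◁ (κ ≫ eqToHom h₃) ≫ eqToHom (Strict.assoc g q r).symm := by
  simp

/-- Composing the diagram with the identity changes pseudocones in form only; the recasting functor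
is injective on objects and faithful, so `isIso_of_comp` applies. -/
theorem PseudoCone.isPseudolimit_of_map_id {L : P} {ϖ : PseudoCone X L}
    (h : (ϖ.map (StrictPseudofunctor.id P)).IsPseudolimit) : ϖ.IsPseudolimit := by
  intro M
  have := h M
  have e : ϖ.precompFunctor M ⋙ PseudoCone.compIdFunctor X M =
      (ϖ.map (StrictPseudofunctor.id P)).precompFunctor M :=
    PseudoCone.functor_ext (fun i => rfl) fun g => PseudoCone.ext_legs (fun i => rfl) fun {i j} u =>
      whiskerLeft_comp_id_aux g (ϖ.iso u.op).hom (h₃ := rfl)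
  rw [← e] at this
  refine isIso_of_comp (h := this) _ (PseudoCone.compIdFunctor X M) (fun θ η h => ?_) fun θ η ρ σ h => ?_
  · exact congrArg PseudoCone.ofCompId h
  · exact PseudoCone.Hom.ext (congrArg (fun ζ : PseudoCone.Hom θ.compId η.compId => ζ.app) h)

end

/-! ### Kan extensions along c preserve small 2-cofiltered pseudolimits. -/

section Preservation

variable {C : Type u} [Bicategory.{w, w} C] [Bicategory.Strict C]
  {P : Type u₂} [Bicategory.{w₂, v₂} P] [Bicategory.Strict P]
  {E : Type u₁} [Bicategory.{w₁, v₁} E] [Bicategory.Strict E]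
  {c : StrictPseudofunctor C P} {F : StrictPseudofunctor C E} {R : StrictPseudofunctor P E}
  {pres : ∀ X : P, Presentation c X}

theorem Ran.isPseudolimit_mapCone (ran : Ran pres F R) {Y : P} (p : Presentation c Y) (h : pres Y = p) :
    ((ran.het Y).mapCone p.cone).IsPseudolimit := by
  subst h
  exact ran.univ Y

/-- A pointwise right Kan extension along `c` preserves small 2-cofiltered pseudolimits, provided that every
small 2-cofiltered diagram in `C` is one of the chosen presentations. -/
theorem Ran.preserves (ran : Ran pres F R)
    (hpres : ∀ (K : Type w) [Bicategory.{w, w} K] [Bicategory.Strict K] [IsTwoFiltered K]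
      (D : StrictPseudofunctor Kᵒᵖ C), ∃ (Y : P) (π : PseudoCone (D.comp c) Y)
        (h : ∀ d, (π.ev d).IsIso) (h' : π.IsPseudolimit),
        pres Y = { I := K, diagram := D, cone := π, isIso_ev := h, isPseudolimit := h' }) :
    PreservesSmallTwoCofilteredPseudolimits.{w} R := by
  intro I _ _ _ X L ϖ₀ hϖ₀
  obtain ⟨Y, π, h, h', hY⟩ := hpres (Idx pres X) (Idx.diagram pres X)
  obtain ⟨ϖ, hϖ⟩ := exists_isLift π
  -- The identity is the Kan extension of c, so the statement used for R also shows that ϖ is a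
  -- pseudolimit in P.
  have h₁ : ϖ.IsPseudolimit := PseudoCone.isPseudolimit_of_map_id
    ((Ran.id pres).isPseudolimit_map hϖ ((Ran.id pres).isPseudolimit_mapCone _ hY))
  have h₂ := ran.isPseudolimit_map hϖ (ran.isPseudolimit_mapCone _ hY)
  -- The arbitrary pseudolimit cone equals ϖ precomposed with an invertible 1-cell, and R keeps that
  -- 1-cell invertible.
  obtain ⟨e, e', he, he', rfl⟩ := h₁.exists_equiv hϖ₀
  rw [PseudoCone.map_precomp]
  exact h₂.precomp (by rw [← R.map_comp, he, R.map_id]) (by rw [← R.map_comp, he', R.map_id])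

end Preservation

end TwoPro

namespace TwoPro

open CategoryTheory Bicategory Opposite

set_option linter.unusedSectionVars false
set_option linter.unusedVariables false

/-! ### From 2-natural families on the pseudocolimits back to pseudocones. -/

section OfEv

variable {C : Type u} [Bicategory.{w, w} C] [Bicategory.Strict C]
  {I : Type w} [Bicategory.{w, w} I]  [Bicategory.Strict I]
  {E : Type u₁} [Bicategory.{w₁, v₁} E] [Bicategory.Strict E]
  {F : StrictPseudofunctor C E} {D : StrictPseudofunctor Iᵒᵖ C} {M : E}

/-- A family of functors `colim_i C(D_i, d) ⥤ E(M, F d)`, 2-natural in `d`. -/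
structure EvFamily (D : StrictPseudofunctor Iᵒᵖ C) (F : StrictPseudofunctor C E) (M : E) where
  app (d : C) : PseudoColim D d ⥤ (M ⟶ F.obj d)
  leg (i : I) : M ⟶ F.obj (D.obj (op i))
  post {d d' : C} (g : d ⟶ d') : app d ⋙ Bicategory.postcomp M (F.map g) = PseudoColim.post D g ⋙ app d'
  inc (i : I) (d : C) : PseudoCone.inc D i d ⋙ app d = F.mapFunctor _ d ⋙ Bicategory.precomp _ (leg i)

namespace EvFamily

variable (e : EvFamily D F M)

theorem app_obj {d : C} {i : I} (r : D.obj (op i) ⟶ d) : (e.app d).obj ⟨i, r⟩ = e.leg i ≫ F.map r :=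
  Functor.congr_obj (e.inc i d) r

theorem map_cell {d : C} {i : I} {r s : D.obj (op i) ⟶ d} (α : r ⟶ s) :
    (e.app d).map (PseudoColim.cell α) = eqToHom (e.app_obj r) ≫ e.leg i ◁ F.map₂ α ≫
      eqToHom (e.app_obj s).symm :=
  Functor.congr_hom (e.inc i d) α

theorem map_cell_eqToHom {d : C} {i : I} {r s : D.obj (op i) ⟶ d} (h : r = s) :
    (e.app d).map (PseudoColim.cell (eqToHom h)) = eqToHom (by rw [h]) := by
  subst h
  rw [eqToHom_refl, PseudoColim.cell_id, (e.app d).map_id, eqToHom_refl]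

theorem legIso_eq {i j : I} (u : i ⟶ j) : (e.app _).obj ⟨j, D.map u.op ≫ 𝟙 (D.obj (op i))⟩ =
    e.leg j ≫ F.map (D.map u.op) := by
  rw [Strict.comp_id, app_obj]

theorem leg_eq (i : I) : e.leg i = (e.app _).obj ⟨i, 𝟙 _⟩ := by
  rw [app_obj, F.map_id, Strict.comp_id]

/-- The structure 2-cell of the pseudocone given by a 2-natural family. -/
def legIso {i j : I} (u : i ⟶ j) : e.leg i ≅ e.leg j ≫ F.map (D.map u.op) :=
  eqToIso (e.leg_eq i) ≪≫ (e.app _).mapIso (PseudoColim.push u (𝟙 _)) ≪≫ eqToIso (e.legIso_eq u)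

theorem legIso_hom {i j : I} (u : i ⟶ j) : (e.legIso u).hom = eqToHom (e.leg_eq i) ≫
    (e.app _).map (PseudoColim.push u (𝟙 _)).hom ≫ eqToHom (e.legIso_eq u) := rfl

/-- The Yoneda step: naturality in d at r moves the value at `push u` of an identity to the value at
`push u` of r, so the structure 2-cells read at identities determine the family on all pushes
(`map_push`). -/
theorem push_post {i j : I} (u : i ⟶ j) {d : C} (r : D.obj (op i) ⟶ d) :
    ((e.app d).map (PseudoColim.push u (𝟙 _ ≫ r)).hom) ≫
        eqToHom (congrArg (fun s => (e.app d).obj ⟨j, s⟩) (Strict.assoc (D.map u.op) (𝟙 _) r).symm) =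
      eqToHom (Functor.congr_obj (e.post r) ⟨i, 𝟙 _⟩).symm ≫
        (e.app _).map (PseudoColim.push u (𝟙 _)).hom ▷ F.map r ≫
          eqToHom (Functor.congr_obj (e.post r) ⟨j, D.map u.op ≫ 𝟙 _⟩) := by
  have h := Functor.congr_hom (e.post r).symm (PseudoColim.push u (𝟙 _)).hom
  refine Eq.trans ?_ h
  refine Eq.trans ?_ (congrArg (e.app d).map (PseudoColim.post_map_push r u (𝟙 _))).symm
  refine Eq.trans ?_ ((e.app d).map_comp _ _).symm
  exact congrArg (_ ≫ ·) (e.map_cell_eqToHom _).symm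

theorem map_push_congr {i j : I} (u : i ⟶ j) {d : C} {r s : D.obj (op i) ⟶ d} (h : r = s) :
    (e.app d).map (PseudoColim.push u r).hom = eqToHom (by rw [h]) ≫
      (e.app d).map (PseudoColim.push u s).hom ≫ eqToHom (by rw [h]) := by
  subst h
  simp

theorem eq_of_conj_eq {K : Type*} [Category K] {a b a₁ b₁ b₂ a' b' a'' b'' : K} {m : a ⟶ b} {κ : a' ⟶ b'}
    {h₁ : a₁ = a} {h₂ : b = b₁} {h₃ : b₁ = b₂} {h₄ : a₁ = a'} {h₅ : b' = b₂} {h₆ : a = a''} {h₇ : b'' = b}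
    {h₈ : a'' = a'} {h₉ : b' = b''}
    (h : (eqToHom h₁ ≫ m ≫ eqToHom h₂) ≫ eqToHom h₃ = eqToHom h₄ ≫ κ ≫ eqToHom h₅) :
    m = eqToHom h₆ ≫ (eqToHom h₈ ≫ κ ≫ eqToHom h₉) ≫ eqToHom h₇ := by
  subst h₁ h₂ h₃ h₄ h₅ h₆
  simpa using h

theorem map_push {i j : I} (u : i ⟶ j) {d : C} (r : D.obj (op i) ⟶ d) :
    (e.app d).map (PseudoColim.push u r).hom = eqToHom (e.app_obj r) ≫ (e.legIso u).hom ▷ F.map r ≫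
      eqToHom ((PseudoCone.ev_eq _ _ _).trans (e.app_obj _).symm) := by
  have h := e.push_post u r
  rw [map_push_congr e u (Strict.id_comp r)] at h
  have h₂ : (e.legIso u).hom ▷ F.map r = eqToHom (by rw [← e.leg_eq]) ≫
      (e.app _).map (PseudoColim.push u (𝟙 _)).hom ▷ F.map r ≫ eqToHom (by rw [e.legIso_eq u]) := by
    rw [legIso_hom]
    simp
  rw [h₂]
  exact eq_of_conj_eq h

/-- The pseudocone given by a 2-natural family. -/
def cone : PseudoCone (D.comp F) M :=
  PseudoCone.ofLegs e.leg e.legIso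
    (fun i => by
      rw [legIso_hom, PseudoColim.push_id, map_cell_eqToHom, eqToHom_trans, eqToHom_trans])
    (fun {i j k} u v => by
      rw [legIso_hom, PseudoColim.push_comp, Functor.map_comp, Functor.map_comp, map_cell_eqToHom,
        map_push_congr e v (Strict.comp_id (D.map u.op)), map_push e v (D.map u.op), legIso_hom e u]
      simp)
    (fun {i j u v} α => by
      have h := congrArg (e.app _).map (PseudoColim.push_cell (X := D) α (𝟙 (D.obj (op i))))
      rw [Functor.map_comp, map_cell] at h
      rw [legIso_hom, legIso_hom, ← h]
      simp [Strict.rightUnitor_eqToIso, PrelaxFunctor.map₂_eqToHom])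

/-- Any such family is the `ev` of a pseudocone. It will be applied to the inverse of the Yoneda
isomorphism. -/
theorem cone_ev (d : C) : e.cone.ev d = e.app d :=
  PseudoColim.functor_ext (fun x => (e.app_obj x.arr).symm)
    (fun i r s α => by
      change e.leg i ◁ F.map₂ α ≫ eqToHom (e.app_obj s).symm = eqToHom (e.app_obj r).symm ≫ _
      rw [map_cell]
      simp)
    (fun {i j} u r => by
      change ((e.legIso u).hom ▷ F.map r ≫ eqToHom (PseudoCone.ev_eq (e.leg j) u r)) ≫
        eqToHom (e.app_obj (D.map u.op ≫ r)).symm = eqToHom (e.app_obj r).symm ≫ _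
      rw [map_push]
      simp)

end EvFamily

end OfEv

end TwoPro

namespace TwoPro

open CategoryTheory Bicategory Opposite

set_option linter.unusedSectionVars false
set_option linter.unusedVariables false

/-! ### Hom-categories of Cat as functor categories. -/

section CatHom

/-- The functor underlying a 1-cell of `Cat`, as a functor on the hom-category. -/
def catFun (K K' : Cat.{w₁, w₂}) : (K ⟶ K') ⥤ (K ⥤ K') where
  obj f := f.toFunctor
  map α := α.toNatTrans

/-- The 1-cell of `Cat` given by a functor, as a functor to the hom-category. -/
def ofCatFun (K K' : Cat.{w₁, w₂}) : (K ⥤ K') ⥤ (K ⟶ K') where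
  obj f := f.toCatHom
  map α := α.toCatHom₂

variable {J : Type*} [Category J]

instance (K K' : Cat.{w₁, w₂}) : (catFun K K').IsIso := isIso_of_inverse _ (ofCatFun K K') rfl rfl

/-- The first hypothesis settles objects; the second, with the other variable fixed, settles arrows.
In use they are the two one-variable naturality statements. -/
theorem functor_ext₂ {K K' : Type*} [Category K] [Category K'] {S T : J ⥤ K ⥤ K'}
    (h : ∀ j, S.obj j = T.obj j) (h' : ∀ x, S.flip.obj x = T.flip.obj x) : S = T :=
  CategoryTheory.Functor.ext h fun i j m => by
    ext x
    rw [NatTrans.comp_app, NatTrans.comp_app, eqToHom_app, eqToHom_app]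
    exact Functor.congr_hom (h' x) m

end CatHom

/-! ### The action of 1-cells of 2-Pro(C) on pseudocolimits. -/

section Act

variable {C : Type u} [Bicategory.{w, w} C] [Bicategory.Strict C]

section

variable {I : Type w} [Bicategory.{w, w} I] [Bicategory.Strict I] {d e : C}

/-- The functor `C(d, e) ⥤ colim_i C(X_i, e)` given by the action on an object of
`colim_i C(X_i, d)`. -/
def orb (X : StrictPseudofunctor Iᵒᵖ C) (x : PseudoColim X d) (e : C) : (d ⟶ e) ⥤ PseudoColim X e where
  obj g := (PseudoColim.post X g).obj x
  map ρ := (PseudoColim.post₂ X ρ).app x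
  map_id g := congrArg (fun α => NatTrans.app α x) (PseudoColim.post₂_id X g)
  map_comp ρ σ := congrArg (fun α => NatTrans.app α x) (PseudoColim.post₂_comp X ρ σ)

end

/-- A 2-pro-object, as an object of `2-Pro(C)`. -/
def toPro (X : ProObj C) : Pro C := X

variable (Z X Y : ProObj C)

/-- The 1-cells `Z ⟶ X` of `2-Pro(C)` are the 2-natural transformations `L X ⟶ L Z`. -/
def proHomFunctor : (toPro Z ⟶ toPro X) ⥤ (proFunctor X.diagram ⟶ proFunctor Z.diagram) where
  obj f := f.hom.unop
  map α := α.hom.unop2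

/-- The inverse of `proHomFunctor`. -/
def proHomFunctor' : (proFunctor X.diagram ⟶ proFunctor Z.diagram) ⥤ (toPro Z ⟶ toPro X) where
  obj f := InducedBicategory.mkHom f.op
  map α := InducedBicategory.mkHom₂ (_root_.Bicategory.Opposite.op2 α)

instance : (proHomFunctor Z X).IsIso := isIso_of_inverse _ (proHomFunctor' Z X) rfl rfl

/-- The functor `colim_i C(X_i, d) ⥤ colim_j C(Z_j, d)` induced by a 1-cell `Z ⟶ X`. -/
def act (d : C) : (toPro Z ⟶ toPro X) ⥤ (PseudoColim X.diagram d ⥤ PseudoColim Z.diagram d) :=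
  proHomFunctor Z X ⋙ TwoNatTrans.evalApp _ _ d ⋙ catFun _ _

variable {Z X Y}

/-- 2-naturality of f, read at a fixed element x as an equality of functors of the 1-cell out of d.
-/
theorem orb_act (f : toPro Z ⟶ toPro X) {d : C} (x : PseudoColim X.diagram d) (e : C) :
    orb X.diagram x e ⋙ (act Z X e).obj f = orb Z.diagram (((act Z X d).obj f).obj x) e :=
  congrArg (fun T : (d ⟶ e) ⥤ ((proFunctor X.diagram).obj d ⟶ (proFunctor Z.diagram).obj e) =>
    (T ⋙ catFun _ _).flip.obj (show (proFunctor X.diagram).obj d from x)) (TwoNatTrans.mapFunctor_eq ((proHomFunctor Z X).obj f) d e)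

theorem act_post {d e : C} (g : d ⟶ e) :
    act Z X e ⋙ (Functor.whiskeringLeft _ _ _).obj (PseudoColim.post X.diagram g) =
      act Z X d ⋙ (Functor.whiskeringRight _ _ _).obj (PseudoColim.post Z.diagram g) :=
  congrArg (proHomFunctor Z X ⋙ · ⋙ catFun _ _) (TwoNatTrans.evalApp_precomp _ _ g)

variable {Q : Type*} [Category Q]

theorem proHom_functor_ext {S T : Q ⥤ (toPro Z ⟶ toPro X)} (h : ∀ d, S ⋙ act Z X d = T ⋙ act Z X d) : S = T :=
  cancel_right_isIso (proHomFunctor Z X) (TwoNatTrans.functor_ext fun d =>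
    cancel_right_isIso (catFun _ _) (h d))

/-- A functor to the category of 1-cells `Z ⟶ X`, from its action. -/
def proHomLift (S : ∀ d, Q ⥤ (PseudoColim X.diagram d ⥤ PseudoColim Z.diagram d))
    (h₁ : ∀ q d (x : PseudoColim X.diagram d) e, orb X.diagram x e ⋙ (S e).obj q =
      orb Z.diagram (((S d).obj q).obj x) e)
    (h₂ : ∀ q {d e} (g : d ⟶ e), PseudoColim.post X.diagram g ⋙ (S e).obj q =
      (S d).obj q ⋙ PseudoColim.post Z.diagram g)
    (h : ∀ {d e} (g : d ⟶ e),
      S e ⋙ (Functor.whiskeringLeft _ _ _).obj (PseudoColim.post X.diagram g) =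
      S d ⋙ (Functor.whiskeringRight _ _ _).obj (PseudoColim.post Z.diagram g)) : Q ⥤ (toPro Z ⟶ toPro X) :=
  TwoNatTrans.functorOf (F := proFunctor X.diagram) (G := proFunctor Z.diagram)
    (fun d => S d ⋙ ofCatFun (Cat.of _) (Cat.of _))
    (fun q d e => cancel_right_isIso (catFun _ _)
      (functor_ext₂ (fun g => h₂ q g) (fun x => h₁ q d x e)))
    (fun g => cancel_right_isIso (catFun _ _) (h g)) ⋙ proHomFunctor' Z X

end Act

end TwoPro

namespace TwoPro

open CategoryTheory Bicategory Opposite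

set_option linter.unusedSectionVars false
set_option linter.unusedVariables false

/-! ### The Yoneda lemma for the objects c d of 2-Pro(C). -/

section Point

variable {C : Type u} [Bicategory.{w, w} C] [Bicategory.Strict C]

/-- The object of the one-point 2-category. -/
abbrev pt : PointIndex.{w} := ⟨⟨⟨⟩⟩⟩

/-- The object `a` as a 2-pro-object. -/
def ptObj (a : C) : ProObj C := ProObj.mk PointIndex.{w} (constDiagram PointIndex.{w}ᵒᵖ a)

/-- The diagram indexed by the one-point 2-category with value `a`. -/
abbrev ptDiagram (a : C) : StrictPseudofunctor PointIndex.{w}ᵒᵖ C := constDiagram PointIndex.{w}ᵒᵖ a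

/-- The inclusion `C(d, e) ⥤ colim_{i ∈ pt} C(d, e)`. -/
abbrev ptInc (d e : C) : (d ⟶ e) ⥤ PseudoColim (ptDiagram d) e := PseudoCone.inc (ptDiagram d) pt e

theorem comp_eqToHom_id_comp {d e : C} {r s : d ⟶ e} (θ : r ⟶ s) :
    θ ≫ eqToHom (Strict.id_comp s).symm = eqToHom (Strict.id_comp r).symm ≫ 𝟙 d ◁ θ := by
  simp [Strict.leftUnitor_eqToIso]

theorem eqToHom_comp_whiskerRight_id {d e : C} {r s : d ⟶ e} {k : d ⟶ d} (h : s = k ≫ r) :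
    eqToHom h ≫ 𝟙 k ▷ r = eqToHom h := by
  simp

theorem eqToHom_eq_comp₃ {K : Type*} [Category K] {a b c d : K} (h : a = d) (p : a = b) (q : b = c)
    (r : c = d) : eqToHom h = eqToHom p ≫ eqToHom q ≫ eqToHom r := by
  simp

theorem isIso_of_comp_eq {K K' K'' : Type*} [Category K] [Category K'] [Category K''] {S : K ⥤ K'}
    {N : K' ⥤ K''} {T : K ⥤ K''} (hN : N.IsIso) (hT : T.IsIso) (h : S ⋙ N = T) : S.IsIso :=
  isIso_of_inverse _ (N ⋙ T.strictInv)
    (by rw [← Functor.assoc, h, comp_strictInv])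
    (cancel_right_isIso N (by
      rw [Functor.assoc, h, Functor.assoc, strictInv_comp, Functor.comp_id, Functor.id_comp]))

/-- The retraction `colim_{i ∈ pt} C(d, e) ⥤ C(d, e)`. -/
def ptRetr (d e : C) : PseudoColim (ptDiagram d) e ⥤ (d ⟶ e) :=
  PseudoColim.CoconeData.functor
    { obj _ r := r
      cell _ _ _ θ := θ
      push u r := eqToIso (Strict.id_comp r).symm
      cell_id _ _ := rfl
      cell_comp _ _ _ _ _ _ := rfl
      push_naturality _ _ _ θ := comp_eqToHom_id_comp θ
      push_id _ _ := rfl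
      push_comp _ _ r := eqToHom_eq_comp₃ (Strict.id_comp r).symm (Strict.id_comp r).symm
        (Strict.id_comp (𝟙 d ≫ r)).symm (Strict.id_comp (𝟙 d ≫ r))
      push_cell _ r := eqToHom_comp_whiskerRight_id (Strict.id_comp r).symm }

theorem ptInc_retr (d e : C) : ptInc d e ⋙ ptRetr d e = 𝟭 _ := rfl

/-- The one-point pseudocolimit adjoins isomorphisms `push` to C(d, e). Its only 1-cell is the
identity, though, and by `push_id` the corresponding arrows already come from C(d, e). -/
theorem ptRetr_inc (d e : C) : ptRetr d e ⋙ ptInc d e = 𝟭 _ :=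
  PseudoColim.functor_ext (fun ⟨i, r⟩ => rfl)
    (fun i r s θ => (Category.comp_id _).trans (Category.id_comp _).symm)
    (fun {i j} u r => by
      obtain ⟨⟨⟨⟩⟩⟩ := i
      obtain ⟨⟨⟨⟩⟩⟩ := j
      obtain ⟨⟨⟨u⟩⟩⟩ := u
      have h := PseudoColim.push_id (X := ptDiagram d) (i := pt) r
      change PseudoColim.cell (eqToHom (Strict.id_comp r).symm) ≫ 𝟙 _ =
        𝟙 _ ≫ (PseudoColim.push (X := ptDiagram d) (𝟙 pt) r).hom
      exact (Category.comp_id _).trans (h.symm.trans (Category.id_comp _).symm))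

instance isIso_ptInc (d e : C) : (ptInc d e).IsIso := isIso_of_inverse _ (ptRetr d e) (ptInc_retr d e) (ptRetr_inc d e)

/-- The universal element of `colim_{i ∈ pt} C(d, d)`. -/
abbrev ptElt (d : C) : PseudoColim (ptDiagram d) d := ⟨pt, 𝟙 d⟩

theorem orb_ptElt (d e : C) : orb (ptDiagram d) (ptElt d) e = ptInc d e :=
  congrArg (· ⋙ ptInc d e) (precomp_functor_id d e)

/-- The functor `2-Pro(C)(Z, c d) ⥤ colim_j C(Z_j, d)`. -/
def proYoneda (Z : ProObj C) (d : C) : (toPro Z ⟶ toPro (ptObj d)) ⥤ PseudoColim Z.diagram d :=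
  act Z (ptObj d) d ⋙ (evaluation _ _).obj (ptElt d)

/-- Reduces invertibility of c on hom-categories to that of `proYoneda` and `ptInc`. -/
theorem mapFunctor_proYoneda (d e : C) :
    (proEmbedding C).mapFunctor d e ⋙ proYoneda (ptObj d) e = ptInc d e :=
  (congrArg (· ⋙ ptInc d e) (postcomp_functor_id d e) :)

theorem proYoneda_post' (Z : ProObj C) {d e : C} (g : d ⟶ e) :
    proYoneda Z d ⋙ PseudoColim.post Z.diagram g =
      act Z (ptObj d) e ⋙ (evaluation _ _).obj (⟨pt, g⟩ : PseudoColim (ptDiagram d) e) :=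
  have h := congrArg (· ⋙ (evaluation _ _).obj (ptElt d)) (act_post (Z := Z) (X := ptObj d) g).symm
  h.trans (congrArg (fun r => act Z (ptObj d) e ⋙ (evaluation _ _).obj
    (⟨pt, r⟩ : PseudoColim (ptDiagram d) e)) (Strict.id_comp g))

theorem proYoneda_post (Z : ProObj C) {d e : C} (g : d ⟶ e) :
    proYoneda Z d ⋙ PseudoColim.post Z.diagram g =
      Bicategory.postcomp (toPro Z) ((proEmbedding C).map g) ⋙ proYoneda Z e :=
  (proYoneda_post' Z g).trans (congrArg (fun r => act Z (ptObj d) e ⋙ (evaluation _ _).obj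
    (⟨pt, r⟩ : PseudoColim (ptDiagram d) e)) (Strict.comp_id g).symm)

theorem inc_act {Z : ProObj C} {d : C} (k : toPro Z ⟶ toPro (ptObj d)) (e : C) :
    ptInc d e ⋙ (act Z (ptObj d) e).obj k = orb Z.diagram ((proYoneda Z d).obj k) e :=
  (congrArg (· ⋙ (act Z (ptObj d) e).obj k) (orb_ptElt d e)).symm.trans
    (orb_act (X := ptObj d) k (ptElt d) e)

theorem mapFunctor_precomp_proYoneda {Z : ProObj C} {d : C} (k : toPro Z ⟶ toPro (ptObj d)) (e : C) :
    (proEmbedding C).mapFunctor d e ⋙ Bicategory.precomp _ k ⋙ proYoneda Z e =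
      orb Z.diagram ((proYoneda Z d).obj k) e :=
  (congrArg (· ⋙ (act Z (ptObj d) e).obj k) (mapFunctor_proYoneda d e)).trans (inc_act k e)

section

variable {I : Type w} [Bicategory.{w, w} I] [Bicategory.Strict I] (X : StrictPseudofunctor Iᵒᵖ C)

/-- The functors `post X g`, as a functor of `g`. -/
def postFunctor (d e : C) : (d ⟶ e) ⥤ PseudoColim X d ⥤ PseudoColim X e :=
  (proFunctor X).mapFunctor d e ⋙ catFun _ _

theorem precomp_orb {d e : C} (x : PseudoColim X d) (r : d ⟶ e) (e' : C) :
    Bicategory.precomp e' r ⋙ orb X x e' = orb X ((PseudoColim.post X r).obj x) e' :=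
  congrArg (· ⋙ PseudoCone.inc X x.idx e') (precomp_functor_comp e' x.arr r).symm

theorem orb_post {d : C} (x : PseudoColim X d) {e e' : C} (g : e ⟶ e') :
    orb X x e ⋙ PseudoColim.post X g = Bicategory.postcomp d g ⋙ orb X x e' :=
  congrArg (· ⋙ PseudoCone.inc X x.idx e') (precomp_postcomp x.arr g)

end

theorem post_ptRetr (d : C) {e e' : C} (g : e ⟶ e') :
    PseudoColim.post (ptDiagram d) g ⋙ ptRetr d e' = ptRetr d e ⋙ Bicategory.postcomp d g :=
  cancel_left_isIso (ptInc d e) rfl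

theorem ptRetr_orb_post (Z : ProObj C) {d : C} (y : PseudoColim Z.diagram d) {e e' : C} (g : e ⟶ e') :
    PseudoColim.post (ptDiagram d) g ⋙ ptRetr d e' ⋙ orb Z.diagram y e' =
      (ptRetr d e ⋙ orb Z.diagram y e) ⋙ PseudoColim.post Z.diagram g :=
  (congrArg (· ⋙ orb Z.diagram y e') (post_ptRetr d g)).trans
    (congrArg (ptRetr d e ⋙ ·) (orb_post Z.diagram y g)).symm

/-- The inverse of `proYoneda`. -/
def proYonedaInv (Z : ProObj C) (d : C) : PseudoColim Z.diagram d ⥤ (toPro Z ⟶ toPro (ptObj d)) :=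
  proHomLift (X := ptObj d) (fun e => (ptRetr d e ⋙ postFunctor Z.diagram d e).flip)
    (fun y d' x e => precomp_orb Z.diagram y x.arr e)
    (fun y {_ _} g => ptRetr_orb_post Z y g)
    (fun {e e'} g => functor_ext₂ (fun y => ptRetr_orb_post Z y g)
      (fun x => PseudoColim.post_comp Z.diagram x.arr g))

/-- By 2-naturality a 1-cell is determined by its value on the universal element: `inc_act` says
this for a fixed 1-cell, `proYoneda_post'` for a fixed element with the 1-cell varying. -/
theorem proYoneda_inv (Z : ProObj C) (d : C) : proYoneda Z d ⋙ proYonedaInv Z d = 𝟭 _ :=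
  proHom_functor_ext fun e => functor_ext₂
    (fun f => cancel_left_isIso (ptInc d e) (inc_act f e).symm)
    (fun x => proYoneda_post' Z x.arr)

theorem proYonedaInv_comp (Z : ProObj C) (d : C) : proYonedaInv Z d ⋙ proYoneda Z d = 𝟭 _ :=
  PseudoColim.post_id Z.diagram d

instance isIso_proYoneda (Z : ProObj C) (d : C) : (proYoneda Z d).IsIso :=
  isIso_of_inverse _ _ (proYoneda_inv Z d) (proYonedaInv_comp Z d)

theorem isIso_mapFunctor_proEmbedding (d e : C) : ((proEmbedding C).mapFunctor d e).IsIso :=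
  isIso_of_comp_eq (isIso_proYoneda (ptObj d) e) (isIso_ptInc d e) (mapFunctor_proYoneda d e)

end Point

end TwoPro

namespace TwoPro

open CategoryTheory Bicategory Opposite

set_option linter.unusedSectionVars false
set_option linter.unusedVariables false

/-! ### Every 2-pro-object is presented by its own diagram. -/

section ProPresentation

variable {C : Type u} [Bicategory.{w, w} C] [Bicategory.Strict C]

theorem inv_comp_of_comp_eq {K K' L L' : Type*} [Category K] [Category K'] [Category L] [Category L']
    {N : K ⥤ K'} {M : K' ⥤ K} {N' : L ⥤ L'} {M' : L' ⥤ L} {S : K ⥤ L} {T : K' ⥤ L'}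
    (h : M ⋙ N = 𝟭 _) (h' : N' ⋙ M' = 𝟭 _) (e : N ⋙ T = S ⋙ N') : M ⋙ S = T ⋙ M' := by
  have := congrArg (fun R => M ⋙ R ⋙ M') e
  simpa only [Functor.assoc, h', Functor.comp_id, ← Functor.assoc M N, h, Functor.id_comp] using this.symm

theorem comp_inv_of_eq_comp {K K' L : Type*} [Category K] [Category K'] [Category L]
    {N : K ⥤ K'} {M : K' ⥤ K} {S : L ⥤ K'} {T : L ⥤ K}
    (h : N ⋙ M = 𝟭 _) (e : T ⋙ N = S) : S ⋙ M = T := by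
  rw [← e, Functor.assoc, h, Functor.comp_id]

theorem PseudoCone.orb_ev {I : Type w} [Bicategory.{w, w} I] [Bicategory.Strict I]
    {E : Type u₁} [Bicategory.{w₁, v₁} E] [Bicategory.Strict E] {D : StrictPseudofunctor Iᵒᵖ C}
    {F : StrictPseudofunctor C E} {M : E} (θ : PseudoCone (D.comp F) M) {d : C} (x : PseudoColim D d)
    (e : C) : orb D x e ⋙ θ.ev e = F.mapFunctor d e ⋙ Bicategory.precomp _ ((θ.ev d).obj x) :=
  (congrArg (· ⋙ Bicategory.precomp _ (θ.leg x.idx)) (precomp_mapFunctor F e x.arr)).trans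
    (congrArg (F.mapFunctor d e ⋙ ·) (precomp_functor_comp _ (θ.leg x.idx) (F.map x.arr)).symm)

/-- The functors `colim_i C(X_i, d) ⥤ 2-Pro(C)(X, c d)`, as a 2-natural family in `d`. -/
def proEvFamily (X : ProObj C) : EvFamily X.diagram (proEmbedding C) (toPro X) where
  app d := proYonedaInv X d
  leg i := (proYonedaInv X (X.diagram.obj (op i))).obj ⟨i, 𝟙 _⟩
  post {d d'} g := inv_comp_of_comp_eq (proYonedaInv_comp X d) (proYoneda_inv X d') (proYoneda_post X g)
  inc i d :=
    have h := (mapFunctor_precomp_proYoneda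
      ((proYonedaInv X (X.diagram.obj (op i))).obj ⟨i, 𝟙 _⟩) d).trans
        (congrArg (fun x => orb X.diagram x d)
          (Functor.congr_obj (proYonedaInv_comp X (X.diagram.obj (op i))) ⟨i, 𝟙 _⟩))
    comp_inv_of_eq_comp (proYoneda_inv X d)
      (h.trans (congrArg (· ⋙ PseudoCone.inc X.diagram i d) (precomp_functor_id _ d) :))

/-- The pseudocone exhibiting a 2-pro-object as the pseudolimit of its objects. -/
def proCone (X : ProObj C) : PseudoCone (X.diagram.comp (proEmbedding C)) (toPro X) :=
  (proEvFamily X).cone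

/-- The pseudocone is built so that its `ev` is the inverse of the Yoneda isomorphism; this gives
one condition of a presentation immediately and is the main input for the other. -/
theorem proCone_ev (X : ProObj C) (d : C) : (proCone X).ev d = proYonedaInv X d :=
  (proEvFamily X).cone_ev d

theorem isIso_proCone_ev (X : ProObj C) (d : C) : ((proCone X).ev d).IsIso := by
  rw [proCone_ev]
  exact isIso_of_inverse _ _ (proYonedaInv_comp X d) (proYoneda_inv X d)

variable (Z X : ProObj C)

theorem postcomp_proYoneda {d : C} (k : toPro X ⟶ toPro (ptObj d)) :
    Bicategory.postcomp (toPro Z) k ⋙ proYoneda Z d =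
      act Z X d ⋙ (evaluation _ _).obj ((proYoneda X d).obj k) := rfl

theorem proYoneda_proCone_leg {i : X.I} {d : C} (r : X.diagram.obj (op i) ⟶ d) :
    (proYoneda X d).obj ((proCone X).leg i ≫ (proEmbedding C).map r) = ⟨i, r⟩ :=
  (congrArg (proYoneda X d).obj ((proEvFamily X).app_obj r).symm).trans
    (Functor.congr_obj (proYonedaInv_comp X d) ⟨i, r⟩)

/-- The action on `colim_i C(X_i, d)` of the 1-cell `Z ⟶ X` induced by a pseudocone with vertex `Z`. -/
def coneAct (d : C) : PseudoCone (X.diagram.comp (proEmbedding C)) (toPro Z) ⥤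
    (PseudoColim X.diagram d ⥤ PseudoColim Z.diagram d) :=
  PseudoCone.evFunctor X.diagram (proEmbedding C) (toPro Z) d ⋙
    (Functor.whiskeringRight _ _ _).obj (proYoneda Z d)

variable {Z X} in
theorem post_coneAct (θ : PseudoCone (X.diagram.comp (proEmbedding C)) (toPro Z)) {d e : C} (g : d ⟶ e) :
    PseudoColim.post X.diagram g ⋙ (coneAct Z X e).obj θ =
      (coneAct Z X d).obj θ ⋙ PseudoColim.post Z.diagram g :=
  (congrArg (· ⋙ proYoneda Z e) (θ.ev_postcomp g)).symm.trans
    (congrArg (θ.ev d ⋙ ·) (proYoneda_post Z g)).symm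

theorem coneAct_flip {d : C} (x : PseudoColim X.diagram d) : (coneAct Z X d).flip.obj x =
    PseudoCone.legFunctor X.diagram (proEmbedding C) (toPro Z) x.idx ⋙ proYoneda Z _ ⋙
      PseudoColim.post Z.diagram x.arr :=
  (congrArg (PseudoCone.legFunctor X.diagram (proEmbedding C) (toPro Z) x.idx ⋙ ·)
    (proYoneda_post Z x.arr)).symm

/-- The functor from pseudocones with vertex `Z` to 1-cells `Z ⟶ X`. -/
def proConeLift : PseudoCone (X.diagram.comp (proEmbedding C)) (toPro Z) ⥤ (toPro Z ⟶ toPro X) :=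
  proHomLift (coneAct Z X)
    (fun θ d x e => (congrArg (· ⋙ proYoneda Z e) (θ.orb_ev x e)).trans
      (mapFunctor_precomp_proYoneda (Z := Z) (d := d) ((θ.ev d).obj x) e))
    (fun θ {_ _} g => post_coneAct θ g)
    (fun {d e} g => functor_ext₂ (fun θ => post_coneAct θ g) (fun x =>
      (coneAct_flip Z X ((PseudoColim.post X.diagram g).obj x)).trans
        ((congrArg (PseudoCone.legFunctor X.diagram (proEmbedding C) (toPro Z) x.idx ⋙ proYoneda Z _ ⋙ ·)
          (PseudoColim.post_comp Z.diagram x.arr g)).trans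
        (congrArg (· ⋙ PseudoColim.post Z.diagram g) (coneAct_flip Z X x)).symm)))

/-- The Yoneda isomorphism cancels the `ev` of the cone, leaving the action of f. Both composites of
the universal property rest on this computation. -/
theorem precompFunctor_coneAct_obj (f : toPro Z ⟶ toPro X) (d : C) :
    (coneAct Z X d).obj ((proCone X).precomp f) = (act Z X d).obj f :=
  (congrArg (· ⋙ proYoneda Z d) (PseudoCone.precomp_ev (proCone X) f d)).trans
    ((congrArg (· ⋙ Bicategory.precomp (toPro (ptObj d)) f ⋙ proYoneda Z d) (proCone_ev X d)).trans
      (congrArg (· ⋙ (act Z X d).obj f) (proYonedaInv_comp X d)))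

theorem postcomp_proCone_leg (i : X.I) {d : C} (r : X.diagram.obj (op i) ⟶ d) :
    (Bicategory.postcomp (toPro Z) ((proCone X).leg i) ⋙ proYoneda Z _) ⋙ PseudoColim.post Z.diagram r =
      act Z X d ⋙ (evaluation _ _).obj (⟨i, r⟩ : PseudoColim X.diagram d) :=
  (congrArg (Bicategory.postcomp (toPro Z) ((proCone X).leg i) ⋙ ·) (proYoneda_post Z r)).trans
    ((congrArg (· ⋙ proYoneda Z d) (postcomp_functor_comp (toPro Z) ((proCone X).leg i)
      ((proEmbedding C).map r))).symm.trans
      ((postcomp_proYoneda Z X _).trans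
        (congrArg (fun x => act Z X d ⋙ (evaluation _ _).obj x) (proYoneda_proCone_leg X r))))

theorem precompFunctor_proConeLift :
    (proCone X).precompFunctor (toPro Z) ⋙ proConeLift Z X = 𝟭 _ :=
  proHom_functor_ext fun d => functor_ext₂ (fun f => precompFunctor_coneAct_obj Z X f d) (fun x =>
    (congrArg ((proCone X).precompFunctor (toPro Z) ⋙ ·) (coneAct_flip Z X x)).trans
      (postcomp_proCone_leg Z X x.idx x.arr))

/-- Legs and `ev` are compared after the Yoneda isomorphism, where each side becomes an action
computed above. -/
theorem proConeLift_precompFunctor :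
    proConeLift Z X ⋙ (proCone X).precompFunctor (toPro Z) = 𝟭 _ :=
  PseudoCone.functor_ext
    (fun i => cancel_right_isIso (proYoneda Z _) (by
      -- The leg at i is read off at the element given by the identity of X_i, where postcomposition
      -- is trivial by `post_id`.
      have h := congrArg (proConeLift Z X ⋙ ·) (postcomp_proCone_leg Z X i (𝟙 _))
      have h' := coneAct_flip Z X (⟨i, 𝟙 _⟩ : PseudoColim X.diagram _)
      have h'' := h.trans h'
      dsimp only at h''
      rw [PseudoColim.post_id] at h''
      exact h''))
    (fun θ => PseudoCone.ev_injective fun d => cancel_right_isIso (proYoneda Z d)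
      (precompFunctor_coneAct_obj Z X ((proConeLift Z X).obj θ) d))

theorem proCone_isPseudolimit : (proCone X).IsPseudolimit := fun Z =>
  isIso_of_inverse _ _ (precompFunctor_proConeLift Z X) (proConeLift_precompFunctor Z X)

/-- Every 2-pro-object is the pseudolimit of its objects. -/
def proPresentation (X : Pro C) : Presentation (proEmbedding C) X where
  I := ProObj.I X
  bicategory := ProObj.bicategory X
  strict := ProObj.strict X
  isTwoFiltered := ProObj.isTwoFiltered X
  diagram := ProObj.diagram X
  cone := proCone X
  isIso_ev := isIso_proCone_ev X
  isPseudolimit := proCone_isPseudolimit X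

end ProPresentation

end TwoPro

namespace TwoPro

open CategoryTheory Bicategory Opposite

/-! ### Assembly of the 2-equivalence. -/

section

variable {C : Type u} [Bicategory.{w, w} C] [Bicategory.Strict C]
  {E : Type u'} [Bicategory.{w', v'} E] [Bicategory.Strict E]

theorem isIso_mapFunctor_comp {A B D : Type*} [Bicategory A] [Bicategory.Strict A] [Bicategory B]
    [Bicategory.Strict B] [Bicategory D] [Bicategory.Strict D] (H : StrictPseudofunctor A B)
    (K : StrictPseudofunctor B D) {a b : A} (h : (H.mapFunctor a b).IsIso)
    (h' : (K.mapFunctor (H.obj a) (H.obj b)).IsIso) : ((H.comp K).mapFunctor a b).IsIso :=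
  isIso_of_inverse _ ((K.mapFunctor (H.obj a) (H.obj b)).strictInv ⋙ (H.mapFunctor a b).strictInv)
    ((congrArg (H.mapFunctor a b ⋙ · ⋙ (H.mapFunctor a b).strictInv)
      (comp_strictInv (K.mapFunctor (H.obj a) (H.obj b)))).trans (comp_strictInv (H.mapFunctor a b)))
    ((congrArg ((K.mapFunctor (H.obj a) (H.obj b)).strictInv ⋙ · ⋙ K.mapFunctor (H.obj a) (H.obj b))
      (strictInv_comp (H.mapFunctor a b))).trans
        (strictInv_comp (K.mapFunctor (H.obj a) (H.obj b))))

theorem isIso_mapFunctor_forget {A B : Type*} [Bicategory A] [Bicategory.Strict A] (F : B → A)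
    (a b : InducedBicategory A F) :
    ((InducedBicategory.forget (C := A) (F := F)).mapFunctor a b).IsIso :=
  isIso_of_inverse _
    { obj := fun f => InducedBicategory.mkHom f
      map := fun α => InducedBicategory.mkHom₂ α } rfl rfl

/-- The sub-2-category is full, so it has the same hom-categories, and preservation is used for the
target 2-functor only. -/
theorem isIso_mapFunctor_precompPlus (a b : HomPlus C E) : ((precompPlus C E).mapFunctor a b).IsIso :=
  isIso_mapFunctor_comp InducedBicategory.forget (precomp E (proEmbedding C))
    (isIso_mapFunctor_forget _ a b) (isIso_precomp_mapFunctor proPresentation _ _ b.2)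

theorem exists_homPlus (hE : HasSmallTwoCofilteredPseudolimits.{w} E) (F : StrictPseudofunctor C E) :
    ∃ (R : HomPlus C E) (e : (precompPlus C E).obj R ⟶ F) (e' : F ⟶ (precompPlus C E).obj R),
      e ≫ e' = 𝟙 _ ∧ e' ≫ e = 𝟙 _ := by
  obtain ⟨R, ⟨ran⟩⟩ := exists_ran (pres := proPresentation) hE F
  obtain ⟨e, e', h, h'⟩ := ran.exists_counit isIso_mapFunctor_proEmbedding
  -- A small 2-cofiltered diagram in C is itself a 2-pro-object, presented by that very diagram;
  -- hence the condition on presentations is `rfl`.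
  exact ⟨⟨R, ran.preserves fun K _ _ _ D => ⟨ProObj.mk K D, _, _, _, rfl⟩⟩, e, e', h, h'⟩

end

end TwoPro

theorem mainTheorem1 (C : Type u) [CategoryTheory.Bicategory.{w, w} C]
    [CategoryTheory.Bicategory.Strict C]
    (E : Type u') [CategoryTheory.Bicategory.{w', v'} E] [CategoryTheory.Bicategory.Strict E]
    (hE : TwoPro.HasSmallTwoCofilteredPseudolimits.{w} E) :
    TwoPro.IsTwoEquivalence (TwoPro.precompPlus C E) := by
  choose o e e' h h' using fun F => TwoPro.exists_homPlus (C := C) hE F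
  exact TwoPro.isTwoEquivalence_of_isIso _ TwoPro.isIso_mapFunctor_precompPlus o e e' h h'
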